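/- **Setting.** Let $\Sigma$ be a compact smooth $n$-manifold with boundary, $n\ge 1$, with a smooth volume $d^nx$ on $\Sigma$ and a smooth volume on $\partial\Sigma$. The dynamical fields $z^A$ and the Lagrange multipliers $\lambda^a$ are finite families of smooth real functions on $\Sigma$ depending smoothly on $t\in\mathbb R$. A *local function* is a smooth function of $t$, $x\in\Sigma$ and finitely many derivatives of the fields at $x$; a *local functional* is $\int_\Sigma$ of a local function plus $\oint_{\partial\Sigma}$ of a local function; $\frac{\delta}{\delta(\cdot)}$ is the variational (Euler–Lagrange) derivative. Consider the theory $$S=\int dt\Big\{\int_\Sigma d^nx\,\tfrac12 z^A\sigma_{AB}\dot z^B-H[z,\lambda]\Big\},\qquad H=\int_\Sigma d^nx\,\big(h(z)+\lambda^a\phi_a(z)\big)+\oint_{\partial\Sigma} b(z,\lambda),$$ where $\sigma^{AB}$ is a constant antisymmetric invertible matrix with inverse $\sigma_{AB}$; $h,\phi_a,b$ are local and independent of time; and $h$ and the constraints $\phi_a$ are first class: with $\{F,G\}=\int_\Sigma\frac{\delta F}{\delta z^A}\sigma^{AB}\frac{\delta G}{\delta z^B}$, the brackets $\{\phi_a,\int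 h\}$ and $\{\phi_a,\int\eta^b\phi_b\}$ are, for every smearing function $\eta$, linear combinations of the $\phi_c$ and their derivatives, with local coefficients. The internal boundary conditions are $\chi^\alpha(z,\lambda)|_{\partial\Sigma}=\zeta^\alpha$, with $\chi^\alpha$ local and independent of time; the external boundary conditions $\chi_E|_{\partial\Sigma}=0$ are $\partial_{(i)}\phi_a|_{\partial\Sigma}=0$ and $\partial_{(i)}\big(\dot z^A-\sigma^{AB}\tfrac{\delta H}{\delta z^B}\big)|_{\partial\Sigma}=0$ for all multi-indices $(i)$ and all $t$. A *variation* $\delta$ is a smooth vector field on the space of histories $(z,\lambda)$. It *preserves the external boundary conditions* if $\delta\chi_E|_{\partial\Sigma}=0$ for all histories with $\chi_E|_{\partial\Sigma}=0$; it *preserves the internal boundary conditions* if moreover $\delta\chi^\alpha|_{\partial\Sigma}=0$ for all these histories. Assume that $\delta H=\int_\Sigma(\frac{\delta H}{\delta z^A}\delta z^A+\phi_a\delta\lambda^a)$ for every $\delta$ preserving the internal boundary conditions, and that the external boundary conditions are regular: every solution of the linearised conditions at a history with $\chi_E|_{\partial\Sigma}=0$ is tangent to a smooth curve of such histories. **Couples.**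 A couple $(G,\delta^\lambda_G)$ consists of a local functional $G[t,z,\lambda,\dot\lambda,\dots,\lambda^{(k)}]$ and local functions $\Lambda_G^a(t,z,\lambda,\dot\lambda,\dots)$. It generates the transformation $\delta_Gz^A=\sigma^{AB}\frac{\delta G}{\delta z^B}$, $\delta_G\lambda^a=\Lambda^a_G$. At fixed $t$, treat $\lambda,\dot\lambda,\ddot\lambda,\dots$ as independent fields and put $$\tfrac{D}{Dt}=\partial_t+\big(\text{variation with }\lambda^{(l)}\mapsto\lambda^{(l+1)}\big),\qquad \delta_t=\tfrac{D}{Dt}+\big(\text{variation with }z^A\mapsto\sigma^{AB}\tfrac{\delta H}{\delta z^B}\big),$$ $$\tilde\delta_Gz^A=\sigma^{AB}\tfrac{\delta G}{\delta z^B},\qquad \tilde\delta_G\lambda^{a\,(l)}=\delta_t^l\Lambda_G^a .$$ The *differentiability conditions* on $(G,\delta_G^\lambda)$ are: for all $\delta$ preserving the internal boundary conditions and all histories with $\chi_E|_{\partial\Sigma}=0$, $$[\delta_G,\delta]\chi^\alpha|_{\partial\Sigma}=0,\qquad \delta G=\int_\Sigma d^nx\Big(\frac{\delta G}{\delta z^A}\delta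 z^A+\sum_{l}\frac{\delta G}{\delta\lambda^{a(l)}}\delta\lambda^{a(l)}\Big).\tag{D}$$ Such a couple *generates an external symmetry of the action* if $\delta_G$ preserves the external boundary conditions and there is a boundary term $\oint V_G(t,z,\lambda,\dot\lambda,\dots)$, with $V_G$ local and $\delta\oint V_G=0$ for all $\delta$ preserving the internal boundary conditions, such that for all histories with $\chi_E|_{\partial\Sigma}=0$ the Lagrangian changes under $\delta_G$ by $\frac{d}{dt}U+\oint V_G$ for some local functional $U$, and $$\frac{D}{Dt}G+\{G,H\}_\zeta-\delta^\lambda_GH=\oint V_G .$$ Here $\delta^\lambda_G$ is the part of $\tilde\delta_G$ acting on the multipliers only, $\{F,G\}_\zeta=\{F,G\}+\oint\Theta_F[\delta_Gz]-\oint\Theta_G[\delta_Fz]$, and $\oint\Theta_F[\delta z]=\delta F-\int_\Sigma\frac{\delta F}{\delta z^A}\delta z^A$ for variations of $z$ only. **Theorem.** Let $(G_1,\delta_1^\lambda)$ and $(G_2,\delta_2^\lambda)$ be couples that satisfy (D) and generate external symmetries of the action. Then the bracket $[(G_1,\delta_1^\lambda),(G_2,\delta_2^\lambda)]=(\{G_2,G_1\}_g,\delta^\lambda_{[1,2]})$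 defined by $$\{G_2,G_1\}_g=\tilde\delta_1G_2-\tilde\delta_2G_1-\{G_2,G_1\},\qquad \delta^\lambda_{[1,2]}\lambda^a=\tilde\delta_1\Lambda_2^a-\tilde\delta_2\Lambda_1^a$$ is again a couple (a local functional and local functions $\Lambda^a$), it satisfies (D) for all variations preserving the internal boundary conditions, and it generates an external symmetry of the action. -/

import Mathlib

open scoped Manifold ContDiff
open MeasureTheory

noncomputable section

namespace GaugeField

section Geometry

/-- A scalar function on the compact manifold with boundary `M` is smooth (up to the boundary). -/
def IsSmooth (n : ℕ) [NeZero n] {M : Type*} [TopologicalSpace M]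
    [ChartedSpace (EuclideanHalfSpace n) M] (f : M → ℝ) : Prop :=
  ContMDiff (𝓡∂ n) 𝓘(ℝ, ℝ) ∞ f

/-- Jets of order `k` of a scalar function in `n` variables: the partial derivatives of
order `0, …, k`, as symmetric multilinear forms. -/
abbrev Jet (n k : ℕ) : Type :=
  (j : Fin (k + 1)) →
    ContinuousMultilinearMap ℝ (fun _ : Fin (j : ℕ) => EuclideanSpace ℝ (Fin n)) ℝ

/-- The `j`-th derivative of `f` at the point with coordinate `y`, in the chart centred at `x₀`
(one-sided at boundary points). -/
def chartDeriv (n : ℕ) [NeZero n] {M : Type*} [TopologicalSpace M]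
    [ChartedSpace (EuclideanHalfSpace n) M] (j : ℕ) (f : M → ℝ) (x₀ : M)
    (y : EuclideanSpace ℝ (Fin n)) :
    ContinuousMultilinearMap ℝ (fun _ : Fin j => EuclideanSpace ℝ (Fin n)) ℝ :=
  iteratedFDerivWithin ℝ j (f ∘ (extChartAt (𝓡∂ n) x₀).symm) (Set.range (𝓡∂ n)) y

def jet (n : ℕ) [NeZero n] {M : Type*} [TopologicalSpace M]
    [ChartedSpace (EuclideanHalfSpace n) M] (k : ℕ) (f : M → ℝ) (x₀ : M)
    (y : EuclideanSpace ℝ (Fin n)) : Jet n k :=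
  fun j => chartDeriv n j f x₀ y

/-- A (possibly explicitly time dependent) local function of the fields `Φ i`: in every chart,
`f t Φ x` is a smooth function of `t`, of the coordinates of `x` and of finitely many
derivatives at `x` of finitely many of the fields. -/
def IsLocal (n : ℕ) [NeZero n] {M : Type*} [TopologicalSpace M]
    [ChartedSpace (EuclideanHalfSpace n) M] {ι : Type*}
    (f : ℝ → (ι → M → ℝ) → M → ℝ) : Prop :=
  ∃ (k : ℕ) (S : Finset ι), ∀ x₀ : M,
    ∃ F : ℝ × EuclideanSpace ℝ (Fin n) × (S → Jet n k) → ℝ,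
      ContDiffOn ℝ ∞ F (Set.univ ×ˢ ((extChartAt (𝓡∂ n) x₀).target ×ˢ Set.univ)) ∧
      ∀ (t : ℝ) (Φ : ι → M → ℝ), (∀ i, IsSmooth n (Φ i)) →
        ∀ x ∈ (extChartAt (𝓡∂ n) x₀).source,
          f t Φ x = F (t, extChartAt (𝓡∂ n) x₀ x,
            fun i => jet n k (Φ i) x₀ (extChartAt (𝓡∂ n) x₀ x))

/-- A linear differential operator `L Φ` acting on the fields `ψ`, whose coefficients are local
functions of the fields `Φ`. -/
def IsLinearLocal (n : ℕ) [NeZero n] {M : Type*} [TopologicalSpace M]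
    [ChartedSpace (EuclideanHalfSpace n) M] {ι κ : Type*}
    (L : (ι → M → ℝ) → (κ → M → ℝ) → M → ℝ) : Prop :=
  IsLocal n (fun (_ : ℝ) (Ψ : ι ⊕ κ → M → ℝ) => L (fun i => Ψ (Sum.inl i)) (fun j => Ψ (Sum.inr j)))
  ∧ ∀ (Φ : ι → M → ℝ) (ψ ψ' : κ → M → ℝ) (r : ℝ), (∀ i, IsSmooth n (Φ i)) →
      (∀ j, IsSmooth n (ψ j)) → (∀ j, IsSmooth n (ψ' j)) →
      L Φ (r • ψ + ψ') = r • L Φ ψ + L Φ ψ'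

/-- `∂_(i) f |_∂M = 0` for all multi-indices `(i)`, the empty one included. -/
def FlatOnBoundary (n : ℕ) [NeZero n] {M : Type*} [TopologicalSpace M]
    [ChartedSpace (EuclideanHalfSpace n) M] (f : M → ℝ) : Prop :=
  ∀ x ∈ (𝓡∂ n).boundary M, ∀ j : ℕ, chartDeriv n j f x (extChartAt (𝓡∂ n) x x) = 0

/-- `μ` is a smooth positive volume `dⁿx` on `M`. -/
def IsSmoothVolume (n : ℕ) [NeZero n] {M : Type*} [TopologicalSpace M]
    [ChartedSpace (EuclideanHalfSpace n) M] [MeasurableSpace M] (μ : Measure M) : Prop :=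
  ∀ x₀ : M, ∃ w : EuclideanSpace ℝ (Fin n) → ℝ,
    ContDiffOn ℝ ∞ w (extChartAt (𝓡∂ n) x₀).target ∧
    (∀ y ∈ (extChartAt (𝓡∂ n) x₀).target, 0 < w y) ∧
    ∀ s : Set M, MeasurableSet s → s ⊆ (extChartAt (𝓡∂ n) x₀).source →
      μ s = ∫⁻ y in extChartAt (𝓡∂ n) x₀ '' s, ENNReal.ofReal (w y)

/-- `ν` is a smooth positive volume of the boundary `∂M` (seen as a measure on `M`). -/
def IsSmoothBoundaryVolume (n : ℕ) [NeZero n] {M : Type*} [TopologicalSpace M]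
    [ChartedSpace (EuclideanHalfSpace n) M] [MeasurableSpace M] (ν : Measure M) : Prop :=
  ∀ x₀ : M, ∃ w : EuclideanSpace ℝ (Fin n) → ℝ,
    ContDiffOn ℝ ∞ w (extChartAt (𝓡∂ n) x₀).target ∧
    (∀ y ∈ (extChartAt (𝓡∂ n) x₀).target, 0 < w y) ∧
    ∀ s : Set M, MeasurableSet s → s ⊆ (extChartAt (𝓡∂ n) x₀).source →
      ν s = ∫⁻ y in (extChartAt (𝓡∂ n) x₀ '' s) ∩ frontier (Set.range (𝓡∂ n)),
        ENNReal.ofReal (w y) ∂(Measure.hausdorffMeasure ((n : ℝ) - 1))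

end Geometry

section Variations

/-- Variation of the functional `F` at `Φ` along `Y`. -/
def fder {ι M : Type*} (F : (ι → M → ℝ) → ℝ) (Φ Y : ι → M → ℝ) : ℝ :=
  deriv (fun s : ℝ => F (Φ + s • Y)) 0

/-- Variation of the function-valued expression `f` at `Φ` along `Y`. -/
def dder {ι M : Type*} (f : (ι → M → ℝ) → M → ℝ) (Φ Y : ι → M → ℝ) : M → ℝ :=
  fun x => deriv (fun s : ℝ => f (Φ + s • Y) x) 0

/-- `E` is the variational derivative `δF/δΦ` of the functional `F`, which depends on the fields
with index in the finite set `S`: all variations supported inside `M` give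
`δF = ∫ ∑_i E_i δΦ_i`. -/
def IsVarDeriv (n : ℕ) [NeZero n] {M : Type*} [TopologicalSpace M]
    [ChartedSpace (EuclideanHalfSpace n) M] [MeasurableSpace M] (vol : Measure M) {ι : Type*}
    (S : Finset ι) (F : (ι → M → ℝ) → ℝ) (E : ι → (ι → M → ℝ) → M → ℝ) : Prop :=
  ∀ Φ Y : ι → M → ℝ, (∀ i, IsSmooth n (Φ i)) → (∀ i, IsSmooth n (Y i)) →
    (∀ i, tsupport (Y i) ⊆ (𝓡∂ n).interior M) →
    fder F Φ Y = ∫ x, ∑ i ∈ S, E i Φ x * Y i x ∂vol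

/-- Fields at a fixed time: `z^A` (indices `A`), and all the time derivatives of `λ^a`, treated as
independent fields; the index `(l, a)` stands for the `l`-th time derivative of `λ^a`. -/
abbrev Conf (M A Λ : Type*) : Type _ := A ⊕ (ℕ × Λ) → M → ℝ

/-- Histories `(z^A(t, x), λ^a(t, x))`. -/
abbrev Hist (M A Λ : Type*) : Type _ := A ⊕ Λ → ℝ → M → ℝ

/-- The indices of `z` and of the time derivatives of `λ` of order at most `k`. -/
def upTo (A Λ : Type*) [Fintype A] [Fintype Λ] (k : ℕ) : Finset (A ⊕ (ℕ × Λ)) :=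
  Finset.univ.disjSum (Finset.range (k + 1) ×ˢ Finset.univ)

/-- The pair `(z, λ)` contained in a configuration. -/
def low {M A Λ : Type*} (Φ : Conf M A Λ) : A ⊕ Λ → M → ℝ :=
  Sum.elim (fun i => Φ (Sum.inl i)) (fun a => Φ (Sum.inr (0, a)))

/-- The configuration `(z(t), λ(t), λ'(t), …)` of a history at time `t`. -/
def inst {M A Λ : Type*} (u : Hist M A Λ) (t : ℝ) : Conf M A Λ :=
  Sum.elim (fun i => u (Sum.inl i) t)
    (fun p x => iteratedDeriv p.1 (fun τ => u (Sum.inr p.2) τ x) t)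

/-- A smooth family of histories, with parameter in `P`. -/
def SmoothFamily (n : ℕ) [NeZero n] {M A Λ : Type*} [TopologicalSpace M]
    [ChartedSpace (EuclideanHalfSpace n) M] (P : Type*) [NormedAddCommGroup P] [NormedSpace ℝ P]
    (c : P → Hist M A Λ) : Prop :=
  ∀ i, ContMDiff (𝓘(ℝ, P).prod (𝓘(ℝ, ℝ).prod (𝓡∂ n))) 𝓘(ℝ, ℝ) ∞
    (fun p : P × (ℝ × M) => c p.1 i p.2.1 p.2.2)

def SmoothHist (n : ℕ) [NeZero n] {M A Λ : Type*} [TopologicalSpace M]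
    [ChartedSpace (EuclideanHalfSpace n) M] (u : Hist M A Λ) : Prop :=
  ∀ i, ContMDiff (𝓘(ℝ, ℝ).prod (𝓡∂ n)) 𝓘(ℝ, ℝ) ∞ (fun p : ℝ × M => u i p.1 p.2)

/-- A variation `δ`, i.e. a smooth vector field on the space of histories: `δ u` is the variation
of the history `u`, and `δ` maps smooth finite-dimensional families to smooth families. -/
def SmoothVariation (n : ℕ) [NeZero n] {M A Λ : Type*} [TopologicalSpace M]
    [ChartedSpace (EuclideanHalfSpace n) M] (δ : Hist M A Λ → Hist M A Λ) : Prop :=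
  (∀ u, SmoothHist n u → SmoothHist n (δ u)) ∧
  ∀ (d : ℕ) (c : EuclideanSpace ℝ (Fin d) → Hist M A Λ),
    SmoothFamily n (EuclideanSpace ℝ (Fin d)) c →
      SmoothFamily n (EuclideanSpace ℝ (Fin d)) (fun s => δ (c s))

/-- Derivative at the history `u`, in the direction `Y`, of an expression `f` in the history. -/
def hder {M A Λ : Type*} (f : Hist M A Λ → ℝ → M → ℝ) (u Y : Hist M A Λ) : ℝ → M → ℝ :=
  fun t x => deriv (fun s : ℝ => f (u + s • Y) t x) 0

/-- The action `δ f` of the variation `δ` on an expression `f`. -/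
def vary {M A Λ : Type*} (δ : Hist M A Λ → Hist M A Λ) (f : Hist M A Λ → ℝ → M → ℝ) :
    Hist M A Λ → ℝ → M → ℝ :=
  fun u => hder f u (δ u)

/-- The action `[δ₁, δ₂] f = δ₁ δ₂ f - δ₂ δ₁ f` of a commutator of variations. -/
def commutator {M A Λ : Type*} (δ₁ δ₂ : Hist M A Λ → Hist M A Λ)
    (f : Hist M A Λ → ℝ → M → ℝ) : Hist M A Λ → ℝ → M → ℝ :=
  fun u t x => vary δ₁ (vary δ₂ f) u t x - vary δ₂ (vary δ₁ f) u t x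

/-- The variation, at time `t`, of a functional of the fields at time `t`. -/
def varyFun {M A Λ : Type*} (δ : Hist M A Λ → Hist M A Λ) (G : ℝ → Conf M A Λ → ℝ)
    (u : Hist M A Λ) (t : ℝ) : ℝ :=
  deriv (fun s : ℝ => G t (inst (u + s • δ u) t)) 0

end Variations

/-- The data of a gauge field theory
`S = ∫ dt { ∫ ½ z^A σ_AB ∂_t z^B - H }`, `H = ∫ (h(z) + λ^a φ_a(z)) + ∮ b(z, λ)`,
with internal boundary conditions `χ^α(z, λ) |_∂M = ζ^α`, on the compact manifold with
boundary `M`. -/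
structure GaugeTheory (n : ℕ) [NeZero n] (M : Type*) [TopologicalSpace M]
    [ChartedSpace (EuclideanHalfSpace n) M] [MeasurableSpace M]
    (A Λ α : Type*) [Fintype A] [DecidableEq A] [Fintype Λ] where
  vol : Measure M
  bvol : Measure M
  /-- the constant matrix `σ^{AB}` -/
  σ : Matrix A A ℝ
  h : (A → M → ℝ) → M → ℝ
  φ : Λ → (A → M → ℝ) → M → ℝ
  b : (A ⊕ Λ → M → ℝ) → M → ℝ
  χ : α → (A ⊕ Λ → M → ℝ) → M → ℝ
  /-- the variational derivatives of `∫ h` -/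
  dh : A → (A → M → ℝ) → M → ℝ
  /-- the variational derivatives with respect to `z` of `∫ λ^a φ_a`, at fixed `λ` -/
  dφ : A → (A ⊕ Λ → M → ℝ) → M → ℝ
  vol_smooth : IsSmoothVolume n vol
  bvol_smooth : IsSmoothBoundaryVolume n bvol
  σ_antisymm : σ.transpose = -σ
  σ_invertible : IsUnit σ.det
  h_local : IsLocal n (fun _ => h)
  φ_local : ∀ a, IsLocal n (fun _ => φ a)
  b_local : IsLocal n (fun _ => b)
  χ_local : ∀ i, IsLocal n (fun _ => χ i)
  dh_local : ∀ i, IsLocal n (fun _ => dh i)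
  dφ_local : ∀ i, IsLocal n (fun _ => dφ i)
  dh_spec : IsVarDeriv n vol Finset.univ (fun z => ∫ x, h z x ∂vol) dh
  dφ_spec : ∀ l : Λ → M → ℝ, (∀ a, IsSmooth n (l a)) →
    IsVarDeriv n vol Finset.univ (fun z => ∫ x, ∑ a, l a x * φ a z x ∂vol)
      (fun i z => dφ i (Sum.elim z l))
  /-- `h` is first class: `{φ_a, ∫ h}` is a combination of the constraints and their
  derivatives. -/
  h_firstClass : ∀ a, ∃ L : (A → M → ℝ) → (Λ → M → ℝ) → M → ℝ, IsLinearLocal n L ∧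
    ∀ z : A → M → ℝ, (∀ i, IsSmooth n (z i)) →
      dder (φ a) z (fun i x => ∑ j, σ i j * dh j z x) = L z (fun c => φ c z)
  /-- the constraints are first class: `{φ_a, ∫ η^b φ_b}` is, for every smearing function `η`, a
  combination of the constraints and their derivatives. Here `Φ = (z, η)`. -/
  φ_firstClass : ∀ a, ∃ L : (A ⊕ Λ → M → ℝ) → (Λ → M → ℝ) → M → ℝ, IsLinearLocal n L ∧
    ∀ Φ : A ⊕ Λ → M → ℝ, (∀ i, IsSmooth n (Φ i)) →
      dder (φ a) (fun i => Φ (Sum.inl i)) (fun i x => ∑ j, σ i j * dφ j Φ x) =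
        L Φ (fun c => φ c (fun i => Φ (Sum.inl i)))

namespace GaugeTheory

variable {n : ℕ} [NeZero n] {M : Type*} [TopologicalSpace M]
  [ChartedSpace (EuclideanHalfSpace n) M] [MeasurableSpace M]
  {A Λ α : Type*} [Fintype A] [DecidableEq A] [Fintype Λ] (T : GaugeTheory n M A Λ α)

/-- The hamiltonian `H[z, λ]`. -/
def H (Φ : A ⊕ Λ → M → ℝ) : ℝ :=
  (∫ x, (T.h (fun i => Φ (Sum.inl i)) x
      + ∑ a, Φ (Sum.inr a) x * T.φ a (fun i => Φ (Sum.inl i)) x) ∂T.vol)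
    + ∫ x, T.b Φ x ∂T.bvol

/-- `δH/δz^A`; the boundary term does not contribute. -/
def dH (i : A) (Φ : A ⊕ Λ → M → ℝ) : M → ℝ :=
  T.dh i (fun j => Φ (Sum.inl j)) + T.dφ i Φ

/-- `σ^{AB} δH/δz^B`. -/
def XH (i : A) (Φ : A ⊕ Λ → M → ℝ) : M → ℝ :=
  fun x => ∑ j, T.σ i j * T.dH j Φ x

/-- The equations of motion `∂_t z^A - σ^{AB} δH/δz^B`. -/
def eom (i : A) (u : Hist M A Λ) : ℝ → M → ℝ :=
  fun t x => deriv (fun τ => u (Sum.inl i) τ x) t - T.XH i (low (inst u t)) x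

/-- `φ_a` along a history. -/
def constraintAlong (a : Λ) (u : Hist M A Λ) : ℝ → M → ℝ :=
  fun t => T.φ a (fun i => u (Sum.inl i) t)

/-- `χ^α` along a history. -/
def χAlong (i : α) (u : Hist M A Λ) : ℝ → M → ℝ :=
  fun t => T.χ i (low (inst u t))

/-- Smooth histories satisfying the external boundary conditions `χ_E |_∂M = 0`: the constraints,
the equations of motion and all their derivatives vanish on the boundary. -/
def External (u : Hist M A Λ) : Prop :=
  SmoothHist n u ∧ (∀ a t, FlatOnBoundary n (T.constraintAlong a u t)) ∧
    ∀ i t, FlatOnBoundary n (T.eom i u t)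

/-- The linearised external boundary conditions at `u`, `δχ_E |_∂M = 0`, for `δu = Y`. -/
def LinExternal (u Y : Hist M A Λ) : Prop :=
  (∀ a t, FlatOnBoundary n (hder (T.constraintAlong a) u Y t)) ∧
    ∀ i t, FlatOnBoundary n (hder (T.eom i) u Y t)

/-- `δχ_E |_∂M = 0` for all histories with `χ_E |_∂M = 0`. -/
def PreservesExternal (δ : Hist M A Λ → Hist M A Λ) : Prop :=
  ∀ u, T.External u → T.LinExternal u (δ u)

/-- Variations preserving the internal boundary conditions: `δχ_E |_∂M = 0` and `δχ |_∂M = 0`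
for all histories with `χ_E |_∂M = 0`. -/
def PreservesInternal (δ : Hist M A Λ → Hist M A Λ) : Prop :=
  SmoothVariation n δ ∧ T.PreservesExternal δ ∧
    ∀ u, T.External u → ∀ i t, ∀ x ∈ (𝓡∂ n).boundary M, vary δ (T.χAlong i) u t x = 0

/-- Regularity of the external boundary conditions: every solution of the linearised conditions is
tangent to a curve of solutions. -/
def RegularExternal : Prop :=
  ∀ u Y : Hist M A Λ, T.External u → SmoothHist n Y → T.LinExternal u Y →
    ∃ c : ℝ → Hist M A Λ, SmoothFamily n ℝ c ∧ (∀ s, T.External (c s)) ∧ c 0 = u ∧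
      ∀ i t x, deriv (fun s => c s i t x) 0 = Y i t x

/-- The hamiltonian has a well defined variation: `δH = ∫ (δH/δz^A δz^A + φ_a δλ^a)` for all `δ`
preserving the internal boundary conditions. -/
def RegularHamiltonian : Prop :=
  ∀ δ : Hist M A Λ → Hist M A Λ, T.PreservesInternal δ → ∀ u, T.External u → ∀ t,
    varyFun δ (fun _ Φ => T.H (low Φ)) u t =
      ∫ x, ((∑ i, T.dH i (low (inst u t)) x * δ u (Sum.inl i) t x)
        + ∑ a, T.φ a (fun i => u (Sum.inl i) t) x * δ u (Sum.inr a) t x) ∂T.vol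

/-- Local functionals `G[t, z, λ, λ', …]`: the integral over `M` of a local function, plus the
integral over `∂M` of a local function. -/
def IsLocalFunctional (G : ℝ → Conf M A Λ → ℝ) : Prop :=
  ∃ g k : ℝ → Conf M A Λ → M → ℝ, IsLocal n g ∧ IsLocal n k ∧
    ∀ t Φ, (∀ i, IsSmooth n (Φ i)) → G t Φ = (∫ x, g t Φ x ∂T.vol) + ∫ x, k t Φ x ∂T.bvol

/-- A couple `(G, δ_G^λ)`: a local functional `G[t, z, λ, λ', …]` and a transformation
`δ_G λ^a = Λ^a(t, z, λ, λ', …)` given by local functions. The variational derivatives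
`E` of `G`, which always exist and are unique, are recorded together with `G`; those with respect to
the time derivatives of `λ` of order greater than `order` vanish and are left out of all sums. -/
structure Couple where
  G : ℝ → Conf M A Λ → ℝ
  δlam : Λ → ℝ → Conf M A Λ → M → ℝ
  order : ℕ
  E : A ⊕ (ℕ × Λ) → ℝ → Conf M A Λ → M → ℝ
  G_local : T.IsLocalFunctional G
  δlam_local : ∀ a, IsLocal n (δlam a)
  E_local : ∀ i, IsLocal n (E i)
  E_spec : ∀ t, IsVarDeriv n T.vol (upTo A Λ order) (G t) (fun i => E i t)

/-- `d/dt` of the multipliers: the direction `λ^(l) ↦ λ^(l+1)`, with `z` fixed. -/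
def shift (Φ : Conf M A Λ) : Conf M A Λ :=
  Sum.elim 0 (fun p => Φ (Sum.inr (p.1 + 1, p.2)))

/-- `D/Dt` on functionals: `∂/∂t` plus the time derivative of the multipliers. -/
def DDt (G : ℝ → Conf M A Λ → ℝ) (t : ℝ) (Φ : Conf M A Λ) : ℝ :=
  deriv (fun τ => G τ Φ) t + fder (G t) Φ (shift Φ)

/-- `δ_t = D/Dt + {·, H}` on local functions. -/
def δt (f : ℝ → Conf M A Λ → M → ℝ) : ℝ → Conf M A Λ → M → ℝ :=
  fun t Φ x => deriv (fun τ => f τ Φ x) t +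
    dder (f t) Φ (Sum.elim (fun i => T.XH i (low Φ)) (fun p => Φ (Sum.inr (p.1 + 1, p.2)))) x

/-- The hamiltonian vector field `σ^{AB} E_B`. -/
def ham (E : A → ℝ → Conf M A Λ → M → ℝ) (t : ℝ) (Φ : Conf M A Λ) : A → M → ℝ :=
  fun i x => ∑ j, T.σ i j * E j t Φ x

/-- The same, as a variation of `z` only. -/
def hamZ (E : A → ℝ → Conf M A Λ → M → ℝ) (t : ℝ) (Φ : Conf M A Λ) : Conf M A Λ :=
  Sum.elim (T.ham E t Φ) 0

/-- The Poisson bracket `{F, G} = ∫ δF/δz^A σ^{AB} δG/δz^B`, in terms of `EF = δF/δz` and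
`EG = δG/δz`. -/
def poisson (EF EG : A → ℝ → Conf M A Λ → M → ℝ) (t : ℝ) (Φ : Conf M A Λ) : ℝ :=
  ∫ x, ∑ i, EF i t Φ x * T.ham EG t Φ i x ∂T.vol

/-- The boundary term `∮ Θ_F[δz] = δF - ∫ δF/δz^A δz^A` in the variation of `F` under a variation
of `z` only. -/
def boundaryTerm (F : ℝ → Conf M A Λ → ℝ) (EF : A → ℝ → Conf M A Λ → M → ℝ)
    (t : ℝ) (Φ : Conf M A Λ) (dz : A → M → ℝ) : ℝ :=
  fder (F t) Φ (Sum.elim dz 0) - ∫ x, ∑ i, EF i t Φ x * dz i x ∂T.vol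

/-- The modified bracket `{F, G}_ζ = {F, G} + ∮ Θ_F[δ_G z] - ∮ Θ_G[δ_F z]`, which involves
only `z`. -/
def bracketζ (F : ℝ → Conf M A Λ → ℝ) (EF : A → ℝ → Conf M A Λ → M → ℝ)
    (G : ℝ → Conf M A Λ → ℝ) (EG : A → ℝ → Conf M A Λ → M → ℝ)
    (t : ℝ) (Φ : Conf M A Λ) : ℝ :=
  T.poisson EF EG t Φ + T.boundaryTerm F EF t Φ (T.ham EG t Φ)
    - T.boundaryTerm G EG t Φ (T.ham EF t Φ)

/-- The boundary functional `∮ v`. -/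
def boundaryFunctional (v : ℝ → Conf M A Λ → M → ℝ) : ℝ → Conf M A Λ → ℝ :=
  fun t Φ => ∫ x, v t Φ x ∂T.bvol

/-- The Lagrangian `∫ ½ z^A σ_AB ∂_t z^B - H[z, λ]` at time `t`. -/
def lagrangian (u : Hist M A Λ) (t : ℝ) : ℝ :=
  (∫ x, (1 / 2 : ℝ) * ∑ i, ∑ j,
      u (Sum.inl i) t x * T.σ⁻¹ i j * deriv (fun τ => u (Sum.inl j) τ x) t ∂T.vol)
    - T.H (low (inst u t))

namespace Couple

variable {T}

/-- `δG/δz^A`. -/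
def Ez (c : T.Couple) : A → ℝ → Conf M A Λ → M → ℝ := fun i => c.E (Sum.inl i)

/-- The transformation of histories generated by the couple:
`δ_G z^A = σ^{AB} δG/δz^B`, `δ_G λ^a = Λ^a`. -/
def variation (c : T.Couple) : Hist M A Λ → Hist M A Λ :=
  fun u => Sum.elim (fun i t => T.ham c.Ez t (inst u t) i) (fun a t => c.δlam a t (inst u t))

/-- `δ̃_G^λ λ^(l) = δ_t^l Λ`, with `z` fixed. -/
def tildeLam (c : T.Couple) (t : ℝ) (Φ : Conf M A Λ) : Conf M A Λ :=
  Sum.elim 0 (fun p => (T.δt)^[p.1] (c.δlam p.2) t Φ)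

/-- The variation `δ̃_G` of the fields at fixed time:
`δ̃_G z^A = σ^{AB} δG/δz^B`, `δ̃_G λ^(l) = δ_t^l Λ`. -/
def tilde (c : T.Couple) (t : ℝ) (Φ : Conf M A Λ) : Conf M A Λ :=
  Sum.elim (T.ham c.Ez t Φ) (fun p => (T.δt)^[p.1] (c.δlam p.2) t Φ)

/-- The differentiability conditions: for all variations `δ` preserving the internal boundary
conditions and all histories satisfying the external ones, `[δ_G, δ] χ^α |_∂M = 0` and
`δG = ∫ (δG/δz^A δz^A + ∑_l δG/δλ^(l) δλ^(l))`. -/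
def IsDifferentiable (c : T.Couple) : Prop :=
  ∀ δ : Hist M A Λ → Hist M A Λ, T.PreservesInternal δ → ∀ u, T.External u → ∀ t,
    (∀ i, ∀ x ∈ (𝓡∂ n).boundary M, commutator c.variation δ (T.χAlong i) u t x = 0) ∧
    varyFun δ c.G u t =
      ∫ x, ∑ i ∈ upTo A Λ c.order, c.E i t (inst u t) x * inst (δ u) t i x ∂T.vol

/-- The couple generates an external symmetry of the action: the transformation generated by the
couple preserves the external boundary conditions, and there is a boundary term `∮ V`, invariant
under all variations preserving the internal boundary conditions, such that on all histories
satisfying the external boundary conditions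
* the transformation changes the Lagrangian by a total time derivative plus `∮ V`;
* `G` satisfies the conservation law `D/Dt G + {G, H}_ζ - δ_G^λ H = ∮ V`. -/
def GeneratesExternalSymmetry (c : T.Couple) : Prop :=
  T.PreservesExternal c.variation ∧
  ∃ v : ℝ → Conf M A Λ → M → ℝ, IsLocal n v ∧
    (∀ δ : Hist M A Λ → Hist M A Λ, T.PreservesInternal δ → ∀ u, T.External u → ∀ t,
      varyFun δ (T.boundaryFunctional v) u t = 0) ∧
    (∃ U : ℝ → Conf M A Λ → ℝ, T.IsLocalFunctional U ∧ ∀ u, T.External u → ∀ t,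
      deriv (fun s : ℝ => T.lagrangian (u + s • c.variation u) t) 0 =
        deriv (fun τ => U τ (inst u τ)) t + T.boundaryFunctional v t (inst u t)) ∧
    ∀ u, T.External u → ∀ t,
      DDt c.G t (inst u t)
        + T.bracketζ c.G c.Ez (fun _ Φ => T.H (low Φ)) (fun i _ Φ => T.dH i (low Φ)) t (inst u t)
        - fder (fun Φ => T.H (low Φ)) (inst u t) (c.tildeLam t (inst u t))
      = T.boundaryFunctional v t (inst u t)

end Couple

/-- The functional `{G₂, G₁}_g = δ̃₁ G₂ - δ̃₂ G₁ - {G₂, G₁}`. -/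
def bracketG (c₁ c₂ : T.Couple) (t : ℝ) (Φ : Conf M A Λ) : ℝ :=
  fder (c₂.G t) Φ (c₁.tilde t Φ) - fder (c₁.G t) Φ (c₂.tilde t Φ) - T.poisson c₂.Ez c₁.Ez t Φ

/-- `δ_[1,2] λ^a = δ̃₁ Λ₂^a - δ̃₂ Λ₁^a`. -/
def bracketLam (c₁ c₂ : T.Couple) (a : Λ) (t : ℝ) (Φ : Conf M A Λ) : M → ℝ :=
  dder (c₂.δlam a t) Φ (c₁.tilde t Φ) - dder (c₁.δlam a t) Φ (c₂.tilde t Φ)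

end GaugeTheory

end GaugeField

end

/-!
# The bracket of external symmetries of a first order gauge theory

Call a history external if it satisfies the external boundary conditions, and a function flat if
all its derivatives vanish at the boundary. The proof rests on the fact that flat terms never
produce boundary terms, together with two ways of deriving an identity that holds at external
histories only.

*Calculus.* Spaces of fields and histories carry the smooth structure given by their
finite-dimensional smooth families (`PlotSpace`); Hadamard's lemma provides the chain rule, and
second derivatives commute (`SmoothFun.hd_comm`, `SmoothFun.hd_commutator`). Every local function
has a local formal adjoint of its linearisation (`exists_eulerLagrange`), obtained in charts by
integration by parts and glued by the fundamental lemma of the calculus of variations. Hence `δG =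
∫ ∑ (δG/δΦ_i) δΦ_i` for every flat variation (`HasEL`), and the second variation is symmetric if
one of the two directions is flat (`HasEL.integral_dder_symm`).

*Identities at external histories.* Adding a flat history to an external one gives an external
one. Therefore external histories are arbitrary in the interior, and a local functional vanishing
on them has vanishing Euler–Lagrange derivatives everywhere (`fder_eq_zero_of_external`). Besides,
by regularity, an identity at external histories may be derived along any variation that preserves
the external boundary conditions (`hd_eq_zero_of_external`).

*Consequences of the conservation law.* Let `D = ∂_t + flow`, where the flow is the right-hand
side of the equations of motion. The conservation law of `G` reads `D G - δ̃_G H - {G, H} = ∮ v`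
(`noether`, `Couple.Conserved`). The first principle gives its Euler–Lagrange equations
(`exists_noether_relations`): `D (δG/δz) = δ̃_G (δH/δz) + Q`, and `δG/δλ^(l)` is the sum of a
constraint term `Q` and of `-D (δG/δλ^(l+1))`. Here `Q` is flat at external histories, because the
constraints are. By downward induction on `l`, all `δG/δλ^(l)` are flat (`flatExternal_Ebar`). The
equations of motion being flat as well, `δ̃_G` differs from the variation `δ_G` of histories by a
flat defect (`flat_defect`).

*Differentiability of the bracket.* If `δ` preserves the internal boundary conditions, so does
`[δ_G, δ]` (`preservesInternal_comm`). Computing `δ δ_1 G_2` as `δ_1 δ G_2 - [δ_1, δ] G_2` shows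
that `δ̃_1 G_2` has a variation without boundary terms (`mixed_of_external`). The remaining
derivatives of the multiplier transformations can be integrated by parts since they are multiplied
by the flat functions `δG/δλ^(l)` (`exists_bracket`). This also shows that the transformation
generated by the bracket is `[δ_1, δ_2]` up to flat terms (`IsBracket.flat_sub_comm`). So it
preserves the external boundary conditions, and its commutator with `δ` annihilates the `χ^α`,
because `δ_1` and `δ_2` map expressions annihilated by all such `δ` to expressions of the same
kind (`InternallyInvariant.variation`).

*The conservation law of the bracket.* By the Euler–Lagrange equations above, `[D, δ̃_G]` acts on
`z` only, by the hamiltonian vector field of the flat `Q` (`lieFun_flow_tilde`). Commuting `D`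
past `δ̃_1` and `δ̃_2` and using the two conservation laws yields the conservation law of the
bracket with the boundary term `δ̃_1 v_2 - δ̃_2 v_1` (`IsBracket.conserved`). Finally, the
conservation law alone implies that the Lagrangian changes by the boundary term and the time
derivative of `½ ∫ z^A δG/δz^A - G` (`Conserved.exists_lagrangian`).
-/

set_option linter.unusedSectionVars false

set_option maxSynthPendingDepth 3

noncomputable section

namespace GaugeField

open Set Filter Topology

/-! ### Calculus on spaces of fields -/

/-- A smooth structure on a vector space `V` of fields, given by the smooth finite-dimensional
families ("plots") in `V`. The last axiom is Hadamard's lemma; it makes the derivative of a smooth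
function along a curve depend on the velocity of the curve only. -/
structure PlotSpace (V : Type*) [AddCommGroup V] [Module ℝ V] where
  IsPlot : ∀ (P : Type) [NormedAddCommGroup P] [NormedSpace ℝ P] [FiniteDimensional ℝ P],
    (P → V) → Prop
  add : ∀ {P : Type} [NormedAddCommGroup P] [NormedSpace ℝ P] [FiniteDimensional ℝ P]
    {c c' : P → V}, IsPlot P c → IsPlot P c' → IsPlot P (fun p => c p + c' p)
  smul : ∀ {P : Type} [NormedAddCommGroup P] [NormedSpace ℝ P] [FiniteDimensional ℝ P]
    {a : P → ℝ} {c : P → V}, ContDiff ℝ ∞ a → IsPlot P c → IsPlot P (fun p => a p • c p)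
  comp : ∀ {P Q : Type} [NormedAddCommGroup P] [NormedSpace ℝ P] [FiniteDimensional ℝ P]
    [NormedAddCommGroup Q] [NormedSpace ℝ Q] [FiniteDimensional ℝ Q] {g : Q → P} {c : P → V},
    ContDiff ℝ ∞ g → IsPlot P c → IsPlot Q (fun q => c (g q))
  hadamard : ∀ {c : ℝ → V}, IsPlot ℝ c → ∃ R : ℝ → V, IsPlot ℝ R ∧ ∀ s, c s = c 0 + s • R s

/-- The derivative of `f` at `u` in the direction `Y`. -/
def hd {V : Type*} [AddCommGroup V] [Module ℝ V] (f : V → ℝ) (u Y : V) : ℝ :=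
  deriv (fun s : ℝ => f (u + s • Y)) 0

namespace PlotSpace

variable {V W : Type*} [AddCommGroup V] [Module ℝ V] [AddCommGroup W] [Module ℝ W]
  (𝒱 : PlotSpace V) (𝒲 : PlotSpace W)

/-- Smooth points: the constant families are smooth. -/
def Pt (u : V) : Prop := 𝒱.IsPlot ℝ (fun _ => u)

/-- Smooth real functions of the fields. -/
def SmoothFun (f : V → ℝ) : Prop :=
  ∀ (P : Type) [NormedAddCommGroup P] [NormedSpace ℝ P] [FiniteDimensional ℝ P] (c : P → V),
    𝒱.IsPlot P c → ContDiff ℝ ∞ (fun p => f (c p))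

/-- Smooth maps: they send smooth families to smooth families. -/
def SmoothMap (X : V → W) : Prop :=
  ∀ (P : Type) [NormedAddCommGroup P] [NormedSpace ℝ P] [FiniteDimensional ℝ P] (c : P → V),
    𝒱.IsPlot P c → 𝒲.IsPlot P (fun p => X (c p))

/-- The smooth curve `c` has velocity `Y` at the parameter `0`. -/
def HasVel (c : ℝ → V) (Y : V) : Prop :=
  ∃ R : ℝ → V, 𝒱.IsPlot ℝ R ∧ (∀ s, c s = c 0 + s • R s) ∧ R 0 = Y

variable {𝒱 𝒲}

lemma IsPlot.pt {P : Type} [NormedAddCommGroup P] [NormedSpace ℝ P] [FiniteDimensional ℝ P]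
    {c : P → V} (hc : 𝒱.IsPlot P c) (p : P) : 𝒱.Pt (c p) :=
  𝒱.comp (g := fun _ : ℝ => p) contDiff_const hc

lemma Pt.plot {u : V} (hu : 𝒱.Pt u) (P : Type) [NormedAddCommGroup P] [NormedSpace ℝ P]
    [FiniteDimensional ℝ P] : 𝒱.IsPlot P (fun _ => u) :=
  𝒱.comp (g := fun _ : P => (0 : ℝ)) contDiff_const hu

lemma Pt.add {u v : V} (hu : 𝒱.Pt u) (hv : 𝒱.Pt v) : 𝒱.Pt (u + v) := 𝒱.add hu hv

lemma Pt.smul {u : V} (hu : 𝒱.Pt u) (r : ℝ) : 𝒱.Pt (r • u) := 𝒱.smul contDiff_const hu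

lemma Pt.neg {u : V} (hu : 𝒱.Pt u) : 𝒱.Pt (-u) := by
  simpa using hu.smul (-1)

lemma Pt.sub {u v : V} (hu : 𝒱.Pt u) (hv : 𝒱.Pt v) : 𝒱.Pt (u - v) := by
  simpa [sub_eq_add_neg] using hu.add hv.neg

lemma Pt.line {u v : V} (hu : 𝒱.Pt u) (hv : 𝒱.Pt v) :
    𝒱.IsPlot ℝ (fun s => u + s • v) :=
  𝒱.add hu (𝒱.smul contDiff_id hv)

lemma SmoothMap.pt {X : V → W} (hX : 𝒱.SmoothMap 𝒲 X) {u : V} (hu : 𝒱.Pt u) : 𝒲.Pt (X u) :=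
  hX ℝ _ hu

lemma hasVel_line {u Y : V} (hY : 𝒱.Pt Y) : 𝒱.HasVel (fun s => u + s • Y) Y :=
  ⟨fun _ => Y, hY, by simp, rfl⟩

lemma _root_.ContDiff.hasDerivAt_diag {F : ℝ × ℝ → ℝ} (hF : ContDiff ℝ ∞ F) :
    HasDerivAt (fun s => F (s, s))
      (deriv (fun a => F (a, 0)) 0 + deriv (fun b => F (0, b)) 0) 0 := by
  have hd : HasFDerivAt F (fderiv ℝ F (0, 0)) (0, 0) :=
    (hF.differentiable (by simp) _).hasFDerivAt
  have h1 : HasDerivAt (fun a : ℝ => F (a, 0)) (fderiv ℝ F (0, 0) (1, 0)) 0 :=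
    HasFDerivAt.comp_hasDerivAt (f := fun a : ℝ => (a, (0 : ℝ))) (0 : ℝ) hd
      ((hasDerivAt_id (0 : ℝ)).prodMk (hasDerivAt_const (0 : ℝ) (0 : ℝ)))
  have h2 : HasDerivAt (fun a : ℝ => F (0, a)) (fderiv ℝ F (0, 0) (0, 1)) 0 :=
    HasFDerivAt.comp_hasDerivAt (f := fun a : ℝ => ((0 : ℝ), a)) (0 : ℝ) hd
      ((hasDerivAt_const (0 : ℝ) (0 : ℝ)).prodMk (hasDerivAt_id (0 : ℝ)))
  have h3 : HasDerivAt (fun a : ℝ => F (a, a)) (fderiv ℝ F (0, 0) (1, 1)) 0 :=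
    HasFDerivAt.comp_hasDerivAt (f := fun a : ℝ => (a, a)) (0 : ℝ) hd
      ((hasDerivAt_id (0 : ℝ)).prodMk (hasDerivAt_id (0 : ℝ)))
  rw [h1.deriv, h2.deriv, ← map_add]
  simpa using h3

lemma _root_.ContDiff.deriv_param {P : Type*} [NormedAddCommGroup P] [NormedSpace ℝ P]
    {F : P × ℝ → ℝ} (hF : ContDiff ℝ ∞ F) :
    ContDiff ℝ ∞ (fun p => deriv (fun r => F (p, r)) 0) := by
  have : (fun p => deriv (fun r => F (p, r)) 0) = fun p => fderiv ℝ F (p, 0) (0, 1) := by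
    funext p
    exact (HasFDerivAt.comp_hasDerivAt (f := fun a : ℝ => (p, a)) (0 : ℝ)
      ((hF.differentiable (by simp) (p, 0)).hasFDerivAt)
      ((hasDerivAt_const (0 : ℝ) p).prodMk (hasDerivAt_id (0 : ℝ)))).deriv
  rw [this]
  exact ((hF.fderiv_right (m := ∞) (by simp)).comp (contDiff_id.prodMk contDiff_const)).clm_apply
    contDiff_const

lemma SmoothFun.contDiff_hd {f : V → ℝ} (hf : 𝒱.SmoothFun f) {P : Type} [NormedAddCommGroup P]
    [NormedSpace ℝ P] [FiniteDimensional ℝ P] {c Y : P → V} (hc : 𝒱.IsPlot P c)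
    (hY : 𝒱.IsPlot P Y) : ContDiff ℝ ∞ (fun p => hd f (c p) (Y p)) :=
  ContDiff.deriv_param (F := fun q : P × ℝ => f (c q.1 + q.2 • Y q.1))
    (hf (P × ℝ) _ (𝒱.add (𝒱.comp contDiff_fst hc) (𝒱.smul contDiff_snd (𝒱.comp contDiff_fst hY))))

/-- The derivative along a smooth vector field of a smooth function is smooth. -/
lemma SmoothFun.hd {f : V → ℝ} (hf : 𝒱.SmoothFun f) {X : V → V} (hX : 𝒱.SmoothMap 𝒱 X) :
    𝒱.SmoothFun (fun u => hd f u (X u)) :=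
  fun P _ _ _ c hc => hf.contDiff_hd hc (hX P c hc)

/-- The chain rule along smooth curves. -/
lemma SmoothFun.hasDerivAt {f : V → ℝ} (hf : 𝒱.SmoothFun f) {c : ℝ → V} {Y : V}
    (h0 : 𝒱.Pt (c 0)) (hc : 𝒱.HasVel c Y) :
    HasDerivAt (fun s => f (c s)) (GaugeField.hd f (c 0) Y) 0 := by
  obtain ⟨R, hR, hcR, rfl⟩ := hc
  have hF : ContDiff ℝ ∞ (fun q : ℝ × ℝ => f (c 0 + q.1 • R q.2)) :=
    hf (ℝ × ℝ) _ (𝒱.add (h0.plot _) (𝒱.smul contDiff_fst (𝒱.comp contDiff_snd hR)))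
  have := hF.hasDerivAt_diag
  simp only [zero_smul, add_zero, deriv_const] at this
  exact this.congr_of_eventuallyEq (Filter.Eventually.of_forall fun s => by
    show f (c s) = _
    rw [hcR s])

lemma SmoothFun.hasDerivAt_line {f : V → ℝ} (hf : 𝒱.SmoothFun f) {u Y : V}
    (hu : 𝒱.Pt u) (hY : 𝒱.Pt Y) :
    HasDerivAt (fun s : ℝ => f (u + s • Y)) (GaugeField.hd f u Y) 0 := by
  have := hf.hasDerivAt (c := fun s => u + s • Y) (by simpa using hu) (hasVel_line hY)
  simpa using this

lemma SmoothFun.hd_add {f : V → ℝ} (hf : 𝒱.SmoothFun f) {u Y Z : V}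
    (hu : 𝒱.Pt u) (hY : 𝒱.Pt Y) (hZ : 𝒱.Pt Z) :
    GaugeField.hd f u (Y + Z) = GaugeField.hd f u Y + GaugeField.hd f u Z := by
  have hF : ContDiff ℝ ∞ (fun q : ℝ × ℝ => f (u + q.1 • Y + q.2 • Z)) :=
    hf (ℝ × ℝ) _ (𝒱.add (𝒱.add (hu.plot _) (𝒱.smul contDiff_fst (hY.plot _)))
      (𝒱.smul contDiff_snd (hZ.plot _)))
  have := hF.hasDerivAt_diag.deriv
  simp only [zero_smul, add_zero] at this
  rw [GaugeField.hd, GaugeField.hd, GaugeField.hd, ← this]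
  simp only [smul_add, add_assoc]

lemma SmoothFun.hd_smul {f : V → ℝ} (hf : 𝒱.SmoothFun f) {u Y : V}
    (hu : 𝒱.Pt u) (hY : 𝒱.Pt Y) (r : ℝ) :
    GaugeField.hd f u (r • Y) = r * GaugeField.hd f u Y := by
  have h := hf.hasDerivAt_line hu hY
  have h2 : HasDerivAt (fun s : ℝ => s * r) r 0 := by
    simpa using (hasDerivAt_id (0 : ℝ)).mul_const r
  have h3 := HasDerivAt.comp (0 : ℝ) (h₂ := fun s : ℝ => f (u + s • Y)) (h := fun s : ℝ => s * r)
    (h₂' := GaugeField.hd f u Y) (by simpa using h) h2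
  have h4 := h3.deriv
  rw [mul_comm, ← h4, GaugeField.hd]
  simp [Function.comp_def, smul_smul]

lemma SmoothFun.hd_sub {f : V → ℝ} (hf : 𝒱.SmoothFun f) {u Y Z : V}
    (hu : 𝒱.Pt u) (hY : 𝒱.Pt Y) (hZ : 𝒱.Pt Z) :
    GaugeField.hd f u (Y - Z) = GaugeField.hd f u Y - GaugeField.hd f u Z := by
  have h := hf.hd_add hu hY (hZ.smul (-1))
  rw [hf.hd_smul hu hZ] at h
  rw [sub_eq_add_neg, ← neg_one_smul ℝ Z, h]
  ring

lemma SmoothFun.hd_fun_add {f g : V → ℝ} (hf : 𝒱.SmoothFun f) (hg : 𝒱.SmoothFun g) {u Y : V}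
    (hu : 𝒱.Pt u) (hY : 𝒱.Pt Y) :
    GaugeField.hd (fun v => f v + g v) u Y = GaugeField.hd f u Y + GaugeField.hd g u Y :=
  ((hf.hasDerivAt_line hu hY).add (hg.hasDerivAt_line hu hY)).deriv

lemma SmoothFun.hd_fun_sub {f g : V → ℝ} (hf : 𝒱.SmoothFun f) (hg : 𝒱.SmoothFun g) {u Y : V}
    (hu : 𝒱.Pt u) (hY : 𝒱.Pt Y) :
    GaugeField.hd (fun v => f v - g v) u Y = GaugeField.hd f u Y - GaugeField.hd g u Y :=
  ((hf.hasDerivAt_line hu hY).sub (hg.hasDerivAt_line hu hY)).deriv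

lemma SmoothFun.hd_fun_mul {f g : V → ℝ} (hf : 𝒱.SmoothFun f) (hg : 𝒱.SmoothFun g) {u Y : V}
    (hu : 𝒱.Pt u) (hY : 𝒱.Pt Y) :
    GaugeField.hd (fun v => f v * g v) u Y
      = GaugeField.hd f u Y * g u + f u * GaugeField.hd g u Y := by
  have := ((hf.hasDerivAt_line hu hY).mul (hg.hasDerivAt_line hu hY)).deriv
  simpa [GaugeField.hd, Pi.mul_def] using this

lemma SmoothFun.add {f g : V → ℝ} (hf : 𝒱.SmoothFun f) (hg : 𝒱.SmoothFun g) :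
    𝒱.SmoothFun (fun u => f u + g u) :=
  fun P _ _ _ c hc => (hf P c hc).add (hg P c hc)

lemma SmoothFun.sub {f g : V → ℝ} (hf : 𝒱.SmoothFun f) (hg : 𝒱.SmoothFun g) :
    𝒱.SmoothFun (fun u => f u - g u) :=
  fun P _ _ _ c hc => (hf P c hc).sub (hg P c hc)

lemma SmoothFun.mul {f g : V → ℝ} (hf : 𝒱.SmoothFun f) (hg : 𝒱.SmoothFun g) :
    𝒱.SmoothFun (fun u => f u * g u) :=
  fun P _ _ _ c hc => (hf P c hc).mul (hg P c hc)

lemma smoothFun_const (r : ℝ) : 𝒱.SmoothFun (fun _ => r) :=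
  fun _ _ _ _ _ _ => contDiff_const

lemma SmoothFun.hd_fun_sum {κ : Type*} (s : Finset κ) {f : κ → V → ℝ}
    (hf : ∀ i ∈ s, 𝒱.SmoothFun (f i)) {u Y : V} (hu : 𝒱.Pt u) (hY : 𝒱.Pt Y) :
    GaugeField.hd (fun v => ∑ i ∈ s, f i v) u Y = ∑ i ∈ s, GaugeField.hd (f i) u Y :=
  (HasDerivAt.fun_sum fun i hi => (hf i hi).hasDerivAt_line hu hY).deriv

/-- Second derivatives of smooth functions are symmetric. -/
lemma SmoothFun.hd_comm {f : V → ℝ} (hf : 𝒱.SmoothFun f) {u Y Z : V}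
    (hu : 𝒱.Pt u) (hY : 𝒱.Pt Y) (hZ : 𝒱.Pt Z) :
    GaugeField.hd (fun v => GaugeField.hd f v Z) u Y =
      GaugeField.hd (fun v => GaugeField.hd f v Y) u Z := by
  have hF : ContDiff ℝ ∞ (fun q : ℝ × ℝ => f (u + q.1 • Y + q.2 • Z)) :=
    hf (ℝ × ℝ) _ (𝒱.add (𝒱.add (hu.plot _) (𝒱.smul contDiff_fst (hY.plot _)))
      (𝒱.smul contDiff_snd (hZ.plot _)))
  set F := (fun q : ℝ × ℝ => f (u + q.1 • Y + q.2 • Z)) with hFdef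
  have hd1 : ∀ (q w : ℝ × ℝ), deriv (fun r : ℝ => F (q + r • w)) 0 = fderiv ℝ F q w := by
    intro q w
    have h2 : HasDerivAt (fun r : ℝ => q + r • w) w 0 := by
      simpa using ((hasDerivAt_id (0 : ℝ)).smul_const w).const_add q
    exact (HasFDerivAt.comp_hasDerivAt (f := fun r : ℝ => q + r • w) (0 : ℝ)
      (by simpa using (hF.differentiable (by simp) q).hasFDerivAt) h2).deriv
  have hF' : ContDiff ℝ ∞ (fderiv ℝ F) := hF.fderiv_right (by simp)
  have hd2 : ∀ (w w' : ℝ × ℝ), deriv (fun r : ℝ => fderiv ℝ F (0 + r • w) w') 0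
      = fderiv ℝ (fderiv ℝ F) 0 w w' := by
    intro w w'
    have h2 : HasDerivAt (fun r : ℝ => (0 : ℝ × ℝ) + r • w) w 0 := by
      simpa using ((hasDerivAt_id (0 : ℝ)).smul_const w).const_add (0 : ℝ × ℝ)
    have h3 := HasFDerivAt.comp_hasDerivAt (f := fun r : ℝ => (0 : ℝ × ℝ) + r • w) (0 : ℝ)
      (l := fderiv ℝ F) (by simpa using (hF'.differentiable (by simp) 0).hasFDerivAt) h2
    exact (h3.clm_apply (hasDerivAt_const (0 : ℝ) w')).deriv.trans (by simp)
  have e1 : GaugeField.hd (fun v => GaugeField.hd f v Z) u Y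
      = fderiv ℝ (fderiv ℝ F) 0 (1, 0) (0, 1) := by
    rw [← hd2]
    simp only [← hd1]
    simp [GaugeField.hd, hFdef]
  have e2 : GaugeField.hd (fun v => GaugeField.hd f v Y) u Z
      = fderiv ℝ (fderiv ℝ F) 0 (0, 1) (1, 0) := by
    rw [← hd2]
    simp only [← hd1]
    simp [GaugeField.hd, hFdef, add_right_comm]
  rw [e1, e2]
  have h2 : (2 : WithTop ℕ∞) ≤ ∞ := WithTop.coe_le_coe.2 (le_top : (2 : ℕ∞) ≤ ⊤)
  exact (hF.contDiffAt.isSymmSndFDerivAt (by simpa using h2)).eq _ _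

/-- The product rule for `X f`, where `X` is a vector field whose derivative along `Y` is `Z`. -/
lemma SmoothFun.hd_hd {f : V → ℝ} (hf : 𝒱.SmoothFun f) {X : V → V} (hX : 𝒱.SmoothMap 𝒱 X)
    {u Y Z : V} (hu : 𝒱.Pt u) (hY : 𝒱.Pt Y) (hZ : 𝒱.HasVel (fun s => X (u + s • Y)) Z) :
    GaugeField.hd (fun v => GaugeField.hd f v (X v)) u Y =
      GaugeField.hd (fun v => GaugeField.hd f v (X u)) u Y + GaugeField.hd f u Z := by
  obtain ⟨R, hR, hcR, rfl⟩ := hZ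
  have hl : 𝒱.IsPlot ℝ (fun s => u + s • Y) := hu.line hY
  have he : ContDiff ℝ ∞ (fun q : ℝ × ℝ => GaugeField.hd f (u + q.1 • Y) (X (u + q.2 • Y))) :=
    hf.contDiff_hd (𝒱.comp contDiff_fst hl) (𝒱.comp contDiff_snd (hX ℝ _ hl))
  have h := he.hasDerivAt_diag.deriv
  have h2 : deriv (fun b : ℝ => GaugeField.hd f u (X (u + b • Y))) 0 = GaugeField.hd f u (R 0) := by
    have hc : ContDiff ℝ ∞ (fun b => GaugeField.hd f u (R b)) := hf.contDiff_hd hu hR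
    have e : (fun b : ℝ => GaugeField.hd f u (X (u + b • Y)))
        = fun b => GaugeField.hd f u (X u) + b * GaugeField.hd f u (R b) := by
      funext b
      have h0 : X (u + b • Y) = X u + b • R b := by simpa using hcR b
      have hXu : 𝒱.Pt (X u) := hX.pt hu
      rw [h0, hf.hd_add hu hXu ((IsPlot.pt hR b).smul b), hf.hd_smul hu (IsPlot.pt hR b)]
    rw [e]
    have h5 := ((hasDerivAt_id (0 : ℝ)).mul
      ((hc.differentiable (by simp) 0).hasDerivAt)).const_add (GaugeField.hd f u (X u))
    have h6 := h5.deriv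
    simpa using h6
  simp only [zero_smul, add_zero] at h
  rw [h2] at h
  exact h

/-- The derivative along `DY·X - DX·Y` is the commutator of the derivatives along `X` and `Y`. -/
lemma SmoothFun.hd_commutator {f : V → ℝ} (hf : 𝒱.SmoothFun f) {X Y : V → V}
    (hX : 𝒱.SmoothMap 𝒱 X) (hY : 𝒱.SmoothMap 𝒱 Y) {u Z Z' : V} (hu : 𝒱.Pt u)
    (hZ : 𝒱.HasVel (fun s => Y (u + s • X u)) Z) (hZ' : 𝒱.HasVel (fun s => X (u + s • Y u)) Z') :
    GaugeField.hd (fun v => GaugeField.hd f v (Y v)) u (X u)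
      - GaugeField.hd (fun v => GaugeField.hd f v (X v)) u (Y u)
      = GaugeField.hd f u (Z - Z') := by
  have h1 : 𝒱.Pt Z := by
    obtain ⟨R, hR, -, rfl⟩ := hZ
    exact IsPlot.pt hR 0
  have h2 : 𝒱.Pt Z' := by
    obtain ⟨R, hR, -, rfl⟩ := hZ'
    exact IsPlot.pt hR 0
  rw [hf.hd_hd hY hu (hX.pt hu) hZ, hf.hd_hd hX hu (hY.pt hu) hZ', hf.hd_sub hu h1 h2,
    hf.hd_comm hu (hX.pt hu) (hY.pt hu)]
  ring

end PlotSpace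

/-! ### Differentiation under the integral sign -/

section ParametricIntegral

variable {P : Type} [NormedAddCommGroup P] [NormedSpace ℝ P]
  {K : Type*} [TopologicalSpace K] [MeasurableSpace K] [OpensMeasurableSpace K]

/-- `F p κ` has `m` derivatives in `p ∈ D`, jointly continuous in `(p, κ) ∈ D × k`. -/
def ParamSmooth (D : Set P) (k : Set K) : ℕ → (G : Type) → [NormedAddCommGroup G] →
    [NormedSpace ℝ G] → (P → K → G) → Prop
  | 0, _, _, _, F => ContinuousOn (Function.uncurry F) (D ×ˢ k)
  | m + 1, G, _, _, F => ContinuousOn (Function.uncurry F) (D ×ˢ k) ∧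
      ∃ F' : P → K → (P →L[ℝ] G),
        (∀ p ∈ D, ∀ κ ∈ k, HasFDerivWithinAt (fun p => F p κ) (F' p κ) D p) ∧
        ParamSmooth D k m (P →L[ℝ] G) F'

variable {D : Set P} {k : Set K} {μ : Measure K}

lemma ParamSmooth.continuousOn {G : Type} [NormedAddCommGroup G] [NormedSpace ℝ G] {m : ℕ}
    {F : P → K → G} (h : ParamSmooth D k m G F) :
    ContinuousOn (Function.uncurry F) (D ×ˢ k) := by
  cases m with
  | zero => exact h
  | succ m => exact h.1

lemma continuousOn_slice {G : Type} [TopologicalSpace G] {F : P → K → G}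
    (h : ContinuousOn (Function.uncurry F) (D ×ˢ k)) {p : P} (hp : p ∈ D) :
    ContinuousOn (F p) k :=
  h.comp (f := fun κ => (p, κ)) (by fun_prop) (fun κ hκ => ⟨hp, hκ⟩)

variable [IsFiniteMeasure μ]

/-- Local convexity of `D` replaces openness, so that the statement applies to charts with boundary:
the difference quotients are controlled by the mean value inequality, uniformly on the compact set
of integration. -/
lemma hasFDerivWithinAt_integral (hk : IsCompact k) (hkm : MeasurableSet k)
    {G : Type} [NormedAddCommGroup G] [NormedSpace ℝ G] [CompleteSpace G]
    {F : P → K → G} {F' : P → K → (P →L[ℝ] G)}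
    (hD : ∀ p ∈ D, ∃ ε > 0, Convex ℝ (D ∩ Metric.ball p ε))
    (hF : ContinuousOn (Function.uncurry F) (D ×ˢ k))
    (hd : ∀ p ∈ D, ∀ κ ∈ k, HasFDerivWithinAt (fun p => F p κ) (F' p κ) D p)
    (hF' : ContinuousOn (Function.uncurry F') (D ×ˢ k)) {p₀ : P} (hp₀ : p₀ ∈ D) :
    HasFDerivWithinAt (fun p => ∫ κ in k, F p κ ∂μ) (∫ κ in k, F' p₀ κ ∂μ) D p₀ := by
  have hint : ∀ p ∈ D, IntegrableOn (F p) k μ := fun p hp =>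
    (continuousOn_slice hF hp).integrableOn_compact' hk hkm
  have hint' : IntegrableOn (F' p₀) k μ :=
    (continuousOn_slice hF' hp₀).integrableOn_compact' hk hkm
  obtain ⟨ε, hε, hconv⟩ := hD p₀ hp₀
  rw [hasFDerivWithinAt_iff_isLittleO, Asymptotics.isLittleO_iff]
  intro c hc
  -- `+ 1` because the measure of `k` may vanish
  set c' := c / (μ.real k + 1) with hc'
  have hμ : 0 ≤ μ.real k := measureReal_nonneg
  have hc'pos : 0 < c' := by positivity
  obtain ⟨v, hv, hvc⟩ := hk.mem_uniformity_of_prod hF' hp₀ (Metric.dist_mem_uniformity hc'pos)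
  obtain ⟨ε', hε', hvε⟩ := Metric.mem_nhdsWithin_iff.1 hv
  set r := min ε ε'
  have hr : 0 < r := lt_min hε hε'
  have hconv' : Convex ℝ (D ∩ Metric.ball p₀ r) := by
    have : D ∩ Metric.ball p₀ r = (D ∩ Metric.ball p₀ ε) ∩ Metric.ball p₀ r := by
      rw [inter_assoc, inter_eq_self_of_subset_right (Metric.ball_subset_ball (min_le_left _ _))]
    rw [this]
    exact hconv.inter (convex_ball _ _)
  filter_upwards [inter_mem self_mem_nhdsWithin
    (mem_nhdsWithin_of_mem_nhds (Metric.ball_mem_nhds p₀ hr))] with p hp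
  have hbound : ∀ κ ∈ k, ‖F p κ - F p₀ κ - F' p₀ κ (p - p₀)‖ ≤ c' * ‖p - p₀‖ := by
    intro κ hκ
    refine hconv'.norm_image_sub_le_of_norm_hasFDerivWithin_le' (f' := fun q => F' q κ)
      (fun q hq => (hd q hq.1 κ hκ).mono inter_subset_left) (fun q hq => ?_)
      ⟨hp₀, Metric.mem_ball_self hr⟩ hp
    have := hvc q (hvε ⟨Metric.ball_subset_ball (min_le_right _ _) hq.2, hq.1⟩) κ hκ
    rw [mem_ofPred_eq, dist_eq_norm] at this
    exact this.le
  have e : (∫ κ in k, F p κ ∂μ) - (∫ κ in k, F p₀ κ ∂μ) - (∫ κ in k, F' p₀ κ ∂μ) (p - p₀)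
      = ∫ κ in k, (F p κ - F p₀ κ - F' p₀ κ (p - p₀)) ∂μ := by
    rw [ContinuousLinearMap.integral_apply hint', integral_sub, integral_sub (hint p hp.1)
      (hint p₀ hp₀)]
    · exact (hint p hp.1).sub (hint p₀ hp₀)
    · exact hint'.apply_continuousLinearMap _
  rw [e]
  have := norm_setIntegral_le_of_norm_le_const (μ := μ) (measure_lt_top μ k) hbound
  refine this.trans ?_
  rw [mul_right_comm]
  gcongr
  rw [hc', div_mul_eq_mul_div, div_le_iff₀ (by positivity)]
  nlinarith

lemma continuousOn_integral (hk : IsCompact k) (hkm : MeasurableSet k)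
    {G : Type} [NormedAddCommGroup G] [NormedSpace ℝ G]
    {F : P → K → G} (hF : ContinuousOn (Function.uncurry F) (D ×ˢ k)) :
    ContinuousOn (fun p => ∫ κ in k, F p κ ∂μ) D := by
  have hint : ∀ p ∈ D, IntegrableOn (F p) k μ := fun p hp =>
    (continuousOn_slice hF hp).integrableOn_compact' hk hkm
  intro p₀ hp₀
  rw [ContinuousWithinAt, Metric.tendsto_nhds]
  intro c hc
  have hμ : 0 ≤ μ.real k := measureReal_nonneg
  have hc'pos : 0 < c / (μ.real k + 1) := by positivity
  obtain ⟨v, hv, hvc⟩ := hk.mem_uniformity_of_prod hF hp₀ (Metric.dist_mem_uniformity hc'pos)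
  filter_upwards [hv, self_mem_nhdsWithin] with p hp hpD
  rw [dist_eq_norm, ← integral_sub (hint p hpD) (hint p₀ hp₀)]
  have := norm_setIntegral_le_of_norm_le_const (μ := μ) (measure_lt_top μ k)
    (f := fun κ => F p κ - F p₀ κ) (s := k) (C := c / (μ.real k + 1)) (fun κ hκ => by
      have := hvc p hp κ hκ
      rw [mem_ofPred_eq, dist_eq_norm] at this
      exact this.le)
  refine this.trans_lt ?_
  rw [div_mul_eq_mul_div, div_lt_iff₀ (by positivity)]
  nlinarith

lemma contDiffOn_integral (hk : IsCompact k) (hkm : MeasurableSet k)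
    (hD : ∀ p ∈ D, ∃ ε > 0, Convex ℝ (D ∩ Metric.ball p ε)) (hu : UniqueDiffOn ℝ D) (m : ℕ)
    (G : Type) [NormedAddCommGroup G] [NormedSpace ℝ G] [CompleteSpace G]
    (F : P → K → G) (hF : ParamSmooth D k m G F) :
    ContDiffOn ℝ m (fun p => ∫ κ in k, F p κ ∂μ) D := by
  induction m generalizing G with
  | zero => exact contDiffOn_zero.2 (continuousOn_integral hk hkm hF)
  | succ m ih =>
    obtain ⟨hc, F', hd, hF'⟩ := hF
    have := ih (P →L[ℝ] G) F' hF'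
    push_cast
    rw [contDiffOn_succ_iff_hasFDerivWithinAt_of_uniqueDiffOn hu]
    exact ⟨by simp, _, this,
      fun p hp => hasFDerivWithinAt_integral hk hkm hD hc hd hF'.continuousOn hp⟩

end ParametricIntegral

/-! ### Smooth families of functions on a manifold with boundary -/

section JointSmooth

variable (n : ℕ) [NeZero n] {M : Type*} [TopologicalSpace M]
  [ChartedSpace (EuclideanHalfSpace n) M]

/-- The image of the chart centred at `x₀`. -/
abbrev chartTarget (x₀ : M) : Set (EuclideanSpace ℝ (Fin n)) := (extChartAt (𝓡∂ n) x₀).target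

/-- `f p x` is jointly smooth in the parameter `p` and the point `x`, as seen in the charts. -/
def JointSmooth (P : Type) [NormedAddCommGroup P] [NormedSpace ℝ P] {G : Type}
    [NormedAddCommGroup G] [NormedSpace ℝ G] (f : P → M → G) : Prop :=
  ∀ x₀ : M, ContDiffOn ℝ ∞ (fun q : P × EuclideanSpace ℝ (Fin n) =>
    f q.1 ((extChartAt (𝓡∂ n) x₀).symm q.2)) (univ ×ˢ chartTarget n x₀)

variable {n}

lemma uniqueDiffOn_chartTarget (x₀ : M) : UniqueDiffOn ℝ (chartTarget n x₀) :=
  uniqueDiffOn_extChartAt_target x₀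

lemma uniqueDiffOn_univ_prod_chartTarget (P : Type*) [NormedAddCommGroup P] [NormedSpace ℝ P]
    (x₀ : M) : UniqueDiffOn ℝ ((univ : Set P) ×ˢ chartTarget n x₀) :=
  uniqueDiffOn_univ.prod (uniqueDiffOn_chartTarget x₀)

lemma chartTarget_eventuallyEq {x₀ : M} {y : EuclideanSpace ℝ (Fin n)}
    (hy : y ∈ chartTarget n x₀) : chartTarget n x₀ =ᶠ[𝓝 y] range (𝓡∂ n) := by
  have h := extChartAt_target_mem_nhdsWithin_of_mem (I := 𝓡∂ n) hy
  rw [mem_nhdsWithin_iff_eventually] at h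
  filter_upwards [h] with z hz
  exact propext ⟨fun h => extChartAt_target_subset_range (I := 𝓡∂ n) x₀ h, fun h => hz h⟩

lemma chartTarget_locallyConvex {x₀ : M} {y : EuclideanSpace ℝ (Fin n)}
    (hy : y ∈ chartTarget n x₀) : ∃ ε > 0, Convex ℝ (chartTarget n x₀ ∩ Metric.ball y ε) := by
  obtain ⟨ε, hε, h⟩ := Metric.eventually_nhds_iff_ball.1 (chartTarget_eventuallyEq hy)
  refine ⟨ε, hε, ?_⟩
  have : chartTarget n x₀ ∩ Metric.ball y ε = range (𝓡∂ n) ∩ Metric.ball y ε := by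
    ext z
    constructor
    · rintro ⟨h1, h2⟩
      exact ⟨(h z h2).mp h1, h2⟩
    · rintro ⟨h1, h2⟩
      exact ⟨(h z h2).mpr h1, h2⟩
  rw [this]
  exact (𝓡∂ n).convex_range.inter (convex_ball _ _)

lemma univ_prod_chartTarget_locallyConvex {P : Type*} [NormedAddCommGroup P] [NormedSpace ℝ P]
    {x₀ : M} {q : P × EuclideanSpace ℝ (Fin n)} (hq : q ∈ (univ : Set P) ×ˢ chartTarget n x₀) :
    ∃ ε > 0, Convex ℝ (((univ : Set P) ×ˢ chartTarget n x₀) ∩ Metric.ball q ε) := by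
  obtain ⟨ε, hε, h⟩ := chartTarget_locallyConvex hq.2
  refine ⟨ε, hε, ?_⟩
  have : ((univ : Set P) ×ˢ chartTarget n x₀) ∩ Metric.ball q ε
      = Metric.ball q.1 ε ×ˢ (chartTarget n x₀ ∩ Metric.ball q.2 ε) := by
    rw [show q = (q.1, q.2) from rfl, ← ball_prod_same]
    ext z
    simp only [mem_inter_iff, mem_prod, mem_univ, true_and]
    tauto
  rw [this]
  exact (convex_ball _ _).prod h

variable {P : Type} [NormedAddCommGroup P] [NormedSpace ℝ P] {G : Type} [NormedAddCommGroup G]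
  [NormedSpace ℝ G]

lemma JointSmooth.continuous {f : P → M → G} (hf : JointSmooth n P f) :
    Continuous (fun q : P × M => f q.1 q.2) := by
  rw [continuous_iff_continuousAt]
  rintro ⟨p, x⟩
  have hs : (extChartAt (𝓡∂ n) x).source ∈ 𝓝 x := extChartAt_source_mem_nhds x
  have h : ContinuousOn (fun q : P × M => f q.1 q.2)
      (univ ×ˢ (extChartAt (𝓡∂ n) x).source) := by
    have := (hf x).continuousOn.comp (f := fun q : P × M => (q.1, extChartAt (𝓡∂ n) x q.2))
      (s := univ ×ˢ (extChartAt (𝓡∂ n) x).source)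
      (continuousOn_fst.prodMk ((continuousOn_extChartAt x).comp continuousOn_snd
        (fun q hq => hq.2))) (fun q hq => ⟨mem_univ _, (extChartAt (𝓡∂ n) x).map_source hq.2⟩)
    refine this.congr fun q hq => ?_
    simp only [Function.comp, (extChartAt (𝓡∂ n) x).left_inv hq.2]
  exact h.continuousAt (prod_mem_nhds univ_mem hs)

lemma JointSmooth.hasFDerivAt_chart {f : P → M → G} (hf : JointSmooth n P f) {x₀ : M} (p : P)
    {y : EuclideanSpace ℝ (Fin n)} (hy : y ∈ chartTarget n x₀) :
    HasFDerivAt (fun p => f p ((extChartAt (𝓡∂ n) x₀).symm y))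
      ((fderivWithin ℝ (fun q : P × EuclideanSpace ℝ (Fin n) =>
      f q.1 ((extChartAt (𝓡∂ n) x₀).symm q.2)) (univ ×ˢ chartTarget n x₀)
        (p, y)).comp (ContinuousLinearMap.inl ℝ P _)) p := by
  have hmem : (p, y) ∈ (univ : Set P) ×ˢ chartTarget n x₀ := ⟨mem_univ _, hy⟩
  have h := ((hf x₀).differentiableOn (by simp) _ hmem).hasFDerivWithinAt
  have h2 := h.comp (f := fun p : P => (p, y)) (s := univ) p
    (hasFDerivAt_prodMk_left p y).hasFDerivWithinAt
    (fun p' _ => ⟨mem_univ _, hy⟩)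
  rw [hasFDerivWithinAt_univ] at h2
  simpa [Function.comp_def] using h2

lemma JointSmooth.differentiableAt {f : P → M → G} (hf : JointSmooth n P f) (p : P) (x : M) :
    DifferentiableAt ℝ (fun p => f p x) p := by
  have := (hf.hasFDerivAt_chart p (mem_extChartAt_target x)).differentiableAt
  simpa only [extChartAt_to_inv] using this

lemma JointSmooth.fderiv {f : P → M → G} (hf : JointSmooth n P f) :
    JointSmooth n P (fun p x => fderiv ℝ (fun p => f p x) p) := by
  intro x₀
  have h := (hf x₀).fderivWithin (uniqueDiffOn_univ_prod_chartTarget P x₀) (m := ∞) (by simp)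
  have h2 : ContDiffOn ℝ ∞ (fun q => ((ContinuousLinearMap.compL ℝ P
      (P × EuclideanSpace ℝ (Fin n)) G).flip (ContinuousLinearMap.inl ℝ P _))
      (fderivWithin ℝ (fun q : P × EuclideanSpace ℝ (Fin n) =>
        f q.1 ((extChartAt (𝓡∂ n) x₀).symm q.2)) (univ ×ˢ chartTarget n x₀) q))
      (univ ×ˢ chartTarget n x₀) :=
    (ContinuousLinearMap.contDiff _).comp_contDiffOn h
  refine h2.congr fun q hq => ?_
  exact (hf.hasFDerivAt_chart q.1 hq.2).fderiv

lemma JointSmooth.paramSmooth {f : P → M → G} (hf : JointSmooth n P f) (m : ℕ) :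
    ParamSmooth univ univ m G f := by
  induction m generalizing G with
  | zero => exact hf.continuous.continuousOn
  | succ m ih =>
    refine ⟨hf.continuous.continuousOn, fun p x => _root_.fderiv ℝ (fun p => f p x) p, ?_,
      ih hf.fderiv⟩
    intro p _ x _
    exact (hf.differentiableAt p x).hasFDerivAt.hasFDerivWithinAt

section Integral

variable [CompactSpace M] [MeasurableSpace M] [OpensMeasurableSpace M] {μ : Measure M}
  [IsFiniteMeasure μ]

lemma JointSmooth.contDiff_integral [CompleteSpace G] {f : P → M → G} (hf : JointSmooth n P f) :
    ContDiff ℝ ∞ (fun p => ∫ x, f p x ∂μ) := by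
  rw [← contDiffOn_univ, contDiffOn_infty]
  intro m
  have := contDiffOn_integral (μ := μ) (D := univ) isCompact_univ MeasurableSet.univ
    (fun p _ => ⟨1, one_pos, by simpa using convex_ball p 1⟩) uniqueDiffOn_univ m G f
    (hf.paramSmooth m)
  simpa using this

lemma JointSmooth.integrable {f : P → M → G} (hf : JointSmooth n P f) (p : P) :
    Integrable (f p) μ :=
  (hf.continuous.comp (Continuous.prodMk_right p)).integrable_of_hasCompactSupport
    (HasCompactSupport.of_compactSpace _)

lemma JointSmooth.hasDerivAt_integral {f : ℝ → M → ℝ} (hf : JointSmooth n ℝ f) (s : ℝ) :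
    HasDerivAt (fun s => ∫ x, f s x ∂μ) (∫ x, deriv (fun s => f s x) s ∂μ) s := by
  have h := hasFDerivWithinAt_integral (μ := μ) (D := univ) isCompact_univ MeasurableSet.univ
    (fun p _ => ⟨1, one_pos, by simpa using convex_ball p 1⟩) (F := f)
    (F' := fun p x => _root_.fderiv ℝ (fun p => f p x) p) hf.continuous.continuousOn
    (fun p _ x _ => (hf.differentiableAt p x).hasFDerivAt.hasFDerivWithinAt)
    hf.fderiv.continuous.continuousOn (mem_univ s)
  rw [hasFDerivWithinAt_univ] at h
  have h2 := h.hasDerivAt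
  simp only [Measure.restrict_univ] at h2
  rw [ContinuousLinearMap.integral_apply (hf.fderiv.integrable s)] at h2
  simpa using h2

end Integral

end JointSmooth

section JointSmooth

variable {n : ℕ} [NeZero n] {M : Type*} [TopologicalSpace M]
  [ChartedSpace (EuclideanHalfSpace n) M]
  {P : Type} [NormedAddCommGroup P] [NormedSpace ℝ P] {G G' : Type} [NormedAddCommGroup G]
  [NormedSpace ℝ G] [NormedAddCommGroup G'] [NormedSpace ℝ G']

lemma JointSmooth.comp {Q : Type} [NormedAddCommGroup Q] [NormedSpace ℝ Q] {f : P → M → G}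
    (hf : JointSmooth n P f) {g : Q → P} (hg : ContDiff ℝ ∞ g) :
    JointSmooth n Q (fun q => f (g q)) := fun x₀ =>
  (hf x₀).comp (g := fun q : P × EuclideanSpace ℝ (Fin n) =>
      f q.1 ((extChartAt (𝓡∂ n) x₀).symm q.2))
    (f := fun q : Q × EuclideanSpace ℝ (Fin n) => (g q.1, q.2))
    ((hg.comp contDiff_fst).prodMk contDiff_snd).contDiffOn (fun _ hq => ⟨mem_univ _, hq.2⟩)

lemma JointSmooth.map {f : P → M → G} (hf : JointSmooth n P f) {g : G → G'}
    (hg : ContDiff ℝ ∞ g) : JointSmooth n P (fun p x => g (f p x)) :=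
  fun x₀ => hg.comp_contDiffOn (hf x₀)

lemma JointSmooth.add {f g : P → M → G} (hf : JointSmooth n P f) (hg : JointSmooth n P g) :
    JointSmooth n P (fun p x => f p x + g p x) := fun x₀ => (hf x₀).add (hg x₀)

lemma JointSmooth.sub {f g : P → M → G} (hf : JointSmooth n P f) (hg : JointSmooth n P g) :
    JointSmooth n P (fun p x => f p x - g p x) := fun x₀ => (hf x₀).sub (hg x₀)

lemma JointSmooth.mul {f g : P → M → ℝ} (hf : JointSmooth n P f) (hg : JointSmooth n P g) :
    JointSmooth n P (fun p x => f p x * g p x) := fun x₀ => (hf x₀).mul (hg x₀)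

lemma JointSmooth.sum {κ : Type*} {s : Finset κ} {f : κ → P → M → G}
    (hf : ∀ i ∈ s, JointSmooth n P (f i)) : JointSmooth n P (fun p x => ∑ i ∈ s, f i p x) :=
  fun x₀ => ContDiffOn.sum fun i hi => hf i hi x₀

lemma jointSmooth_param {a : P → G} (ha : ContDiff ℝ ∞ a) :
    JointSmooth n P (fun p (_ : M) => a p) :=
  fun _ => (ha.comp contDiff_fst).contDiffOn

lemma JointSmooth.fderiv_apply {f : P → M → G} (hf : JointSmooth n P f) (v : P) :
    JointSmooth n P (fun p x => _root_.fderiv ℝ (fun p => f p x) p v) :=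
  hf.fderiv.map (g := fun L : P →L[ℝ] G => L v) (ContinuousLinearMap.apply ℝ G v).contDiff

lemma JointSmooth.deriv_snd {f : P × ℝ → M → ℝ} (hf : JointSmooth n (P × ℝ) f) :
    JointSmooth n (P × ℝ) (fun q x => deriv (fun τ => f (q.1, τ) x) q.2) := by
  have := hf.fderiv_apply (0, 1)
  convert this using 3 with q x
  exact ((HasFDerivAt.comp_hasDerivAt (l := fun q => f q x) (f := fun τ : ℝ => (q.1, τ)) q.2
    (hf.differentiableAt q x).hasFDerivAt)
    ((hasDerivAt_const _ _).prodMk (hasDerivAt_id _))).deriv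

lemma JointSmooth.deriv_fst {f : ℝ × P → M → ℝ} (hf : JointSmooth n (ℝ × P) f) :
    JointSmooth n (ℝ × P) (fun q x => deriv (fun s => f (s, q.2) x) q.1) := by
  have := hf.fderiv_apply (1, 0)
  convert this using 3 with q x
  exact ((HasFDerivAt.comp_hasDerivAt (l := fun q => f q x) (f := fun τ : ℝ => (τ, q.2)) q.1
    (hf.differentiableAt q x).hasFDerivAt)
    ((hasDerivAt_id _).prodMk (hasDerivAt_const _ _))).deriv

lemma JointSmooth.iteratedDeriv_snd {f : P × ℝ → M → ℝ} (hf : JointSmooth n (P × ℝ) f) (l : ℕ) :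
    JointSmooth n (P × ℝ) (fun q x => iteratedDeriv l (fun τ => f (q.1, τ) x) q.2) := by
  induction l with
  | zero => simpa using hf
  | succ l ih =>
    simp only [iteratedDeriv_succ]
    exact ih.deriv_snd

lemma JointSmooth.deriv_line {f : ℝ → M → ℝ} (hf : JointSmooth n ℝ f) :
    JointSmooth n ℝ (fun s x => deriv (fun s => f s x) s) := by
  simpa using hf.fderiv_apply (1 : ℝ)

lemma JointSmooth.iteratedDeriv {f : ℝ → M → ℝ} (hf : JointSmooth n ℝ f) (l : ℕ) :
    JointSmooth n ℝ (fun s x => _root_.iteratedDeriv l (fun s => f s x) s) := by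
  induction l with
  | zero => simpa using hf
  | succ l ih =>
    simp only [iteratedDeriv_succ]
    exact ih.deriv_line

lemma JointSmooth.contDiff {f : P → M → G} (hf : JointSmooth n P f) (x : M) :
    ContDiff ℝ ∞ (fun p => f p x) := by
  rw [← contDiffOn_univ]
  have := (hf x).comp (f := fun p : P => (p, extChartAt (𝓡∂ n) x x)) (s := univ)
    (contDiff_id.prodMk contDiff_const).contDiffOn
    (fun p _ => ⟨mem_univ _, mem_extChartAt_target x⟩)
  simpa only [Function.comp_def, extChartAt_to_inv] using this

/-- Hadamard's lemma: `f (s, q) - f (0, q)` is smoothly divisible by `s`. -/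
lemma JointSmooth.hadamard {f : ℝ × P → M → ℝ} (hf : JointSmooth n (ℝ × P) f) :
    ∃ R : ℝ × P → M → ℝ, JointSmooth n (ℝ × P) R ∧
      ∀ s q x, f (s, q) x = f (0, q) x + s * R (s, q) x := by
  set g : ℝ × P → M → ℝ := fun q x => deriv (fun s => f (s, q.2) x) q.1 with hg
  have hgs : JointSmooth n (ℝ × P) g := hf.deriv_fst
  have hc2 : JointSmooth n ((ℝ × P) × ℝ) (fun q x => g (q.2 * q.1.1, q.1.2) x) :=
    hgs.comp (g := fun q : (ℝ × P) × ℝ => (q.2 * q.1.1, q.1.2)) (by fun_prop)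
  have : IsFiniteMeasure (volume.restrict (Icc (0 : ℝ) 1)) := ⟨by simp⟩
  refine ⟨fun q x => ∫ θ in Icc (0 : ℝ) 1, g (θ * q.1, q.2) x ∂(volume.restrict (Icc (0 : ℝ) 1)),
    ?_, ?_⟩
  · intro x₀
    rw [contDiffOn_infty]
    intro m
    refine contDiffOn_integral (μ := volume.restrict (Icc (0 : ℝ) 1)) isCompact_Icc
      measurableSet_Icc (fun p hp => univ_prod_chartTarget_locallyConvex hp)
      (uniqueDiffOn_univ_prod_chartTarget (ℝ × P) x₀) m ℝ
      (fun q θ => g (θ * q.1.1, q.1.2) ((extChartAt (𝓡∂ n) x₀).symm q.2)) ?_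
    have hsm : ContDiffOn ℝ ∞ (Function.uncurry fun
        (q : (ℝ × P) × EuclideanSpace ℝ (Fin n)) (θ : ℝ) =>
          g (θ * q.1.1, q.1.2) ((extChartAt (𝓡∂ n) x₀).symm q.2))
        ((univ ×ˢ chartTarget n x₀) ×ˢ univ) :=
      (hgs x₀).comp (f := fun r : ((ℝ × P) × EuclideanSpace ℝ (Fin n)) × ℝ =>
        ((r.2 * r.1.1.1, r.1.1.2), r.1.2)) (by fun_prop) (fun r hr => ⟨mem_univ _, hr.1.2⟩)
    have key : ∀ (m : ℕ) (W : Type) [NormedAddCommGroup W] [NormedSpace ℝ W]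
        (F : (ℝ × P) × EuclideanSpace ℝ (Fin n) → ℝ → W),
        ContDiffOn ℝ ∞ (Function.uncurry F) ((univ ×ˢ chartTarget n x₀) ×ˢ univ) →
        ParamSmooth (univ ×ˢ chartTarget n x₀) (Icc (0 : ℝ) 1) m W F := by
      intro m
      induction m with
      | zero =>
        intro W _ _ F hF
        exact hF.continuousOn.mono (prod_mono_right (subset_univ _))
      | succ m ih =>
        intro W _ _ F hF
        have hu : UniqueDiffOn ℝ (((univ : Set (ℝ × P)) ×ˢ chartTarget n x₀) ×ˢ (univ : Set ℝ)) :=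
          (uniqueDiffOn_univ_prod_chartTarget (ℝ × P) x₀).prod uniqueDiffOn_univ
        refine ⟨hF.continuousOn.mono (prod_mono_right (subset_univ _)),
          fun q θ => (fderivWithin ℝ (Function.uncurry F)
            ((univ ×ˢ chartTarget n x₀) ×ˢ univ) (q, θ)).comp (ContinuousLinearMap.inl ℝ _ ℝ),
          ?_, ih _ _ ?_⟩
        · intro q hq θ _
          have h := (hF.differentiableOn (by simp) (q, θ) ⟨hq, mem_univ _⟩).hasFDerivWithinAt
          exact h.comp (f := fun q => (q, θ)) q (hasFDerivAt_prodMk_left q θ).hasFDerivWithinAt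
            (fun q' hq' => ⟨hq', mem_univ _⟩)
        · exact (((ContinuousLinearMap.compL ℝ _ _ W).flip
            (ContinuousLinearMap.inl ℝ _ ℝ)).contDiff).comp_contDiffOn
              (hF.fderivWithin hu (m := ∞) (by simp))
    exact key m ℝ _ hsm
  · intro s q x
    have h1 : ∀ θ ∈ uIcc (0 : ℝ) 1, HasDerivAt (fun θ => f (θ * s, q) x)
        (s * g (θ * s, q) x) θ := by
      intro θ _
      have hd : HasDerivAt (fun r => f (r, q) x) (g (θ * s, q) x) (θ * s) := by
        have : DifferentiableAt ℝ (fun r : ℝ => f (r, q) x) (θ * s) :=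
          ((hf.comp (g := fun r : ℝ => (r, q)) (by fun_prop)).differentiableAt (θ * s) x)
        exact this.hasDerivAt
      have := hd.comp θ ((hasDerivAt_id θ).mul_const s)
      simpa [mul_comm, Function.comp_def] using this
    have hcont : Continuous (fun θ : ℝ => s * g (θ * s, q) x) := by
      have := (hgs.contDiff x).continuous.comp (f := fun θ : ℝ => (θ * s, q)) (by fun_prop)
      exact continuous_const.mul this
    have h2 := intervalIntegral.integral_eq_sub_of_hasDerivAt h1
      (hcont.intervalIntegrable _ _)
    rw [intervalIntegral.integral_of_le zero_le_one, ← integral_Icc_eq_integral_Ioc,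
      integral_const_mul] at h2
    rw [Measure.restrict_restrict measurableSet_Icc, inter_self, h2]
    simp

end JointSmooth

section Conversions

variable {n : ℕ} [NeZero n] {M : Type*} [TopologicalSpace M]
  [ChartedSpace (EuclideanHalfSpace n) M] [IsManifold (𝓡∂ n) ∞ M]

lemma isSmooth_iff {f : M → ℝ} : IsSmooth n f ↔ ∀ x₀ : M,
    ContDiffOn ℝ ∞ (fun y => f ((extChartAt (𝓡∂ n) x₀).symm y)) (chartTarget n x₀) := by
  constructor
  · intro h x₀
    rw [← contMDiffOn_iff_contDiffOn]
    exact h.comp_contMDiffOn (contMDiffOn_extChartAt_symm x₀)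
  · intro h x
    have h1 : ContMDiffOn (𝓡∂ n) 𝓘(ℝ, ℝ) ∞ (fun z => f ((extChartAt (𝓡∂ n) x).symm
        (extChartAt (𝓡∂ n) x z))) (chartAt (EuclideanHalfSpace n) x).source :=
      (contMDiffOn_iff_contDiffOn.2 (h x)).comp contMDiffOn_extChartAt
        (fun z hz => (extChartAt (𝓡∂ n) x).map_source (by rwa [extChartAt_source]))
    have h2 : ContMDiffOn (𝓡∂ n) 𝓘(ℝ, ℝ) ∞ f (chartAt (EuclideanHalfSpace n) x).source :=
      h1.congr fun z hz => by
        rw [(extChartAt (𝓡∂ n) x).left_inv (by rwa [extChartAt_source])]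
    exact h2.contMDiffAt (chart_source_mem_nhds _ x)

lemma IsSmooth.jointSmooth {f : M → ℝ} (hf : IsSmooth n f) (P : Type) [NormedAddCommGroup P]
    [NormedSpace ℝ P] : JointSmooth n P (fun _ => f) := fun x₀ =>
  ((isSmooth_iff.1 hf) x₀).comp contDiff_snd.contDiffOn (fun _ hq => hq.2)

lemma JointSmooth.isSmooth {P : Type} [NormedAddCommGroup P] [NormedSpace ℝ P] {f : P → M → ℝ}
    (hf : JointSmooth n P f) (p : P) : IsSmooth n (f p) := isSmooth_iff.2 fun x₀ =>
  (hf x₀).comp (f := fun y => (p, y)) (contDiff_const.prodMk contDiff_id).contDiffOn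
    (fun _ hy => ⟨mem_univ _, hy⟩)

lemma jointSmooth_iff_contMDiff {P : Type} [NormedAddCommGroup P] [NormedSpace ℝ P]
    {f : P × ℝ → M → ℝ} : JointSmooth n (P × ℝ) f ↔
      ContMDiff (𝓘(ℝ, P).prod (𝓘(ℝ, ℝ).prod (𝓡∂ n))) 𝓘(ℝ, ℝ) ∞
        (fun p : P × (ℝ × M) => f (p.1, p.2.1) p.2.2) := by
  constructor
  · rintro h ⟨p, t, x⟩
    set U : Set (P × (ℝ × M)) := {q | q.2.2 ∈ (chartAt (EuclideanHalfSpace n) x).source} with hU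
    have hUo : IsOpen U := (chartAt (EuclideanHalfSpace n) x).open_source.preimage
      (continuous_snd.comp continuous_snd)
    have h1 : ContMDiffOn (𝓘(ℝ, P).prod (𝓘(ℝ, ℝ).prod (𝓡∂ n)))
        𝓘(ℝ, (P × ℝ) × EuclideanSpace ℝ (Fin n)) ∞
        (fun q : P × (ℝ × M) => ((q.1, q.2.1), extChartAt (𝓡∂ n) x q.2.2)) U := by
      refine ContMDiffOn.prodMk_space (ContMDiffOn.prodMk_space contMDiffOn_fst
        (contMDiff_fst.comp contMDiff_snd).contMDiffOn) ?_
      exact (contMDiffOn_extChartAt (I := 𝓡∂ n) (x := x)).comp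
        (contMDiff_snd.comp contMDiff_snd).contMDiffOn (fun q hq => hq)
    have h2 := (contMDiffOn_iff_contDiffOn.2 (h x)).comp h1 (fun q hq => ⟨mem_univ _,
      (extChartAt (𝓡∂ n) x).map_source (by rw [extChartAt_source]; exact hq)⟩)
    have h3 : ContMDiffOn (𝓘(ℝ, P).prod (𝓘(ℝ, ℝ).prod (𝓡∂ n))) 𝓘(ℝ, ℝ) ∞
        (fun p : P × (ℝ × M) => f (p.1, p.2.1) p.2.2) U :=
      h2.congr fun q hq => by
        simp only [Function.comp]
        rw [(extChartAt (𝓡∂ n) x).left_inv (by rw [extChartAt_source]; exact hq)]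
    exact h3.contMDiffAt (hUo.mem_nhds (mem_chart_source _ x))
  · intro h x₀
    rw [← contMDiffOn_iff_contDiffOn]
    have h1 : ContMDiffOn 𝓘(ℝ, (P × ℝ) × EuclideanSpace ℝ (Fin n))
        (𝓘(ℝ, P).prod (𝓘(ℝ, ℝ).prod (𝓡∂ n))) ∞
        (fun q : (P × ℝ) × EuclideanSpace ℝ (Fin n) =>
          (q.1.1, (q.1.2, (extChartAt (𝓡∂ n) x₀).symm q.2))) (univ ×ˢ chartTarget n x₀) := by
      refine ContMDiffOn.prodMk (contDiff_fst.comp contDiff_fst).contMDiff.contMDiffOn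
        (ContMDiffOn.prodMk (contDiff_snd.comp contDiff_fst).contMDiff.contMDiffOn ?_)
      exact (contMDiffOn_extChartAt_symm (I := 𝓡∂ n) x₀).comp contDiff_snd.contMDiff.contMDiffOn
        (fun q hq => hq.2)
    exact h.comp_contMDiffOn h1

lemma smoothFamily_iff {A Λ : Type*} {P : Type} [NormedAddCommGroup P] [NormedSpace ℝ P]
    {c : P → Hist M A Λ} : SmoothFamily n P c ↔
      ∀ i, JointSmooth n (P × ℝ) (fun q x => c q.1 i q.2 x) :=
  forall_congr' fun i =>
    (jointSmooth_iff_contMDiff (f := fun q : P × ℝ => c q.1 i q.2)).symm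

lemma smoothHist_iff {A Λ : Type*} {u : Hist M A Λ} :
    SmoothHist n u ↔ ∀ i, JointSmooth n ℝ (u i) := by
  refine forall_congr' fun i => ?_
  constructor
  · intro h
    have h2 : JointSmooth n (ℝ × ℝ) (fun q : ℝ × ℝ => u i q.2) :=
      jointSmooth_iff_contMDiff.2 (h.comp contMDiff_snd)
    exact h2.comp (g := fun t : ℝ => ((0 : ℝ), t)) (by fun_prop)
  · intro h
    have h2 := jointSmooth_iff_contMDiff.1 (h.comp (g := fun q : ℝ × ℝ => q.2) (by fun_prop))
    exact h2.comp (contMDiff_const (c := (0 : ℝ)).prodMk contMDiff_id)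

end Conversions

section Plots

variable (n : ℕ) [NeZero n] (M : Type*) [TopologicalSpace M]
  [ChartedSpace (EuclideanHalfSpace n) M]

/-- Smooth families of fields on `M`. -/
def fieldPlots (ι : Type*) : PlotSpace (ι → M → ℝ) where
  IsPlot P _ _ _ c := ∀ i, JointSmooth n P (fun p x => c p i x)
  add h h' i := (h i).add (h' i)
  smul ha h i := (jointSmooth_param ha).mul (h i)
  comp hg h i := (h i).comp hg
  hadamard {c} h := by
    have h2 : ∀ i, ∃ R : ℝ → M → ℝ, JointSmooth n ℝ R ∧
        ∀ s x, c s i x = c 0 i x + s * R s x := by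
      intro i
      obtain ⟨R, hR, hcR⟩ := ((h i).comp (g := fun q : ℝ × ℝ => q.1) contDiff_fst).hadamard
      exact ⟨fun s => R (s, 0), hR.comp (g := fun s : ℝ => (s, (0 : ℝ))) (by fun_prop),
        fun s x => hcR s 0 x⟩
    choose R hR hcR using h2
    exact ⟨fun s i => R i s, hR, fun s => by ext i x; simpa using hcR i s x⟩

/-- Smooth families of histories. -/
def histPlots (A Λ : Type*) : PlotSpace (Hist M A Λ) where
  IsPlot P _ _ _ c := ∀ i, JointSmooth n (P × ℝ) (fun q x => c q.1 i q.2 x)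
  add h h' i := (h i).add (h' i)
  smul ha h i := (jointSmooth_param (ha.comp contDiff_fst)).mul (h i)
  comp {P Q _ _ _ _ _ _ g c} hg h i := (h i).comp (g := fun q : Q × ℝ => (g q.1, q.2)) (by fun_prop)
  hadamard {c} h := by
    have h2 : ∀ i, ∃ R : ℝ × ℝ → M → ℝ, JointSmooth n (ℝ × ℝ) R ∧
        ∀ s t x, c s i t x = c 0 i t x + s * R (s, t) x := fun i => (h i).hadamard
    choose R hR hcR using h2
    exact ⟨fun s i t => R i (s, t), hR, fun s => by ext i t x; simpa using hcR i s t x⟩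

/-- Smooth families of pairs of a time and of fields on `M`. -/
def timedPlots (ι : Type*) : PlotSpace (ℝ × (ι → M → ℝ)) where
  IsPlot P _ _ _ c := ContDiff ℝ ∞ (fun p => (c p).1) ∧
    (fieldPlots n M ι).IsPlot P (fun p => (c p).2)
  add h h' := ⟨h.1.add h'.1, (fieldPlots n M ι).add h.2 h'.2⟩
  smul ha h := ⟨ha.mul h.1, (fieldPlots n M ι).smul ha h.2⟩
  comp hg h := ⟨h.1.comp hg, (fieldPlots n M ι).comp hg h.2⟩
  hadamard {c} h := by
    obtain ⟨R, hR, hcR⟩ := (fieldPlots n M ι).hadamard h.2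
    have h1 : JointSmooth n (ℝ × ℝ) (fun q (_ : EuclideanHalfSpace n) => (c q.1).1) :=
      jointSmooth_param (h.1.comp contDiff_fst)
    obtain ⟨r, hr, hcr⟩ := h1.hadamard
    refine ⟨fun s => (r (s, 0) default, R s), ⟨?_, hR⟩, fun s =>
      Prod.ext (hcr s 0 default) (hcR s)⟩
    exact (hr.comp (g := fun s : ℝ => (s, (0 : ℝ))) (by fun_prop)).contDiff default

end Plots

/-! ### Calculus of local functions -/

section LocAt

variable {n : ℕ} [NeZero n] {M : Type*} [TopologicalSpace M]
  [ChartedSpace (EuclideanHalfSpace n) M] {ι κ : Type*}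
  {W W' : Type*} [NormedAddCommGroup W] [NormedSpace ℝ W] [NormedAddCommGroup W']
  [NormedSpace ℝ W']

variable (n) in
/-- The domain of the functions of the time, the coordinates and the jets that represent local
functions in the chart centred at `x₀`. -/
abbrev jetDomain (x₀ : M) (V : Type*) : Set (ℝ × EuclideanSpace ℝ (Fin n) × V) :=
  univ ×ˢ (chartTarget n x₀ ×ˢ univ)

lemma uniqueDiffOn_jetDomain (x₀ : M) (V : Type*) [NormedAddCommGroup V] [NormedSpace ℝ V] :
    UniqueDiffOn ℝ (jetDomain n x₀ V) :=
  uniqueDiffOn_univ.prod ((uniqueDiffOn_chartTarget x₀).prod uniqueDiffOn_univ)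

/-- In the chart centred at `x₀`, the expression `f` with values in the normed space `W` is a smooth
function of the time, the coordinates and the jets of order `k` of the fields with index in `S`. -/
def LocAt (n : ℕ) [NeZero n] {M : Type*} [TopologicalSpace M]
    [ChartedSpace (EuclideanHalfSpace n) M] {ι : Type*} (x₀ : M) (k : ℕ) (S : Finset ι)
    {W : Type*} [NormedAddCommGroup W] [NormedSpace ℝ W]
    (f : ℝ → (ι → M → ℝ) → EuclideanSpace ℝ (Fin n) → W) : Prop :=
  ∃ F : ℝ × EuclideanSpace ℝ (Fin n) × (S → Jet n k) → W,
    ContDiffOn ℝ ∞ F (jetDomain n x₀ (S → Jet n k)) ∧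
    ∀ (t : ℝ) (Φ : ι → M → ℝ), (∀ i, IsSmooth n (Φ i)) → ∀ y ∈ chartTarget n x₀,
      f t Φ y = F (t, y, fun i => jet n k (Φ i) x₀ y)

lemma isLocal_iff {f : ℝ → (ι → M → ℝ) → M → ℝ} : IsLocal n f ↔ ∃ (k : ℕ) (S : Finset ι),
    ∀ x₀ : M, LocAt n x₀ k S (fun t Φ y => f t Φ ((extChartAt (𝓡∂ n) x₀).symm y)) := by
  refine exists_congr fun k => exists_congr fun S => forall_congr' fun x₀ =>
    exists_congr fun F => and_congr_right fun _ => ?_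
  constructor
  · intro h t Φ hΦ y hy
    have := h t Φ hΦ _ ((extChartAt (𝓡∂ n) x₀).map_target hy)
    rwa [(extChartAt (𝓡∂ n) x₀).right_inv hy] at this
  · intro h t Φ hΦ x hx
    have : f t Φ ((extChartAt (𝓡∂ n) x₀).symm (extChartAt (𝓡∂ n) x₀ x)) = _ := h t Φ hΦ _ ((extChartAt (𝓡∂ n) x₀).map_source hx)
    rwa [(extChartAt (𝓡∂ n) x₀).left_inv hx] at this

variable {x₀ : M} {k k' : ℕ} {S S' : Finset ι}
  {f : ℝ → (ι → M → ℝ) → EuclideanSpace ℝ (Fin n) → W}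

/-- Restriction of jets to a lower order and to fewer fields. -/
def jetRestrict (n : ℕ) {ι : Type*} {k k' : ℕ} {S S' : Finset ι} (hk : k ≤ k') (hS : S ⊆ S') :
    (S' → Jet n k') →L[ℝ] (S → Jet n k) :=
  ContinuousLinearMap.pi fun i => ContinuousLinearMap.pi fun j =>
    (ContinuousLinearMap.proj (R := ℝ) (φ := fun j : Fin (k' + 1) =>
      ContinuousMultilinearMap ℝ (fun _ : Fin (j : ℕ) => EuclideanSpace ℝ (Fin n)) ℝ)
      (⟨j, lt_of_lt_of_le j.2 (Nat.succ_le_succ hk)⟩ : Fin (k' + 1))).comp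
    (ContinuousLinearMap.proj (R := ℝ) (φ := fun _ : S' => Jet n k') ⟨i, hS i.2⟩)

lemma LocAt.mono (hf : LocAt n x₀ k S f) (hk : k ≤ k') (hS : S ⊆ S') : LocAt n x₀ k' S' f := by
  obtain ⟨F, hF, h⟩ := hf
  refine ⟨fun q => F (q.1, q.2.1, jetRestrict n hk hS q.2.2), ?_, fun t Φ hΦ y hy => h t Φ hΦ y hy⟩
  exact hF.comp (f := fun q : ℝ × EuclideanSpace ℝ (Fin n) × (S' → Jet n k') =>
    (q.1, q.2.1, jetRestrict n hk hS q.2.2)) (by fun_prop) (fun q hq => ⟨hq.1, hq.2.1, mem_univ _⟩)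

lemma LocAt.comp (hf : LocAt n x₀ k S f) {g : ℝ × EuclideanSpace ℝ (Fin n) × W → W'}
    (hg : ContDiffOn ℝ ∞ g (jetDomain n x₀ W)) :
    LocAt n x₀ k S (fun t Φ y => g (t, y, f t Φ y)) := by
  obtain ⟨F, hF, h⟩ := hf
  refine ⟨fun q => g (q.1, q.2.1, F q), ?_, fun t Φ hΦ y hy => by simp only [h t Φ hΦ y hy]⟩
  exact hg.comp (contDiff_fst.contDiffOn.prodMk
    ((contDiff_fst.comp contDiff_snd).contDiffOn.prodMk hF))
    (fun q hq => ⟨hq.1, hq.2.1, mem_univ _⟩)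

lemma LocAt.map (hf : LocAt n x₀ k S f) {g : W → W'} (hg : ContDiff ℝ ∞ g) :
    LocAt n x₀ k S (fun t Φ y => g (f t Φ y)) :=
  hf.comp (g := fun q => g q.2.2) (hg.comp (contDiff_snd.comp contDiff_snd)).contDiffOn

lemma locAt_coord {g : ℝ × EuclideanSpace ℝ (Fin n) → W}
    (hg : ContDiffOn ℝ ∞ g (univ ×ˢ chartTarget n x₀)) :
    LocAt n x₀ k S (fun t _ y => g (t, y)) :=
  ⟨fun q => g (q.1, q.2.1), hg.comp (f := fun q : ℝ × EuclideanSpace ℝ (Fin n) × (S → Jet n k) =>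
    (q.1, q.2.1)) (by fun_prop) (fun q hq => ⟨hq.1, hq.2.1⟩), fun t Φ _ y _ => rfl⟩

lemma LocAt.pi {β : Type*} [Fintype β] {W : β → Type*} [∀ b, NormedAddCommGroup (W b)]
    [∀ b, NormedSpace ℝ (W b)] {f : ∀ b, ℝ → (ι → M → ℝ) → EuclideanSpace ℝ (Fin n) → W b}
    (hf : ∀ b, LocAt n x₀ k S (f b)) : LocAt n x₀ k S (fun t Φ y b => f b t Φ y) := by
  choose F hF h using hf
  exact ⟨fun q b => F b q, contDiffOn_pi.2 hF, fun t Φ hΦ y hy => funext fun b => h b t Φ hΦ y hy⟩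

lemma LocAt.prodMk {g : ℝ → (ι → M → ℝ) → EuclideanSpace ℝ (Fin n) → W'}
    (hf : LocAt n x₀ k S f) (hg : LocAt n x₀ k S g) :
    LocAt n x₀ k S (fun t Φ y => (f t Φ y, g t Φ y)) := by
  obtain ⟨F, hF, h⟩ := hf
  obtain ⟨F', hF', h'⟩ := hg
  exact ⟨fun q => (F q, F' q), hF.prodMk hF', fun t Φ hΦ y hy => by
    simp only [h t Φ hΦ y hy, h' t Φ hΦ y hy]⟩

lemma LocAt.congr {g : ℝ → (ι → M → ℝ) → EuclideanSpace ℝ (Fin n) → W} (hf : LocAt n x₀ k S f)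
    (h : ∀ t Φ, (∀ i, IsSmooth n (Φ i)) → ∀ y ∈ chartTarget n x₀, g t Φ y = f t Φ y) :
    LocAt n x₀ k S g := by
  obtain ⟨F, hF, hf⟩ := hf
  exact ⟨F, hF, fun t Φ hΦ y hy => (h t Φ hΦ y hy).trans (hf t Φ hΦ y hy)⟩

/-! ### Jets of fields in a chart -/

lemma chartDeriv_zero (φ : M → ℝ) (x₀ : M) (y : EuclideanSpace ℝ (Fin n)) :
    chartDeriv n 0 φ x₀ y = (continuousMultilinearCurryFin0 ℝ (EuclideanSpace ℝ (Fin n)) ℝ).symm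
      (φ ((extChartAt (𝓡∂ n) x₀).symm y)) := rfl

lemma chartDeriv_succ (j : ℕ) (φ : M → ℝ) (x₀ : M) {y : EuclideanSpace ℝ (Fin n)}
    (hy : y ∈ chartTarget n x₀) :
    chartDeriv n (j + 1) φ x₀ y =
      (continuousMultilinearCurryLeftEquiv ℝ (fun _ : Fin (j + 1) => EuclideanSpace ℝ (Fin n))
        ℝ).symm (fderivWithin ℝ (chartDeriv n j φ x₀) (chartTarget n x₀) y) := by
  rw [fderivWithin_congr_set (chartTarget_eventuallyEq (x₀ := x₀) hy)]
  rfl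

lemma chartDeriv_eq (j : ℕ) (φ : M → ℝ) (x₀ : M) {y : EuclideanSpace ℝ (Fin n)}
    (hy : y ∈ chartTarget n x₀) :
    chartDeriv n j φ x₀ y = iteratedFDerivWithin ℝ j (φ ∘ (extChartAt (𝓡∂ n) x₀).symm)
      (chartTarget n x₀) y :=
  (iteratedFDerivWithin_congr_set (chartTarget_eventuallyEq (x₀ := x₀) hy) j).symm

variable [IsManifold (𝓡∂ n) ∞ M]

lemma IsSmooth.add {φ ψ : M → ℝ} (hφ : IsSmooth n φ) (hψ : IsSmooth n ψ) : IsSmooth n (φ + ψ) :=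
  isSmooth_iff.2 fun x₀ => (isSmooth_iff.1 hφ x₀).add (isSmooth_iff.1 hψ x₀)

lemma IsSmooth.sub {φ ψ : M → ℝ} (hφ : IsSmooth n φ) (hψ : IsSmooth n ψ) : IsSmooth n (φ - ψ) :=
  isSmooth_iff.2 fun x₀ => (isSmooth_iff.1 hφ x₀).sub (isSmooth_iff.1 hψ x₀)

lemma IsSmooth.mul {φ ψ : M → ℝ} (hφ : IsSmooth n φ) (hψ : IsSmooth n ψ) : IsSmooth n (φ * ψ) :=
  isSmooth_iff.2 fun x₀ => (isSmooth_iff.1 hφ x₀).mul (isSmooth_iff.1 hψ x₀)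

lemma isSmooth_const (r : ℝ) : IsSmooth n (fun _ : M => r) :=
  isSmooth_iff.2 fun _ => contDiffOn_const

lemma IsSmooth.smul {φ : M → ℝ} (hφ : IsSmooth n φ) (r : ℝ) : IsSmooth n (r • φ) :=
  isSmooth_iff.2 fun x₀ => contDiffOn_const.smul (isSmooth_iff.1 hφ x₀)

lemma IsSmooth.contDiffOn_chart {φ : M → ℝ} (hφ : IsSmooth n φ) (x₀ : M) :
    ContDiffOn ℝ ∞ (φ ∘ (extChartAt (𝓡∂ n) x₀).symm) (chartTarget n x₀) :=
  isSmooth_iff.1 hφ x₀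

lemma contDiffOn_chartDeriv {P : Type} [NormedAddCommGroup P] [NormedSpace ℝ P] {φ : P → M → ℝ}
    (hφ : JointSmooth n P φ) (j : ℕ) (x₀ : M) :
    ContDiffOn ℝ ∞ (fun q : P × EuclideanSpace ℝ (Fin n) => chartDeriv n j (φ q.1) x₀ q.2)
      (univ ×ˢ chartTarget n x₀) := by
  induction j with
  | zero =>
    simp only [chartDeriv_zero]
    exact (LinearIsometryEquiv.contDiff _).comp_contDiffOn (hφ x₀)
  | succ j ih =>
    have hu := uniqueDiffOn_univ_prod_chartTarget (n := n) P x₀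
    have h1 : ContDiffOn ℝ ∞ (fun q => (fderivWithin ℝ
        (fun q : P × EuclideanSpace ℝ (Fin n) => chartDeriv n j (φ q.1) x₀ q.2)
        (univ ×ˢ chartTarget n x₀) q).comp (ContinuousLinearMap.inr ℝ P _))
        (univ ×ˢ chartTarget n x₀) :=
      (ih.fderivWithin hu (m := ∞) (by simp)).clm_comp contDiffOn_const
    refine ((LinearIsometryEquiv.contDiff (continuousMultilinearCurryLeftEquiv ℝ
      (fun _ : Fin (j + 1) => EuclideanSpace ℝ (Fin n)) ℝ).symm).comp_contDiffOn h1).congr ?_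
    intro q hq
    rw [chartDeriv_succ j _ _ hq.2]
    simp only [Function.comp]
    congr 1
    have h := ((ih.differentiableOn (by simp)) q hq).hasFDerivWithinAt
    have h2 := h.comp (f := fun y => (q.1, y)) (s := chartTarget n x₀) q.2
      (hasFDerivAt_prodMk_right q.1 q.2).hasFDerivWithinAt (fun y hy => ⟨mem_univ _, hy⟩)
    exact h2.fderivWithin (uniqueDiffOn_chartTarget x₀ _ hq.2)

lemma IsSmooth.contDiffOn_chartDeriv {φ : M → ℝ} (hφ : IsSmooth n φ) (j : ℕ) (x₀ : M) :
    ContDiffOn ℝ ∞ (chartDeriv n j φ x₀) (chartTarget n x₀) :=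
  (GaugeField.contDiffOn_chartDeriv (hφ.jointSmooth ℝ) j x₀).comp
    (f := fun y => ((0 : ℝ), y)) (by fun_prop) (fun y hy => ⟨mem_univ _, hy⟩)

lemma chartDeriv_add {φ ψ : M → ℝ} (hφ : IsSmooth n φ) (hψ : IsSmooth n ψ) (j : ℕ) {x₀ : M}
    {y : EuclideanSpace ℝ (Fin n)} (hy : y ∈ chartTarget n x₀) :
    chartDeriv n j (φ + ψ) x₀ y = chartDeriv n j φ x₀ y + chartDeriv n j ψ x₀ y := by
  have hj : (j : WithTop ℕ∞) ≤ ∞ := WithTop.coe_le_coe.2 le_top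
  rw [chartDeriv_eq j _ _ hy, chartDeriv_eq j _ _ hy, chartDeriv_eq j _ _ hy]
  exact iteratedFDerivWithin_add_apply
    ((hφ.contDiffOn_chart x₀).of_le hj y hy) ((hψ.contDiffOn_chart x₀).of_le hj y hy)
    (uniqueDiffOn_chartTarget x₀) hy

lemma chartDeriv_smul {φ : M → ℝ} (hφ : IsSmooth n φ) (r : ℝ) (j : ℕ) {x₀ : M}
    {y : EuclideanSpace ℝ (Fin n)} (hy : y ∈ chartTarget n x₀) :
    chartDeriv n j (r • φ) x₀ y = r • chartDeriv n j φ x₀ y := by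
  have hj : (j : WithTop ℕ∞) ≤ ∞ := WithTop.coe_le_coe.2 le_top
  rw [chartDeriv_eq j _ _ hy, chartDeriv_eq j _ _ hy]
  exact iteratedFDerivWithin_const_smul_apply
    ((hφ.contDiffOn_chart x₀).of_le hj y hy) (uniqueDiffOn_chartTarget x₀) hy

lemma chartDeriv_sub {φ ψ : M → ℝ} (hφ : IsSmooth n φ) (hψ : IsSmooth n ψ) (j : ℕ) {x₀ : M}
    {y : EuclideanSpace ℝ (Fin n)} (hy : y ∈ chartTarget n x₀) :
    chartDeriv n j (φ - ψ) x₀ y = chartDeriv n j φ x₀ y - chartDeriv n j ψ x₀ y := by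
  have hj : (j : WithTop ℕ∞) ≤ ∞ := WithTop.coe_le_coe.2 le_top
  rw [chartDeriv_eq j _ _ hy, chartDeriv_eq j _ _ hy, chartDeriv_eq j _ _ hy]
  exact iteratedFDerivWithin_sub_apply
    ((hφ.contDiffOn_chart x₀).of_le hj y hy) ((hψ.contDiffOn_chart x₀).of_le hj y hy)
    (uniqueDiffOn_chartTarget x₀) hy

/-- The derivative in `y` of the jet of order `k` is given by the jet of order `k + 1`. -/
lemma hasFDerivWithinAt_jet {φ : M → ℝ} (hφ : IsSmooth n φ) (k : ℕ) {x₀ : M}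
    {y : EuclideanSpace ℝ (Fin n)} (hy : y ∈ chartTarget n x₀) :
    HasFDerivWithinAt (fun y => jet n k φ x₀ y) (ContinuousLinearMap.pi fun j : Fin (k + 1) =>
      continuousMultilinearCurryLeftEquiv ℝ
        (fun _ : Fin ((j : ℕ) + 1) => EuclideanSpace ℝ (Fin n)) ℝ
        (jet n (k + 1) φ x₀ y ⟨j + 1, Nat.succ_lt_succ j.2⟩)) (chartTarget n x₀) y := by
  rw [hasFDerivWithinAt_pi]
  intro j
  have h := (((hφ.contDiffOn_chartDeriv j x₀).differentiableOn (by simp)) y hy).hasFDerivWithinAt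
  convert h using 1
  case e'_11 => rfl
  show continuousMultilinearCurryLeftEquiv ℝ
    (fun _ : Fin ((j : ℕ) + 1) => EuclideanSpace ℝ (Fin n)) ℝ
    (chartDeriv n ((j : ℕ) + 1) φ x₀ y) = _
  rw [chartDeriv_succ _ _ _ hy, LinearIsometryEquiv.apply_symm_apply]

/-- The derivative in `y` of a local expression of order `k` is a local expression of order
`k + 1` ("total derivative"). -/
lemma LocAt.fderivWithin (hf : LocAt n x₀ k S f) :
    LocAt n x₀ (k + 1) S (fun t Φ y => fderivWithin ℝ (f t Φ) (chartTarget n x₀) y) := by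
  obtain ⟨F, hF, h⟩ := hf
  set D := jetDomain n x₀ (S → Jet n k)
  have hu : UniqueDiffOn ℝ D := uniqueDiffOn_jetDomain x₀ _
  set sh : (S → Jet n (k + 1)) → (EuclideanSpace ℝ (Fin n) →L[ℝ] (S → Jet n k)) := fun J =>
    ContinuousLinearMap.pi fun i => ContinuousLinearMap.pi fun j : Fin (k + 1) =>
      (continuousMultilinearCurryLeftEquiv ℝ
        (fun _ : Fin ((j : ℕ) + 1) => EuclideanSpace ℝ (Fin n)) ℝ
        (J i ⟨j + 1, Nat.succ_lt_succ j.2⟩) : _ →L[ℝ] _) with hsh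
  set r := jetRestrict n (Nat.le_succ k) (Finset.Subset.refl S)
  refine ⟨fun q => (_root_.fderivWithin ℝ F D (q.1, q.2.1, r q.2.2)).comp
    ((0 : _ →L[ℝ] ℝ).prod ((ContinuousLinearMap.id ℝ _).prod (sh q.2.2))), ?_, ?_⟩
  · rw [contDiffOn_clm_apply]
    intro v
    have h1 : ContDiffOn ℝ ∞ (fun q : ℝ × EuclideanSpace ℝ (Fin n) × (S → Jet n (k + 1)) =>
        _root_.fderivWithin ℝ F D (q.1, q.2.1, r q.2.2)) (jetDomain n x₀ _) :=
      (hF.fderivWithin hu (m := ∞) (by simp)).comp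
        (f := fun q : ℝ × EuclideanSpace ℝ (Fin n) × (S → Jet n (k + 1)) =>
          (q.1, q.2.1, r q.2.2)) (by fun_prop) (fun q hq => ⟨hq.1, hq.2.1, mem_univ _⟩)
    have h2 : ContDiff ℝ ∞ (fun q : ℝ × EuclideanSpace ℝ (Fin n) × (S → Jet n (k + 1)) =>
        ((0 : ℝ), v, sh q.2.2 v)) := by
      refine contDiff_const.prodMk (contDiff_const.prodMk ?_)
      rw [contDiff_pi]
      intro i
      rw [contDiff_pi]
      intro j
      refine ContDiff.clm_apply (f := fun q : ℝ × EuclideanSpace ℝ (Fin n) × (S → Jet n (k + 1)) =>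
        (continuousMultilinearCurryLeftEquiv ℝ
        (fun _ : Fin ((j : ℕ) + 1) => EuclideanSpace ℝ (Fin n)) ℝ
        (q.2.2 i ⟨j + 1, Nat.succ_lt_succ j.2⟩) : _ →L[ℝ] _)) ?_ contDiff_const
      refine (LinearIsometryEquiv.contDiff _).comp ?_
      have h3 : ContDiff ℝ ∞ (fun q : ℝ × EuclideanSpace ℝ (Fin n) × (S → Jet n (k + 1)) =>
          q.2.2 i) := (contDiff_apply ℝ _ i).comp (contDiff_snd.comp contDiff_snd)
      exact contDiff_pi.1 h3 (⟨j + 1, Nat.succ_lt_succ j.2⟩ : Fin (k + 1 + 1))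
    exact h1.clm_apply h2.contDiffOn
  · intro t Φ hΦ y hy
    have h1 : HasFDerivWithinAt (fun y => (t, y, fun i : S => jet n k (Φ i) x₀ y))
        ((0 : _ →L[ℝ] ℝ).prod ((ContinuousLinearMap.id ℝ _).prod
          (sh (fun i : S => jet n (k + 1) (Φ i) x₀ y)))) (chartTarget n x₀) y := by
      refine (hasFDerivWithinAt_const t y _).prodMk ((hasFDerivWithinAt_id y _).prodMk ?_)
      rw [hasFDerivWithinAt_pi]
      exact fun i => hasFDerivWithinAt_jet (hΦ i) k hy
    have h2 := ((hF.differentiableOn (by simp) (t, y, fun i : S => jet n k (Φ i) x₀ y)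
      ⟨mem_univ _, hy, mem_univ _⟩).hasFDerivWithinAt).comp y h1
      (fun z hz => (⟨mem_univ _, hz, mem_univ _⟩ :
        (t, z, fun i : S => jet n k (Φ i) x₀ z) ∈ D))
    have h3 : HasFDerivWithinAt (f t Φ) _ (chartTarget n x₀) y :=
      h2.congr (fun z hz => h t Φ hΦ z hz) (h t Φ hΦ y hy)
    exact h3.fderivWithin (uniqueDiffOn_chartTarget x₀ _ hy)

/-- The derivatives of local functions are local expressions. -/
lemma LocAt.chartDeriv {f : ℝ → (ι → M → ℝ) → M → ℝ}
    (hf : LocAt n x₀ k S (fun t Φ y => f t Φ ((extChartAt (𝓡∂ n) x₀).symm y))) (m : ℕ) :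
    LocAt n x₀ (k + m) S (fun t Φ y => GaugeField.chartDeriv n m (f t Φ) x₀ y) := by
  induction m with
  | zero =>
    simp only [chartDeriv_zero]
    exact hf.map (LinearIsometryEquiv.contDiff _)
  | succ m ih =>
    exact (ih.fderivWithin.map (LinearIsometryEquiv.contDiff
      (continuousMultilinearCurryLeftEquiv ℝ
        (fun _ : Fin (m + 1) => EuclideanSpace ℝ (Fin n)) ℝ).symm)).congr
        fun t Φ _ y hy => chartDeriv_succ m _ _ hy

lemma locAt_chartDeriv {i : ι} (hi : i ∈ S) {j : ℕ} (hj : j ≤ k) :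
    LocAt n x₀ k S (fun _ Φ y => GaugeField.chartDeriv n j (Φ i) x₀ y) := by
  refine ⟨fun q => q.2.2 ⟨i, hi⟩ ⟨j, Nat.lt_succ_of_le hj⟩, ?_, fun t Φ _ y _ => rfl⟩
  have h3 : ContDiff ℝ ∞ (fun q : ℝ × EuclideanSpace ℝ (Fin n) × (S → Jet n k) =>
      q.2.2 ⟨i, hi⟩) := (contDiff_apply ℝ _ _).comp (contDiff_snd.comp contDiff_snd)
  exact (contDiff_pi.1 h3 ⟨j, Nat.lt_succ_of_le hj⟩).contDiffOn

end LocAt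

section IsLocal

variable {n : ℕ} [NeZero n] {M : Type*} [TopologicalSpace M]
  [ChartedSpace (EuclideanHalfSpace n) M] [IsManifold (𝓡∂ n) ∞ M] {ι κ : Type*}

/-- Local functions of smooth families are smooth families. -/
lemma IsLocal.jointSmooth {f : ℝ → (ι → M → ℝ) → M → ℝ} (hf : IsLocal n f) {P : Type}
    [NormedAddCommGroup P] [NormedSpace ℝ P] {τ : P → ℝ} (hτ : ContDiff ℝ ∞ τ)
    {Φ : P → ι → M → ℝ} (hΦ : ∀ i, JointSmooth n P (fun p => Φ p i)) :
    JointSmooth n P (fun p => f (τ p) (Φ p)) := by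
  obtain ⟨k, S, h⟩ := isLocal_iff.1 hf
  intro x₀
  obtain ⟨F, hF, hfF⟩ := h x₀
  have h1 : ContDiffOn ℝ ∞ (fun q : P × EuclideanSpace ℝ (Fin n) =>
      (τ q.1, q.2, fun i : S => jet n k (Φ q.1 i) x₀ q.2)) (univ ×ˢ chartTarget n x₀) := by
    refine (hτ.comp contDiff_fst).contDiffOn.prodMk (contDiff_snd.contDiffOn.prodMk ?_)
    exact contDiffOn_pi.2 fun i => contDiffOn_pi.2 fun j => contDiffOn_chartDeriv (hΦ i) j x₀
  refine (hF.comp h1 (fun q hq => ⟨mem_univ _, hq.2, mem_univ _⟩)).congr fun q hq => ?_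
  exact hfF _ _ (fun i => (hΦ i).isSmooth q.1) _ hq.2

lemma IsLocal.isSmooth {f : ℝ → (ι → M → ℝ) → M → ℝ} (hf : IsLocal n f) (t : ℝ)
    {Φ : ι → M → ℝ} (hΦ : ∀ i, IsSmooth n (Φ i)) : IsSmooth n (f t Φ) :=
  (hf.jointSmooth (P := ℝ) (contDiff_const (c := t))
    (fun i => (hΦ i).jointSmooth ℝ)).isSmooth 0

/-- The derivatives of a local function at a point only depend on the derivatives at this point of
finitely many fields. -/
lemma IsLocal.congr_jet {f : ℝ → (ι → M → ℝ) → M → ℝ} (hf : IsLocal n f) :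
    ∃ S : Finset ι, ∀ (t : ℝ) (Φ Φ' : ι → M → ℝ), (∀ i, IsSmooth n (Φ i)) →
      (∀ i, IsSmooth n (Φ' i)) → ∀ x₀ : M, ∀ y ∈ chartTarget n x₀,
      (∀ i ∈ S, ∀ j, chartDeriv n j (Φ i) x₀ y = chartDeriv n j (Φ' i) x₀ y) →
      ∀ j, chartDeriv n j (f t Φ) x₀ y = chartDeriv n j (f t Φ') x₀ y := by
  obtain ⟨k, S, h⟩ := isLocal_iff.1 hf
  refine ⟨S, fun t Φ Φ' hΦ hΦ' x₀ y hy he j => ?_⟩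
  obtain ⟨F, -, hF⟩ := (h x₀).chartDeriv j
  refine (hF t Φ hΦ y hy).trans (Eq.trans ?_ (hF t Φ' hΦ' y hy).symm)
  congr 3
  funext i
  funext j
  exact he i i.2 j

lemma IsLocal.congr {f g : ℝ → (ι → M → ℝ) → M → ℝ} (hf : IsLocal n f)
    (h : ∀ t Φ, (∀ i, IsSmooth n (Φ i)) → g t Φ = f t Φ) : IsLocal n g := by
  obtain ⟨k, S, hS⟩ := isLocal_iff.1 hf
  exact isLocal_iff.2 ⟨k, S, fun x₀ => (hS x₀).congr fun t Φ hΦ y _ => by rw [h t Φ hΦ]⟩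

lemma isLocal_field (i : ι) : IsLocal n (fun _ (Φ : ι → M → ℝ) => Φ i) := by
  refine isLocal_iff.2 ⟨0, {i}, fun x₀ => ?_⟩
  exact ((locAt_chartDeriv (Finset.mem_singleton_self i) le_rfl).map
    (LinearIsometryEquiv.contDiff
      (continuousMultilinearCurryFin0 ℝ (EuclideanSpace ℝ (Fin n)) ℝ))).congr
      fun t Φ _ y _ => by simp [chartDeriv_zero]

lemma isLocal_const (r : ℝ) : IsLocal n (fun _ (_ : ι → M → ℝ) _ => r) :=
  isLocal_iff.2 ⟨0, ∅, fun _ => locAt_coord (g := fun _ => r) contDiffOn_const⟩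

lemma isLocal_zero : IsLocal n (fun _ (_ : ι → M → ℝ) => (0 : M → ℝ)) := isLocal_const 0

/-- Composition of local functions. -/
lemma IsLocal.subst {f : ℝ → (κ → M → ℝ) → M → ℝ} (hf : IsLocal n f)
    {Ψ : ℝ → (ι → M → ℝ) → κ → M → ℝ} (hΨ : ∀ j, IsLocal n (fun t Φ => Ψ t Φ j)) :
    IsLocal n (fun t Φ => f t (Ψ t Φ)) := by
  classical
  obtain ⟨k, S, h⟩ := isLocal_iff.1 hf
  choose K T hT using fun j => isLocal_iff.1 (hΨ j)
  refine isLocal_iff.2 ⟨S.sup K + k, S.biUnion T, fun x₀ => ?_⟩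
  obtain ⟨F, hF, hfF⟩ := h x₀
  have h1 : LocAt n x₀ (S.sup K + k) (S.biUnion T) (fun t Φ y =>
      fun (i : S) => jet n k (Ψ t Φ i) x₀ y) := by
    refine LocAt.pi fun i => LocAt.pi fun j => ?_
    exact ((hT i x₀).chartDeriv (f := fun t Φ => Ψ t Φ i) j).mono
      (Nat.add_le_add (Finset.le_sup i.2) (Nat.lt_succ_iff.1 j.2))
      (Finset.subset_biUnion_of_mem T i.2)
  exact (h1.comp hF).congr fun t Φ hΦ y hy =>
    hfF t (Ψ t Φ) (fun i => (hΨ i).isSmooth t hΦ) y hy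

lemma IsLocal.reindex {f : ℝ → (κ → M → ℝ) → M → ℝ} (hf : IsLocal n f) (e : κ → ι) :
    IsLocal n (fun t (Φ : ι → M → ℝ) => f t (fun j => Φ (e j))) :=
  hf.subst (Ψ := fun _ Φ j => Φ (e j)) fun j => isLocal_field (e j)

lemma IsLocal.map₂ {f g : ℝ → (ι → M → ℝ) → M → ℝ} (hf : IsLocal n f) (hg : IsLocal n g)
    {m : ℝ × ℝ → ℝ} (hm : ContDiff ℝ ∞ m) : IsLocal n (fun t Φ x => m (f t Φ x, g t Φ x)) := by
  classical
  obtain ⟨k, S, h⟩ := isLocal_iff.1 hf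
  obtain ⟨k', S', h'⟩ := isLocal_iff.1 hg
  exact isLocal_iff.2 ⟨max k k', S ∪ S', fun x₀ =>
    (((h x₀).mono (le_max_left _ _) Finset.subset_union_left).prodMk
      ((h' x₀).mono (le_max_right _ _) Finset.subset_union_right)).map hm⟩

lemma IsLocal.add {f g : ℝ → (ι → M → ℝ) → M → ℝ} (hf : IsLocal n f) (hg : IsLocal n g) :
    IsLocal n (fun t Φ x => f t Φ x + g t Φ x) :=
  hf.map₂ hg (contDiff_fst.add contDiff_snd)

lemma IsLocal.sub {f g : ℝ → (ι → M → ℝ) → M → ℝ} (hf : IsLocal n f) (hg : IsLocal n g) :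
    IsLocal n (fun t Φ x => f t Φ x - g t Φ x) :=
  hf.map₂ hg (contDiff_fst.sub contDiff_snd)

lemma IsLocal.mul {f g : ℝ → (ι → M → ℝ) → M → ℝ} (hf : IsLocal n f) (hg : IsLocal n g) :
    IsLocal n (fun t Φ x => f t Φ x * g t Φ x) :=
  hf.map₂ hg (contDiff_fst.mul contDiff_snd)

lemma IsLocal.sum {β : Type*} {s : Finset β} {f : β → ℝ → (ι → M → ℝ) → M → ℝ}
    (hf : ∀ b ∈ s, IsLocal n (f b)) : IsLocal n (fun t Φ x => ∑ b ∈ s, f b t Φ x) := by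
  classical
  induction s using Finset.induction_on with
  | empty => simpa using isLocal_const 0
  | insert b s hb ih =>
    simp only [Finset.sum_insert hb]
    exact (hf b (Finset.mem_insert_self _ _)).add
      (ih fun c hc => hf c (Finset.mem_insert_of_mem hc))

/-- The variation of a local function in a chart. -/
lemma dder_eq_fderivWithin {f : ℝ → (ι → M → ℝ) → M → ℝ} {x₀ : M} {k : ℕ} {S : Finset ι}
    {F : ℝ × EuclideanSpace ℝ (Fin n) × (S → Jet n k) → ℝ}
    (hF : ContDiffOn ℝ ∞ F (jetDomain n x₀ (S → Jet n k)))
    (hfF : ∀ (t : ℝ) (Φ : ι → M → ℝ), (∀ i, IsSmooth n (Φ i)) → ∀ y ∈ chartTarget n x₀,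
      f t Φ ((extChartAt (𝓡∂ n) x₀).symm y) = F (t, y, fun i => jet n k (Φ i) x₀ y))
    (t : ℝ) {Φ Y : ι → M → ℝ} (hΦ : ∀ i, IsSmooth n (Φ i)) (hY : ∀ i, IsSmooth n (Y i))
    {y : EuclideanSpace ℝ (Fin n)} (hy : y ∈ chartTarget n x₀) :
    dder (f t) Φ Y ((extChartAt (𝓡∂ n) x₀).symm y) =
      fderivWithin ℝ F (jetDomain n x₀ (S → Jet n k)) (t, y, fun i => jet n k (Φ i) x₀ y)
        (0, 0, fun i => jet n k (Y i) x₀ y) := by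
  set D := jetDomain n x₀ (S → Jet n k)
  have e : ∀ s : ℝ, f t (Φ + s • Y)
      ((extChartAt (𝓡∂ n) x₀).symm y) = F ((t, y, fun i : S => jet n k (Φ i) x₀ y) +
        s • (0, 0, fun i : S => jet n k (Y i) x₀ y)) := by
    intro s
    have hsm : ∀ i, IsSmooth n (s • Y i) := fun i => (hY i).smul s
    refine (hfF t _ (fun i => (hΦ i).add (hsm i)) y hy).trans ?_
    have hz : ∀ (a : ℝ) (b : EuclideanSpace ℝ (Fin n)) (J J' : S → Jet n k),
      (a, b, J) + s • ((0 : ℝ), (0 : EuclideanSpace ℝ (Fin n)), J') = (a, b, J + s • J') := by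
      intro a b J J'
      simp
    rw [hz]
    congr 3
    funext i
    funext j
    simp only [Pi.add_apply, Pi.smul_apply, jet]
    rw [chartDeriv_add (hΦ _) (hsm _) _ hy, chartDeriv_smul (hY _) _ _ hy]
  show deriv (fun s : ℝ => f t (Φ + s • Y) ((extChartAt (𝓡∂ n) x₀).symm y)) 0 = _
  simp only [e]
  set p := (t, y, fun i : S => jet n k (Φ i) x₀ y)
  set v : ℝ × EuclideanSpace ℝ (Fin n) × (S → Jet n k) :=
    (0, 0, fun i : S => jet n k (Y i) x₀ y)
  have hd : HasFDerivWithinAt F (fderivWithin ℝ F D p) D (p + (0 : ℝ) • v) := by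
    rw [zero_smul, add_zero]
    exact (hF.differentiableOn (by simp) p ⟨mem_univ _, hy, mem_univ _⟩).hasFDerivWithinAt
  have hl : HasDerivAt (fun s : ℝ => p + s • v) v 0 := by
    simpa using ((hasDerivAt_id (0 : ℝ)).smul_const v).const_add p
  have := hd.comp_hasDerivWithinAt (0 : ℝ) (hl.hasDerivWithinAt (s := univ))
    (fun s _ => (⟨mem_univ _, by simpa [p, v] using hy, mem_univ _⟩ : p + s • v ∈ D))
  rw [hasDerivWithinAt_univ] at this
  exact this.deriv

/-- The variation of a local function is a local function of the fields and of their variation. -/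
lemma IsLocal.dder {f : ℝ → (ι → M → ℝ) → M → ℝ} (hf : IsLocal n f) :
    IsLocal n (fun t (Ψ : ι ⊕ ι → M → ℝ) =>
      dder (f t) (fun i => Ψ (Sum.inl i)) (fun i => Ψ (Sum.inr i))) := by
  obtain ⟨k, S, h⟩ := isLocal_iff.1 hf
  refine isLocal_iff.2 ⟨k, S.disjSum S, fun x₀ => ?_⟩
  obtain ⟨F, hF, hfF⟩ := h x₀
  set D := jetDomain n x₀ (S → Jet n k)
  have h1 : LocAt n x₀ k (S.disjSum S) (fun (t : ℝ) (Ψ : ι ⊕ ι → M → ℝ) y =>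
      fun i : S => jet n k (Ψ (Sum.inl i)) x₀ y) := by
    refine LocAt.pi fun i => LocAt.pi fun j => ?_
    exact locAt_chartDeriv (Finset.inl_mem_disjSum.2 i.2) (Nat.lt_succ_iff.1 j.2)
  have h2 : LocAt n x₀ k (S.disjSum S) (fun (t : ℝ) (Ψ : ι ⊕ ι → M → ℝ) y =>
      fun i : S => jet n k (Ψ (Sum.inr i)) x₀ y) := by
    refine LocAt.pi fun i => LocAt.pi fun j => ?_
    exact locAt_chartDeriv (Finset.inr_mem_disjSum.2 i.2) (Nat.lt_succ_iff.1 j.2)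
  have h3 : ContDiffOn ℝ ∞ (fun q : ℝ × EuclideanSpace ℝ (Fin n) ×
      ((S → Jet n k) × (S → Jet n k)) =>
      fderivWithin ℝ F D (q.1, q.2.1, q.2.2.1) (0, 0, q.2.2.2)) (jetDomain n x₀ _) := by
    refine ContDiffOn.clm_apply ?_ (by fun_prop)
    exact (hF.fderivWithin (uniqueDiffOn_jetDomain x₀ _) (m := ∞) (by simp)).comp
      (f := fun q : ℝ × EuclideanSpace ℝ (Fin n) × ((S → Jet n k) × (S → Jet n k)) =>
        (q.1, q.2.1, q.2.2.1)) (by fun_prop) (fun q hq => ⟨hq.1, hq.2.1, mem_univ _⟩)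
  exact ((h1.prodMk h2).comp h3).congr fun t Ψ hΨ y hy =>
    dder_eq_fderivWithin hF hfF t (fun i => hΨ (Sum.inl i)) (fun i => hΨ (Sum.inr i)) hy

/-- The partial time derivative of a local function is local. -/
lemma IsLocal.deriv_time {f : ℝ → (ι → M → ℝ) → M → ℝ} (hf : IsLocal n f) :
    IsLocal n (fun t Φ x => deriv (fun τ => f τ Φ x) t) := by
  obtain ⟨k, S, h⟩ := isLocal_iff.1 hf
  refine isLocal_iff.2 ⟨k, S, fun x₀ => ?_⟩
  obtain ⟨F, hF, hfF⟩ := h x₀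
  set D := jetDomain n x₀ (S → Jet n k)
  refine ⟨fun q => fderivWithin ℝ F D q (1, 0, 0), ?_, fun t Φ hΦ y hy => ?_⟩
  · exact ContDiffOn.clm_apply (hF.fderivWithin (uniqueDiffOn_jetDomain x₀ _) (m := ∞) (by simp))
      contDiffOn_const
  · simp only [fun τ => hfF τ Φ hΦ y hy]
    have hd := (hF.differentiableOn (by simp) (t, y, fun i : S => jet n k (Φ i) x₀ y)
      ⟨mem_univ _, hy, mem_univ _⟩).hasFDerivWithinAt
    have hl : HasDerivWithinAt (fun τ : ℝ => (τ, y, fun i : S => jet n k (Φ i) x₀ y))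
        ((1 : ℝ), 0, 0) univ t :=
      (hasDerivWithinAt_id t _).prodMk ((hasDerivWithinAt_const t _ y).prodMk
        (hasDerivWithinAt_const t _ _))
    have := hd.comp_hasDerivWithinAt t hl (fun s _ => (⟨mem_univ _, hy, mem_univ _⟩ : _ ∈ D))
    rw [hasDerivWithinAt_univ] at this
    exact this.deriv

lemma IsLocal.dder_subst {f : ℝ → (ι → M → ℝ) → M → ℝ} (hf : IsLocal n f)
    {Φ Y : ℝ → (κ → M → ℝ) → ι → M → ℝ} (hΦ : ∀ i, IsLocal n (fun t Ψ => Φ t Ψ i))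
    (hY : ∀ i, IsLocal n (fun t Ψ => Y t Ψ i)) :
    IsLocal n (fun t Ψ => GaugeField.dder (f t) (Φ t Ψ) (Y t Ψ)) :=
  hf.dder.subst (Ψ := fun t Ψ => Sum.elim (Φ t Ψ) (Y t Ψ)) (by rintro (i | i); exacts [hΦ i, hY i])

end IsLocal

/-! ### Germs and flatness at the boundary -/

section Flat

variable {n : ℕ} [NeZero n] {M : Type*} [TopologicalSpace M]
  [ChartedSpace (EuclideanHalfSpace n) M] {ι : Type*}

lemma chartDeriv_congr {f g : M → ℝ} {x₀ : M} {y : EuclideanSpace ℝ (Fin n)}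
    (hy : y ∈ chartTarget n x₀) (h : f =ᶠ[𝓝 ((extChartAt (𝓡∂ n) x₀).symm y)] g) (j : ℕ) :
    chartDeriv n j f x₀ y = chartDeriv n j g x₀ y := by
  rw [chartDeriv_eq j _ _ hy, chartDeriv_eq j _ _ hy]
  refine Filter.EventuallyEq.iteratedFDerivWithin_eq (f₁ := f ∘ (extChartAt (𝓡∂ n) x₀).symm)
    (f := g ∘ (extChartAt (𝓡∂ n) x₀).symm) (x := y) ?_ h.self_of_nhds j
  exact ((continuousOn_extChartAt_symm x₀) y hy).eventually h

/-- All derivatives of `f` vanish at `x`. -/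
def FlatAt (n : ℕ) [NeZero n] {M : Type*} [TopologicalSpace M]
    [ChartedSpace (EuclideanHalfSpace n) M] (f : M → ℝ) (x : M) : Prop :=
  ∀ j : ℕ, chartDeriv n j f x (extChartAt (𝓡∂ n) x x) = 0

lemma FlatAt.congr {f g : M → ℝ} {x : M} (hf : FlatAt n f x) (h : g =ᶠ[𝓝 x] f) : FlatAt n g x := by
  intro j
  exact (chartDeriv_congr (mem_extChartAt_target x) (by rwa [extChartAt_to_inv]) j).trans (hf j)

lemma flatAt_zero (x : M) : FlatAt n (0 : M → ℝ) x := by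
  intro j
  have h : (0 : M → ℝ) ∘ (extChartAt (𝓡∂ n) x).symm = 0 := rfl
  rw [chartDeriv_eq _ _ _ (mem_extChartAt_target x), h]
  exact congrFun iteratedFDerivWithin_zero _

lemma flatAt_of_notMem_tsupport {f : M → ℝ} {x : M} (h : x ∉ tsupport f) : FlatAt n f x :=
  (flatAt_zero x).congr (notMem_tsupport_iff_eventuallyEq.1 h)

lemma FlatAt.eq_zero {f : M → ℝ} {x : M} (hf : FlatAt n f x) : f x = 0 := by
  have h := hf 0
  rw [chartDeriv_zero, extChartAt_to_inv] at h
  exact congrArg (fun m => m 0) h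

lemma flatOnBoundary_of_tsupport {f : M → ℝ} (h : tsupport f ⊆ (𝓡∂ n).interior M) :
    FlatOnBoundary n f := fun _ hx => flatAt_of_notMem_tsupport fun hx' =>
  (disjoint_left.1 (𝓡∂ n).disjoint_interior_boundary) (h hx') hx

lemma flatOnBoundary_zero : FlatOnBoundary n (0 : M → ℝ) := fun x _ => flatAt_zero x

variable [IsManifold (𝓡∂ n) ∞ M]

/-- Flatness does not depend on the chart. -/
lemma FlatAt.chartDeriv_eq_zero {f : M → ℝ} (hf : IsSmooth n f) {x : M} (h : FlatAt n f x)
    {x₀ : M} (hx : x ∈ (extChartAt (𝓡∂ n) x₀).source) (j : ℕ) :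
    chartDeriv n j f x₀ (extChartAt (𝓡∂ n) x₀ x) = 0 := by
  set e := extChartAt (𝓡∂ n) x with he
  set e₀ := extChartAt (𝓡∂ n) x₀ with he₀
  have hj : (j : WithTop ℕ∞) ≤ ∞ := WithTop.coe_le_coe.2 le_top
  obtain ⟨U, hU, hUe⟩ := continuousOn_iff'.1 (continuousOn_extChartAt_symm (I := 𝓡∂ n) x₀)
    e.source (isOpen_extChartAt_source x)
  set s := e₀.target ∩ U with hs
  have hsource : s = (e₀.symm.trans e).source := by
    rw [PartialEquiv.trans_source, PartialEquiv.symm_source, hs, inter_comm e₀.target U, ← hUe,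
      inter_comm]
  have hxs : e₀ x ∈ s := by
    rw [hsource, PartialEquiv.trans_source, PartialEquiv.symm_source]
    refine ⟨e₀.map_source hx, ?_⟩
    rw [mem_preimage, e₀.left_inv hx]
    exact mem_extChartAt_source x
  have hsu : UniqueDiffOn ℝ s := (uniqueDiffOn_chartTarget x₀).inter hU
  have htr : ContDiffOn ℝ ∞ (e ∘ e₀.symm) s := by
    rw [hsource]
    exact contDiffOn_ext_coord_change x x₀
  have hmaps : MapsTo (e ∘ e₀.symm) s e.target := by
    intro y hy
    rw [hsource, PartialEquiv.trans_source] at hy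
    exact e.map_source hy.2
  set D := 1 + ∑ i ∈ Finset.range (j + 1), ‖iteratedFDerivWithin ℝ i (e ∘ e₀.symm) s (e₀ x)‖
  have hD1 : 1 ≤ D := le_add_of_nonneg_right (Finset.sum_nonneg fun _ _ => norm_nonneg _)
  have hpt : (e ∘ e₀.symm) (e₀ x) = e x := by simp only [Function.comp, e₀.left_inv hx]
  -- the bound of Faà di Bruno's formula, with bound `0` for the derivatives in the first chart
  have key := norm_iteratedFDerivWithin_comp_le (n := j) (hf.contDiffOn_chart x) htr hj
    (uniqueDiffOn_chartTarget x) hsu hmaps hxs (C := 0) (D := D)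
    (fun i _ => by
      rw [hpt]
      have := h i
      rw [chartDeriv_eq i _ _ (mem_extChartAt_target x)] at this
      rw [this, norm_zero])
    (fun i hi hij => by
      refine le_trans ?_ (le_self_pow₀ hD1 (by omega))
      refine le_trans ?_ (le_add_of_nonneg_left zero_le_one)
      exact Finset.single_le_sum (f := fun i =>
        ‖iteratedFDerivWithin ℝ i (e ∘ e₀.symm) s (e₀ x)‖) (fun _ _ => norm_nonneg _)
        (Finset.mem_range.2 (by omega)))
  rw [mul_zero, zero_mul, norm_le_zero_iff] at key
  rw [chartDeriv_eq j _ _ (e₀.map_source hx), ← key]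
  have h1 : iteratedFDerivWithin ℝ j (f ∘ e₀.symm) s (e₀ x)
      = iteratedFDerivWithin ℝ j (f ∘ e₀.symm) e₀.target (e₀ x) := by
    refine iteratedFDerivWithin_congr_set ?_ j
    filter_upwards [hU.mem_nhds hxs.2] with y hy
    exact propext ⟨fun h => h.1, fun h => ⟨h, hy⟩⟩
  rw [← h1]
  refine iteratedFDerivWithin_congr (fun y hy => ?_) hxs j
  have : e₀.symm y ∈ e.source := by
    rw [hsource, PartialEquiv.trans_source] at hy
    exact hy.2
  show f _ = f (e.symm (e _))
  rw [e.left_inv this]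

/-- If fields have the same derivatives at a point, so do their local functions. -/
lemma IsLocal.flatAt_sub {f : ℝ → (ι → M → ℝ) → M → ℝ} (hf : IsLocal n f) (t : ℝ)
    {Φ Φ' : ι → M → ℝ} (hΦ : ∀ i, IsSmooth n (Φ i)) (hΦ' : ∀ i, IsSmooth n (Φ' i)) {x : M}
    (h : ∀ i, FlatAt n (Φ i - Φ' i) x) : FlatAt n (f t Φ - f t Φ') x := by
  obtain ⟨S, hS⟩ := hf.congr_jet
  intro j
  rw [chartDeriv_sub (hf.isSmooth t hΦ) (hf.isSmooth t hΦ') j (mem_extChartAt_target x),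
    hS t Φ Φ' hΦ hΦ' x _ (mem_extChartAt_target x) (fun i _ j => ?_) j, sub_self]
  have := h i j
  rwa [chartDeriv_sub (hΦ i) (hΦ' i) j (mem_extChartAt_target x), sub_eq_zero] at this

lemma IsLocal.flatAt {f : ℝ → (ι → M → ℝ) → M → ℝ} (hf : IsLocal n f) (t : ℝ)
    {Φ Φ' : ι → M → ℝ} (hΦ : ∀ i, IsSmooth n (Φ i)) (hΦ' : ∀ i, IsSmooth n (Φ' i)) {x : M}
    (h : ∀ i, FlatAt n (Φ i - Φ' i) x) (h0 : f t Φ' = 0) : FlatAt n (f t Φ) x := by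
  simpa [h0] using hf.flatAt_sub t hΦ hΦ' h

/-- The value of a local function at a point only depends on the germs of finitely many fields. -/
lemma IsLocal.congr_germ {f : ℝ → (ι → M → ℝ) → M → ℝ} (hf : IsLocal n f) :
    ∃ S : Finset ι, ∀ (t : ℝ) (Φ Φ' : ι → M → ℝ), (∀ i, IsSmooth n (Φ i)) →
      (∀ i, IsSmooth n (Φ' i)) → ∀ x : M, (∀ i ∈ S, Φ i =ᶠ[𝓝 x] Φ' i) → f t Φ x = f t Φ' x := by
  obtain ⟨S, hS⟩ := hf.congr_jet
  refine ⟨S, fun t Φ Φ' hΦ hΦ' x h => ?_⟩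
  have := hS t Φ Φ' hΦ hΦ' x _ (mem_extChartAt_target x) (fun i hi j =>
    chartDeriv_congr (mem_extChartAt_target x) (by rw [extChartAt_to_inv]; exact h i hi) j) 0
  rw [chartDeriv_zero, chartDeriv_zero, extChartAt_to_inv] at this
  exact congrArg (fun m => m 0) this

lemma IsLocal.congr_germ_all {f : ℝ → (ι → M → ℝ) → M → ℝ} (hf : IsLocal n f) (t : ℝ)
    {Φ Φ' : ι → M → ℝ} (hΦ : ∀ i, IsSmooth n (Φ i)) (hΦ' : ∀ i, IsSmooth n (Φ' i)) {x : M}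
    (h : ∀ i, Φ i =ᶠ[𝓝 x] Φ' i) : f t Φ x = f t Φ' x := by
  obtain ⟨S, hS⟩ := hf.congr_germ
  exact hS t Φ Φ' hΦ hΦ' x fun i _ => h i

lemma dder_zero_right (f : (ι → M → ℝ) → M → ℝ) (Φ : ι → M → ℝ) : dder f Φ 0 = 0 := by
  funext x
  simp [dder]

/-- The variation of a local function under a flat variation of the fields is flat. -/
lemma IsLocal.flatAt_dder {f : ℝ → (ι → M → ℝ) → M → ℝ} (hf : IsLocal n f) (t : ℝ)
    {Φ Y : ι → M → ℝ} (hΦ : ∀ i, IsSmooth n (Φ i)) (hY : ∀ i, IsSmooth n (Y i)) {x : M}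
    (h : ∀ i, FlatAt n (Y i) x) : FlatAt n (GaugeField.dder (f t) Φ Y) x := by
  have h0 : ∀ i : ι, IsSmooth n (0 : M → ℝ) := fun _ => isSmooth_const 0
  refine hf.dder.flatAt t (Φ := Sum.elim Φ Y) (Φ' := Sum.elim Φ 0) ?_ ?_ ?_ ?_
  · rintro (i | i)
    exacts [hΦ i, hY i]
  · rintro (i | i)
    exacts [hΦ i, h0 i]
  · rintro (i | i)
    · simpa using flatAt_zero x
    · simpa using h i
  · exact dder_zero_right _ _

lemma FlatAt.add {f g : M → ℝ} {x : M} (hfs : IsSmooth n f) (hgs : IsSmooth n g)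
    (hf : FlatAt n f x) (hg : FlatAt n g x) : FlatAt n (f + g) x := by
  intro j
  rw [chartDeriv_add hfs hgs j (mem_extChartAt_target x), hf j, hg j, add_zero]

lemma FlatAt.sub {f g : M → ℝ} {x : M} (hfs : IsSmooth n f) (hgs : IsSmooth n g)
    (hf : FlatAt n f x) (hg : FlatAt n g x) : FlatAt n (f - g) x := by
  intro j
  rw [chartDeriv_sub hfs hgs j (mem_extChartAt_target x), hf j, hg j, sub_zero]

lemma FlatAt.smul {f : M → ℝ} {x : M} (hfs : IsSmooth n f) (r : ℝ)
    (hf : FlatAt n f x) : FlatAt n (r • f) x := by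
  intro j
  rw [chartDeriv_smul hfs r j (mem_extChartAt_target x), hf j, smul_zero]

lemma isSmooth_sum {β : Type*} {s : Finset β} {f : β → M → ℝ} (hf : ∀ b ∈ s, IsSmooth n (f b)) :
    IsSmooth n (∑ b ∈ s, f b) := by
  classical
  induction s using Finset.induction_on with
  | empty => exact isSmooth_const 0
  | insert b s hb ih =>
    rw [Finset.sum_insert hb]
    exact (hf b (Finset.mem_insert_self _ _)).add
      (ih fun c hc => hf c (Finset.mem_insert_of_mem hc))

lemma flatAt_sum {β : Type*} {s : Finset β} {f : β → M → ℝ} {x : M}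
    (hf : ∀ b ∈ s, IsSmooth n (f b)) (h : ∀ b ∈ s, FlatAt n (f b) x) :
    FlatAt n (∑ b ∈ s, f b) x := by
  classical
  induction s using Finset.induction_on with
  | empty => exact flatAt_zero x
  | insert b s hb ih =>
    rw [Finset.sum_insert hb]
    exact (h b (Finset.mem_insert_self _ _)).add (hf b (Finset.mem_insert_self _ _))
      (isSmooth_sum fun c hc => hf c (Finset.mem_insert_of_mem hc))
      (ih (fun c hc => hf c (Finset.mem_insert_of_mem hc))
        fun c hc => h c (Finset.mem_insert_of_mem hc))

/-- The derivative of a family of flat functions is flat. -/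
lemma JointSmooth.flatAt_deriv {f : ℝ → M → ℝ} (hf : JointSmooth n ℝ f) {x : M}
    (h : ∀ s, FlatAt n (f s) x) (s : ℝ) : FlatAt n (fun x => deriv (fun s => f s x) s) x := by
  -- Around `s`, `f = f s + r • R r` with `R` smooth, so that `R r` is flat for `r ≠ 0`.
  have h1 : JointSmooth n (ℝ × ℝ) (fun q => f (s + q.1)) :=
    hf.comp (g := fun q : ℝ × ℝ => s + q.1) (by fun_prop)
  obtain ⟨R, hR, hfR⟩ := h1.hadamard
  have hR0 : JointSmooth n ℝ (fun r => R (r, 0)) :=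
    hR.comp (g := fun r : ℝ => (r, (0 : ℝ))) (by fun_prop)
  have hd : (fun x => deriv (fun s => f s x) s) = R (0, 0) := by
    funext z
    have e : (fun r => f (s + r) z) = fun r => f s z + r * R (r, 0) z := by
      funext r
      simpa using hfR r 0 z
    have h2 : HasDerivAt (fun r => f (s + r) z) (R (0, 0) z) 0 := by
      rw [e]
      have := ((hasDerivAt_id (0 : ℝ)).mul
        ((hR0.contDiff z).differentiable (by simp) 0).hasDerivAt).const_add (f s z)
      simpa using this
    have h3 := h2.deriv
    rwa [deriv_comp_const_add (f := fun s => f s z) s 0, add_zero] at h3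
  rw [hd]
  intro j
  have hc : Continuous (fun r : ℝ => chartDeriv n j (R (r, 0)) x (extChartAt (𝓡∂ n) x x)) := by
    rw [← continuousOn_univ]
    exact (contDiffOn_chartDeriv hR0 j x).continuousOn.comp
      (f := fun r : ℝ => (r, extChartAt (𝓡∂ n) x x)) (by fun_prop)
      (fun r _ => ⟨mem_univ _, mem_extChartAt_target x⟩)
  have hz : ∀ r : ℝ, r ≠ 0 → chartDeriv n j (R (r, 0)) x (extChartAt (𝓡∂ n) x x) = 0 := by
    intro r hr
    have e : R (r, 0) = r⁻¹ • (f (s + r) - f s) := by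
      funext z
      have h6 : f (s + r) z = f (s + 0) z + r * R (r, 0) z := hfR r 0 z
      simp only [Pi.smul_apply, Pi.sub_apply, smul_eq_mul]
      rw [h6, add_zero]
      field_simp
      ring
    have h5 := ((h (s + r)).sub (hf.isSmooth _) (hf.isSmooth _) (h s)).smul
      ((hf.isSmooth _).sub (hf.isSmooth _)) r⁻¹ j
    rwa [← e] at h5
  have hd : Dense {r : ℝ | r ≠ 0} := dense_compl_singleton 0
  have := hc.ext_on hd continuous_const (fun r hr => hz r hr)
  exact congrFun this 0

end Flat

section Velocity

variable {n : ℕ} [NeZero n] {M : Type*} [TopologicalSpace M]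
  [ChartedSpace (EuclideanHalfSpace n) M] {ι A Λ : Type*}

lemma deriv_hadamard {g r : ℝ → ℝ} (hr : DifferentiableAt ℝ r 0)
    (h : ∀ s, g s = g 0 + s * r s) : deriv g 0 = r 0 := by
  have := ((hasDerivAt_id (0 : ℝ)).mul hr.hasDerivAt).const_add (g 0)
  have e : g = fun s => g 0 + s * r s := funext h
  rw [e]
  simpa using this.deriv

lemma histPlots_hasVel {c : ℝ → Hist M A Λ} {Y : Hist M A Λ}
    (hc : (histPlots n M A Λ).IsPlot ℝ c) (h : ∀ i t x, deriv (fun s => c s i t x) 0 = Y i t x) :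
    (histPlots n M A Λ).HasVel c Y := by
  obtain ⟨R, hR, hcR⟩ := (histPlots n M A Λ).hadamard hc
  refine ⟨R, hR, hcR, ?_⟩
  ext i t x
  rw [← h i t x]
  refine (deriv_hadamard (r := fun s => R s i t x) ?_
    fun s => congrFun (congrFun (congrFun (hcR s) i) t) x).symm
  have := ((hR i).comp (g := fun s : ℝ => (s, t)) (by fun_prop)).contDiff x
  exact this.differentiable (by simp) 0

lemma timedPlots_hasVel {c : ℝ → ℝ × (ι → M → ℝ)} {a : ℝ} {Y : ι → M → ℝ}
    (hc : (timedPlots n M ι).IsPlot ℝ c) (ha : deriv (fun s => (c s).1) 0 = a)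
    (h : ∀ i x, deriv (fun s => (c s).2 i x) 0 = Y i x) :
    (timedPlots n M ι).HasVel c (a, Y) := by
  obtain ⟨R, hR, hcR⟩ := (timedPlots n M ι).hadamard hc
  refine ⟨R, hR, hcR, Prod.ext ?_ ?_⟩
  · rw [← ha]
    exact (deriv_hadamard (r := fun s => (R s).1) (hR.1.differentiable (by simp) 0)
      fun s => congrArg Prod.fst (hcR s)).symm
  · ext i x
    show (R 0).2 i x = Y i x
    rw [← h i x]
    exact (deriv_hadamard (r := fun s => (R s).2 i x)
      (((hR.2 i).contDiff x).differentiable (by simp) 0)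
      fun s => congrFun (congrFun (congrArg Prod.snd (hcR s)) i) x).symm

end Velocity

/-! ### Smooth volumes -/

section Measures

variable {n : ℕ} [NeZero n] {M : Type*} [TopologicalSpace M]
  [ChartedSpace (EuclideanHalfSpace n) M]

lemma measurableSet_chartTarget (x₀ : M) : MeasurableSet (chartTarget n x₀) := by
  rw [chartTarget, extChartAt_target]
  exact ((chartAt (EuclideanHalfSpace n) x₀).open_target.preimage
    (𝓡∂ n).continuous_symm).measurableSet.inter (𝓡∂ n).isClosed_range.measurableSet

lemma image_source_inter_preimage (x₀ : M) (U : Set (EuclideanSpace ℝ (Fin n))) :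
    extChartAt (𝓡∂ n) x₀ '' ((extChartAt (𝓡∂ n) x₀).source ∩ extChartAt (𝓡∂ n) x₀ ⁻¹' U)
      = chartTarget n x₀ ∩ U := by
  rw [image_inter_preimage, PartialEquiv.image_source_eq_target]

lemma isOpen_source_inter_preimage (x₀ : M) {U : Set (EuclideanSpace ℝ (Fin n))} (hU : IsOpen U) :
    IsOpen ((extChartAt (𝓡∂ n) x₀).source ∩ extChartAt (𝓡∂ n) x₀ ⁻¹' U) :=
  (continuousOn_extChartAt x₀).isOpen_inter_preimage (isOpen_extChartAt_source x₀) hU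

/-- A function that is continuous on the image of a chart is bounded near the centre. -/
lemma exists_isOpen_bounded (x₀ : M) {w : EuclideanSpace ℝ (Fin n) → ℝ}
    (hw : ContinuousOn w (chartTarget n x₀)) :
    ∃ (U : Set (EuclideanSpace ℝ (Fin n))) (C : ℝ), IsOpen U ∧ extChartAt (𝓡∂ n) x₀ x₀ ∈ U ∧
      U ⊆ Metric.ball (extChartAt (𝓡∂ n) x₀ x₀) 1 ∧ ∀ y ∈ chartTarget n x₀ ∩ U, w y ≤ C := by
  set y₀ := extChartAt (𝓡∂ n) x₀ x₀
  obtain ⟨V, hV, hVw⟩ := continuousOn_iff'.1 hw (Iio (w y₀ + 1)) isOpen_Iio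
  have hy₀ : y₀ ∈ chartTarget n x₀ := mem_extChartAt_target x₀
  refine ⟨V ∩ Metric.ball y₀ 1, w y₀ + 1, hV.inter Metric.isOpen_ball,
    ⟨?_, Metric.mem_ball_self one_pos⟩, inter_subset_right, ?_⟩
  · have : y₀ ∈ w ⁻¹' Iio (w y₀ + 1) ∩ chartTarget n x₀ := ⟨by simp, hy₀⟩
    rw [hVw] at this
    exact this.1
  · rintro y ⟨hy, hyV, -⟩
    have : y ∈ V ∩ chartTarget n x₀ := ⟨hyV, hy⟩
    rw [← hVw] at this
    exact le_of_lt this.1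

lemma mem_interior_chartTarget_iff {x₀ : M} {y : EuclideanSpace ℝ (Fin n)}
    (hy : y ∈ chartTarget n x₀) :
    y ∈ interior (chartTarget n x₀) ↔ y ∈ interior (range (𝓡∂ n)) := by
  rw [mem_interior_iff_mem_nhds, mem_interior_iff_mem_nhds]
  have h := chartTarget_eventuallyEq (x₀ := x₀) hy
  constructor <;> intro h' <;> filter_upwards [h, h'] with z hz hz'
  · exact hz.mp hz'
  · exact hz.mpr hz'

lemma mem_interior_iff [IsManifold (𝓡∂ n) ∞ M] {x x₀ : M} (hx : x ∈ (extChartAt (𝓡∂ n) x₀).source) :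
    x ∈ (𝓡∂ n).interior M ↔ extChartAt (𝓡∂ n) x₀ x ∈ interior (chartTarget n x₀) :=
  (𝓡∂ n).isInteriorPoint_iff_of_mem_atlas (n := ∞) (by simp) (chart_mem_atlas _ x₀)
    (by rwa [extChartAt_source] at hx)

lemma isOpen_manifoldInterior [IsManifold (𝓡∂ n) ∞ M] : IsOpen ((𝓡∂ n).interior M) :=
  (𝓡∂ n).isOpen_interior (n := ∞) (by simp)

lemma dense_interior [IsManifold (𝓡∂ n) ∞ M] : Dense ((𝓡∂ n).interior M) := by
  rw [dense_iff_inter_open]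
  rintro U hU ⟨x, hx⟩
  set e := extChartAt (𝓡∂ n) x
  have hV : e.symm ⁻¹' U ∩ e.target ∈ 𝓝[range (𝓡∂ n)] (e x) := by
    refine inter_mem ?_ (extChartAt_target_mem_nhdsWithin x)
    have h := (continuousAt_extChartAt_symm (I := 𝓡∂ n) x).tendsto
    refine nhdsWithin_le_nhds (h ?_)
    rw [extChartAt_to_inv]
    exact hU.mem_nhds hx
  obtain ⟨W, hW, hxW, hWV⟩ := mem_nhdsWithin.1 hV
  have hcl : e x ∈ closure (interior (range (𝓡∂ n))) :=
    (𝓡∂ n).range_subset_closure_interior (mem_range_self _)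
  obtain ⟨y, hyW, hyi⟩ := mem_closure_iff.1 hcl W hW hxW
  have hy := hWV ⟨hyW, interior_subset hyi⟩
  refine ⟨e.symm y, hy.1, (mem_interior_iff (e.map_target hy.2)).2 ?_⟩
  rw [e.right_inv hy.2]
  exact (mem_interior_chartTarget_iff hy.2).2 hyi

variable [MeasurableSpace M]

/-- A measure with smooth densities in the charts is locally finite, hence finite. The set `K` is
the whole space for volumes, and the boundary hyperplane for volumes of the boundary. -/
lemma isFiniteMeasure_of_chart [BorelSpace M] [CompactSpace M] {μ : Measure M}
    {ρ : Measure (EuclideanSpace ℝ (Fin n))} {K : Set (EuclideanSpace ℝ (Fin n))}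
    (hρ : ∀ y r, ρ (Metric.ball y r ∩ K) < ⊤)
    (h : ∀ x₀ : M, ∃ w : EuclideanSpace ℝ (Fin n) → ℝ,
      ContDiffOn ℝ ∞ w (extChartAt (𝓡∂ n) x₀).target ∧
      ∀ s : Set M, MeasurableSet s → s ⊆ (extChartAt (𝓡∂ n) x₀).source →
        μ s = ∫⁻ y in (extChartAt (𝓡∂ n) x₀ '' s) ∩ K, ENNReal.ofReal (w y) ∂ρ)
    (hK : MeasurableSet K) : IsFiniteMeasure μ := by
  have : IsLocallyFiniteMeasure μ := by
    refine ⟨fun x₀ => ?_⟩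
    obtain ⟨w, hw, hμ⟩ := h x₀
    obtain ⟨U, C, hU, hxU, hUb, hUC⟩ := exists_isOpen_bounded x₀ hw.continuousOn
    have ho := isOpen_source_inter_preimage x₀ hU
    refine ⟨_, ho.mem_nhds ⟨mem_extChartAt_source x₀, hxU⟩, ?_⟩
    rw [hμ _ ho.measurableSet inter_subset_left, image_source_inter_preimage]
    calc ∫⁻ y in chartTarget n x₀ ∩ U ∩ K, ENNReal.ofReal (w y) ∂ρ
        ≤ ∫⁻ y in chartTarget n x₀ ∩ U ∩ K, ENNReal.ofReal C ∂ρ :=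
          setLIntegral_mono' (((measurableSet_chartTarget x₀).inter hU.measurableSet).inter hK)
            fun y hy => ENNReal.ofReal_le_ofReal (hUC y hy.1)
      _ = ENNReal.ofReal C * ρ (chartTarget n x₀ ∩ U ∩ K) := by
          rw [setLIntegral_const]
      _ < ⊤ := ENNReal.mul_lt_top ENNReal.ofReal_lt_top
          ((measure_mono (inter_subset_inter_left K (inter_subset_right.trans hUb))).trans_lt
            (hρ _ _))
  exact CompactSpace.isFiniteMeasure

lemma IsSmoothVolume.isFiniteMeasure [BorelSpace M] [CompactSpace M] {μ : Measure M}
    (hμ : IsSmoothVolume n μ) : IsFiniteMeasure μ := by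
  refine isFiniteMeasure_of_chart (n := n) (ρ := volume) (K := univ) (fun y r => ?_) (fun x₀ => ?_)
    MeasurableSet.univ
  · rw [inter_univ]
    exact measure_ball_lt_top
  · obtain ⟨w, hw, -, h⟩ := hμ x₀
    exact ⟨w, hw, fun s hs hss => by rw [inter_univ]; exact h s hs hss⟩

/-- The boundary of the half-space has locally finite `(n - 1)`-dimensional measure: the boundary
part of a ball lies in a Lipschitz image of a ball of `ℝ ^ (n - 1)`, on which the Hausdorff measure
is the Lebesgue measure. -/
lemma hausdorffMeasure_ball_inter_frontier (y : EuclideanSpace ℝ (Fin n)) (r : ℝ) :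
    Measure.hausdorffMeasure ((n : ℝ) - 1) (Metric.ball y r ∩ frontier (range (𝓡∂ n))) < ⊤ := by
  obtain ⟨m, rfl⟩ := Nat.exists_eq_succ_of_ne_zero (NeZero.ne n)
  set ψ : (Fin m → ℝ) →L[ℝ] EuclideanSpace ℝ (Fin (m + 1)) :=
    ((EuclideanSpace.equiv (Fin (m + 1)) ℝ).symm : (Fin (m + 1) → ℝ) →L[ℝ] _).comp
      (ContinuousLinearMap.pi fun i => Fin.cases (motive := fun _ => (Fin m → ℝ) →L[ℝ] ℝ) 0
        (fun i => ContinuousLinearMap.proj i) i) with hψ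
  have hsub : Metric.ball y r ∩ frontier (range (𝓡∂ (m + 1))) ⊆
      ψ '' Metric.closedBall 0 (‖y‖ + r) := by
    rintro z ⟨hz, hz0⟩
    rw [frontier_range_modelWithCornersEuclideanHalfSpace] at hz0
    refine ⟨fun i => z i.succ, ?_, ?_⟩
    · rw [mem_closedBall_zero_iff]
      have hz' : ‖z‖ ≤ ‖y‖ + r := by
        have := norm_sub_norm_le z y
        rw [Metric.mem_ball, dist_eq_norm] at hz
        linarith
      refine (pi_norm_le_iff_of_nonneg ((norm_nonneg z).trans hz')).2 fun i => ?_
      exact (PiLp.norm_apply_le z i.succ).trans hz'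
    · ext i
      refine Fin.cases ?_ (fun i => ?_) i
      · exact hz0
      · rfl
  have hm : ((m + 1 : ℕ) : ℝ) - 1 = Fintype.card (Fin m) := by simp
  calc _ ≤ Measure.hausdorffMeasure (((m + 1 : ℕ) : ℝ) - 1)
          (ψ '' Metric.closedBall 0 (‖y‖ + r)) := measure_mono hsub
    _ ≤ (‖ψ‖₊ : ENNReal) ^ (((m + 1 : ℕ) : ℝ) - 1) *
        Measure.hausdorffMeasure (((m + 1 : ℕ) : ℝ) - 1) (Metric.closedBall 0 (‖y‖ + r)) :=
          ψ.lipschitz.hausdorffMeasure_image_le (by rw [hm]; positivity) _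
    _ < ⊤ := by
      rw [hm, hausdorffMeasure_pi_real]
      exact ENNReal.mul_lt_top (ENNReal.rpow_lt_top_of_nonneg (by positivity) ENNReal.coe_ne_top)
        measure_closedBall_lt_top

lemma IsSmoothBoundaryVolume.isFiniteMeasure [BorelSpace M] [CompactSpace M] {ν : Measure M}
    (hν : IsSmoothBoundaryVolume n ν) : IsFiniteMeasure ν := by
  refine isFiniteMeasure_of_chart (n := n) hausdorffMeasure_ball_inter_frontier (fun x₀ => ?_)
    isClosed_frontier.measurableSet
  obtain ⟨w, hw, -, h⟩ := hν x₀
  exact ⟨w, hw, h⟩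

variable [IsManifold (𝓡∂ n) ∞ M]

lemma IsSmoothVolume.isOpenPosMeasure [BorelSpace M] {μ : Measure M}
    (hμ : IsSmoothVolume n μ) : μ.IsOpenPosMeasure := by
  refine ⟨fun U hU hne h0 => ?_⟩
  obtain ⟨x, hxU, hx⟩ := dense_iff_inter_open.1 (dense_interior (n := n)) U hU hne
  set e := extChartAt (𝓡∂ n) x
  obtain ⟨w, hw, hw0, h⟩ := hμ x
  have hs : IsOpen (U ∩ e.source) := hU.inter (isOpen_extChartAt_source x)
  have h1 : ∫⁻ y in e '' (U ∩ e.source), ENNReal.ofReal (w y) = 0 := by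
    rw [← h _ hs.measurableSet inter_subset_right]
    exact measure_mono_null inter_subset_left h0
  have hxi : e.target ∈ 𝓝 (e x) :=
    mem_interior_iff_mem_nhds.1 ((mem_interior_iff (mem_extChartAt_source x)).1 hx)
  have himg : e '' (U ∩ e.source) = e.target ∩ e.symm ⁻¹' U := by
    rw [inter_comm, e.image_source_inter_eq']
  have hnhds : e '' (U ∩ e.source) ∈ 𝓝 (e x) := by
    rw [himg]
    refine inter_mem hxi ((continuousAt_extChartAt_symm (I := 𝓡∂ n) x).tendsto ?_)
    rw [extChartAt_to_inv]
    exact hU.mem_nhds hxU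
  set V := interior (e '' (U ∩ e.source)) with hV
  have hVt : V ⊆ e.target := interior_subset.trans (himg.le.trans inter_subset_left)
  have h2 : ∫⁻ y in V, ENNReal.ofReal (w y) = 0 :=
    le_antisymm ((lintegral_mono_set interior_subset).trans h1.le) zero_le
  have hVm : MeasurableSet V := isOpen_interior.measurableSet
  have h3 : volume V = 0 := by
    by_contra hne
    rw [lintegral_eq_zero_iff' ((hw.continuousOn.mono hVt).aemeasurable hVm).ennreal_ofReal,
      EventuallyEq, ae_restrict_iff' hVm] at h2
    have h4 : volume {y | ¬(y ∈ V → ENNReal.ofReal (w y) = 0)} = 0 := ae_iff.1 h2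
    exact hne (measure_mono_null (fun y hy (h' : y ∈ V → ENNReal.ofReal (w y) = 0) =>
      (ENNReal.ofReal_pos.2 (hw0 y (hVt hy))).ne' (h' hy)) h4)
  exact (isOpen_interior.measure_pos volume ⟨e x, mem_interior_iff_mem_nhds.2 hnhds⟩).ne' h3

/-- The boundary volume is carried by the boundary. -/
lemma IsSmoothBoundaryVolume.ae_mem_boundary [BorelSpace M] [CompactSpace M] {ν : Measure M}
    (hν : IsSmoothBoundaryVolume n ν) : ∀ᵐ x ∂ν, x ∈ (𝓡∂ n).boundary M := by
  rw [ae_iff]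
  have h1 : ∀ x₀ : M, ν ((extChartAt (𝓡∂ n) x₀).source ∩ (𝓡∂ n).interior M) = 0 := by
    intro x₀
    obtain ⟨w, -, -, h⟩ := hν x₀
    rw [h _ ((isOpen_extChartAt_source x₀).inter isOpen_manifoldInterior).measurableSet inter_subset_left]
    have : extChartAt (𝓡∂ n) x₀ '' ((extChartAt (𝓡∂ n) x₀).source ∩ (𝓡∂ n).interior M) ∩
        frontier (range (𝓡∂ n)) = ∅ := by
      rw [eq_empty_iff_forall_notMem]
      rintro _ ⟨⟨x, ⟨hx, hxi⟩, rfl⟩, hf⟩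
      exact hf.2 ((mem_interior_chartTarget_iff ((extChartAt (𝓡∂ n) x₀).map_source hx)).1
        ((mem_interior_iff hx).1 hxi))
    rw [this, setLIntegral_empty]
  obtain ⟨s, -, hs⟩ := isCompact_univ.elim_nhds_subcover
    (fun x₀ : M => (extChartAt (𝓡∂ n) x₀).source) (fun x₀ _ => extChartAt_source_mem_nhds x₀)
  refine measure_mono_null (t := ⋃ x₀ ∈ s, (extChartAt (𝓡∂ n) x₀).source ∩ (𝓡∂ n).interior M)
    (fun x hx => ?_) ((measure_biUnion_null_iff s.countable_toSet).2 fun x₀ _ => h1 x₀)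
  obtain ⟨x₀, hx₀, hxs⟩ := mem_iUnion₂.1 (hs (mem_univ x))
  refine mem_iUnion₂.2 ⟨x₀, hx₀, hxs, ?_⟩
  rw [← (𝓡∂ n).compl_boundary]
  exact hx

/-- The integral in a chart. -/
lemma IsSmoothVolume.integral_eq [BorelSpace M] {μ : Measure M} {x₀ : M}
    {w : EuclideanSpace ℝ (Fin n) → ℝ} (hw : ContDiffOn ℝ ∞ w (chartTarget n x₀))
    (hw0 : ∀ y ∈ chartTarget n x₀, 0 < w y)
    (h : ∀ s : Set M, MeasurableSet s → s ⊆ (extChartAt (𝓡∂ n) x₀).source →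
      μ s = ∫⁻ y in extChartAt (𝓡∂ n) x₀ '' s, ENNReal.ofReal (w y))
    {f : M → ℝ} (hf : ContinuousOn f (extChartAt (𝓡∂ n) x₀).source)
    (hfs : Function.support f ⊆ (extChartAt (𝓡∂ n) x₀).source) :
    ∫ x, f x ∂μ = ∫ y in chartTarget n x₀, w y * f ((extChartAt (𝓡∂ n) x₀).symm y) := by
  set e := extChartAt (𝓡∂ n) x₀
  have hsm : MeasurableSet e.source := (isOpen_extChartAt_source x₀).measurableSet
  have htm : MeasurableSet (chartTarget n x₀) := measurableSet_chartTarget x₀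
  have hem : AEMeasurable e (μ.restrict e.source) :=
    (continuousOn_extChartAt x₀).aemeasurable hsm
  have hmap : (μ.restrict e.source).map e =
      (volume.restrict (chartTarget n x₀)).withDensity fun y => ENNReal.ofReal (w y) := by
    ext B hB
    have hm : NullMeasurableSet (e ⁻¹' B) (μ.restrict e.source) := hem.nullMeasurable hB
    have hm' : MeasurableSet (e.source ∩ e ⁻¹' B) := by
      have h1 := hsm.subtype_image
        ((continuousOn_iff_continuous_domRestrict.1 (continuousOn_extChartAt x₀)).measurable hB)
      convert h1 using 1
      ext x
      simp [e, and_comm]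
    rw [Measure.map_apply_of_aemeasurable hem hB, withDensity_apply _ hB,
      Measure.restrict_apply₀ hm, inter_comm, h _ hm' inter_subset_left,
      image_source_inter_preimage, Measure.restrict_restrict hB, inter_comm]
  rw [← setIntegral_eq_integral_of_forall_compl_eq_zero (s := e.source)
    (fun x hx => Function.notMem_support.1 fun h => hx (hfs h))]
  have h1 : ∫ x in e.source, f x ∂μ = ∫ x in e.source, (f ∘ e.symm) (e x) ∂μ :=
    setIntegral_congr_fun hsm fun x hx => by simp only [Function.comp, e.left_inv hx]
  have hfc : ContinuousOn (f ∘ e.symm) (chartTarget n x₀) :=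
    hf.comp (continuousOn_extChartAt_symm x₀) (fun y hy => e.map_target hy)
  have hwm : AEMeasurable (fun y => (w y).toNNReal) (volume.restrict (chartTarget n x₀)) :=
    (hw.continuousOn.aemeasurable htm).real_toNNReal
  rw [h1, ← integral_map hem (f := f ∘ e.symm), hmap]
  · show ∫ y, (f ∘ e.symm) y ∂((volume.restrict (chartTarget n x₀)).withDensity
      fun y => ((w y).toNNReal : ENNReal)) = _
    rw [integral_withDensity_eq_integral_smul₀ hwm]
    refine setIntegral_congr_fun htm fun y hy => ?_
    simp only [NNReal.smul_def, Real.coe_toNNReal _ (hw0 y hy).le, smul_eq_mul]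
    rfl
  · rw [hmap]
    exact ((hfc.aestronglyMeasurable htm).mono_ac (withDensity_absolutelyContinuous _ _))

end Measures

/-! ### The fundamental lemma of the calculus of variations -/

lemma IsSmooth.continuous {n : ℕ} [NeZero n] {M : Type*} [TopologicalSpace M]
    [ChartedSpace (EuclideanHalfSpace n) M] {f : M → ℝ} (hf : IsSmooth n f) : Continuous f :=
  ContMDiff.continuous hf

section Fundamental

variable {n : ℕ} [NeZero n] {M : Type*} [TopologicalSpace M] [T2Space M]
  [ChartedSpace (EuclideanHalfSpace n) M] [IsManifold (𝓡∂ n) ∞ M]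

lemma exists_bump {U : Set M} (hU : IsOpen U) {x : M} (hx : x ∈ U) :
    ∃ ψ : M → ℝ, IsSmooth n ψ ∧ (∀ y, 0 ≤ ψ y) ∧ (∀ᶠ y in 𝓝 x, ψ y = 1) ∧ tsupport ψ ⊆ U := by
  obtain ⟨f, -, hf⟩ := (SmoothBumpFunction.nhds_basis_tsupport (I := 𝓡∂ n) x).mem_iff.1
    (hU.mem_nhds hx)
  exact ⟨f, f.contMDiff, fun y => f.nonneg, f.eventuallyEq_one, hf⟩

variable [CompactSpace M] [MeasurableSpace M] [BorelSpace M]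

/-- A continuous function on an open set that is orthogonal to all test functions supported in the
interior part of the set vanishes, up to the boundary. -/
lemma fundamental_lemma {μ : Measure M} (hμ : IsSmoothVolume n μ) {U : Set M} (hU : IsOpen U)
    {f : M → ℝ} (hf : ContinuousOn f U)
    (h : ∀ Y : M → ℝ, IsSmooth n Y → tsupport Y ⊆ U ∩ (𝓡∂ n).interior M → ∫ x, f x * Y x ∂μ = 0) :
    ∀ x ∈ U, f x = 0 := by
  have := hμ.isFiniteMeasure
  have := hμ.isOpenPosMeasure
  -- At an interior point where `f` is positive, a bump function gives a contradiction.
  have key : ∀ g : M → ℝ, ContinuousOn g U →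
      (∀ Y : M → ℝ, IsSmooth n Y → tsupport Y ⊆ U ∩ (𝓡∂ n).interior M → ∫ x, g x * Y x ∂μ = 0) →
      ∀ x ∈ U ∩ (𝓡∂ n).interior M, ¬ 0 < g x := by
    intro g hg hgY x hx hpos
    have hV : IsOpen ((U ∩ g ⁻¹' Ioi 0) ∩ (𝓡∂ n).interior M) :=
      (hg.isOpen_inter_preimage hU isOpen_Ioi).inter isOpen_manifoldInterior
    obtain ⟨ψ, hψ, hψ0, hψ1, hψs⟩ := exists_bump (n := n) hV ⟨⟨hx.1, hpos⟩, hx.2⟩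
    have hts : tsupport (fun y => g y * ψ y) ⊆ tsupport ψ := tsupport_mul_subset_right
    have hc : Continuous (fun y => g y * ψ y) := by
      rw [continuous_iff_continuousAt]
      intro y
      by_cases hy : y ∈ tsupport ψ
      · exact (hg.continuousAt (hU.mem_nhds (hψs hy).1.1)).mul hψ.continuous.continuousAt
      · have : (fun y => g y * ψ y) =ᶠ[𝓝 y] fun _ => 0 := by
          filter_upwards [notMem_tsupport_iff_eventuallyEq.1 hy] with z hz
          rw [hz, Pi.zero_apply, mul_zero]
        exact continuousAt_const.congr this.symm
    have hne : g x * ψ x ≠ 0 := by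
      rw [hψ1.self_of_nhds, mul_one]
      exact hpos.ne'
    have hnn : ∀ y, 0 ≤ g y * ψ y := fun y => by
      by_cases hy : y ∈ tsupport ψ
      · exact mul_nonneg (le_of_lt (hψs hy).1.2) (hψ0 y)
      · rw [image_eq_zero_of_notMem_tsupport hy, mul_zero]
    exact (hc.integral_pos_of_hasCompactSupport_nonneg_nonzero (μ := μ)
      (HasCompactSupport.of_compactSpace _) hnn hne).ne'
      (hgY ψ hψ fun y hy => ⟨(hψs hy).1.1, (hψs hy).2⟩)
  have hint : ∀ x ∈ U ∩ (𝓡∂ n).interior M, f x = 0 := by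
    intro x hx
    have h1 := key f hf h x hx
    have h2 := key (fun y => - f y) hf.neg (fun Y hY hYs => by
      simp only [neg_mul, integral_neg, h Y hY hYs, neg_zero]) x hx
    linarith [neg_pos.not.1 h2]
  intro x hx
  have hcl : x ∈ closure (U ∩ (𝓡∂ n).interior M) := by
    have h1 := hU.inter_closure ⟨hx, dense_interior (n := n) x⟩
    exact h1
  have hc : ContinuousWithinAt f (U ∩ (𝓡∂ n).interior M) x := (hf x hx).mono inter_subset_left
  have := hc.mem_closure hcl (t := {0}) hint
  simpa using this

lemma exists_partition : ∃ (s : Finset M) (p : M → M → ℝ), (∀ c, IsSmooth n (p c)) ∧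
    (∀ c, tsupport (p c) ⊆ (extChartAt (𝓡∂ n) c).source) ∧ ∑ c ∈ s, p c = 1 := by
  obtain ⟨f, hf⟩ := SmoothPartitionOfUnity.exists_isSubordinate_chartAt_source (𝓡∂ n) M
  have hfin := f.locallyFinite.finite_nonempty_of_compact
  refine ⟨hfin.toFinset, fun c => f c, fun c => (f c).contMDiff, fun c => ?_, ?_⟩
  · rw [extChartAt_source]
    exact hf c
  · funext x
    rw [Finset.sum_apply, Pi.one_apply, ← f.sum_eq_one (mem_univ x), finsum_eq_sum_of_support_subset]
    intro c hc
    rw [hfin.coe_toFinset]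
    exact ⟨x, hc⟩

end Fundamental

/-! ### Integration by parts in a chart -/

section Parts

variable {n : ℕ} [NeZero n] {M : Type*} [TopologicalSpace M]
  [ChartedSpace (EuclideanHalfSpace n) M] {x₀ : M}

local notation "E" => EuclideanSpace ℝ (Fin n)

/-- The divergence theorem in a chart, for a compactly supported function which vanishes at the
boundary together with its first derivative. -/
lemma integral_fderivWithin_eq_zero {F : E → ℝ} (hF : ContDiffOn ℝ ∞ F (chartTarget n x₀))
    {K : Set E} (hK : IsCompact K) (hKO : K ⊆ chartTarget n x₀)
    (h0 : ∀ y ∈ chartTarget n x₀ \ K, F y = 0)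
    (hb : ∀ y ∈ chartTarget n x₀ ∩ frontier (range (𝓡∂ n)),
      F y = 0 ∧ fderivWithin ℝ F (chartTarget n x₀) y = 0) (v : E) :
    ∫ y in chartTarget n x₀, fderivWithin ℝ F (chartTarget n x₀) y v = 0 := by
  set O := chartTarget n x₀
  have hOm : MeasurableSet O := measurableSet_chartTarget x₀
  -- The extension by zero is differentiable, since `F` is flat at the boundary.
  have hder : ∀ y, HasFDerivAt (O.indicator F) (O.indicator (fderivWithin ℝ F O) y) y := by
    intro y
    by_cases hy : y ∈ O
    · rw [indicator_of_mem hy]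
      have hd := (hF.differentiableOn (by simp) y hy).hasFDerivWithinAt
      have h1 : HasFDerivWithinAt (O.indicator F) (fderivWithin ℝ F O y) O y :=
        hd.congr (fun z hz => indicator_of_mem hz F) (indicator_of_mem hy F)
      by_cases hi : y ∈ interior (range (𝓡∂ n))
      · exact h1.hasFDerivAt
          (mem_interior_iff_mem_nhds.1 ((mem_interior_chartTarget_iff hy).2 hi))
      · have hyf : y ∈ O ∩ frontier (range (𝓡∂ n)) :=
          ⟨hy, subset_closure (extChartAt_target_subset_range x₀ hy), hi⟩
        obtain ⟨hz, hz'⟩ := hb y hyf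
        rw [hz'] at h1 ⊢
        have h2 : HasFDerivWithinAt (O.indicator F) (0 : E →L[ℝ] ℝ) Oᶜ y := by
          refine (hasFDerivWithinAt_const (0 : ℝ) y Oᶜ).congr
            (fun z hz => indicator_of_notMem hz F) ?_
          rw [indicator_of_mem hy, hz]
        have h3 := h1.union h2
        rwa [union_compl_self, hasFDerivWithinAt_univ] at h3
    · rw [indicator_of_notMem hy]
      refine (hasFDerivAt_const (0 : ℝ) y).congr_of_eventuallyEq ?_
      filter_upwards [hK.isClosed.isOpen_compl.mem_nhds fun h => hy (hKO h)] with z hz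
      by_cases hzO : z ∈ O
      · rw [indicator_of_mem hzO, h0 z ⟨hzO, hz⟩]
      · rw [indicator_of_notMem hzO]
  have hzero : ∀ y ∉ K, O.indicator (fderivWithin ℝ F O) y = 0 := by
    intro y hy
    have : O.indicator F =ᶠ[𝓝 y] fun _ => 0 := by
      filter_upwards [hK.isClosed.isOpen_compl.mem_nhds hy] with z hz
      by_cases hzO : z ∈ O
      · rw [indicator_of_mem hzO, h0 z ⟨hzO, hz⟩]
      · rw [indicator_of_notMem hzO]
    exact (hder y).unique ((hasFDerivAt_const (0 : ℝ) y).congr_of_eventuallyEq this)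
  -- integrate by parts against a bump function which is equal to `1` near the support
  obtain ⟨r, hr⟩ := hK.isBounded.subset_ball (0 : E)
  set R := max r 1
  have hR : 0 < R := lt_of_lt_of_le one_pos (le_max_right _ _)
  set χ : ContDiffBump (0 : E) := ⟨R, R + 1, hR, by linarith⟩
  have hχ1 : ∀ y ∈ K, χ =ᶠ[𝓝 y] 1 := by
    intro y hy
    refine χ.eventuallyEq_one_of_mem_ball ?_
    exact Metric.ball_subset_ball (le_max_left _ _) (hr hy)
  have hint : Integrable (fun y => O.indicator (fderivWithin ℝ F O) y v) := by
    rw [← integrableOn_iff_integrable_of_support_subset (s := K)]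
    · refine ContinuousOn.integrableOn_compact hK ?_
      have h1 : ContinuousOn (fun y => fderivWithin ℝ F O y v) O :=
        (hF.continuousOn_fderivWithin (uniqueDiffOn_chartTarget x₀) (by simp)).clm_apply
          continuousOn_const
      exact (h1.mono hKO).congr fun y hy => by rw [indicator_of_mem (hKO hy)]
    · intro y hy
      by_contra h
      exact hy (by simp only [hzero y h]; rfl)
  have hcont : Continuous (O.indicator F) :=
    continuous_iff_continuousAt.2 fun y => (hder y).continuousAt
  have hp1 : (fun y => χ y * O.indicator (fderivWithin ℝ F O) y v)
      = fun y => O.indicator (fderivWithin ℝ F O) y v := by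
    funext y
    by_cases hy : y ∈ K
    · rw [(hχ1 y hy).self_of_nhds, Pi.one_apply, one_mul]
    · rw [hzero y hy, zero_apply, mul_zero]
  have hp2 : (fun y => fderiv ℝ χ y v * O.indicator F y) = fun _ => 0 := by
    funext y
    by_cases hy : y ∈ K
    · rw [(hχ1 y hy).fderiv_eq, show (1 : E → ℝ) = fun _ => 1 from rfl, fderiv_fun_const]
      simp
    · have : O.indicator F y = 0 := by
        by_cases hzO : y ∈ O
        · rw [indicator_of_mem hzO, h0 y ⟨hzO, hy⟩]
        · rw [indicator_of_notMem hzO]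
      rw [this, mul_zero]
  have hfd : ∀ y, fderiv ℝ (O.indicator F) y = O.indicator (fderivWithin ℝ F O) y :=
    fun y => (hder y).fderiv
  have h := integral_mul_fderiv_eq_neg_fderiv_mul_of_integrable (μ := (volume : Measure E))
    (f := χ) (g := O.indicator F) (v := v) (by rw [hp2]; exact integrable_zero _ _ _)
    (by simp only [hfd, hp1]; exact hint)
    ((χ.continuous.mul hcont).integrable_of_hasCompactSupport χ.hasCompactSupport.mul_right)
    (fun y _ => (χ.contDiff (n := 1)).differentiable one_ne_zero y)
    (fun y _ => (hder y).differentiableAt)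
  simp only [hfd, hp1, hp2, integral_zero, neg_zero] at h
  rw [← h, ← integral_indicator hOm]
  congr 1
  funext y
  by_cases hy : y ∈ O
  · rw [indicator_of_mem hy, indicator_of_mem hy]
  · rw [indicator_of_notMem hy, indicator_of_notMem hy, zero_apply]

variable {V : Type} [NormedAddCommGroup V] [NormedSpace ℝ V]
  {V' : Type} [NormedAddCommGroup V'] [NormedSpace ℝ V']
  {V'' : Type} [NormedAddCommGroup V''] [NormedSpace ℝ V'']

/-- All derivatives of a function in a chart vanish at the boundary points. -/
def ChartFlat (x₀ : M) (m : E → V) : Prop :=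
  ∀ y ∈ chartTarget n x₀ ∩ frontier (range (𝓡∂ n)), ∀ j : ℕ,
    iteratedFDerivWithin ℝ j m (chartTarget n x₀) y = 0

lemma ChartFlat.eq_zero {m : E → V} (h : ChartFlat x₀ m) {y : E}
    (hy : y ∈ chartTarget n x₀ ∩ frontier (range (𝓡∂ n))) : m y = 0 := by
  rw [← norm_eq_zero, ← norm_iteratedFDerivWithin_zero (𝕜 := ℝ) (s := chartTarget n x₀), h y hy 0,
    norm_zero]

lemma ChartFlat.fderivWithin {m : E → V} (h : ChartFlat x₀ m) :
    ChartFlat x₀ (fderivWithin ℝ m (chartTarget n x₀)) := by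
  intro y hy j
  rw [← norm_eq_zero, norm_iteratedFDerivWithin_fderivWithin (uniqueDiffOn_chartTarget x₀) hy.1,
    h y hy, norm_zero]

lemma ChartFlat.bilin {m : E → V} {m' : E → V'} (B : V →L[ℝ] V' →L[ℝ] V'')
    (hm : ContDiffOn ℝ ∞ m (chartTarget n x₀)) (hm' : ContDiffOn ℝ ∞ m' (chartTarget n x₀))
    (h : ChartFlat x₀ m ∨ ChartFlat x₀ m') : ChartFlat x₀ (fun y => B (m y) (m' y)) := by
  intro y hy j
  have := B.norm_iteratedFDerivWithin_le_of_bilinear hm hm'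
    (uniqueDiffOn_chartTarget x₀) hy.1 (n := j) (WithTop.coe_le_coe.2 le_top)
  rw [Finset.sum_eq_zero, mul_zero, norm_le_zero_iff] at this
  · exact this
  · intro i _
    rcases h with h | h
    · rw [h y hy i, norm_zero, mul_zero, zero_mul]
    · rw [h y hy (j - i), norm_zero, mul_zero]

lemma ChartFlat.map {m : E → V} (hm : ContDiffOn ℝ ∞ m (chartTarget n x₀)) (h : ChartFlat x₀ m)
    (L : V →L[ℝ] V') : ChartFlat x₀ (fun y => L (m y)) := by
  intro y hy j
  have := L.iteratedFDerivWithin_comp_left (hm y hy.1) (uniqueDiffOn_chartTarget x₀) hy.1 (i := j)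
    (WithTop.coe_le_coe.2 le_top)
  refine this.trans ?_
  rw [h y hy j]
  ext
  simp

/-- Integration by parts in a chart. -/
lemma chart_integral_by_parts {m : E → V →L[ℝ] ℝ} {Ψ : E → V}
    (hm : ContDiffOn ℝ ∞ m (chartTarget n x₀)) (hΨ : ContDiffOn ℝ ∞ Ψ (chartTarget n x₀))
    {K : Set E} (hK : IsCompact K) (hKO : K ⊆ chartTarget n x₀)
    (h0 : ∀ y ∈ chartTarget n x₀ \ K, Ψ y = 0) (hb : ChartFlat x₀ m ∨ ChartFlat x₀ Ψ) (v : E) :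
    IntegrableOn (fun y => m y (fderivWithin ℝ Ψ (chartTarget n x₀) y v)) (chartTarget n x₀) ∧
    IntegrableOn (fun y => fderivWithin ℝ m (chartTarget n x₀) y v (Ψ y)) (chartTarget n x₀) ∧
    ∫ y in chartTarget n x₀, m y (fderivWithin ℝ Ψ (chartTarget n x₀) y v)
      = - ∫ y in chartTarget n x₀, fderivWithin ℝ m (chartTarget n x₀) y v (Ψ y) := by
  set O := chartTarget n x₀
  have hOm : MeasurableSet O := measurableSet_chartTarget x₀
  have hu : UniqueDiffOn ℝ O := uniqueDiffOn_chartTarget x₀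
  have hprod : ∀ y ∈ O, fderivWithin ℝ (fun y => m y (Ψ y)) O y v =
      m y (fderivWithin ℝ Ψ O y v) + fderivWithin ℝ m O y v (Ψ y) := by
    intro y hy
    rw [fderivWithin_clm_apply (hu y hy) (hm.differentiableOn (by simp) y hy)
      (hΨ.differentiableOn (by simp) y hy)]
    simp
  have hΨ' : ∀ y ∈ O \ K, fderivWithin ℝ Ψ O y = 0 := by
    intro y hy
    have : Ψ =ᶠ[𝓝[O] y] fun _ => 0 := by
      filter_upwards [nhdsWithin_le_nhds (hK.isClosed.isOpen_compl.mem_nhds hy.2),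
        self_mem_nhdsWithin] with z hz hzO
      exact h0 z ⟨hzO, hz⟩
    rw [this.fderivWithin_eq (h0 y hy)]
    simp
  have hint : ∀ {F : E → ℝ}, ContinuousOn F O → (∀ y ∈ O \ K, F y = 0) → IntegrableOn F O := by
    intro F hF hF0
    exact ((hF.mono hKO).integrableOn_compact hK).of_forall_sdiff_eq_zero hOm hF0
  have i1 : IntegrableOn (fun y => m y (fderivWithin ℝ Ψ O y v)) O := by
    refine hint ?_ fun y hy => by simp [hΨ' y hy]
    exact hm.continuousOn.clm_apply ((hΨ.continuousOn_fderivWithin hu (by simp)).clm_apply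
      continuousOn_const)
  have i2 : IntegrableOn (fun y => fderivWithin ℝ m O y v (Ψ y)) O := by
    refine hint ?_ fun y hy => by simp [h0 y hy]
    exact ((hm.continuousOn_fderivWithin hu (by simp)).clm_apply
      continuousOn_const).clm_apply hΨ.continuousOn
  refine ⟨i1, i2, ?_⟩
  have hF : ContDiffOn ℝ ∞ (fun y => m y (Ψ y)) O := hm.clm_apply hΨ
  have hflat : ChartFlat x₀ (fun y => m y (Ψ y)) :=
    ChartFlat.bilin (ContinuousLinearMap.id ℝ (V →L[ℝ] ℝ)) hm hΨ hb
  have h := integral_fderivWithin_eq_zero hF hK hKO (fun y hy => by simp [h0 y hy])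
    (fun y hy => ⟨hflat.eq_zero hy, hflat.fderivWithin.eq_zero hy⟩) v
  rw [setIntegral_congr_fun hOm hprod, integral_add i1 i2] at h
  linarith

end Parts

/-! ### Adjoints of differential operators in a chart -/

/-- Multilinear forms of degree `j`: the values of the derivatives of order `j`. -/
abbrev Form (n j : ℕ) : Type :=
  ContinuousMultilinearMap ℝ (fun _ : Fin j => EuclideanSpace ℝ (Fin n)) ℝ

section Adjoint

variable {n : ℕ} [NeZero n] {M : Type*} [TopologicalSpace M]
  [ChartedSpace (EuclideanHalfSpace n) M] {x₀ : M}

local notation "E" => EuclideanSpace ℝ (Fin n)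

/-- The form `dy^a ⊗ m`. -/
def prependCoord (a : Fin n) (j : ℕ) : Form n j →L[ℝ] Form n (j + 1) :=
  ((continuousMultilinearCurryLeftEquiv ℝ (fun _ : Fin (j + 1) => E) ℝ).symm :
    (E →L[ℝ] Form n j) →L[ℝ] Form n (j + 1)).comp
      (ContinuousLinearMap.smulRightL ℝ E (Form n j) (EuclideanSpace.proj a))

lemma sum_prependCoord {j : ℕ} (T : E →L[ℝ] Form n j) :
    (continuousMultilinearCurryLeftEquiv ℝ (fun _ : Fin (j + 1) => E) ℝ).symm T =
      ∑ a, prependCoord a j (T (EuclideanSpace.single a 1)) := by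
  have h : T = ∑ a, (ContinuousLinearMap.smulRightL ℝ E (Form n j) (EuclideanSpace.proj a))
      (T (EuclideanSpace.single a 1)) := by
    ext v : 1
    have hv : v = ∑ a, v a • EuclideanSpace.single a (1 : ℝ) := by
      conv_lhs => rw [← (EuclideanSpace.basisFun (Fin n) ℝ).sum_repr v]
      simp
    conv_lhs => rw [hv, map_sum]
    simp
  conv_lhs => rw [h]
  exact map_sum (continuousMultilinearCurryLeftEquiv ℝ
    (fun _ : Fin (j + 1) => E) ℝ).symm.toLinearEquiv _ _

variable (n) in
/-- Minus the divergence in the first index of the dual forms. -/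
def chartDivergence (j : ℕ) : (E →L[ℝ] (Form n (j + 1) →L[ℝ] ℝ)) →L[ℝ] (Form n j →L[ℝ] ℝ) :=
  -∑ a, (ContinuousLinearMap.precomp ℝ (prependCoord a j)).comp
    (ContinuousLinearMap.apply ℝ (Form n (j + 1) →L[ℝ] ℝ) (EuclideanSpace.single a (1 : ℝ)))

lemma chartDivergence_apply {j : ℕ} (T : E →L[ℝ] (Form n (j + 1) →L[ℝ] ℝ)) (φ : Form n j) :
    chartDivergence n j T φ = -∑ a, T (EuclideanSpace.single a 1) (prependCoord a j φ) := by
  simp [chartDivergence, sum_apply]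

/-- The formal adjoint of the differential operator `Y ↦ m (D^j Y)` in a chart. -/
def chartAdjoint (x₀ : M) : ∀ j : ℕ, (E → Form n j →L[ℝ] ℝ) → E → ℝ
  | 0, m => fun y => m y ((continuousMultilinearCurryFin0 ℝ E ℝ).symm 1)
  | j + 1, m => chartAdjoint x₀ j fun y =>
      chartDivergence n j (fderivWithin ℝ m (chartTarget n x₀) y)

lemma contDiffOn_chartDivergence {j : ℕ} {m : E → Form n (j + 1) →L[ℝ] ℝ}
    (hm : ContDiffOn ℝ ∞ m (chartTarget n x₀)) :
    ContDiffOn ℝ ∞ (fun y => chartDivergence n j (fderivWithin ℝ m (chartTarget n x₀) y))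
      (chartTarget n x₀) :=
  (chartDivergence n j).contDiff.comp_contDiffOn
    (hm.fderivWithin (uniqueDiffOn_chartTarget x₀) (m := ∞) (by simp))

lemma contDiffOn_chartAdjoint {j : ℕ} {m : E → Form n j →L[ℝ] ℝ}
    (hm : ContDiffOn ℝ ∞ m (chartTarget n x₀)) :
    ContDiffOn ℝ ∞ (chartAdjoint x₀ j m) (chartTarget n x₀) := by
  induction j with
  | zero => exact hm.clm_apply contDiffOn_const
  | succ j ih => exact ih (contDiffOn_chartDivergence hm)

lemma ChartFlat.congr {V : Type} [NormedAddCommGroup V] [NormedSpace ℝ V] {m m' : E → V}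
    (h : ChartFlat x₀ m) (hc : ∀ y ∈ chartTarget n x₀, m' y = m y) : ChartFlat x₀ m' :=
  fun y hy j => (iteratedFDerivWithin_congr hc hy.1 j).trans (h y hy j)

variable [IsManifold (𝓡∂ n) ∞ M]

lemma LocAt.chartAdjoint {ι : Type*} {k : ℕ} {S : Finset ι} {j : ℕ}
    {m : ℝ → (ι → M → ℝ) → E → Form n j →L[ℝ] ℝ} (hm : LocAt n x₀ k S m) :
    LocAt n x₀ (k + j) S (fun t Φ => GaugeField.chartAdjoint x₀ j (m t Φ)) := by
  induction j generalizing k with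
  | zero => exact hm.map (ContinuousLinearMap.apply ℝ ℝ _).contDiff
  | succ j ih =>
    have := ih (hm.fderivWithin.map (chartDivergence n j).contDiff)
    rwa [add_assoc, add_comm 1 j] at this

lemma LocAt.contDiffOn {ι W : Type*} [NormedAddCommGroup W]
    [NormedSpace ℝ W] {k : ℕ} {S : Finset ι} {m : ℝ → (ι → M → ℝ) → E → W}
    (hm : LocAt n x₀ k S m) (t : ℝ) {Φ : ι → M → ℝ} (hΦ : ∀ i, IsSmooth n (Φ i)) :
    ContDiffOn ℝ ∞ (m t Φ) (chartTarget n x₀) := by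
  obtain ⟨F, hF, h⟩ := hm
  refine ContDiffOn.congr ?_ (h t Φ hΦ)
  refine hF.comp (f := fun y => (t, y, fun i : S => jet n k (Φ i) x₀ y)) ?_
    (fun y hy => ⟨mem_univ _, hy, mem_univ _⟩)
  refine contDiffOn_const.prodMk (contDiffOn_id.prodMk ?_)
  exact contDiffOn_pi.2 fun i => contDiffOn_pi.2 fun j => (hΦ i).contDiffOn_chartDeriv j x₀

lemma mem_boundary_iff {y : E} (hy : y ∈ chartTarget n x₀) :
    (extChartAt (𝓡∂ n) x₀).symm y ∈ (𝓡∂ n).boundary M ↔ y ∈ frontier (range (𝓡∂ n)) := by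
  rw [← (𝓡∂ n).compl_interior, mem_compl_iff,
    mem_interior_iff ((extChartAt (𝓡∂ n) x₀).map_target hy), (extChartAt (𝓡∂ n) x₀).right_inv hy,
    mem_interior_chartTarget_iff hy]
  exact ⟨fun h => ⟨subset_closure (extChartAt_target_subset_range x₀ hy), h⟩, fun h => h.2⟩

/-- The chart representation of the derivatives of a flat function is flat. -/
lemma FlatOnBoundary.chartFlat {f : M → ℝ} (hf : IsSmooth n f) (h : FlatOnBoundary n f) :
    ChartFlat x₀ (f ∘ (extChartAt (𝓡∂ n) x₀).symm) := by
  intro y hy j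
  have := FlatAt.chartDeriv_eq_zero hf (h _ ((mem_boundary_iff hy.1).2 hy.2))
    ((extChartAt (𝓡∂ n) x₀).map_target hy.1) j
  rwa [(extChartAt (𝓡∂ n) x₀).right_inv hy.1, chartDeriv_eq j _ _ hy.1] at this

lemma FlatOnBoundary.chartFlat_chartDeriv {f : M → ℝ} (hf : IsSmooth n f)
    (h : FlatOnBoundary n f) (j : ℕ) : ChartFlat x₀ (chartDeriv n j f x₀) := by
  induction j with
  | zero =>
    exact (h.chartFlat hf).map (hf.contDiffOn_chart x₀)
      ((continuousMultilinearCurryFin0 ℝ E ℝ).symm : ℝ →L[ℝ] Form n 0)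
  | succ j ih =>
    have h1 : ContDiffOn ℝ ∞ (fderivWithin ℝ (chartDeriv n j f x₀) (chartTarget n x₀))
        (chartTarget n x₀) := (hf.contDiffOn_chartDeriv j x₀).fderivWithin
          (uniqueDiffOn_chartTarget x₀) (m := ∞) (by simp)
    have h2 := ih.fderivWithin.map h1
      ((continuousMultilinearCurryLeftEquiv ℝ (fun _ : Fin (j + 1) => E) ℝ).symm :
        (E →L[ℝ] Form n j) →L[ℝ] Form n (j + 1))
    exact h2.congr fun y hy => chartDeriv_succ j f x₀ hy

lemma FlatOnBoundary.mul_left {f : M → ℝ} (p : M → ℝ) (hp : IsSmooth n p) (hf : IsSmooth n f)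
    (h : FlatOnBoundary n f) : FlatOnBoundary n (p * f) := by
  intro x hx j
  rw [chartDeriv_eq j _ _ (mem_extChartAt_target x)]
  refine ChartFlat.bilin (x₀ := x) (ContinuousLinearMap.mul ℝ ℝ) (hp.contDiffOn_chart x)
    (hf.contDiffOn_chart x) (Or.inr (h.chartFlat hf)) _ ⟨mem_extChartAt_target x, ?_⟩ j
  rw [← mem_boundary_iff (mem_extChartAt_target x), extChartAt_to_inv]
  exact hx

/-- The derivatives of a function supported in a chart vanish off the image of its support. -/
lemma chartDeriv_eq_zero_of_notMem {f : M → ℝ} {y : E}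
    (hy : y ∈ chartTarget n x₀ \ extChartAt (𝓡∂ n) x₀ '' tsupport f) (j : ℕ) :
    chartDeriv n j f x₀ y = 0 := by
  have h : (extChartAt (𝓡∂ n) x₀).symm y ∉ tsupport f := fun h =>
    hy.2 ⟨_, h, (extChartAt (𝓡∂ n) x₀).right_inv hy.1⟩
  rw [chartDeriv_congr hy.1 (notMem_tsupport_iff_eventuallyEq.1 h) j, chartDeriv_eq j _ _ hy.1]
  exact congrFun iteratedFDerivWithin_zero _

lemma isCompact_image_tsupport [CompactSpace M] {f : M → ℝ}
    (hf : tsupport f ⊆ (extChartAt (𝓡∂ n) x₀).source) :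
    IsCompact (extChartAt (𝓡∂ n) x₀ '' tsupport f) ∧
      extChartAt (𝓡∂ n) x₀ '' tsupport f ⊆ chartTarget n x₀ :=
  ⟨(isClosed_tsupport f).isCompact.image_of_continuousOn ((continuousOn_extChartAt x₀).mono hf),
    by rintro _ ⟨x, hx, rfl⟩; exact (extChartAt (𝓡∂ n) x₀).map_source (hf hx)⟩

lemma integrableOn_chart_of_tsupport [CompactSpace M] {f : M → ℝ}
    (hf : tsupport f ⊆ (extChartAt (𝓡∂ n) x₀).source) {F : E → ℝ}
    (hF : ContinuousOn F (chartTarget n x₀))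
    (h0 : ∀ y ∈ chartTarget n x₀ \ extChartAt (𝓡∂ n) x₀ '' tsupport f, F y = 0) :
    IntegrableOn F (chartTarget n x₀) :=
  ((hF.mono (isCompact_image_tsupport hf).2).integrableOn_compact
    (isCompact_image_tsupport hf).1).of_forall_sdiff_eq_zero (measurableSet_chartTarget x₀) h0

/-- Repeated integration by parts. -/
lemma integral_chartDeriv_eq_chartAdjoint [CompactSpace M] {j : ℕ} {m : E → Form n j →L[ℝ] ℝ}
    (hm : ContDiffOn ℝ ∞ m (chartTarget n x₀)) {Y : M → ℝ} (hY : IsSmooth n Y)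
    (hYs : tsupport Y ⊆ (extChartAt (𝓡∂ n) x₀).source)
    (hflat : ChartFlat x₀ m ∨ FlatOnBoundary n Y) :
    ∫ y in chartTarget n x₀, m y (chartDeriv n j Y x₀ y) =
      ∫ y in chartTarget n x₀, chartAdjoint x₀ j m y * Y ((extChartAt (𝓡∂ n) x₀).symm y) := by
  induction j with
  | zero =>
    refine setIntegral_congr_fun (measurableSet_chartTarget x₀) fun y _ => ?_
    have : (continuousMultilinearCurryFin0 ℝ E ℝ).symm (Y ((extChartAt (𝓡∂ n) x₀).symm y)) =
        Y ((extChartAt (𝓡∂ n) x₀).symm y) • (continuousMultilinearCurryFin0 ℝ E ℝ).symm 1 := by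
      rw [← LinearIsometryEquiv.map_smul, smul_eq_mul, mul_one]
    simp only [chartDeriv_zero, chartAdjoint]
    rw [this, map_smul, smul_eq_mul, mul_comm]
  | succ j ih =>
    set O := chartTarget n x₀
    have hOm : MeasurableSet O := measurableSet_chartTarget x₀
    obtain ⟨hK, hKO⟩ := isCompact_image_tsupport hYs
    have hma : ∀ a, ContDiffOn ℝ ∞ (fun z => (m z).comp (prependCoord a j)) O := fun a =>
      hm.clm_comp contDiffOn_const
    have hparts := fun a => chart_integral_by_parts (hma a)
      (hY.contDiffOn_chartDeriv j x₀) hK hKO (fun y hy => chartDeriv_eq_zero_of_notMem hy j)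
      (hflat.imp (fun h => (h.map hm (V' := Form n j →L[ℝ] ℝ)
        (ContinuousLinearMap.precomp ℝ (prependCoord a j))).congr fun _ _ => rfl)
        fun h => h.chartFlat_chartDeriv hY j) (EuclideanSpace.single a 1)
    have hder : ∀ a, ∀ y ∈ O, fderivWithin ℝ (fun z => (m z).comp (prependCoord a j)) O y
        (EuclideanSpace.single a 1) =
          (fderivWithin ℝ m O y (EuclideanSpace.single a 1)).comp (prependCoord a j) := by
      intro a y hy
      have h1 := ((ContinuousLinearMap.precomp ℝ (prependCoord a j)).hasFDerivAt
        (x := m y)).comp_hasFDerivWithinAt y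
        (hm.differentiableOn (by simp) y hy).hasFDerivWithinAt
      have h2 := h1.fderivWithin (uniqueDiffOn_chartTarget x₀ y hy)
      exact congrArg (fun L => L (EuclideanSpace.single a 1)) h2
    have e1 : ∫ y in O, m y (chartDeriv n (j + 1) Y x₀ y) = ∑ a, ∫ y in O,
        ((m y).comp (prependCoord a j)) (fderivWithin ℝ (chartDeriv n j Y x₀) O y
          (EuclideanSpace.single a 1)) := by
      rw [← integral_finsetSum _ fun a _ => (hparts a).1]
      refine setIntegral_congr_fun hOm fun y hy => ?_
      rw [chartDeriv_succ j Y x₀ hy, sum_prependCoord, map_sum]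
      rfl
    have e2 : ∫ y in O, chartDivergence n j (fderivWithin ℝ m O y) (chartDeriv n j Y x₀ y) =
        -∑ a, ∫ y in O, fderivWithin ℝ (fun z => (m z).comp (prependCoord a j)) O y
          (EuclideanSpace.single a 1) (chartDeriv n j Y x₀ y) := by
      rw [← integral_finsetSum _ fun a _ => (hparts a).2.1, ← integral_neg]
      refine setIntegral_congr_fun hOm fun y hy => ?_
      simp only [chartDivergence_apply]
      congr 1
      refine Finset.sum_congr rfl fun a _ => ?_
      rw [hder a y hy]
      rfl
    rw [e1, Finset.sum_congr rfl fun a _ => (hparts a).2.2, Finset.sum_neg_distrib, ← e2]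
    exact ih (contDiffOn_chartDivergence hm) (hflat.imp_left fun h =>
      h.fderivWithin.map (hm.fderivWithin (uniqueDiffOn_chartTarget x₀) (m := ∞) (by simp)) _)

end Adjoint

/-! ### Euler–Lagrange operators -/

section EulerLagrange

variable {n : ℕ} [NeZero n] {M : Type*} [TopologicalSpace M]
  [ChartedSpace (EuclideanHalfSpace n) M] [IsManifold (𝓡∂ n) ∞ M] {ι : Type*}

local notation "E" => EuclideanSpace ℝ (Fin n)

lemma IsLocal.smoothFun {f : ℝ → (ι → M → ℝ) → M → ℝ} (hf : IsLocal n f) (t : ℝ) (x : M) :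
    (fieldPlots n M ι).SmoothFun (fun Φ => f t Φ x) := fun P _ _ _ _ hc =>
  (hf.jointSmooth (P := P) (τ := fun _ => t) contDiff_const hc).contDiff x

lemma fieldPlots_pt {Φ : ι → M → ℝ} (hΦ : ∀ i, IsSmooth n (Φ i)) : (fieldPlots n M ι).Pt Φ :=
  fun i => (hΦ i).jointSmooth ℝ

lemma IsLocal.dder_add {f : ℝ → (ι → M → ℝ) → M → ℝ} (hf : IsLocal n f) (t : ℝ)
    {Φ Y Z : ι → M → ℝ} (hΦ : ∀ i, IsSmooth n (Φ i)) (hY : ∀ i, IsSmooth n (Y i))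
    (hZ : ∀ i, IsSmooth n (Z i)) :
    GaugeField.dder (f t) Φ (Y + Z) = GaugeField.dder (f t) Φ Y + GaugeField.dder (f t) Φ Z :=
  funext fun x => (hf.smoothFun t x).hd_add (fieldPlots_pt hΦ) (fieldPlots_pt hY)
    (fieldPlots_pt hZ)

lemma IsLocal.dder_sub {f : ℝ → (ι → M → ℝ) → M → ℝ} (hf : IsLocal n f) (t : ℝ)
    {Φ Y Z : ι → M → ℝ} (hΦ : ∀ i, IsSmooth n (Φ i)) (hY : ∀ i, IsSmooth n (Y i))
    (hZ : ∀ i, IsSmooth n (Z i)) :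
    GaugeField.dder (f t) Φ (Y - Z) = GaugeField.dder (f t) Φ Y - GaugeField.dder (f t) Φ Z :=
  funext fun x => (hf.smoothFun t x).hd_sub (fieldPlots_pt hΦ) (fieldPlots_pt hY)
    (fieldPlots_pt hZ)

lemma IsLocal.dder_sum {f : ℝ → (ι → M → ℝ) → M → ℝ} (hf : IsLocal n f) (t : ℝ)
    {Φ : ι → M → ℝ} (hΦ : ∀ i, IsSmooth n (Φ i)) {β : Type*} (s : Finset β)
    {Y : β → ι → M → ℝ} (hY : ∀ b i, IsSmooth n (Y b i)) :
    GaugeField.dder (f t) Φ (∑ b ∈ s, Y b) = ∑ b ∈ s, GaugeField.dder (f t) Φ (Y b) := by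
  classical
  induction s using Finset.induction_on with
  | empty => exact dder_zero_right _ _
  | insert b s hb ih =>
    rw [Finset.sum_insert hb, Finset.sum_insert hb, hf.dder_add t hΦ (hY b), ih]
    intro i
    rw [Finset.sum_apply]
    exact isSmooth_sum fun c _ => hY c i

lemma IsLocal.isSmooth_dder {f : ℝ → (ι → M → ℝ) → M → ℝ} (hf : IsLocal n f) (t : ℝ)
    {Φ Y : ι → M → ℝ} (hΦ : ∀ i, IsSmooth n (Φ i)) (hY : ∀ i, IsSmooth n (Y i)) :
    IsSmooth n (GaugeField.dder (f t) Φ Y) :=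
  hf.dder.isSmooth t (Φ := Sum.elim Φ Y) (by rintro (i | i); exacts [hΦ i, hY i])

lemma IsLocal.dder_eq_zero_of_notMem {f : ℝ → (ι → M → ℝ) → M → ℝ} (hf : IsLocal n f) (t : ℝ)
    {Φ Y : ι → M → ℝ} (hΦ : ∀ i, IsSmooth n (Φ i)) (hY : ∀ i, IsSmooth n (Y i)) {x : M}
    (hx : ∀ i, x ∉ tsupport (Y i)) : GaugeField.dder (f t) Φ Y x = 0 := by
  have h0 : ∀ i : ι, IsSmooth n (0 : M → ℝ) := fun _ => isSmooth_const 0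
  have := hf.dder.congr_germ_all t (Φ := Sum.elim Φ Y) (Φ' := Sum.elim Φ 0) (x := x)
    (by rintro (i | i); exacts [hΦ i, hY i]) (by rintro (i | i); exacts [hΦ i, h0 i])
    (by
      rintro (i | i)
      · exact EventuallyEq.rfl
      · exact notMem_tsupport_iff_eventuallyEq.1 (hx i))
  refine this.trans ?_
  exact congrFun (dder_zero_right (f t) Φ) x

/-- The jet of the field `i` whose only non-zero component is the derivative of order `j`. -/
def jetSingle (n : ℕ) {k : ℕ} {S : Finset ι} (i : S) (j : Fin (k + 1)) :
    Form n j →L[ℝ] ℝ × EuclideanSpace ℝ (Fin n) × (S → Jet n k) := by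
  classical
  exact (ContinuousLinearMap.inr ℝ ℝ (EuclideanSpace ℝ (Fin n) × (S → Jet n k))).comp
    ((ContinuousLinearMap.inr ℝ (EuclideanSpace ℝ (Fin n)) (S → Jet n k)).comp
      ((ContinuousLinearMap.single ℝ (fun _ : S => Jet n k) i).comp
        (ContinuousLinearMap.single ℝ (fun j : Fin (k + 1) => Form n j) j)))

lemma sum_jetSingle {k : ℕ} {S : Finset ι} (J : S → Jet n k) :
    ((0 : ℝ), (0 : E), J) = ∑ i, ∑ j, jetSingle n i j (J i j) := by
  classical
  have h1 : ∀ i, J i = ∑ j, Pi.single j (J i j) := fun i => (Finset.univ_sum_single (J i)).symm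
  have h2 : J = ∑ i, Pi.single i (J i) := (Finset.univ_sum_single J).symm
  have h3 : ∀ i, Pi.single (M := fun _ : S => Jet n k) i (J i)
      = ∑ j, Pi.single (M := fun _ : S => Jet n k) i (Pi.single j (J i j)) := by
    intro i
    conv_lhs => rw [h1 i]
    exact map_sum (AddMonoidHom.single (fun _ : S => Jet n k) i) _ _
  have h4 : J = ∑ i, ∑ j, Pi.single (M := fun _ : S => Jet n k) i (Pi.single j (J i j)) := by
    conv_lhs => rw [h2]
    exact Finset.sum_congr rfl fun i _ => h3 i
  refine Prod.ext ?_ (Prod.ext ?_ ?_)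
  · simp [jetSingle, Prod.fst_sum]
  · simp [jetSingle, Prod.fst_sum, Prod.snd_sum]
  · simp only [Prod.snd_sum]
    exact h4

variable [CompactSpace M] [MeasurableSpace M] [BorelSpace M] {μ : Measure M}

/-- The Euler–Lagrange operator of a local function, smeared with `η`, in a chart. The coefficients
of the variation are of order `k` in the fields, and their adjoint has up to `k` derivatives more.
-/
lemma exists_chart_eulerLagrange (hμ : IsSmoothVolume n μ) {g : ℝ → (ι → M → ℝ) → M → ℝ}
    (hg : IsLocal n g) {x₀ : M} {k : ℕ} {S : Finset ι}
    (hgS : LocAt n x₀ k S (fun t Φ y => g t Φ ((extChartAt (𝓡∂ n) x₀).symm y))) :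
    ∃ EL : S → ℝ → (ι ⊕ Unit → M → ℝ) → E → ℝ,
      (∀ i, LocAt n x₀ (k + k) (S.disjSum Finset.univ) (EL i)) ∧
      ∀ (t : ℝ) (Φ Y : ι → M → ℝ) (η : M → ℝ), (∀ i, IsSmooth n (Φ i)) →
        (∀ i, IsSmooth n (Y i)) → IsSmooth n η →
        (FlatOnBoundary n η ∨ ∀ i, FlatOnBoundary n (Y i)) →
        (∀ i, tsupport (Y i) ⊆ (extChartAt (𝓡∂ n) x₀).source) →
        ∫ x, η x * dder (g t) Φ Y x ∂μ = ∫ x, ∑ i : S,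
          EL i t (Sum.elim Φ fun _ => η) (extChartAt (𝓡∂ n) x₀ x) * Y i x ∂μ := by
  obtain ⟨w, hw, hw0, hwμ⟩ := hμ x₀
  obtain ⟨F, hF, hgF⟩ := hgS
  set O := chartTarget n x₀
  set e := extChartAt (𝓡∂ n) x₀ with he
  have hOm : MeasurableSet O := measurableSet_chartTarget x₀
  set D := jetDomain n x₀ (S → Jet n k) with hD
  set Sη : Finset (ι ⊕ Unit) := S.disjSum Finset.univ
  -- The coefficients of the smeared variation of `g`.
  set m : ∀ (i : S) (j : Fin (k + 1)), ℝ → (ι ⊕ Unit → M → ℝ) → E → (Form n j →L[ℝ] ℝ) :=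
    fun i j t Ψ y => (w y * Ψ (Sum.inr ()) (e.symm y)) • (fderivWithin ℝ F D
      (t, y, fun i : S => jet n k (Ψ (Sum.inl i)) x₀ y)).comp (jetSingle n i j) with hm
  have hmloc : ∀ i j, LocAt n x₀ k Sη (m i j) := by
    intro i j
    have h1 : LocAt n x₀ k Sη (fun (t : ℝ) (Ψ : ι ⊕ Unit → M → ℝ) y =>
        fun i : S => jet n k (Ψ (Sum.inl i)) x₀ y) := by
      refine LocAt.pi fun i => LocAt.pi fun j => ?_
      exact locAt_chartDeriv (Finset.inl_mem_disjSum.2 i.2) (Nat.lt_succ_iff.1 j.2)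
    have h2 : LocAt n x₀ k Sη (fun (t : ℝ) (Ψ : ι ⊕ Unit → M → ℝ) y =>
        Ψ (Sum.inr ()) (e.symm y)) := by
      have := (locAt_chartDeriv (n := n) (x₀ := x₀) (k := k) (S := Sη) (i := Sum.inr ()) (j := 0)
        (Finset.inr_mem_disjSum.2 (Finset.mem_univ _)) (Nat.zero_le k)).map
        (LinearIsometryEquiv.contDiff (continuousMultilinearCurryFin0 ℝ E ℝ))
      exact this
    have h3 : ContDiffOn ℝ ∞ (fun q : ℝ × E × ((S → Jet n k) × ℝ) =>
        (w q.2.1 * q.2.2.2) • (fderivWithin ℝ F D (q.1, q.2.1, q.2.2.1)).comp (jetSingle n i j))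
        (jetDomain n x₀ _) := by
      have h4 : ContDiff ℝ ∞ (fun q : ℝ × E × ((S → Jet n k) × ℝ) => q.2.2.2) := by fun_prop
      refine ContDiffOn.smul (ContDiffOn.mul ?_ h4.contDiffOn) (ContDiffOn.clm_comp ?_
        contDiffOn_const)
      · exact hw.comp (f := fun q : ℝ × E × ((S → Jet n k) × ℝ) => q.2.1) (by fun_prop)
          (fun q hq => hq.2.1)
      · exact (hF.fderivWithin (uniqueDiffOn_jetDomain x₀ _) (m := ∞) (by simp)).comp
          (f := fun q : ℝ × E × ((S → Jet n k) × ℝ) => (q.1, q.2.1, q.2.2.1)) (by fun_prop)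
          (fun q hq => ⟨hq.1, hq.2.1, mem_univ _⟩)
    exact (h1.prodMk h2).comp h3
  refine ⟨fun i t Ψ y => (w y)⁻¹ * ∑ j : Fin (k + 1), chartAdjoint x₀ j (m i j t Ψ) y,
    fun i => ?_, ?_⟩
  · have h1 : LocAt n x₀ (k + k) Sη (fun t Ψ y => fun j : Fin (k + 1) =>
        chartAdjoint x₀ j (m i j t Ψ) y) := LocAt.pi fun j => (hmloc i j).chartAdjoint.mono
          (by have := j.2; omega) (Finset.Subset.refl _)
    have h3 : ContDiffOn ℝ ∞ (fun q : ℝ × E × (Fin (k + 1) → ℝ) =>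
        (w q.2.1)⁻¹ * ∑ j, q.2.2 j) (jetDomain n x₀ _) := by
      refine ContDiffOn.mul ?_ (by fun_prop)
      exact (hw.inv fun y hy => (hw0 y hy).ne').comp
        (f := fun q : ℝ × E × (Fin (k + 1) → ℝ) => q.2.1) (by fun_prop) (fun q hq => hq.2.1)
    exact h1.comp h3
  · intro t Φ Y η hΦ hY hη hflat hYs
    set Ψ : ι ⊕ Unit → M → ℝ := Sum.elim Φ fun _ => η with hΨdef
    have hΨ : ∀ i, IsSmooth n (Ψ i) := by
      rintro (i | i)
      exacts [hΦ i, hη]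
    have hmd : ∀ i j, ContDiffOn ℝ ∞ (m i j t Ψ) O := fun i j => (hmloc i j).contDiffOn t hΨ
    have hsm : IsSmooth n (η * dder (g t) Φ Y) := hη.mul (hg.isSmooth_dder t hΦ hY)
    have hterm : ∀ i j, ∫ y in O, m i j t Ψ y (chartDeriv n j (Y i) x₀ y) =
        ∫ y in O, chartAdjoint x₀ j (m i j t Ψ) y * Y i (e.symm y) := by
      intro i j
      refine integral_chartDeriv_eq_chartAdjoint (hmd i j) (hY i) (hYs i)
        (hflat.imp (fun h => ?_) fun h => h i)
      have h1 : ContDiffOn ℝ ∞ (fun y => (w y) • (fderivWithin ℝ F D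
          (t, y, fun i : S => jet n k (Φ i) x₀ y)).comp (jetSingle n i j)) O := by
        have h2 : LocAt n x₀ k S (fun (t : ℝ) (Φ : ι → M → ℝ) y =>
            fun i : S => jet n k (Φ i) x₀ y) :=
          LocAt.pi fun i => LocAt.pi fun j => locAt_chartDeriv i.2 (Nat.lt_succ_iff.1 j.2)
        have h3 : LocAt n x₀ k S (fun (t : ℝ) (Φ : ι → M → ℝ) y =>
            fderivWithin ℝ F D (t, y, fun i : S => jet n k (Φ i) x₀ y)) :=
          h2.comp (hF.fderivWithin (uniqueDiffOn_jetDomain x₀ _) (m := ∞) (by simp))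
        exact hw.smul ((h3.contDiffOn t hΦ).clm_comp contDiffOn_const)
      refine (ChartFlat.bilin (ContinuousLinearMap.lsmul ℝ ℝ) (hη.contDiffOn_chart x₀) h1
        (Or.inl (h.chartFlat hη))).congr fun y _ => ?_
      simp only [hm, ContinuousLinearMap.lsmul_apply, smul_smul]
      rw [mul_comm]
      rfl
    have hF1 : ∀ i j, IntegrableOn (fun y => m i j t Ψ y (chartDeriv n j (Y i) x₀ y)) O := by
      intro i j
      refine integrableOn_chart_of_tsupport (hYs i) ((hmd i j).continuousOn.clm_apply
        ((hY i).contDiffOn_chartDeriv j x₀).continuousOn) fun y hy => ?_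
      rw [chartDeriv_eq_zero_of_notMem hy, map_zero]
    have hF2 : ∀ (i : S) (j : Fin (k + 1)), IntegrableOn
        (fun y => chartAdjoint x₀ j (m i j t Ψ) y * Y i (e.symm y)) O := by
      intro i j
      refine integrableOn_chart_of_tsupport (hYs i)
        ((contDiffOn_chartAdjoint (hmd i j)).continuousOn.mul
          ((hY i).contDiffOn_chart x₀).continuousOn) fun y hy => ?_
      have : Y i (e.symm y) = 0 := image_eq_zero_of_notMem_tsupport fun h =>
        hy.2 ⟨_, h, e.right_inv hy.1⟩
      rw [this, mul_zero]
    have hsupp : Function.support (fun x => η x * dder (g t) Φ Y x) ⊆ e.source := by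
      intro x hx
      by_contra h
      exact hx (by simp only [hg.dder_eq_zero_of_notMem t hΦ hY fun i hi => h (hYs i hi), mul_zero])
    have hELc : ∀ i : S, ContinuousOn
        (fun y => (w y)⁻¹ * ∑ j : Fin (k + 1), chartAdjoint x₀ j (m i j t Ψ) y) O := fun i =>
      ((hw.inv fun y hy => (hw0 y hy).ne').mul (ContDiffOn.sum fun j _ =>
        contDiffOn_chartAdjoint (hmd i j))).continuousOn
    rw [IsSmoothVolume.integral_eq hw hw0 hwμ (f := fun x => η x * dder (g t) Φ Y x)
      hsm.continuous.continuousOn hsupp,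
      IsSmoothVolume.integral_eq hw hw0 hwμ]
    · have e1 : ∫ y in O, w y * (η (e.symm y) * dder (g t) Φ Y (e.symm y)) =
          ∫ y in O, ∑ i, ∑ j, m i j t Ψ y (chartDeriv n j (Y i) x₀ y) := by
        refine setIntegral_congr_fun hOm fun y hy => ?_
        rw [dder_eq_fderivWithin hF hgF t hΦ hY hy, sum_jetSingle]
        simp only [map_sum, Finset.mul_sum]
        refine Finset.sum_congr rfl fun i _ => Finset.sum_congr rfl fun j _ => ?_
        simp only [hm, smul_apply, smul_eq_mul, mul_assoc]
        rfl
      have e2 : ∫ y in O, w y * ∑ i : S, ((w (e (e.symm y)))⁻¹ * ∑ j : Fin (k + 1),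
            chartAdjoint x₀ j (m i j t Ψ) (e (e.symm y))) * Y i (e.symm y) =
          ∫ y in O, ∑ i : S, ∑ j : Fin (k + 1),
            chartAdjoint x₀ j (m i j t Ψ) y * Y i (e.symm y) := by
        refine setIntegral_congr_fun hOm fun y hy => ?_
        rw [e.right_inv hy, Finset.mul_sum]
        refine Finset.sum_congr rfl fun i _ => ?_
        rw [← mul_assoc, ← mul_assoc, mul_inv_cancel₀ (hw0 y hy).ne', one_mul, Finset.sum_mul]
      rw [e1, e2, integral_finsetSum _ fun i _ => integrable_finsetSum _ fun j _ => hF1 i j,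
        integral_finsetSum _ fun i _ => integrable_finsetSum _ fun j _ => hF2 i j]
      refine Finset.sum_congr rfl fun i _ => ?_
      rw [integral_finsetSum _ fun j _ => hF1 i j, integral_finsetSum _ fun j _ => hF2 i j]
      exact Finset.sum_congr rfl fun j _ => hterm i j
    · refine continuousOn_finsetSum _ fun i _ => ContinuousOn.mul ?_ (hY i).continuous.continuousOn
      exact (hELc i).comp (continuousOn_extChartAt x₀) fun x hx => e.map_source hx
    · intro x hx
      by_contra h
      refine hx (Finset.sum_eq_zero fun i _ => ?_)
      rw [image_eq_zero_of_notMem_tsupport fun hi => h (hYs i hi), mul_zero]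

lemma IsSmooth.integrable [IsFiniteMeasure μ] {f : M → ℝ} (hf : IsSmooth n f) : Integrable f μ :=
  (hf.jointSmooth ℝ).integrable 0

variable [T2Space M]

/-- Every local function `g` has Euler–Lagrange operators: the smeared functional `∫ η g` has
variational derivatives `EL i`, local in the fields and in `η`; the formula for the variation holds
when the smearing function or the variation is flat at the boundary. -/
theorem exists_eulerLagrange (hμ : IsSmoothVolume n μ) {g : ℝ → (ι → M → ℝ) → M → ℝ}
    (hg : IsLocal n g) :
    ∃ (S : Finset ι) (EL : ι → ℝ → (ι ⊕ Unit → M → ℝ) → M → ℝ), (∀ i, IsLocal n (EL i)) ∧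
      (∀ i ∉ S, ∀ t Ψ, EL i t Ψ = 0) ∧
      ∀ (t : ℝ) (Φ Y : ι → M → ℝ) (η : M → ℝ), (∀ i, IsSmooth n (Φ i)) →
        (∀ i, IsSmooth n (Y i)) → IsSmooth n η →
        (FlatOnBoundary n η ∨ ∀ i, FlatOnBoundary n (Y i)) →
        ∫ x, η x * dder (g t) Φ Y x ∂μ =
          ∫ x, ∑ i ∈ S, EL i t (Sum.elim Φ fun _ => η) x * Y i x ∂μ := by
  classical
  have := hμ.isFiniteMeasure
  obtain ⟨k, S, hgS⟩ := isLocal_iff.1 hg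
  choose EL hELloc hEL using fun x₀ => exists_chart_eulerLagrange hμ hg (hgS x₀)
  -- The operators at a point are computed in the chart centred there; by the fundamental lemma,
  -- every other chart gives the same result.
  have hcont : ∀ (c : M) (i : S) (t : ℝ) (Ψ : ι ⊕ Unit → M → ℝ), (∀ i, IsSmooth n (Ψ i)) →
      ContinuousOn (fun x => EL c i t Ψ (extChartAt (𝓡∂ n) c x)) (extChartAt (𝓡∂ n) c).source :=
    fun c i t Ψ hΨ => ((hELloc c i).contDiffOn t hΨ).continuousOn.comp (continuousOn_extChartAt c)
      fun x hx => (extChartAt (𝓡∂ n) c).map_source hx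
  have hagree : ∀ (c x₀ : M) (i : S) (t : ℝ) (Ψ : ι ⊕ Unit → M → ℝ), (∀ i, IsSmooth n (Ψ i)) →
      ∀ x ∈ (extChartAt (𝓡∂ n) c).source ∩ (extChartAt (𝓡∂ n) x₀).source,
        EL c i t Ψ (extChartAt (𝓡∂ n) c x) = EL x₀ i t Ψ (extChartAt (𝓡∂ n) x₀ x) := by
    intro c x₀ i t Ψ hΨ x hx
    have hU : IsOpen ((extChartAt (𝓡∂ n) c).source ∩ (extChartAt (𝓡∂ n) x₀).source) :=
      (isOpen_extChartAt_source c).inter (isOpen_extChartAt_source x₀)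
    refine sub_eq_zero.1 (fundamental_lemma (n := n) hμ hU (((hcont c i t Ψ hΨ).mono
      inter_subset_left).sub ((hcont x₀ i t Ψ hΨ).mono inter_subset_right)) (fun ψ hψ hψs => ?_)
      x hx)
    have hΨe : Ψ = Sum.elim (fun i => Ψ (Sum.inl i)) fun _ => Ψ (Sum.inr ()) := by
      funext j
      rcases j with j | j <;> rfl
    have hYsm : ∀ j, IsSmooth n (Pi.single (M := fun _ : ι => M → ℝ) (i : ι) ψ j) := by
      intro j
      by_cases hj : j = i
      · rw [hj, Pi.single_eq_same]
        exact hψ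
      · rw [Pi.single_eq_of_ne hj]
        exact isSmooth_const 0
    have hYts : ∀ j, tsupport (Pi.single (M := fun _ : ι => M → ℝ) (i : ι) ψ j) ⊆ tsupport ψ := by
      intro j
      by_cases hj : j = i
      · rw [hj, Pi.single_eq_same]
      · rw [Pi.single_eq_of_ne hj]
        have : tsupport (0 : M → ℝ) = ∅ := tsupport_eq_empty_iff.2 rfl
        rw [this]
        exact empty_subset _
    have key : ∀ d : M, tsupport ψ ⊆ (extChartAt (𝓡∂ n) d).source →
        ∫ x, Ψ (Sum.inr ()) x * dder (g t) (fun i => Ψ (Sum.inl i)) (Pi.single (i : ι) ψ) x ∂μ =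
          ∫ x, EL d i t Ψ (extChartAt (𝓡∂ n) d x) * ψ x ∂μ := by
      intro d hd
      rw [hEL d t (fun i => Ψ (Sum.inl i)) (Pi.single (i : ι) ψ) (Ψ (Sum.inr ()))
        (fun i => hΨ _) hYsm (hΨ _)
        (Or.inr fun j => flatOnBoundary_of_tsupport ((hYts j).trans fun y hy => (hψs hy).2))
        (fun j => (hYts j).trans hd)]
      refine integral_congr_ae (Eventually.of_forall fun y => ?_)
      simp only
      rw [Finset.sum_eq_single i, Pi.single_eq_same, ← hΨe]
      · intro j _ hj
        rw [Pi.single_eq_of_ne (fun h => hj (Subtype.ext h)), Pi.zero_apply, mul_zero]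
      · simp
    have hint : ∀ d : M, tsupport ψ ⊆ (extChartAt (𝓡∂ n) d).source →
        Integrable (fun x => EL d i t Ψ (extChartAt (𝓡∂ n) d x) * ψ x) μ := by
      intro d hd
      refine Continuous.integrable_of_hasCompactSupport ?_ (HasCompactSupport.of_compactSpace _)
      rw [continuous_iff_continuousAt]
      intro y
      by_cases hy : y ∈ tsupport ψ
      · exact ((hcont d i t Ψ hΨ).continuousAt ((isOpen_extChartAt_source d).mem_nhds (hd hy))).mul
          hψ.continuous.continuousAt
      · have : (fun x => EL d i t Ψ (extChartAt (𝓡∂ n) d x) * ψ x) =ᶠ[𝓝 y] fun _ => 0 := by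
          filter_upwards [notMem_tsupport_iff_eventuallyEq.1 hy] with z hz
          rw [hz, Pi.zero_apply, mul_zero]
        exact continuousAt_const.congr this.symm
    have hc : tsupport ψ ⊆ (extChartAt (𝓡∂ n) c).source := fun y hy => (hψs hy).1.1
    have hx₀ : tsupport ψ ⊆ (extChartAt (𝓡∂ n) x₀).source := fun y hy => (hψs hy).1.2
    refine (integral_congr_ae (Eventually.of_forall fun y => sub_mul _ _ _)).trans ?_
    rw [integral_sub (hint c hc) (hint x₀ hx₀), ← key c hc, ← key x₀ hx₀, sub_self]
  set EL' : ι → ℝ → (ι ⊕ Unit → M → ℝ) → M → ℝ := fun i t Ψ x =>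
    if h : i ∈ S then EL x ⟨i, h⟩ t Ψ (extChartAt (𝓡∂ n) x x) else 0 with hEL'
  have hELS : ∀ (i : S) (t : ℝ) (Ψ : ι ⊕ Unit → M → ℝ), (∀ i, IsSmooth n (Ψ i)) → ∀ c : M,
      ∀ x ∈ (extChartAt (𝓡∂ n) c).source, EL' i t Ψ x = EL c i t Ψ (extChartAt (𝓡∂ n) c x) := by
    intro i t Ψ hΨ c x hx
    simp only [hEL', i.2, dite_true]
    exact hagree x c i t Ψ hΨ x ⟨mem_extChartAt_source x, hx⟩
  have hloc : ∀ i, IsLocal n (EL' i) := by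
    intro i
    by_cases hi : i ∈ S
    · refine isLocal_iff.2 ⟨k + k, S.disjSum Finset.univ, fun c =>
        (hELloc c ⟨i, hi⟩).congr fun t Ψ hΨ y hy => ?_⟩
      rw [hELS ⟨i, hi⟩ t Ψ hΨ c _ ((extChartAt (𝓡∂ n) c).map_target hy),
        (extChartAt (𝓡∂ n) c).right_inv hy]
    · have : EL' i = fun _ _ => 0 := by
        funext t Ψ x
        simp [hEL', hi]
      rw [this]
      exact isLocal_zero
  refine ⟨S, EL', hloc, fun i hi t Ψ => ?_, fun t Φ Y η hΦ hY hη hflat => ?_⟩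
  · funext x
    simp [hEL', hi]
  · have hΨ : ∀ i, IsSmooth n ((Sum.elim Φ fun _ : Unit => η) i) := by
      rintro (i | i)
      exacts [hΦ i, hη]
    -- a partition of unity decomposes the variation into variations supported in charts
    obtain ⟨s, p, hp, hps, hsum⟩ := exists_partition (n := n) (M := M)
    have hpY : ∀ c i, IsSmooth n (p c * Y i) := fun c i => (hp c).mul (hY i)
    have hYsum : Y = ∑ c ∈ s, fun i => p c * Y i := by
      funext i
      rw [Finset.sum_apply, ← Finset.sum_mul, hsum, one_mul]
    have hloc' : ∀ c, ∫ x, η x * dder (g t) Φ (fun i => p c * Y i) x ∂μ =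
        ∫ x, ∑ i ∈ S, EL' i t (Sum.elim Φ fun _ => η) x * (p c * Y i) x ∂μ := by
      intro c
      have hts : ∀ i, tsupport (p c * Y i) ⊆ (extChartAt (𝓡∂ n) c).source := fun i =>
        tsupport_mul_subset_left.trans (hps c)
      rw [hEL c t Φ _ η hΦ (hpY c) hη (hflat.imp_right fun h i => (h i).mul_left _ (hp c) (hY i))
        hts]
      refine integral_congr_ae (Eventually.of_forall fun x => ?_)
      simp only
      rw [← Finset.sum_coe_sort S]
      refine Finset.sum_congr rfl fun i _ => ?_
      by_cases hx : x ∈ (extChartAt (𝓡∂ n) c).source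
      · rw [hELS i t _ hΨ c x hx]
      · rw [image_eq_zero_of_notMem_tsupport fun h => hx (hts i h), mul_zero, mul_zero]
    have hint1 : ∀ c ∈ s, Integrable (fun x => η x * dder (g t) Φ (fun i => p c * Y i) x) μ :=
      fun c _ => (hη.mul (hg.isSmooth_dder t hΦ (hpY c))).integrable
    have hint2 : ∀ c ∈ s, Integrable
        (fun x => ∑ i ∈ S, EL' i t (Sum.elim Φ fun _ => η) x * (p c * Y i) x) μ :=
      fun c _ => integrable_finsetSum _ fun i _ =>
        (((hloc i).isSmooth t hΨ).mul (hpY c i)).integrable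
    calc ∫ x, η x * dder (g t) Φ Y x ∂μ
        = ∫ x, ∑ c ∈ s, η x * dder (g t) Φ (fun i => p c * Y i) x ∂μ := by
          conv_lhs => rw [hYsum, hg.dder_sum t hΦ s hpY]
          simp only [Finset.sum_apply, Finset.mul_sum]
      _ = ∑ c ∈ s, ∫ x, ∑ i ∈ S, EL' i t (Sum.elim Φ fun _ => η) x * (p c * Y i) x ∂μ := by
          rw [integral_finsetSum _ hint1]
          exact Finset.sum_congr rfl fun c _ => hloc' c
      _ = ∫ x, ∑ i ∈ S, EL' i t (Sum.elim Φ fun _ => η) x * Y i x ∂μ := by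
          rw [← integral_finsetSum _ hint2]
          refine integral_congr_ae (Eventually.of_forall fun x => ?_)
          simp only
          rw [Finset.sum_comm]
          refine Finset.sum_congr rfl fun i _ => ?_
          rw [← Finset.mul_sum]
          congr 1
          have := congrFun hsum x
          simp only [Finset.sum_apply, Pi.one_apply] at this
          simp only [Pi.mul_apply]
          rw [← Finset.sum_mul, this, one_mul]

end EulerLagrange

/-! ### Local functionals and their Euler–Lagrange derivatives -/

section Timed

variable {n : ℕ} [NeZero n] {M : Type*} [TopologicalSpace M]
  [ChartedSpace (EuclideanHalfSpace n) M] {ι : Type*}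

lemma hd_timed (F : ℝ → (ι → M → ℝ) → ℝ) (t : ℝ) (Φ Y : ι → M → ℝ) :
    hd (fun u : ℝ × (ι → M → ℝ) => F u.1 u.2) (t, Φ) (0, Y) = fder (F t) Φ Y := by
  simp [hd, fder]

lemma hd_timed_apply (f : ℝ → (ι → M → ℝ) → M → ℝ) (t : ℝ) (Φ Y : ι → M → ℝ) (x : M) :
    hd (fun u : ℝ × (ι → M → ℝ) => f u.1 u.2 x) (t, Φ) (0, Y) = dder (f t) Φ Y x := by
  simp [hd, dder]

variable [IsManifold (𝓡∂ n) ∞ M]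

lemma timedPlots_pt (t : ℝ) {Φ : ι → M → ℝ} (hΦ : ∀ i, IsSmooth n (Φ i)) :
    (timedPlots n M ι).Pt (t, Φ) :=
  ⟨contDiff_const, fieldPlots_pt hΦ⟩

lemma IsLocal.smoothFun_timed {f : ℝ → (ι → M → ℝ) → M → ℝ} (hf : IsLocal n f) (x : M) :
    (timedPlots n M ι).SmoothFun (fun u => f u.1 u.2 x) := fun _ _ _ _ _ hc =>
  (hf.jointSmooth hc.1 hc.2).contDiff x

lemma smoothMap_timed {Z : ℝ → (ι → M → ℝ) → ι → M → ℝ} (a : ℝ)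
    (hZ : ∀ i, IsLocal n (fun t Φ => Z t Φ i)) :
    (timedPlots n M ι).SmoothMap (timedPlots n M ι) (fun u => (a, Z u.1 u.2)) :=
  fun _ _ _ _ _ hc => ⟨contDiff_const, fun i => (hZ i).jointSmooth hc.1 hc.2⟩

lemma hd_timed_split {F : ℝ → (ι → M → ℝ) → ℝ}
    (hF : (timedPlots n M ι).SmoothFun (fun u => F u.1 u.2)) (t a : ℝ) {Φ Y : ι → M → ℝ}
    (hΦ : ∀ i, IsSmooth n (Φ i)) (hY : ∀ i, IsSmooth n (Y i)) :
    hd (fun u : ℝ × (ι → M → ℝ) => F u.1 u.2) (t, Φ) (a, Y) =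
      a * deriv (fun τ => F τ Φ) t + fder (F t) Φ Y := by
  have h0 : ∀ i, IsSmooth n ((0 : ι → M → ℝ) i) := fun _ => isSmooth_const 0
  have h1 : ((a, Y) : ℝ × (ι → M → ℝ)) = a • ((1 : ℝ), (0 : ι → M → ℝ)) + (0, Y) := by simp
  rw [h1, hF.hd_add (timedPlots_pt t hΦ) ((timedPlots_pt 1 h0).smul a) (timedPlots_pt 0 hY),
    hF.hd_smul (timedPlots_pt t hΦ) (timedPlots_pt 1 h0), hd_timed]
  have h2 := deriv_comp_const_add (f := fun τ => F τ Φ) t 0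
  simp only [add_zero] at h2
  rw [← h2]
  simp [hd]

/-- The derivative of the local function `f`, at time `t` and fields `Φ`, along the vector field
`a ∂/∂t + Z`. -/
def lie (a : ℝ) (Z : ℝ → (ι → M → ℝ) → ι → M → ℝ) (f : ℝ → (ι → M → ℝ) → M → ℝ)
    (t : ℝ) (Φ : ι → M → ℝ) : M → ℝ :=
  fun x => hd (fun u : ℝ × (ι → M → ℝ) => f u.1 u.2 x) (t, Φ) (a, Z t Φ)

/-- The derivative of the functional `F` along the vector field `a ∂/∂t + Z`. -/
def lieFun (a : ℝ) (Z : ℝ → (ι → M → ℝ) → ι → M → ℝ) (F : ℝ → (ι → M → ℝ) → ℝ)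
    (t : ℝ) (Φ : ι → M → ℝ) : ℝ :=
  hd (fun u : ℝ × (ι → M → ℝ) => F u.1 u.2) (t, Φ) (a, Z t Φ)

lemma lie_zero_left (Z : ℝ → (ι → M → ℝ) → ι → M → ℝ) (f : ℝ → (ι → M → ℝ) → M → ℝ)
    (t : ℝ) (Φ : ι → M → ℝ) : lie 0 Z f t Φ = dder (f t) Φ (Z t Φ) :=
  funext fun x => hd_timed_apply f t Φ (Z t Φ) x

lemma lieFun_zero_left (Z : ℝ → (ι → M → ℝ) → ι → M → ℝ) (F : ℝ → (ι → M → ℝ) → ℝ)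
    (t : ℝ) (Φ : ι → M → ℝ) : lieFun 0 Z F t Φ = fder (F t) Φ (Z t Φ) := hd_timed F t Φ (Z t Φ)

lemma IsLocal.lie_eq {f : ℝ → (ι → M → ℝ) → M → ℝ} (hf : IsLocal n f) (a : ℝ)
    {Z : ℝ → (ι → M → ℝ) → ι → M → ℝ} (t : ℝ) {Φ : ι → M → ℝ}
    (hΦ : ∀ i, IsSmooth n (Φ i)) (hZ : ∀ i, IsSmooth n (Z t Φ i)) (x : M) :
    lie a Z f t Φ x = a * deriv (fun τ => f τ Φ x) t + GaugeField.dder (f t) Φ (Z t Φ) x :=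
  hd_timed_split (F := fun t Φ => f t Φ x) (hf.smoothFun_timed x) t a hΦ hZ

lemma IsLocal.lie {f : ℝ → (ι → M → ℝ) → M → ℝ} (hf : IsLocal n f) (a : ℝ)
    {Z : ℝ → (ι → M → ℝ) → ι → M → ℝ} (hZ : ∀ i, IsLocal n (fun t Φ => Z t Φ i)) :
    IsLocal n (GaugeField.lie a Z f) := by
  refine (((isLocal_const a).mul hf.deriv_time).add
    (hf.dder_subst (Φ := fun _ Φ => Φ) (Y := Z) isLocal_field hZ)).congr fun t Φ hΦ => ?_
  ext x
  exact hf.lie_eq a t hΦ (fun i => (hZ i).isSmooth t hΦ) x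

section Integrals

variable [CompactSpace M] [MeasurableSpace M] [BorelSpace M] {μ : Measure M} [IsFiniteMeasure μ]

lemma IsLocal.smoothFun_integral {f : ℝ → (ι → M → ℝ) → M → ℝ} (hf : IsLocal n f) :
    (timedPlots n M ι).SmoothFun (fun u => ∫ x, f u.1 u.2 x ∂μ) := fun _ _ _ _ _ hc =>
  (hf.jointSmooth hc.1 hc.2).contDiff_integral

lemma IsLocal.hd_integral {f : ℝ → (ι → M → ℝ) → M → ℝ} (hf : IsLocal n f) (t a : ℝ)
    {Φ Y : ι → M → ℝ} (hΦ : ∀ i, IsSmooth n (Φ i)) (hY : ∀ i, IsSmooth n (Y i)) :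
    GaugeField.hd (fun u : ℝ × (ι → M → ℝ) => ∫ x, f u.1 u.2 x ∂μ) (t, Φ) (a, Y) =
      ∫ x, GaugeField.hd (fun u : ℝ × (ι → M → ℝ) => f u.1 u.2 x) (t, Φ) (a, Y) ∂μ := by
  have hl := (timedPlots_pt t hΦ).line (timedPlots_pt a hY)
  exact ((hf.jointSmooth hl.1 hl.2).hasDerivAt_integral (μ := μ) 0).deriv

lemma IsLocal.fder_integral {f : ℝ → (ι → M → ℝ) → M → ℝ} (hf : IsLocal n f) (t : ℝ)
    {Φ Y : ι → M → ℝ} (hΦ : ∀ i, IsSmooth n (Φ i)) (hY : ∀ i, IsSmooth n (Y i)) :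
    fder (fun Φ => ∫ x, f t Φ x ∂μ) Φ Y = ∫ x, GaugeField.dder (f t) Φ Y x ∂μ := by
  have := hf.hd_integral (μ := μ) t 0 hΦ hY
  simp only [hd_timed_apply] at this
  rw [← this]
  exact (hd_timed (fun t Φ => ∫ x, f t Φ x ∂μ) t Φ Y).symm

/-- The variation of a boundary functional along a field vanishing to infinite order at the
boundary is zero. -/
lemma IsLocal.fder_boundary {ν : Measure M} (hν : IsSmoothBoundaryVolume n ν)
    {f : ℝ → (ι → M → ℝ) → M → ℝ} (hf : IsLocal n f) (t : ℝ)
    {Φ Y : ι → M → ℝ} (hΦ : ∀ i, IsSmooth n (Φ i)) (hY : ∀ i, IsSmooth n (Y i))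
    (hflat : ∀ i, FlatOnBoundary n (Y i)) :
    fder (fun Φ => ∫ x, f t Φ x ∂ν) Φ Y = 0 := by
  have := hν.isFiniteMeasure
  rw [hf.fder_integral t hΦ hY]
  refine integral_eq_zero_of_ae (hν.ae_mem_boundary.mono fun x hx => ?_)
  exact (hf.flatAt_dder t hΦ hY fun i => hflat i x hx).eq_zero

end Integrals

end Timed

section LocalFunctional

variable (n : ℕ) [NeZero n] {M : Type*} [TopologicalSpace M]
  [ChartedSpace (EuclideanHalfSpace n) M] {ι : Type*} [MeasurableSpace M]

/-- Local functionals, for an arbitrary family of fields. -/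
def LocalFunctional (vol bvol : Measure M) (G : ℝ → (ι → M → ℝ) → ℝ) : Prop :=
  ∃ g k : ℝ → (ι → M → ℝ) → M → ℝ, IsLocal n g ∧ IsLocal n k ∧
    ∀ t Φ, (∀ i, IsSmooth n (Φ i)) → G t Φ = (∫ x, g t Φ x ∂vol) + ∫ x, k t Φ x ∂bvol

/-- `E` are local functions with `δG = ∫ ∑_{i ∈ S} E_i δΦ_i` for every variation which vanishes
to infinite order at the boundary, and `G` is smooth along smooth families. -/
structure HasEL (vol : Measure M) (S : Finset ι) (G : ℝ → (ι → M → ℝ) → ℝ)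
    (E : ι → ℝ → (ι → M → ℝ) → M → ℝ) : Prop where
  smooth : (timedPlots n M ι).SmoothFun (fun u => G u.1 u.2)
  isLocal : ∀ i, IsLocal n (E i)
  spec : ∀ (t : ℝ) (Φ Y : ι → M → ℝ), (∀ i, IsSmooth n (Φ i)) → (∀ i, IsSmooth n (Y i)) →
    (∀ i, FlatOnBoundary n (Y i)) → fder (G t) Φ Y = ∫ x, ∑ i ∈ S, E i t Φ x * Y i x ∂vol

variable {n} [IsManifold (𝓡∂ n) ∞ M] [CompactSpace M] [BorelSpace M] {vol bvol : Measure M}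

lemma localFunctional_integral {f : ℝ → (ι → M → ℝ) → M → ℝ} (hf : IsLocal n f) :
    LocalFunctional n vol bvol (fun t Φ => ∫ x, f t Φ x ∂vol) :=
  ⟨f, _, hf, isLocal_zero, fun t Φ _ => by simp⟩

lemma localFunctional_boundary {f : ℝ → (ι → M → ℝ) → M → ℝ} (hf : IsLocal n f) :
    LocalFunctional n vol bvol (fun t Φ => ∫ x, f t Φ x ∂bvol) :=
  ⟨_, f, isLocal_zero, hf, fun t Φ _ => by simp⟩

lemma PlotSpace.SmoothFun.congr_timed {F F' : ℝ → (ι → M → ℝ) → ℝ}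
    (hF : (timedPlots n M ι).SmoothFun (fun u => F u.1 u.2))
    (h : ∀ t Φ, (∀ i, IsSmooth n (Φ i)) → F' t Φ = F t Φ) :
    (timedPlots n M ι).SmoothFun (fun u => F' u.1 u.2) := fun P _ _ _ c hc => by
  have : (fun p => F' (c p).1 (c p).2) = fun p => F (c p).1 (c p).2 := funext fun p =>
    h _ _ fun i => (hc.2 i).isSmooth p
  rw [this]
  exact hF P c hc

lemma hd_timed_congr {F F' : ℝ → (ι → M → ℝ) → ℝ}
    (h : ∀ t Φ, (∀ i, IsSmooth n (Φ i)) → F' t Φ = F t Φ) (t a : ℝ)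
    {Φ Y : ι → M → ℝ} (hΦ : ∀ i, IsSmooth n (Φ i)) (hY : ∀ i, IsSmooth n (Y i)) :
    hd (fun u : ℝ × (ι → M → ℝ) => F' u.1 u.2) (t, Φ) (a, Y) =
      hd (fun u : ℝ × (ι → M → ℝ) => F u.1 u.2) (t, Φ) (a, Y) := by
  unfold hd
  congr 1
  funext s
  exact h _ _ fun i => (hΦ i).add ((hY i).smul s)

lemma fder_congr {F F' : (ι → M → ℝ) → ℝ}
    (h : ∀ Φ, (∀ i, IsSmooth n (Φ i)) → F' Φ = F Φ)
    {Φ Y : ι → M → ℝ} (hΦ : ∀ i, IsSmooth n (Φ i)) (hY : ∀ i, IsSmooth n (Y i)) :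
    fder F' Φ Y = fder F Φ Y := by
  unfold fder
  congr 1
  funext s
  exact h _ fun i => (hΦ i).add ((hY i).smul s)

section Calculus

variable [IsFiniteMeasure vol] [IsFiniteMeasure bvol]

lemma LocalFunctional.smoothFun {G : ℝ → (ι → M → ℝ) → ℝ} (hG : LocalFunctional n vol bvol G) :
    (timedPlots n M ι).SmoothFun (fun u => G u.1 u.2) := by
  obtain ⟨g, k, hg, hk, h⟩ := hG
  exact (hg.smoothFun_integral.add hk.smoothFun_integral).congr_timed
    (F := fun t Φ => (∫ x, g t Φ x ∂vol) + ∫ x, k t Φ x ∂bvol) h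

lemma LocalFunctional.add {G G' : ℝ → (ι → M → ℝ) → ℝ} (hG : LocalFunctional n vol bvol G)
    (hG' : LocalFunctional n vol bvol G') :
    LocalFunctional n vol bvol (fun t Φ => G t Φ + G' t Φ) := by
  obtain ⟨g, k, hg, hk, h⟩ := hG
  obtain ⟨g', k', hg', hk', h'⟩ := hG'
  refine ⟨_, _, hg.add hg', hk.add hk', fun t Φ hΦ => ?_⟩
  beta_reduce
  rw [h t Φ hΦ, h' t Φ hΦ, integral_add (hg.isSmooth t hΦ).integrable
    (hg'.isSmooth t hΦ).integrable, integral_add (hk.isSmooth t hΦ).integrable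
    (hk'.isSmooth t hΦ).integrable]
  ring

lemma LocalFunctional.sub {G G' : ℝ → (ι → M → ℝ) → ℝ} (hG : LocalFunctional n vol bvol G)
    (hG' : LocalFunctional n vol bvol G') :
    LocalFunctional n vol bvol (fun t Φ => G t Φ - G' t Φ) := by
  obtain ⟨g, k, hg, hk, h⟩ := hG
  obtain ⟨g', k', hg', hk', h'⟩ := hG'
  refine ⟨_, _, hg.sub hg', hk.sub hk', fun t Φ hΦ => ?_⟩
  beta_reduce
  rw [h t Φ hΦ, h' t Φ hΦ, integral_sub (hg.isSmooth t hΦ).integrable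
    (hg'.isSmooth t hΦ).integrable, integral_sub (hk.isSmooth t hΦ).integrable
    (hk'.isSmooth t hΦ).integrable]
  ring

lemma LocalFunctional.lieFun {G : ℝ → (ι → M → ℝ) → ℝ} (hG : LocalFunctional n vol bvol G)
    (a : ℝ) {Z : ℝ → (ι → M → ℝ) → ι → M → ℝ} (hZ : ∀ i, IsLocal n (fun t Φ => Z t Φ i)) :
    LocalFunctional n vol bvol (GaugeField.lieFun a Z G) := by
  obtain ⟨g, k, hg, hk, h⟩ := hG
  refine ⟨_, _, hg.lie a hZ, hk.lie a hZ, fun t Φ hΦ => ?_⟩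
  have hZs := fun i => (hZ i).isSmooth t hΦ
  refine (hd_timed_congr h t a hΦ hZs).trans ?_
  rw [hg.smoothFun_integral.hd_fun_add hk.smoothFun_integral (timedPlots_pt t hΦ)
    (timedPlots_pt a hZs), hg.hd_integral t a hΦ hZs, hk.hd_integral t a hΦ hZs]
  rfl

end Calculus

variable [T2Space M]

/-- The fundamental lemma of the calculus of variations, for finitely many fields. -/
lemma eq_zero_of_integral_sum {μ : Measure M} (hμ : IsSmoothVolume n μ) {S : Finset ι}
    {f : ι → M → ℝ} (hf : ∀ i ∈ S, IsSmooth n (f i))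
    (h : ∀ Y : ι → M → ℝ, (∀ i, IsSmooth n (Y i)) →
      (∀ i, tsupport (Y i) ⊆ (𝓡∂ n).interior M) → ∫ x, ∑ i ∈ S, f i x * Y i x ∂μ = 0) :
    ∀ i ∈ S, f i = 0 := by
  classical
  intro i hi
  funext x
  refine fundamental_lemma (n := n) hμ isOpen_univ (hf i hi).continuous.continuousOn
    (fun Y hY hYs => ?_) x (mem_univ x)
  have h0 : tsupport (0 : M → ℝ) = ∅ := by simp
  have := h (Pi.single i Y) (fun j => ?_) (fun j => ?_)
  · rw [← this]
    congr 1
    funext x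
    rw [Finset.sum_eq_single i]
    · simp
    · intro j _ hj
      simp [Pi.single_eq_of_ne hj]
    · exact fun h => absurd hi h
  · by_cases hj : j = i
    · subst hj; simpa using hY
    · rw [Pi.single_eq_of_ne hj]; exact isSmooth_const 0
  · by_cases hj : j = i
    · subst hj; simpa using hYs
    · rw [Pi.single_eq_of_ne hj, h0]; exact empty_subset _

/-- Two linear forms `∑ a_i Y_i` and `∑ b_i Y_i` which have the same integral for all `Y`
supported in the interior are equal. -/
lemma sum_eq_sum_of_integral {μ : Measure M} (hμ : IsSmoothVolume n μ) {S S' : Finset ι}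
    {a b : ι → M → ℝ} (ha : ∀ i ∈ S, IsSmooth n (a i)) (hb : ∀ i ∈ S', IsSmooth n (b i))
    (h : ∀ Y : ι → M → ℝ, (∀ i, IsSmooth n (Y i)) →
      (∀ i, tsupport (Y i) ⊆ (𝓡∂ n).interior M) →
      ∫ x, ∑ i ∈ S, a i x * Y i x ∂μ = ∫ x, ∑ i ∈ S', b i x * Y i x ∂μ)
    (Y : ι → M → ℝ) (x : M) : ∑ i ∈ S, a i x * Y i x = ∑ i ∈ S', b i x * Y i x := by
  classical
  have := hμ.isFiniteMeasure
  have e1 : ∀ (Y : ι → M → ℝ) (x : M), ∑ i ∈ S, a i x * Y i x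
      = ∑ i ∈ S ∪ S', (if i ∈ S then a i else 0) x * Y i x := by
    intro Y x
    rw [← Finset.sum_subset (Finset.subset_union_left (s₁ := S) (s₂ := S'))]
    · exact Finset.sum_congr rfl fun i hi => by simp [hi]
    · intro i _ hi; simp [hi]
  have e2 : ∀ (Y : ι → M → ℝ) (x : M), ∑ i ∈ S', b i x * Y i x
      = ∑ i ∈ S ∪ S', (if i ∈ S' then b i else 0) x * Y i x := by
    intro Y x
    rw [← Finset.sum_subset (Finset.subset_union_right (s₁ := S) (s₂ := S'))]
    · exact Finset.sum_congr rfl fun i hi => by simp [hi]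
    · intro i _ hi; simp [hi]
  have hsa : ∀ i, IsSmooth n (if i ∈ S then a i else 0) := by
    intro i
    split_ifs with hi
    exacts [ha i hi, isSmooth_const 0]
  have hsb : ∀ i, IsSmooth n (if i ∈ S' then b i else 0) := by
    intro i
    split_ifs with hi
    exacts [hb i hi, isSmooth_const 0]
  have key : ∀ i ∈ S ∪ S', (if i ∈ S then a i else 0) - (if i ∈ S' then b i else 0) = 0 := by
    refine eq_zero_of_integral_sum hμ (fun i _ => (hsa i).sub (hsb i)) fun Y hY hYs => ?_
    have h1 := h Y hY hYs
    simp only [e1, e2] at h1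
    simp only [Pi.sub_apply, sub_mul, Finset.sum_sub_distrib]
    rw [integral_sub, h1, sub_self]
    · exact integrable_finsetSum _ fun i _ => ((hsa i).mul (hY i)).integrable
    · exact integrable_finsetSum _ fun i _ => ((hsb i).mul (hY i)).integrable
  rw [e1, e2]
  exact Finset.sum_congr rfl fun i hi => by rw [sub_eq_zero.1 (key i hi)]

/-- Every local functional has Euler–Lagrange derivatives. -/
lemma LocalFunctional.exists_hasEL (hvol : IsSmoothVolume n vol)
    (hbvol : IsSmoothBoundaryVolume n bvol) {G : ℝ → (ι → M → ℝ) → ℝ}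
    (hG : LocalFunctional n vol bvol G) : ∃ S E, HasEL n vol S G E ∧ ∀ i ∉ S, ∀ t Φ, E i t Φ = 0 := by
  have := hvol.isFiniteMeasure
  have := hbvol.isFiniteMeasure
  have hs := hG.smoothFun
  obtain ⟨g, k, hg, hk, h⟩ := hG
  obtain ⟨S, EL, hEL, hEL0, hspec⟩ := exists_eulerLagrange hvol hg
  refine ⟨S, fun i t Φ => EL i t (Sum.elim Φ fun _ => fun _ => 1), ⟨hs, fun i => ?_, ?_⟩,
    fun i hi t Φ => hEL0 i hi t _⟩
  · refine (hEL i).subst (Ψ := fun t Φ => Sum.elim Φ fun _ => fun _ => 1) fun j => ?_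
    cases j with
    | inl j => exact isLocal_field j
    | inr j => exact isLocal_const 1
  · intro t Φ Y hΦ hY hflat
    have h1 : fder (G t) Φ Y = fder (fun Φ => ∫ x, g t Φ x ∂vol) Φ Y
        + fder (fun Φ => ∫ x, k t Φ x ∂bvol) Φ Y := by
      rw [← hd_timed, hd_timed_congr h t 0 hΦ hY, hg.smoothFun_integral.hd_fun_add
        hk.smoothFun_integral (timedPlots_pt t hΦ) (timedPlots_pt 0 hY),
        hd_timed (fun t Φ => ∫ x, g t Φ x ∂vol), hd_timed (fun t Φ => ∫ x, k t Φ x ∂bvol)]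
    rw [h1, hk.fder_boundary hbvol t hΦ hY hflat, add_zero, hg.fder_integral t hΦ hY,
      ← hspec t Φ Y (fun _ => 1) hΦ hY (isSmooth_const 1) (Or.inr hflat)]
    simp

/-- Variational derivatives, characterised by variations supported in the interior, also
represent the variations which vanish to infinite order at the boundary. -/
lemma LocalFunctional.hasEL (hvol : IsSmoothVolume n vol)
    (hbvol : IsSmoothBoundaryVolume n bvol) {G : ℝ → (ι → M → ℝ) → ℝ}
    (hG : LocalFunctional n vol bvol G) {S : Finset ι} {E : ι → ℝ → (ι → M → ℝ) → M → ℝ}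
    (hE : ∀ i, IsLocal n (E i)) (h : ∀ t, IsVarDeriv n vol S (G t) (fun i => E i t)) :
    HasEL n vol S G E := by
  obtain ⟨S', E', hE', -⟩ := hG.exists_hasEL hvol hbvol
  refine ⟨hE'.smooth, hE, fun t Φ Y hΦ hY hflat => ?_⟩
  rw [hE'.spec t Φ Y hΦ hY hflat]
  congr 1
  funext x
  refine sum_eq_sum_of_integral hvol (fun i _ => (hE'.isLocal i).isSmooth t hΦ)
    (fun i _ => (hE i).isSmooth t hΦ) (fun Y hY hYs => ?_) Y x
  rw [← h t Φ Y hΦ hY hYs, hE'.spec t Φ Y hΦ hY fun i => flatOnBoundary_of_tsupport (hYs i)]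

end LocalFunctional

/-! ### Second variations -/

section SecondVariation

variable {n : ℕ} [NeZero n] {M : Type*} [TopologicalSpace M]
  [ChartedSpace (EuclideanHalfSpace n) M] [IsManifold (𝓡∂ n) ∞ M] {ι : Type*}

lemma isLocal_fixed {f : M → ℝ} (hf : IsSmooth n f) : IsLocal n (fun _ (_ : ι → M → ℝ) => f) := by
  refine isLocal_iff.2 ⟨0, ∅, fun x₀ => ?_⟩
  exact locAt_coord (g := fun q => f ((extChartAt (𝓡∂ n) x₀).symm q.2))
    ((hf.contDiffOn_chart x₀).comp contDiffOn_snd fun q hq => hq.2)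

lemma smooth_dder_field {Z : ℝ → (ι → M → ℝ) → ι → M → ℝ}
    (hZ : ∀ i, IsLocal n (fun t Φ => Z t Φ i)) (t : ℝ) {Φ Y : ι → M → ℝ}
    (hΦ : ∀ i, IsSmooth n (Φ i)) (hY : ∀ i, IsSmooth n (Y i)) (i : ι) :
    IsSmooth n (dder (fun Φ => Z t Φ i) Φ Y) := (hZ i).isSmooth_dder t hΦ hY

/-- Derivative of a local vector field along a line. -/
lemma hasVel_field {Z : ℝ → (ι → M → ℝ) → ι → M → ℝ} (a : ℝ)
    (hZ : ∀ i, IsLocal n (fun t Φ => Z t Φ i)) (t b : ℝ) {Φ Y : ι → M → ℝ}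
    (hΦ : ∀ i, IsSmooth n (Φ i)) (hY : ∀ i, IsSmooth n (Y i)) :
    (timedPlots n M ι).HasVel
      (fun s => ((a, Z ((t, Φ) + s • (b, Y)).1 ((t, Φ) + s • (b, Y)).2) : ℝ × (ι → M → ℝ)))
      (0, fun i x => hd (fun u : ℝ × (ι → M → ℝ) => Z u.1 u.2 i x) (t, Φ) (b, Y)) := by
  refine timedPlots_hasVel (smoothMap_timed a hZ ℝ _
    ((timedPlots_pt t hΦ).line (timedPlots_pt b hY))) (by simp) fun i x => rfl

/-- The variation of the derivative of `G` along `a ∂/∂t + Z`: second derivatives commute, and the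
variation of `Z` gives the second term. -/
lemma fder_lieFun {G : ℝ → (ι → M → ℝ) → ℝ}
    (hG : (timedPlots n M ι).SmoothFun (fun u => G u.1 u.2)) (a : ℝ)
    {Z : ℝ → (ι → M → ℝ) → ι → M → ℝ} (hZ : ∀ i, IsLocal n (fun t Φ => Z t Φ i)) (t : ℝ)
    {Φ Y : ι → M → ℝ} (hΦ : ∀ i, IsSmooth n (Φ i)) (hY : ∀ i, IsSmooth n (Y i)) :
    fder (lieFun a Z G t) Φ Y =
      hd (fun v : ℝ × (ι → M → ℝ) => fder (G v.1) v.2 Y) (t, Φ) (a, Z t Φ) +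
        fder (G t) Φ (fun i => dder (fun Φ => Z t Φ i) Φ Y) := by
  have hv := hasVel_field a hZ t 0 hΦ hY
  have h1 := hG.hd_hd (smoothMap_timed a hZ) (timedPlots_pt t hΦ) (timedPlots_pt 0 hY) hv
  have e2 : (fun (i : ι) x => hd (fun u : ℝ × (ι → M → ℝ) => Z u.1 u.2 i x) (t, Φ) (0, Y)) =
      fun i => dder (fun Φ => Z t Φ i) Φ Y := by
    funext i x
    exact hd_timed_apply (fun t Φ => Z t Φ i) t Φ Y x
  rw [← hd_timed (lieFun a Z G)]
  refine h1.trans ?_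
  rw [hG.hd_comm (timedPlots_pt t hΦ) (timedPlots_pt 0 hY)
    (timedPlots_pt a fun i => (hZ i).isSmooth t hΦ), e2, hd_timed]
  simp only [← hd_timed G]

variable [CompactSpace M] [MeasurableSpace M] [BorelSpace M] {vol : Measure M}
  [IsFiniteMeasure vol] {S : Finset ι} {G : ℝ → (ι → M → ℝ) → ℝ}
  {E : ι → ℝ → (ι → M → ℝ) → M → ℝ}

lemma hd_integral_sum_mul (hE : ∀ i, IsLocal n (E i)) (t a : ℝ)
    {Φ Y Z : ι → M → ℝ} (hΦ : ∀ i, IsSmooth n (Φ i)) (hY : ∀ i, IsSmooth n (Y i))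
    (hZ : ∀ i, IsSmooth n (Z i)) :
    hd (fun v : ℝ × (ι → M → ℝ) => ∫ x, ∑ i ∈ S, E i v.1 v.2 x * Y i x ∂vol) (t, Φ) (a, Z) =
      ∫ x, ∑ i ∈ S, hd (fun v : ℝ × (ι → M → ℝ) => E i v.1 v.2 x) (t, Φ) (a, Z) * Y i x ∂vol := by
  have hl : ∀ i, IsLocal n (fun t (Φ : ι → M → ℝ) x => E i t Φ x * Y i x) := fun i =>
    (hE i).mul (isLocal_fixed (hY i))
  rw [(IsLocal.sum fun i (_ : i ∈ S) => hl i).hd_integral t a hΦ hZ]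
  congr 1
  funext x
  have hu := timedPlots_pt t hΦ
  have hv := timedPlots_pt a hZ
  rw [PlotSpace.SmoothFun.hd_fun_sum S (fun i _ => (hl i).smoothFun_timed x) hu hv]
  refine Finset.sum_congr rfl fun i _ => ?_
  have := ((hE i).smoothFun_timed x).hd_fun_mul
    (PlotSpace.smoothFun_const (𝒱 := timedPlots n M ι) (Y i x)) hu hv
  refine this.trans ?_
  have h0 : hd (fun _ : ℝ × (ι → M → ℝ) => Y i x) (t, Φ) (a, Z) = 0 := by simp [hd]
  rw [h0]
  ring

/-- The second variation of `G`, one of the variations being flat at the boundary, in terms of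
the Euler–Lagrange derivatives. -/
lemma HasEL.hd_fder (hG : HasEL n vol S G E) (t a : ℝ)
    {Φ Y Z : ι → M → ℝ} (hΦ : ∀ i, IsSmooth n (Φ i)) (hY : ∀ i, IsSmooth n (Y i))
    (hflat : ∀ i, FlatOnBoundary n (Y i)) (hZ : ∀ i, IsSmooth n (Z i)) :
    hd (fun v : ℝ × (ι → M → ℝ) => fder (G v.1) v.2 Y) (t, Φ) (a, Z) =
      ∫ x, ∑ i ∈ S, hd (fun v : ℝ × (ι → M → ℝ) => E i v.1 v.2 x) (t, Φ) (a, Z) * Y i x ∂vol := by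
  rw [← hd_integral_sum_mul hG.isLocal t a hΦ hY hZ]
  exact hd_timed_congr (F' := fun t Φ => fder (G t) Φ Y)
    (F := fun t Φ => ∫ x, ∑ i ∈ S, E i t Φ x * Y i x ∂vol)
    (fun t Φ hΦ => hG.spec t Φ Y hΦ hY hflat) t a hΦ hZ

/-- The variation of the derivative of `G` along a local vector field, for variations which are flat
at the boundary. There are no boundary terms, since the variation of `Z` is flat as well. -/
lemma HasEL.fder_lieFun (hG : HasEL n vol S G E) (a : ℝ)
    {Z : ℝ → (ι → M → ℝ) → ι → M → ℝ} (hZ : ∀ i, IsLocal n (fun t Φ => Z t Φ i)) (t : ℝ)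
    {Φ Y : ι → M → ℝ} (hΦ : ∀ i, IsSmooth n (Φ i)) (hY : ∀ i, IsSmooth n (Y i))
    (hflat : ∀ i, FlatOnBoundary n (Y i)) :
    fder (lieFun a Z G t) Φ Y = (∫ x, ∑ i ∈ S, lie a Z (E i) t Φ x * Y i x ∂vol) +
      ∫ x, ∑ i ∈ S, E i t Φ x * dder (fun Φ => Z t Φ i) Φ Y x ∂vol := by
  rw [GaugeField.fder_lieFun hG.smooth a hZ t hΦ hY,
    hG.hd_fder t a hΦ hY hflat fun i => (hZ i).isSmooth t hΦ]
  congr 1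
  exact hG.spec t Φ _ hΦ (smooth_dder_field hZ t hΦ hY) fun i x hx =>
    (hZ i).flatAt_dder t hΦ hY fun j => hflat j x hx

variable [T2Space M]

/-- The second variation is symmetric: boundary terms are absent as soon as one of the variations
is flat at the boundary. -/
lemma HasEL.integral_dder_symm (hvol : IsSmoothVolume n vol) (hG : HasEL n vol S G E) (t : ℝ)
    {Φ Y N : ι → M → ℝ} (hΦ : ∀ i, IsSmooth n (Φ i)) (hY : ∀ i, IsSmooth n (Y i))
    (hN : ∀ i, IsSmooth n (N i)) (hflat : ∀ i, FlatOnBoundary n (N i)) :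
    ∫ x, ∑ i ∈ S, dder (E i t) Φ Y x * N i x ∂vol =
      ∫ x, ∑ i ∈ S, dder (E i t) Φ N x * Y i x ∂vol := by
  classical
  have h1 : ∀ Y : ι → M → ℝ, (∀ i, IsSmooth n (Y i)) →
      hd (fun v : ℝ × (ι → M → ℝ) => fder (G v.1) v.2 Y) (t, Φ) (0, N) =
        ∫ x, ∑ i ∈ S, dder (E i t) Φ Y x * N i x ∂vol := by
    intro Y hY
    have h2 := hG.hd_fder t 0 hΦ hN hflat hY
    simp only [hd_timed_apply] at h2
    rw [← h2]
    simp only [← hd_timed G]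
    exact hG.smooth.hd_comm (timedPlots_pt t hΦ) (timedPlots_pt 0 hN) (timedPlots_pt 0 hY)
  choose T EL hEL hEL0 hspec using fun i => exists_eulerLagrange hvol (hG.isLocal i)
  set U := S.biUnion T with hU
  set a : ι → M → ℝ := fun j x => ∑ i ∈ S, EL i j t (Sum.elim Φ fun _ => N i) x with ha
  have hsm : ∀ i j, IsSmooth n (EL i j t (Sum.elim Φ fun _ => N i)) := fun i j =>
    (hEL i j).isSmooth t fun k => by
      cases k with
      | inl k => exact hΦ k
      | inr k => exact hN i
  -- `N` is flat, so that `Y` can be freed of its derivatives without any condition on `Y`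
  have h3 : ∀ Y : ι → M → ℝ, (∀ i, IsSmooth n (Y i)) →
      ∫ x, ∑ i ∈ S, dder (E i t) Φ Y x * N i x ∂vol = ∫ x, ∑ j ∈ U, a j x * Y j x ∂vol := by
    intro Y hY
    rw [integral_finsetSum (f := fun i x => dder (E i t) Φ Y x * N i x) _ fun i _ =>
      (((hG.isLocal i).isSmooth_dder t hΦ hY).mul (hN i)).integrable]
    have e1 : ∀ i ∈ S, ∫ x, dder (E i t) Φ Y x * N i x ∂vol =
        ∫ x, ∑ j ∈ U, EL i j t (Sum.elim Φ fun _ => N i) x * Y j x ∂vol := by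
      intro i hi
      simp only [mul_comm _ (N i _)]
      rw [hspec i t Φ Y (N i) hΦ hY (hN i) (Or.inl (hflat i))]
      congr 1
      funext x
      exact Finset.sum_subset (Finset.subset_biUnion_of_mem T hi) fun j _ hj => by
        simp [hEL0 i j hj]
    rw [Finset.sum_congr rfl e1, ← integral_finsetSum
      (f := fun i x => ∑ j ∈ U, EL i j t (Sum.elim Φ fun _ => N i) x * Y j x) _ fun i _ =>
      (integrable_finsetSum _ fun j _ => ((hsm i j).mul (hY j)).integrable)]
    congr 1
    funext x
    rw [Finset.sum_comm]
    simp only [ha, Finset.sum_mul]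
  rw [h3 Y hY]
  congr 1
  funext x
  -- the adjoint expression `a` is determined by variations supported in the interior, for which
  -- symmetry is the commutation of second derivatives
  refine sum_eq_sum_of_integral hvol (fun j _ => ?_)
    (fun i _ => (hG.isLocal i).isSmooth_dder t hΦ hN) (fun Y hY hYs => ?_) Y x
  · have : a j = ∑ i ∈ S, EL i j t (Sum.elim Φ fun _ => N i) := by
      funext x; simp [ha, Finset.sum_apply]
    rw [this]
    exact isSmooth_sum fun i _ => hsm i j
  · rw [← h3 Y hY, ← h1 Y hY]
    have := hG.hd_fder t 0 hΦ hY (fun i => flatOnBoundary_of_tsupport (hYs i)) hN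
    simpa only [hd_timed_apply] using this

/-- The Euler–Lagrange operators, smeared with `η = 0`, vanish; so they are flat where `η` is. -/
lemma exists_eulerLagrange_zero {μ : Measure M} (hμ : IsSmoothVolume n μ)
    {g : ℝ → (ι → M → ℝ) → M → ℝ} {S : Finset ι} {EL : ι → ℝ → (ι ⊕ Unit → M → ℝ) → M → ℝ}
    (hEL : ∀ i, IsLocal n (EL i)) (h0 : ∀ i ∉ S, ∀ t Ψ, EL i t Ψ = 0)
    (h : ∀ (t : ℝ) (Φ Y : ι → M → ℝ) (η : M → ℝ), (∀ i, IsSmooth n (Φ i)) →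
        (∀ i, IsSmooth n (Y i)) → IsSmooth n η →
        (FlatOnBoundary n η ∨ ∀ i, FlatOnBoundary n (Y i)) →
        ∫ x, η x * dder (g t) Φ Y x ∂μ =
          ∫ x, ∑ i ∈ S, EL i t (Sum.elim Φ fun _ => η) x * Y i x ∂μ)
    (t : ℝ) {Φ : ι → M → ℝ} (hΦ : ∀ i, IsSmooth n (Φ i)) (i : ι) :
    EL i t (Sum.elim Φ fun _ => 0) = 0 := by
  by_cases hi : i ∈ S
  · refine eq_zero_of_integral_sum hμ (f := fun i => EL i t (Sum.elim Φ fun _ => 0))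
      (fun i _ => (hEL i).isSmooth t fun k => ?_) (fun Y hY _ => ?_) i hi
    · cases k with
      | inl k => exact hΦ k
      | inr k => exact isSmooth_const 0
    · rw [← h t Φ Y 0 hΦ hY (isSmooth_const 0) (Or.inl flatOnBoundary_zero)]
      simp
  · exact h0 i hi t _

end SecondVariation

/-! ### Histories -/

section Histories

variable {n : ℕ} [NeZero n] {M : Type*} [TopologicalSpace M]
  [ChartedSpace (EuclideanHalfSpace n) M] [IsManifold (𝓡∂ n) ∞ M] {A Λ : Type*}

lemma histPlots_pt {u : Hist M A Λ} : (histPlots n M A Λ).Pt u ↔ SmoothHist n u := by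
  rw [smoothHist_iff]
  refine ⟨fun h i => (h i).comp (g := fun t : ℝ => ((0 : ℝ), t)) (by fun_prop), fun h i =>
    (h i).comp (g := fun q : ℝ × ℝ => q.2) contDiff_snd⟩

lemma histPlots_isPlot_iff {P : Type} [NormedAddCommGroup P] [NormedSpace ℝ P]
    [FiniteDimensional ℝ P] {c : P → Hist M A Λ} :
    (histPlots n M A Λ).IsPlot P c ↔ SmoothFamily n P c := smoothFamily_iff.symm

lemma jointSmooth_inst {P : Type} [NormedAddCommGroup P] [NormedSpace ℝ P]
    [FiniteDimensional ℝ P] {c : P → Hist M A Λ} (hc : (histPlots n M A Λ).IsPlot P c)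
    (i : A ⊕ (ℕ × Λ)) : JointSmooth n (P × ℝ) (fun q x => inst (c q.1) q.2 i x) := by
  cases i with
  | inl i => exact hc (Sum.inl i)
  | inr p => exact (hc (Sum.inr p.2)).iteratedDeriv_snd p.1

lemma jointSmooth_inst_param {P : Type} [NormedAddCommGroup P] [NormedSpace ℝ P]
    [FiniteDimensional ℝ P] {c : P → Hist M A Λ} (hc : (histPlots n M A Λ).IsPlot P c) (t : ℝ)
    (i : A ⊕ (ℕ × Λ)) : JointSmooth n P (fun p x => inst (c p) t i x) :=
  (jointSmooth_inst hc i).comp (g := fun p : P => (p, t)) (by fun_prop)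

lemma jointSmooth_inst_time {u : Hist M A Λ} (hu : SmoothHist n u) (i : A ⊕ (ℕ × Λ)) :
    JointSmooth n ℝ (fun t x => inst u t i x) :=
  (jointSmooth_inst (histPlots_pt.2 hu) i).comp (g := fun t : ℝ => ((0 : ℝ), t)) (by fun_prop)

lemma isSmooth_inst {u : Hist M A Λ} (hu : SmoothHist n u) (t : ℝ) (i : A ⊕ (ℕ × Λ)) :
    IsSmooth n (inst u t i) := (jointSmooth_inst_time hu i).isSmooth t

lemma SmoothHist.contDiff {u : Hist M A Λ} (hu : SmoothHist n u) (i : A ⊕ Λ) (x : M) :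
    ContDiff ℝ ∞ (fun t => u i t x) := (smoothHist_iff.1 hu i).contDiff x

lemma inst_add {u v : Hist M A Λ} (hu : SmoothHist n u) (hv : SmoothHist n v) (t : ℝ) :
    inst (u + v) t = inst u t + inst v t := by
  funext i x
  cases i with
  | inl i => rfl
  | inr p =>
    exact iteratedDeriv_fun_add (f := fun τ => u (Sum.inr p.2) τ x)
      (g := fun τ => v (Sum.inr p.2) τ x)
      (((hu.contDiff (Sum.inr p.2) x).of_le (by exact_mod_cast le_top)).contDiffAt)
      (((hv.contDiff (Sum.inr p.2) x).of_le (by exact_mod_cast le_top)).contDiffAt)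

lemma inst_smul {u : Hist M A Λ} (hu : SmoothHist n u) (r t : ℝ) :
    inst (r • u) t = r • inst u t := by
  funext i x
  cases i with
  | inl i => rfl
  | inr p =>
    exact iteratedDeriv_const_mul r (f := fun τ => u (Sum.inr p.2) τ x)
      (((hu.contDiff (Sum.inr p.2) x).of_le (by exact_mod_cast le_top)).contDiffAt)

lemma SmoothHist.add {u v : Hist M A Λ} (hu : SmoothHist n u) (hv : SmoothHist n v) :
    SmoothHist n (u + v) := histPlots_pt.1 ((histPlots_pt.2 hu).add (histPlots_pt.2 hv))

lemma SmoothHist.sub {u v : Hist M A Λ} (hu : SmoothHist n u) (hv : SmoothHist n v) :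
    SmoothHist n (u - v) := histPlots_pt.1 ((histPlots_pt.2 hu).sub (histPlots_pt.2 hv))

lemma SmoothHist.smul {u : Hist M A Λ} (hu : SmoothHist n u) (r : ℝ) :
    SmoothHist n (r • u) := histPlots_pt.1 ((histPlots_pt.2 hu).smul r)

lemma inst_sub {u v : Hist M A Λ} (hu : SmoothHist n u) (hv : SmoothHist n v) (t : ℝ) :
    inst (u - v) t = inst u t - inst v t := by
  rw [sub_eq_add_neg, ← neg_one_smul ℝ v, inst_add hu (hv.smul _), inst_smul hv]
  simp [sub_eq_add_neg]

lemma deriv_inst {c : ℝ → Hist M A Λ} {Y : Hist M A Λ} (hc : (histPlots n M A Λ).HasVel c Y)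
    (h0 : SmoothHist n (c 0)) (t : ℝ) (i : A ⊕ (ℕ × Λ)) (x : M) :
    deriv (fun s => inst (c s) t i x) 0 = inst Y t i x := by
  obtain ⟨R, hR, hcR, rfl⟩ := hc
  refine deriv_hadamard (g := fun s => inst (c s) t i x) (r := fun s => inst (R s) t i x) ?_ ?_
  · exact ((jointSmooth_inst_param hR t i).contDiff x).differentiable (by simp) |>.differentiableAt
  · intro s
    have hRs : SmoothHist n (R s) := histPlots_pt.1 (hR.pt s)
    show inst (c s) t i x = inst (c 0) t i x + s * inst (R s) t i x
    conv_lhs => rw [hcR s]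
    rw [inst_add h0 (hRs.smul s), inst_smul hRs]
    rfl

/-- A function-valued expression in the history, smooth along smooth families. -/
def HistSmooth (n : ℕ) [NeZero n] {M : Type*} [TopologicalSpace M]
    [ChartedSpace (EuclideanHalfSpace n) M] {A Λ : Type*} (f : Hist M A Λ → M → ℝ) : Prop :=
  ∀ (P : Type) [NormedAddCommGroup P] [NormedSpace ℝ P] [FiniteDimensional ℝ P]
    (c : P → Hist M A Λ), (histPlots n M A Λ).IsPlot P c → JointSmooth n P (fun p => f (c p))

lemma HistSmooth.smoothFun {f : Hist M A Λ → M → ℝ} (hf : HistSmooth n f) (x : M) :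
    (histPlots n M A Λ).SmoothFun (fun u => f u x) :=
  fun P _ _ _ c hc => (hf P c hc).contDiff x

lemma HistSmooth.isSmooth {f : Hist M A Λ → M → ℝ} (hf : HistSmooth n f) {u : Hist M A Λ}
    (hu : SmoothHist n u) : IsSmooth n (f u) :=
  (hf ℝ (fun _ => u) (histPlots_pt.2 hu)).isSmooth 0

lemma HistSmooth.hd {f : Hist M A Λ → M → ℝ} (hf : HistSmooth n f)
    {δ : Hist M A Λ → Hist M A Λ} (hδ : (histPlots n M A Λ).SmoothMap (histPlots n M A Λ) δ) :
    HistSmooth n (fun u x => GaugeField.hd (fun u => f u x) u (δ u)) := by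
  intro P _ _ _ c hc
  have h1 : (histPlots n M A Λ).IsPlot (ℝ × P) (fun q => c q.2 + q.1 • δ (c q.2)) :=
    (histPlots n M A Λ).add ((histPlots n M A Λ).comp contDiff_snd hc)
      ((histPlots n M A Λ).smul contDiff_fst
        ((histPlots n M A Λ).comp contDiff_snd (hδ P c hc)))
  exact (hf _ _ h1).deriv_fst.comp (g := fun p : P => ((0 : ℝ), p)) (by fun_prop)

lemma HistSmooth.isSmooth_hd {f : Hist M A Λ → M → ℝ} (hf : HistSmooth n f) {u Y : Hist M A Λ}
    (hu : SmoothHist n u) (hY : SmoothHist n Y) :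
    IsSmooth n (fun x => GaugeField.hd (fun u => f u x) u Y) :=
  (hf.hd (δ := fun _ => Y) fun P _ _ _ _ _ => (histPlots_pt.2 hY).plot P).isSmooth hu

lemma HistSmooth.sub {f g : Hist M A Λ → M → ℝ} (hf : HistSmooth n f) (hg : HistSmooth n g) :
    HistSmooth n (fun u x => f u x - g u x) := fun P _ _ _ c hc => (hf P c hc).sub (hg P c hc)

lemma IsLocal.histSmooth {f : ℝ → Conf M A Λ → M → ℝ} (hf : IsLocal n f) (t : ℝ) :
    HistSmooth n (fun u : Hist M A Λ => f t (inst u t)) := fun _ _ _ _ _ hc =>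
  hf.jointSmooth contDiff_const fun i => jointSmooth_inst_param hc t i

lemma histSmooth_deriv (i : A ⊕ Λ) (t : ℝ) :
    HistSmooth n (fun (u : Hist M A Λ) x => deriv (fun τ => u i τ x) t) := fun _ _ _ _ _ hc =>
  (hc i).deriv_snd.comp (g := fun p => (p, t)) (by fun_prop)

/-- Chain rule for an expression in the fields at fixed time. -/
lemma hd_inst (F : ℝ → Conf M A Λ → ℝ) (t : ℝ)
    {u Y : Hist M A Λ} (hu : SmoothHist n u) (hY : SmoothHist n Y) :
    hd (fun u => F t (inst u t)) u Y = fder (F t) (inst u t) (inst Y t) := by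
  have e : (fun s : ℝ => F t (inst (u + s • Y) t)) =
      fun s : ℝ => F t (inst u t + s • inst Y t) := by
    funext s
    rw [inst_add hu (hY.smul s), inst_smul hY]
  simp only [hd, fder, e]

lemma smoothFun_inst {F : ℝ → Conf M A Λ → ℝ}
    (hF : (timedPlots n M (A ⊕ (ℕ × Λ))).SmoothFun (fun u => F u.1 u.2)) (t : ℝ) :
    (histPlots n M A Λ).SmoothFun (fun u => F t (inst u t)) := fun P _ _ _ c hc =>
  hF P (fun p => (t, inst (c p) t)) ⟨contDiff_const, fun i => jointSmooth_inst_param hc t i⟩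

lemma hd_inst_apply (f : ℝ → Conf M A Λ → M → ℝ) (t : ℝ)
    {u Y : Hist M A Λ} (hu : SmoothHist n u) (hY : SmoothHist n Y) (x : M) :
    hd (fun u => f t (inst u t) x) u Y = dder (f t) (inst u t) (inst Y t) x :=
  hd_inst (fun t Φ => f t Φ x) t hu hY

/-- Smooth variations are the smooth maps on the space of histories. -/
lemma smoothVariation_iff {δ : Hist M A Λ → Hist M A Λ} :
    SmoothVariation n δ ↔ (histPlots n M A Λ).SmoothMap (histPlots n M A Λ) δ := by
  constructor
  · rintro ⟨-, h⟩ P _ _ _ c hc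
    let e := toEuclidean (E := P)
    have h1 := (histPlots n M A Λ).comp (g := e.symm) e.symm.contDiff hc
    have h2 := histPlots_isPlot_iff.2 (h _ _ (histPlots_isPlot_iff.1 h1))
    have h3 := (histPlots n M A Λ).comp (g := e) e.contDiff h2
    simpa using h3
  · intro h
    refine ⟨fun u hu => histPlots_pt.1 (h.pt (histPlots_pt.2 hu)), fun d c hc => ?_⟩
    exact histPlots_isPlot_iff.1 (h _ _ (histPlots_isPlot_iff.2 hc))

/-- The Lie bracket of two vector fields on the space of histories. -/
def comm (δ δ' : Hist M A Λ → Hist M A Λ) (u : Hist M A Λ) : Hist M A Λ :=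
  fun i t x => deriv (fun s : ℝ => δ' (u + s • δ u) i t x) 0
    - deriv (fun s : ℝ => δ (u + s • δ' u) i t x) 0

section Comm

variable {δ δ' : Hist M A Λ → Hist M A Λ}
  (hδ : (histPlots n M A Λ).SmoothMap (histPlots n M A Λ) δ)
  (hδ' : (histPlots n M A Λ).SmoothMap (histPlots n M A Λ) δ')

include hδ hδ' in
lemma isPlot_deriv_variation {P : Type} [NormedAddCommGroup P] [NormedSpace ℝ P]
    [FiniteDimensional ℝ P] {c : P → Hist M A Λ} (hc : (histPlots n M A Λ).IsPlot P c) :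
    (histPlots n M A Λ).IsPlot P
      (fun p i t x => deriv (fun s : ℝ => δ' (c p + s • δ (c p)) i t x) 0) := by
  intro i
  have h1 : (histPlots n M A Λ).IsPlot (ℝ × P) (fun q => c q.2 + q.1 • δ (c q.2)) :=
    (histPlots n M A Λ).add ((histPlots n M A Λ).comp contDiff_snd hc)
      ((histPlots n M A Λ).smul contDiff_fst
        ((histPlots n M A Λ).comp contDiff_snd (hδ P c hc)))
  have h2 := (hδ' _ _ h1 i).comp (g := fun q : ℝ × (P × ℝ) => ((q.1, q.2.1), q.2.2))
    (by fun_prop)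
  exact h2.deriv_fst.comp (g := fun q : P × ℝ => ((0 : ℝ), q)) (by fun_prop)

include hδ hδ' in
lemma smoothMap_comm : (histPlots n M A Λ).SmoothMap (histPlots n M A Λ) (comm δ δ') :=
  fun _ _ _ _ _ hc i =>
    (isPlot_deriv_variation hδ hδ' hc i).sub (isPlot_deriv_variation hδ' hδ hc i)

include hδ hδ' in
lemma hasVel_variation {u : Hist M A Λ} (hu : SmoothHist n u) :
    (histPlots n M A Λ).HasVel (fun s => δ' (u + s • δ u))
      (fun i t x => deriv (fun s : ℝ => δ' (u + s • δ u) i t x) 0) :=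
  histPlots_hasVel (hδ' ℝ _ ((histPlots_pt.2 hu).line (hδ.pt (histPlots_pt.2 hu))))
    fun _ _ _ => rfl

include hδ hδ' in
lemma hd_comm_eq {f : Hist M A Λ → ℝ} (hf : (histPlots n M A Λ).SmoothFun f) {u : Hist M A Λ}
    (hu : SmoothHist n u) :
    hd f u (comm δ δ' u) = hd (fun v => hd f v (δ' v)) u (δ u)
      - hd (fun v => hd f v (δ v)) u (δ' u) :=
  (hf.hd_commutator hδ hδ' (histPlots_pt.2 hu) (hasVel_variation hδ hδ' hu)
    (hasVel_variation hδ' hδ hu)).symm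

end Comm

end Histories

/-! ### The external boundary conditions -/

section Low

variable {n : ℕ} [NeZero n] {M : Type*} [TopologicalSpace M]
  [ChartedSpace (EuclideanHalfSpace n) M] [IsManifold (𝓡∂ n) ∞ M] {A Λ : Type*}

lemma low_eq (Φ : Conf M A Λ) :
    low Φ = fun j => Φ (Sum.map id (fun a => ((0 : ℕ), a)) j) := by
  funext j
  cases j <;> rfl

lemma low_add_smul (Φ Y : Conf M A Λ) (s : ℝ) : low (Φ + s • Y) = low Φ + s • low Y := by
  funext j
  cases j <;> rfl

lemma IsLocal.low {f : ℝ → (A ⊕ Λ → M → ℝ) → M → ℝ} (hf : IsLocal n f) :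
    IsLocal n (fun t (Φ : Conf M A Λ) => f t (GaugeField.low Φ)) := by
  have h := hf.reindex (ι := A ⊕ (ℕ × Λ)) (Sum.map id (fun a => ((0 : ℕ), a)))
  exact h.congr fun t Φ _ => by rw [low_eq]

lemma smooth_low {Φ : Conf M A Λ} (hΦ : ∀ i, IsSmooth n (Φ i)) (j : A ⊕ Λ) :
    IsSmooth n (low Φ j) := by
  rw [low_eq]
  exact hΦ _

lemma flat_low {Φ : Conf M A Λ} (hΦ : ∀ i, FlatOnBoundary n (Φ i)) (j : A ⊕ Λ) :
    FlatOnBoundary n (low Φ j) := by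
  rw [low_eq]
  exact hΦ _

lemma fder_low (F : (A ⊕ Λ → M → ℝ) → ℝ) (Φ Y : Conf M A Λ) :
    fder (fun Φ => F (low Φ)) Φ Y = fder F (low Φ) (low Y) := by
  simp only [fder, low_add_smul]

end Low

namespace GaugeTheory

variable {n : ℕ} [NeZero n] {M : Type*} [TopologicalSpace M]
  [ChartedSpace (EuclideanHalfSpace n) M] [MeasurableSpace M]
  {A Λ α : Type*} [Fintype A] [DecidableEq A] [Fintype Λ] (T : GaugeTheory n M A Λ α)

/-- The right-hand side of the equations of motion, as a direction at the configuration `Φ`;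
`δ_t` is the derivative along `∂/∂t + flow`. -/
def flow (_ : ℝ) (Φ : Conf M A Λ) : Conf M A Λ :=
  Sum.elim (fun i => T.XH i (low Φ)) (fun p => Φ (Sum.inr (p.1 + 1, p.2)))

/-- The equations of motion, as a direction at the configuration `inst u t`. -/
def eomConf (u : Hist M A Λ) (t : ℝ) : Conf M A Λ := Sum.elim (fun i => T.eom i u t) 0

section Local

variable [IsManifold (𝓡∂ n) ∞ M]

lemma isLocal_dH (i : A) : IsLocal n (fun _ => T.dH i) :=
  ((T.dh_local i).reindex Sum.inl).add (T.dφ_local i)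

lemma isLocal_XH (i : A) : IsLocal n (fun _ => T.XH i) :=
  IsLocal.sum fun j _ => (isLocal_const (T.σ i j)).mul (T.isLocal_dH j)

lemma isLocal_φ (a : Λ) :
    IsLocal n (fun _ (Φ : Conf M A Λ) => T.φ a (fun i => Φ (Sum.inl i))) :=
  (T.φ_local a).reindex Sum.inl

lemma isLocal_flow (i : A ⊕ (ℕ × Λ)) : IsLocal n (fun t Φ => T.flow t Φ i) := by
  cases i with
  | inl i => exact (T.isLocal_XH i).low
  | inr p => exact isLocal_field _

lemma smooth_flow (t : ℝ) {Φ : Conf M A Λ} (hΦ : ∀ i, IsSmooth n (Φ i)) (i : A ⊕ (ℕ × Λ)) :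
    IsSmooth n (T.flow t Φ i) := (T.isLocal_flow i).isSmooth t hΦ

lemma δt_eq_lie {f : ℝ → Conf M A Λ → M → ℝ} (hf : IsLocal n f) (t : ℝ) {Φ : Conf M A Λ}
    (hΦ : ∀ i, IsSmooth n (Φ i)) : T.δt f t Φ = lie 1 T.flow f t Φ := by
  funext x
  rw [hf.lie_eq 1 t hΦ (T.smooth_flow t hΦ), one_mul]
  rfl

lemma isLocal_δt {f : ℝ → Conf M A Λ → M → ℝ} (hf : IsLocal n f) : IsLocal n (T.δt f) :=
  (hf.lie 1 T.isLocal_flow).congr fun t _ hΦ => T.δt_eq_lie hf t hΦ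

lemma isLocal_iterate_δt {f : ℝ → Conf M A Λ → M → ℝ} (hf : IsLocal n f) (l : ℕ) :
    IsLocal n (T.δt^[l] f) := by
  induction l with
  | zero => exact hf
  | succ l ih =>
    rw [Function.iterate_succ_apply']
    exact T.isLocal_δt ih

lemma histSmooth_constraintAlong (a : Λ) (t : ℝ) :
    HistSmooth n (fun u => T.constraintAlong a u t) := (T.isLocal_φ a).histSmooth t

lemma histSmooth_eom (i : A) (t : ℝ) : HistSmooth n (fun u => T.eom i u t) :=
  (histSmooth_deriv (Sum.inl i) t).sub ((T.isLocal_XH i).low.histSmooth t)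

lemma histSmooth_χAlong (i : α) (t : ℝ) : HistSmooth n (fun u => T.χAlong i u t) :=
  (T.χ_local i).low.histSmooth t

lemma smooth_eomConf {u : Hist M A Λ} (hu : SmoothHist n u) (t : ℝ) (i : A ⊕ (ℕ × Λ)) :
    IsSmooth n (T.eomConf u t i) := by
  cases i with
  | inl i => exact (T.histSmooth_eom i t).isSmooth hu
  | inr p => exact isSmooth_const 0

lemma flat_eomConf {u : Hist M A Λ} (hu : T.External u) (t : ℝ) (i : A ⊕ (ℕ × Λ)) :
    FlatOnBoundary n (T.eomConf u t i) := by
  cases i with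
  | inl i => exact hu.2.2 i t
  | inr p => exact flatOnBoundary_zero

/-- The time derivative along a history is the derivative along `∂/∂t + flow`, up to the equations
of motion. -/
lemma deriv_along {F : ℝ → Conf M A Λ → ℝ}
    (hF : (timedPlots n M (A ⊕ (ℕ × Λ))).SmoothFun (fun u => F u.1 u.2)) {u : Hist M A Λ}
    (hu : SmoothHist n u) (t : ℝ) :
    deriv (fun τ => F τ (inst u τ)) t =
      lieFun 1 T.flow F t (inst u t) + fder (F t) (inst u t) (T.eomConf u t) := by
  have hΦ := isSmooth_inst hu t
  have hc : (timedPlots n M (A ⊕ (ℕ × Λ))).IsPlot ℝ (fun s : ℝ => (t + s, inst u (t + s))) :=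
    ⟨by fun_prop, fun i => (jointSmooth_inst_time hu i).comp (g := fun s : ℝ => t + s)
      (by fun_prop)⟩
  have hvel : (timedPlots n M (A ⊕ (ℕ × Λ))).HasVel (fun s : ℝ => (t + s, inst u (t + s)))
      ((1, T.flow t (inst u t)) + (0, T.eomConf u t)) := by
    have e : ((1 : ℝ), T.flow t (inst u t)) + (0, T.eomConf u t) =
        (1, T.flow t (inst u t) + T.eomConf u t) := by simp
    rw [e]
    refine timedPlots_hasVel hc ?_ fun i x => ?_
    · simp
    · show deriv (fun s => inst u (t + s) i x) 0 = _
      rw [deriv_comp_const_add (f := fun τ => inst u τ i x), add_zero]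
      cases i with
      | inl i =>
        show deriv (fun τ => u (Sum.inl i) τ x) t = T.XH i (low (inst u t)) x + T.eom i u t x
        simp [eom]
      | inr p =>
        show deriv (fun τ => iteratedDeriv p.1 (fun τ => u (Sum.inr p.2) τ x) τ) t =
          iteratedDeriv (p.1 + 1) (fun τ => u (Sum.inr p.2) τ x) t + 0
        rw [iteratedDeriv_succ, add_zero]
  have h1 := (hF.hasDerivAt (c := fun s : ℝ => (t + s, inst u (t + s))) (hc.pt 0) hvel).deriv
  have h2 := deriv_comp_const_add (f := fun τ => F τ (inst u τ)) t 0
  rw [add_zero] at h2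
  rw [← h2]
  refine h1.trans ?_
  simp only [add_zero]
  rw [hF.hd_add (timedPlots_pt t hΦ) (timedPlots_pt 1 (T.smooth_flow t hΦ))
    (timedPlots_pt 0 (T.smooth_eomConf hu t)), hd_timed]
  rfl

lemma deriv_along_apply {f : ℝ → Conf M A Λ → M → ℝ} (hf : IsLocal n f) {u : Hist M A Λ}
    (hu : SmoothHist n u) (t : ℝ) (x : M) :
    deriv (fun τ => f τ (inst u τ) x) t =
      T.δt f t (inst u t) x + dder (f t) (inst u t) (T.eomConf u t) x := by
  rw [T.δt_eq_lie hf t (isSmooth_inst hu t)]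
  exact T.deriv_along (F := fun t Φ => f t Φ x) (hf.smoothFun_timed x) hu t

/-- The local function `f` and all its derivatives vanish at the boundary along every history which
satisfies the external boundary conditions. -/
def FlatExternal (f : ℝ → Conf M A Λ → M → ℝ) : Prop :=
  ∀ u, T.External u → ∀ t, FlatOnBoundary n (f t (inst u t))

lemma jointSmooth_along {f : ℝ → Conf M A Λ → M → ℝ} (hf : IsLocal n f) {u : Hist M A Λ}
    (hu : SmoothHist n u) : JointSmooth n ℝ (fun τ => f τ (inst u τ)) :=
  hf.jointSmooth contDiff_id (jointSmooth_inst_time hu)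

/-- Along a history satisfying the external boundary conditions, the total time derivative of `f` is
flat at the boundary if `f` is, and differs from `δ_t f` by terms in the equations of motion, which
are flat too. -/
lemma FlatExternal.δt {f : ℝ → Conf M A Λ → M → ℝ} (hf : IsLocal n f) (h : T.FlatExternal f) :
    T.FlatExternal (T.δt f) := by
  intro u hu t x hx
  have h1 := (jointSmooth_along hf hu.1).flatAt_deriv (x := x) (fun s => h u hu s x hx) t
  have h2 := hf.flatAt_dder t (isSmooth_inst hu.1 t) (T.smooth_eomConf hu.1 t)
    fun i => T.flat_eomConf hu t i x hx
  have h3 : T.δt f t (inst u t) = (fun x => deriv (fun τ => f τ (inst u τ) x) t) -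
      dder (f t) (inst u t) (T.eomConf u t) := by
    funext x
    rw [Pi.sub_apply, T.deriv_along_apply hf hu.1 t x]
    ring
  rw [h3]
  exact h1.sub ((jointSmooth_along hf hu.1).deriv_line.isSmooth t)
    (hf.isSmooth_dder t (isSmooth_inst hu.1 t) (T.smooth_eomConf hu.1 t)) h2

end Local

/-! ### Regularity of the external boundary conditions -/

section Regular

variable [IsManifold (𝓡∂ n) ∞ M] {T} (hreg : T.RegularExternal)

include hreg in
lemma exists_external_curve {u Y : Hist M A Λ} (hu : T.External u) (hY : SmoothHist n Y)
    (h : T.LinExternal u Y) : ∃ c : ℝ → Hist M A Λ, (histPlots n M A Λ).IsPlot ℝ c ∧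
      (∀ s, T.External (c s)) ∧ c 0 = u ∧ (histPlots n M A Λ).HasVel c Y := by
  obtain ⟨c, hc, hcE, hc0, hcY⟩ := hreg u Y hu hY h
  have hp := histPlots_isPlot_iff.2 hc
  exact ⟨c, hp, hcE, hc0, histPlots_hasVel hp hcY⟩

include hreg in
/-- A function which vanishes on the histories satisfying the external boundary conditions has
vanishing derivative along the solutions of the linearised conditions. -/
lemma hd_eq_zero_of_external {f : Hist M A Λ → ℝ} (hf : (histPlots n M A Λ).SmoothFun f)
    (h0 : ∀ u, T.External u → f u = 0) {u Y : Hist M A Λ} (hu : T.External u)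
    (hY : SmoothHist n Y) (h : T.LinExternal u Y) : hd f u Y = 0 := by
  obtain ⟨c, hp, hcE, rfl, hv⟩ := exists_external_curve hreg hu hY h
  rw [← (hf.hasDerivAt (hp.pt 0) hv).deriv]
  simp [h0 _ (hcE _)]

include hreg in
lemma hd_eq_hd_of_external {f g : Hist M A Λ → ℝ} (hf : (histPlots n M A Λ).SmoothFun f)
    (hg : (histPlots n M A Λ).SmoothFun g)
    (h0 : ∀ u, T.External u → f u = g u) {u Y : Hist M A Λ} (hu : T.External u)
    (hY : SmoothHist n Y) (h : T.LinExternal u Y) : hd f u Y = hd g u Y := by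
  rw [← sub_eq_zero, ← hf.hd_fun_sub hg (histPlots_pt.2 hu.1) (histPlots_pt.2 hY)]
  exact hd_eq_zero_of_external hreg (hf.sub hg) (fun u hu => by rw [h0 u hu, sub_self]) hu hY h

include hreg in
lemma flat_hd_of_external {f : Hist M A Λ → M → ℝ} (hf : HistSmooth n f)
    (h0 : ∀ u, T.External u → FlatOnBoundary n (f u)) {u Y : Hist M A Λ} (hu : T.External u)
    (hY : SmoothHist n Y) (h : T.LinExternal u Y) :
    FlatOnBoundary n (fun x => hd (fun u => f u x) u Y) := by
  obtain ⟨c, hp, hcE, rfl, hv⟩ := exists_external_curve hreg hu hY h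
  intro x hx
  have e : (fun x => hd (fun u => f u x) (c 0) Y) = fun x => deriv (fun s => f (c s) x) 0 :=
    funext fun x => ((hf.smoothFun x).hasDerivAt (hp.pt 0) hv).deriv.symm
  rw [e]
  exact (hf ℝ c hp).flatAt_deriv (fun s => h0 _ (hcE s) x hx) 0

lemma PreservesInternal.smoothMap {δ : Hist M A Λ → Hist M A Λ} (h : T.PreservesInternal δ) :
    (histPlots n M A Λ).SmoothMap (histPlots n M A Λ) δ := smoothVariation_iff.1 h.1

include hreg in
/-- By regularity, the conditions `δ χ_E = 0` at external histories may be derived along `δ'`, so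
that the commutator preserves the external boundary conditions. -/
lemma preservesExternal_comm {δ δ' : Hist M A Λ → Hist M A Λ}
    (hδ : (histPlots n M A Λ).SmoothMap (histPlots n M A Λ) δ)
    (hδ' : (histPlots n M A Λ).SmoothMap (histPlots n M A Λ) δ')
    (h : T.PreservesExternal δ) (h' : T.PreservesExternal δ') :
    T.PreservesExternal (comm δ δ') := by
  intro u hu
  have hs := histPlots_pt.1 (hδ.pt (histPlots_pt.2 hu.1))
  have hs' := histPlots_pt.1 (hδ'.pt (histPlots_pt.2 hu.1))
  have key : ∀ f : Hist M A Λ → M → ℝ, HistSmooth n f →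
      (∀ u, T.External u → FlatOnBoundary n fun x => hd (fun u => f u x) u (δ u)) →
      (∀ u, T.External u → FlatOnBoundary n fun x => hd (fun u => f u x) u (δ' u)) →
      FlatOnBoundary n fun x => hd (fun u => f u x) u (comm δ δ' u) := by
    intro f hf h1 h2 x hx
    have e : (fun x => hd (fun u => f u x) u (comm δ δ' u)) =
        (fun x => hd (fun v => hd (fun u => f u x) v (δ' v)) u (δ u)) -
          (fun x => hd (fun v => hd (fun u => f u x) v (δ v)) u (δ' u)) :=
      funext fun x => hd_comm_eq hδ hδ' (hf.smoothFun x) hu.1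
    rw [e]
    exact FlatAt.sub ((hf.hd hδ').isSmooth_hd hu.1 hs) ((hf.hd hδ).isSmooth_hd hu.1 hs')
      (flat_hd_of_external hreg (hf.hd hδ') h2 hu hs (h u hu) x hx)
      (flat_hd_of_external hreg (hf.hd hδ) h1 hu hs' (h' u hu) x hx)
  exact ⟨fun a t => key _ (T.histSmooth_constraintAlong a t) (fun u hu => (h u hu).1 a t)
    fun u hu => (h' u hu).1 a t, fun i t => key _ (T.histSmooth_eom i t)
    (fun u hu => (h u hu).2 i t) fun u hu => (h' u hu).2 i t⟩

end Regular

section FlatHist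

variable [IsManifold (𝓡∂ n) ∞ M]

lemma flat_inst {Y : Hist M A Λ} (hY : SmoothHist n Y) (hflat : ∀ i t, FlatOnBoundary n (Y i t))
    (t : ℝ) (i : A ⊕ (ℕ × Λ)) : FlatOnBoundary n (inst Y t i) := by
  cases i with
  | inl i => exact hflat _ t
  | inr p =>
    obtain ⟨l, a⟩ := p
    intro x hx
    show FlatAt n (fun x => iteratedDeriv l (fun τ => Y (Sum.inr a) τ x) t) x
    induction l generalizing t with
    | zero => exact hflat _ t x hx
    | succ l ih =>
      simp only [iteratedDeriv_succ]
      exact ((smoothHist_iff.1 hY (Sum.inr a)).iteratedDeriv l).flatAt_deriv ih t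

lemma flat_deriv_hist {Y : Hist M A Λ} (hY : SmoothHist n Y)
    (hflat : ∀ i t, FlatOnBoundary n (Y i t)) (t : ℝ) (i : A ⊕ Λ) :
    FlatOnBoundary n (fun x => deriv (fun τ => Y i τ x) t) := fun x hx =>
  (smoothHist_iff.1 hY i).flatAt_deriv (fun s => hflat i s x hx) t

/-- The external boundary conditions only involve the jets of the history at the boundary. -/
lemma External.add_flat {T : GaugeTheory n M A Λ α} {u Y : Hist M A Λ} (hu : T.External u)
    (hY : SmoothHist n Y) (hflat : ∀ i t, FlatOnBoundary n (Y i t)) : T.External (u + Y) := by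
  have hloc : ∀ {f : ℝ → Conf M A Λ → M → ℝ}, IsLocal n f → ∀ t, ∀ x ∈ (𝓡∂ n).boundary M,
      FlatAt n (f t (inst (u + Y) t) - f t (inst u t)) x := fun {f} hf t x hx =>
    hf.flatAt_sub t (isSmooth_inst (hu.1.add hY) t) (isSmooth_inst hu.1 t) fun i => by
      rw [inst_add hu.1 hY, Pi.add_apply, add_sub_cancel_left]
      exact flat_inst hY hflat t i x hx
  refine ⟨hu.1.add hY, fun a t x hx => ?_, fun i t x hx => ?_⟩
  · have h1 := (hloc (T.isLocal_φ a) t x hx).add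
      (((T.isLocal_φ a).isSmooth t (isSmooth_inst (hu.1.add hY) t)).sub
        ((T.isLocal_φ a).isSmooth t (isSmooth_inst hu.1 t)))
      ((T.isLocal_φ a).isSmooth t (isSmooth_inst hu.1 t)) (hu.2.1 a t x hx)
    rwa [sub_add_cancel] at h1
  · have hXs := ((T.isLocal_XH i).low (A := A) (Λ := Λ)).isSmooth t (isSmooth_inst hu.1 t)
    have hXs' := ((T.isLocal_XH i).low (A := A) (Λ := Λ)).isSmooth t
      (isSmooth_inst (hu.1.add hY) t)
    have hds := ((smoothHist_iff.1 hY (Sum.inl i)).deriv_line).isSmooth t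
    have h1 := hloc (T.isLocal_XH i).low t x hx
    have h2 := (FlatAt.sub hds (hXs'.sub hXs) (flat_deriv_hist hY hflat t (Sum.inl i) x hx) h1).add
      (hds.sub (hXs'.sub hXs)) ((T.histSmooth_eom i t).isSmooth hu.1) (hu.2.2 i t x hx)
    refine h2.congr (Eventually.of_forall fun y => ?_)
    have hd1 : deriv (fun τ => (u + Y) (Sum.inl i) τ y) t =
        deriv (fun τ => u (Sum.inl i) τ y) t + deriv (fun τ => Y (Sum.inl i) τ y) t :=
      deriv_fun_add (((hu.1.contDiff (Sum.inl i) y).differentiable (by simp)).differentiableAt)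
        (((hY.contDiff (Sum.inl i) y).differentiable (by simp)).differentiableAt)
    simp only [eom, Pi.add_apply, Pi.sub_apply] at hd1 ⊢
    rw [hd1]
    ring

/-- Adding multiples of a flat history gives a line of external histories. -/
lemma linExternal_of_flat {T : GaugeTheory n M A Λ α} {u Y : Hist M A Λ} (hu : T.External u)
    (hY : SmoothHist n Y) (hflat : ∀ i t, FlatOnBoundary n (Y i t)) : T.LinExternal u Y := by
  have hl := (histPlots_pt.2 hu.1).line (histPlots_pt.2 hY)
  have hE : ∀ s : ℝ, T.External (u + s • Y) := fun s => hu.add_flat (hY.smul s) fun i t x hx =>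
    FlatAt.smul ((smoothHist_iff.1 hY i).isSmooth t) s (hflat i t x hx)
  exact ⟨fun a t x hx => ((T.histSmooth_constraintAlong a t) ℝ _ hl).flatAt_deriv
      (fun s => (hE s).2.1 a t x hx) 0,
    fun i t x hx => ((T.histSmooth_eom i t) ℝ _ hl).flatAt_deriv
      (fun s => (hE s).2.2 i t x hx) 0⟩

lemma LinExternal.add {T : GaugeTheory n M A Λ α} {u Y Z : Hist M A Λ} (hu : SmoothHist n u)
    (hY : SmoothHist n Y) (hZ : SmoothHist n Z) (h : T.LinExternal u Y) (h' : T.LinExternal u Z) :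
    T.LinExternal u (Y + Z) := by
  have key : ∀ f : Hist M A Λ → M → ℝ, HistSmooth n f →
      (FlatOnBoundary n fun x => hd (fun u => f u x) u Y) →
      (FlatOnBoundary n fun x => hd (fun u => f u x) u Z) →
      FlatOnBoundary n fun x => hd (fun u => f u x) u (Y + Z) := by
    intro f hf h1 h2 x hx
    have e : (fun x => hd (fun u => f u x) u (Y + Z)) =
        (fun x => hd (fun u => f u x) u Y) + fun x => hd (fun u => f u x) u Z :=
      funext fun x => (hf.smoothFun x).hd_add (histPlots_pt.2 hu) (histPlots_pt.2 hY)
        (histPlots_pt.2 hZ)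
    rw [e]
    exact FlatAt.add (hf.isSmooth_hd hu hY) (hf.isSmooth_hd hu hZ) (h1 x hx) (h2 x hx)
  exact ⟨fun a t => key _ (T.histSmooth_constraintAlong a t) (h.1 a t) (h'.1 a t),
    fun i t => key _ (T.histSmooth_eom i t) (h.2 i t) (h'.2 i t)⟩

end FlatHist

end GaugeTheory

/-! ### Functionals vanishing on external histories -/

section UpTo

variable {A Λ : Type*} [Fintype A] [Fintype Λ]

@[simp] lemma inl_mem_upTo (k : ℕ) (i : A) : (Sum.inl i : A ⊕ (ℕ × Λ)) ∈ upTo A Λ k := by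
  simp [upTo]

@[simp] lemma inr_mem_upTo (k : ℕ) (p : ℕ × Λ) :
    (Sum.inr p : A ⊕ (ℕ × Λ)) ∈ upTo A Λ k ↔ p.1 ≤ k := by
  obtain ⟨l, a⟩ := p
  simp [upTo]

lemma upTo_mono {k k' : ℕ} (h : k ≤ k') : upTo A Λ k ⊆ upTo A Λ k' := by
  intro i
  cases i with
  | inl i => simp
  | inr p => simpa using fun h' => h'.trans h

lemma exists_subset_upTo (S : Finset (A ⊕ (ℕ × Λ))) : ∃ k, S ⊆ upTo A Λ k := by
  refine ⟨S.sup (Sum.elim (fun _ => 0) Prod.fst), fun i hi => ?_⟩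
  cases i with
  | inl i => simp
  | inr p => simpa using Finset.le_sup (f := Sum.elim (fun _ => 0) Prod.fst) hi

lemma sum_upTo (k : ℕ) (f : A ⊕ (ℕ × Λ) → ℝ) : ∑ i ∈ upTo A Λ k, f i =
    ∑ i, f (Sum.inl i) + ∑ l ∈ Finset.range (k + 1), ∑ a, f (Sum.inr (l, a)) := by
  rw [upTo, Finset.sum_disjSum, Finset.sum_product]

end UpTo

lemma fder_eq_hd {ι M : Type*} (F : (ι → M → ℝ) → ℝ) (Φ Y : ι → M → ℝ) :
    fder F Φ Y = hd (fun u : ℝ × (ι → M → ℝ) => F u.2) (0, Φ) (0, Y) :=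
  by simp [hd, fder]

section PolyHist

variable {n : ℕ} [NeZero n] {M : Type*} [TopologicalSpace M]
  [ChartedSpace (EuclideanHalfSpace n) M] [IsManifold (𝓡∂ n) ∞ M] {A Λ : Type*}

/-- A history, polynomial in time, with `Ψ` as its configuration at time `t₀`, up to order `N`. -/
def polyHist (N : ℕ) (t₀ : ℝ) (Ψ : Conf M A Λ) : Hist M A Λ :=
  Sum.elim (fun i _ => Ψ (Sum.inl i)) (fun a t x =>
    ∑ l ∈ Finset.range (N + 1), ((l.factorial : ℝ)⁻¹ * Ψ (Sum.inr (l, a)) x) * (t - t₀) ^ l)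

lemma jointSmooth_const {P : Type} [NormedAddCommGroup P] [NormedSpace ℝ P] {f : M → ℝ}
    (hf : IsSmooth n f) : JointSmooth n P (fun _ x => f x) := hf.jointSmooth P

lemma smoothHist_polyHist (N : ℕ) (t₀ : ℝ) {Ψ : Conf M A Λ} (hΨ : ∀ i, IsSmooth n (Ψ i)) :
    SmoothHist n (polyHist N t₀ Ψ) := by
  rw [smoothHist_iff]
  intro i
  cases i with
  | inl i => exact jointSmooth_const (hΨ _)
  | inr a =>
    exact JointSmooth.sum (s := Finset.range (N + 1)) (f := fun l t x =>
      ((l.factorial : ℝ)⁻¹ * Ψ (Sum.inr (l, a)) x) * (t - t₀) ^ l) fun l _ =>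
      ((jointSmooth_param contDiff_const).mul (jointSmooth_const (hΨ _))).mul
      (jointSmooth_param (a := fun t : ℝ => (t - t₀) ^ l) (by fun_prop))

lemma flat_polyHist (N : ℕ) (t₀ : ℝ) {Ψ : Conf M A Λ} (hΨ : ∀ i, IsSmooth n (Ψ i))
    (hflat : ∀ i, FlatOnBoundary n (Ψ i)) (i : A ⊕ Λ) (t : ℝ) :
    FlatOnBoundary n (polyHist N t₀ Ψ i t) := by
  cases i with
  | inl i => exact hflat _
  | inr a =>
    intro x hx
    have e : polyHist N t₀ Ψ (Sum.inr a) t = ∑ l ∈ Finset.range (N + 1),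
        ((l.factorial : ℝ)⁻¹ * (t - t₀) ^ l) • Ψ (Sum.inr (l, a)) := by
      funext x
      simp only [polyHist, Sum.elim_inr, Finset.sum_apply, Pi.smul_apply, smul_eq_mul]
      exact Finset.sum_congr rfl fun l _ => by ring
    rw [e]
    exact flatAt_sum (fun l _ => (hΨ _).smul _) fun l _ => FlatAt.smul (hΨ _) _ (hflat _ x hx)

lemma inst_polyHist [Fintype A] [Fintype Λ] (N : ℕ) (t₀ : ℝ) (Ψ : Conf M A Λ)
    {i : A ⊕ (ℕ × Λ)} (hi : i ∈ upTo A Λ N) : inst (polyHist N t₀ Ψ) t₀ i = Ψ i := by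
  cases i with
  | inl i => rfl
  | inr p =>
    obtain ⟨m, a⟩ := p
    have hm : m ≤ N := by simpa using hi
    funext x
    show iteratedDeriv m (fun τ => ∑ l ∈ Finset.range (N + 1),
      ((l.factorial : ℝ)⁻¹ * Ψ (Sum.inr (l, a)) x) * (τ - t₀) ^ l) t₀ = _
    rw [iteratedDeriv_fun_sum fun l _ => by fun_prop]
    have h : ∀ l, iteratedDeriv m (fun τ =>
        ((l.factorial : ℝ)⁻¹ * Ψ (Sum.inr (l, a)) x) * (τ - t₀) ^ l) t₀ =
        if m = l then Ψ (Sum.inr (l, a)) x else 0 := by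
      intro l
      have h1 := congrFun (iteratedDeriv_comp_sub_const m (fun τ : ℝ => τ ^ l) t₀) t₀
      beta_reduce at h1
      rw [sub_self, iteratedDeriv_fun_pow_zero] at h1
      rw [iteratedDeriv_const_mul_field, h1]
      have := Nat.factorial_ne_zero l
      split_ifs
      · field_simp
      · simp
    rw [Finset.sum_congr rfl fun l _ => h l]
    rw [Finset.sum_ite_eq, if_pos (Finset.mem_range.2 (Nat.lt_succ_of_le hm))]

end PolyHist

namespace GaugeTheory

variable {n : ℕ} [NeZero n] {M : Type*} [TopologicalSpace M] [CompactSpace M] [T2Space M]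
  [ChartedSpace (EuclideanHalfSpace n) M] [IsManifold (𝓡∂ n) ∞ M] [MeasurableSpace M]
  [BorelSpace M] {A Λ α : Type*} [Fintype A] [DecidableEq A] [Fintype Λ]
  (T : GaugeTheory n M A Λ α)

lemma isFiniteMeasure_vol : IsFiniteMeasure T.vol := T.vol_smooth.isFiniteMeasure

lemma isFiniteMeasure_bvol : IsFiniteMeasure T.bvol := T.bvol_smooth.isFiniteMeasure

/-- A local functional which vanishes on all histories satisfying the external boundary conditions
has vanishing Euler–Lagrange derivatives at every configuration: inside `M` and at one instant,
these histories can be prescribed arbitrarily. -/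
lemma fder_eq_zero_of_external {K : ℝ → Conf M A Λ → ℝ}
    (hK : LocalFunctional n T.vol T.bvol K) {u₀ : Hist M A Λ} (hu₀ : T.External u₀)
    (h : ∀ u, T.External u → ∀ t, K t (inst u t) = 0) (t : ℝ) {Φ Y : Conf M A Λ}
    (hΦ : ∀ i, IsSmooth n (Φ i)) (hY : ∀ i, IsSmooth n (Y i))
    (hflat : ∀ i, FlatOnBoundary n (Y i)) : fder (K t) Φ Y = 0 := by
  obtain ⟨S, E, hE, -⟩ := hK.exists_hasEL T.vol_smooth T.bvol_smooth
  -- `K` depends on finitely many fields only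
  have hfin : ∃ N, ∀ t (Φ Φ' : Conf M A Λ), (∀ i, IsSmooth n (Φ i)) →
      (∀ i, IsSmooth n (Φ' i)) → (∀ i ∈ upTo A Λ N, Φ i = Φ' i) → K t Φ = K t Φ' := by
    obtain ⟨g, k, hg, hk, hgk⟩ := hK
    obtain ⟨S₁, h₁⟩ := hg.congr_germ
    obtain ⟨S₂, h₂⟩ := hk.congr_germ
    obtain ⟨N₁, hN₁⟩ := exists_subset_upTo S₁
    obtain ⟨N₂, hN₂⟩ := exists_subset_upTo S₂
    refine ⟨max N₁ N₂, fun t Φ Φ' hΦ hΦ' he => ?_⟩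
    have e1 : g t Φ = g t Φ' := funext fun x => h₁ t Φ Φ' hΦ hΦ' x fun i hi =>
      Eventually.of_forall fun y => by rw [he i (upTo_mono (le_max_left _ _) (hN₁ hi))]
    have e2 : k t Φ = k t Φ' := funext fun x => h₂ t Φ Φ' hΦ hΦ' x fun i hi =>
      Eventually.of_forall fun y => by rw [he i (upTo_mono (le_max_right _ _) (hN₂ hi))]
    rw [hgk t Φ hΦ, hgk t Φ' hΦ', e1, e2]
  obtain ⟨N, hN⟩ := hfin
  have hi₀ := isSmooth_inst hu₀.1 t
  -- adding to `u₀` a history which is polynomial in time changes its configuration at time `t` by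
  -- an arbitrary flat `Ψ`, without leaving the external histories
  have hvan : ∀ Ψ : Conf M A Λ, (∀ i, IsSmooth n (Ψ i)) → (∀ i, FlatOnBoundary n (Ψ i)) →
      K t (inst u₀ t + Ψ) = 0 := by
    intro Ψ hΨ hΨf
    have hp := smoothHist_polyHist N t hΨ
    rw [← h _ (hu₀.add_flat hp (flat_polyHist N t hΨ hΨf)) t, inst_add hu₀.1 hp]
    refine hN t _ _ (fun i => (hi₀ i).add (hΨ i)) (fun i => (hi₀ i).add (isSmooth_inst hp t i))
      fun i hi => ?_
    rw [Pi.add_apply, Pi.add_apply, inst_polyHist N t Ψ hi]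
  -- near a given interior point, `Φ` is of the form `inst u₀ t + Ψ` with `Ψ` supported in the
  -- interior
  have hzero : ∀ i ∈ S, E i t Φ = 0 := by
    intro i hi
    refine Continuous.ext_on (dense_interior (n := n)) ((hE.isLocal i).isSmooth t hΦ).continuous
      continuous_zero fun x hx => ?_
    obtain ⟨ρ, hρ, -, hρ1, hρs⟩ := exists_bump (n := n) isOpen_manifoldInterior hx
    set Ψ : Conf M A Λ := fun i => ρ * (Φ i - inst u₀ t i) with hΨd
    have hΨ : ∀ i, IsSmooth n (Ψ i) := fun i => hρ.mul ((hΦ i).sub (hi₀ i))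
    have hΨf : ∀ i, FlatOnBoundary n (Ψ i) := fun i =>
      flatOnBoundary_of_tsupport ((tsupport_mul_subset_left).trans hρs)
    have e1 : E i t Φ x = E i t (inst u₀ t + Ψ) x := by
      refine (hE.isLocal i).congr_germ_all t hΦ (fun i => (hi₀ i).add (hΨ i)) fun j => ?_
      filter_upwards [hρ1] with y hy
      simp [hΨd, hy]
    rw [e1]
    refine congrFun (eq_zero_of_integral_sum T.vol_smooth (S := S)
      (f := fun i => E i t (inst u₀ t + Ψ)) (fun i _ => (hE.isLocal i).isSmooth t
      fun i => (hi₀ i).add (hΨ i)) (fun Y hY hYs => ?_) i hi) x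
    have hYf : ∀ i, FlatOnBoundary n (Y i) := fun i => flatOnBoundary_of_tsupport (hYs i)
    rw [← hE.spec t (inst u₀ t + Ψ) Y (fun i => (hi₀ i).add (hΨ i)) hY hYf, fder]
    have e2 : ∀ s : ℝ, K t (inst u₀ t + Ψ + s • Y) = 0 := by
      intro s
      rw [add_assoc]
      exact hvan _ (fun i => (hΨ i).add ((hY i).smul s)) fun i y hy =>
        (FlatAt.add (hΨ i) ((hY i).smul s) (hΨf i y hy) (FlatAt.smul (hY i) s (hYf i y hy)))
    simp [e2]
  rw [hE.spec t Φ Y hΦ hY hflat]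
  have e3 : ∀ x, ∑ i ∈ S, E i t Φ x * Y i x = 0 := fun x =>
    Finset.sum_eq_zero fun i hi => by simp [hzero i hi]
  simp [e3]

/-! ### The hamiltonian -/

section Hamiltonian

lemma isLocal_hamiltonian_density : IsLocal n (fun _ (Φ : A ⊕ Λ → M → ℝ) x =>
    T.h (fun i => Φ (Sum.inl i)) x + ∑ a, Φ (Sum.inr a) x * T.φ a (fun i => Φ (Sum.inl i)) x) :=
  (T.h_local.reindex Sum.inl).add (IsLocal.sum fun a _ =>
    (isLocal_field (Sum.inr a)).mul ((T.φ_local a).reindex Sum.inl))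

lemma localFunctional_H : LocalFunctional n T.vol T.bvol (fun _ => T.H) :=
  ⟨_, _, T.isLocal_hamiltonian_density, T.b_local, fun _ _ _ => rfl⟩

/-- The variational derivatives of the hamiltonian. -/
lemma isVarDeriv_H : IsVarDeriv n T.vol Finset.univ T.H
    (Sum.elim T.dH (fun a Φ => T.φ a (fun i => Φ (Sum.inl i)))) := by
  have := T.isFiniteMeasure_vol
  have := T.isFiniteMeasure_bvol
  intro Φ Y hΦ hY hYs
  set z : A → M → ℝ := fun i => Φ (Sum.inl i) with hz
  set l : Λ → M → ℝ := fun a => Φ (Sum.inr a) with hl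
  have hΦe : Φ = Sum.elim z l := by funext i; cases i <;> rfl
  set yz : A → M → ℝ := fun i => Y (Sum.inl i) with hyz
  have h0 : ∀ i, IsSmooth n ((0 : A ⊕ Λ → M → ℝ) i) := fun _ => isSmooth_const 0
  have hzs : ∀ i, IsSmooth n (z i) := fun i => hΦ _
  have hyzs : ∀ i, IsSmooth n (yz i) := fun i => hY _
  have hYz : ∀ i, IsSmooth n ((Sum.elim yz 0 : A ⊕ Λ → M → ℝ) i) := by
    intro i
    cases i
    exacts [hY _, isSmooth_const 0]
  have hYl : ∀ i, IsSmooth n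
      ((Sum.elim (0 : A → M → ℝ) (fun a => Y (Sum.inr a)) : A ⊕ Λ → M → ℝ) i) := by
    intro i
    cases i
    exacts [isSmooth_const 0, hY _]
  have hYe : Y = Sum.elim yz 0 + Sum.elim (0 : A → M → ℝ) (fun a => Y (Sum.inr a)) := by
    funext i
    cases i <;> simp [hyz]
  have hh : IsLocal n (fun _ (Φ : A ⊕ Λ → M → ℝ) => T.h fun i => Φ (Sum.inl i)) :=
    T.h_local.reindex Sum.inl
  have hp : IsLocal n (fun _ (Φ : A ⊕ Λ → M → ℝ) x =>
      ∑ a, Φ (Sum.inr a) x * T.φ a (fun i => Φ (Sum.inl i)) x) :=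
    IsLocal.sum fun a _ => (isLocal_field (Sum.inr a)).mul ((T.φ_local a).reindex Sum.inl)
  -- the boundary term of `H` does not contribute to variations supported in the interior
  have hsplit : fder T.H Φ Y = fder (fun Φ : A ⊕ Λ → M → ℝ =>
        ∫ x, T.h (fun i => Φ (Sum.inl i)) x ∂T.vol) Φ Y
      + fder (fun Φ : A ⊕ Λ → M → ℝ =>
        ∫ x, ∑ a, Φ (Sum.inr a) x * T.φ a (fun i => Φ (Sum.inl i)) x ∂T.vol) Φ Y := by
    have e : ∀ Φ, (∀ i, IsSmooth n (Φ i)) → T.H Φ =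
        ((∫ x, T.h (fun i => Φ (Sum.inl i)) x ∂T.vol)
          + ∫ x, ∑ a, Φ (Sum.inr a) x * T.φ a (fun i => Φ (Sum.inl i)) x ∂T.vol)
          + ∫ x, T.b Φ x ∂T.bvol := by
      intro Φ hΦ
      rw [H, integral_add (hh.isSmooth 0 hΦ).integrable (hp.isSmooth 0 hΦ).integrable]
    rw [fder_congr e hΦ hY]
    have s1 := hh.smoothFun_integral (μ := T.vol)
    have s2 := hp.smoothFun_integral (μ := T.vol)
    have s3 := T.b_local.smoothFun_integral (μ := T.bvol)
    have hu := timedPlots_pt (0 : ℝ) hΦ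
    have hv := timedPlots_pt (0 : ℝ) hY
    have a1 := (s1.add s2).hd_fun_add s3 hu hv
    rw [s1.hd_fun_add s2 hu hv] at a1
    have b3 := T.b_local.fder_boundary T.bvol_smooth 0 hΦ hY
      fun i => flatOnBoundary_of_tsupport (hYs i)
    have c1 := hd_timed (fun _ (Φ : A ⊕ Λ → M → ℝ) =>
      ∫ x, T.h (fun i => Φ (Sum.inl i)) x ∂T.vol) 0 Φ Y
    have c2 := hd_timed (fun _ (Φ : A ⊕ Λ → M → ℝ) =>
      ∫ x, ∑ a, Φ (Sum.inr a) x * T.φ a (fun i => Φ (Sum.inl i)) x ∂T.vol) 0 Φ Y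
    have c3 := hd_timed (fun _ (Φ : A ⊕ Λ → M → ℝ) => ∫ x, T.b Φ x ∂T.bvol) 0 Φ Y
    rw [c1, c2, c3, b3, add_zero] at a1
    rw [← a1]
    exact fder_eq_hd _ Φ Y
  have hz1 : fder (fun Φ : A ⊕ Λ → M → ℝ => ∫ x, T.h (fun i => Φ (Sum.inl i)) x ∂T.vol) Φ Y =
      ∫ x, ∑ i, T.dh i z x * yz i x ∂T.vol :=
    T.dh_spec z yz hzs hyzs fun i => hYs _
  have hz2 : fder (fun Φ : A ⊕ Λ → M → ℝ =>
        ∫ x, ∑ a, Φ (Sum.inr a) x * T.φ a (fun i => Φ (Sum.inl i)) x ∂T.vol) Φ Y =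
      (∫ x, ∑ i, T.dφ i Φ x * yz i x ∂T.vol) + ∫ x, ∑ a, T.φ a z x * Y (Sum.inr a) x ∂T.vol := by
    have e1 : fder (fun Φ : A ⊕ Λ → M → ℝ =>
        ∫ x, ∑ a, Φ (Sum.inr a) x * T.φ a (fun i => Φ (Sum.inl i)) x ∂T.vol) Φ (Sum.elim yz 0) =
        ∫ x, ∑ i, T.dφ i Φ x * yz i x ∂T.vol := by
      have := T.dφ_spec l (fun a => hΦ _) z yz hzs hyzs fun i => hYs _
      beta_reduce at this
      rw [← hΦe] at this
      rw [← this]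
      simp only [fder]
      congr 1
      funext s
      congr 1
      funext x
      refine Finset.sum_congr rfl fun a _ => ?_
      simp [hl]
      left
      rfl
    have e2 : fder (fun Φ : A ⊕ Λ → M → ℝ =>
        ∫ x, ∑ a, Φ (Sum.inr a) x * T.φ a (fun i => Φ (Sum.inl i)) x ∂T.vol) Φ
        (Sum.elim (0 : A → M → ℝ) (fun a => Y (Sum.inr a))) =
        ∫ x, ∑ a, T.φ a z x * Y (Sum.inr a) x ∂T.vol := by
      rw [hp.fder_integral 0 hΦ hYl]
      congr 1
      funext x
      have e3 : (fun s : ℝ => ∑ a, (Φ + s • (Sum.elim (0 : A → M → ℝ) (fun a => Y (Sum.inr a)) :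
            A ⊕ Λ → M → ℝ)) (Sum.inr a) x * T.φ a (fun i => (Φ + s • (Sum.elim (0 : A → M → ℝ)
            (fun a => Y (Sum.inr a)) : A ⊕ Λ → M → ℝ)) (Sum.inl i)) x) =
          fun s : ℝ => ∑ a, (Φ (Sum.inr a) x + s * Y (Sum.inr a) x) * T.φ a z x := by
        funext s
        refine Finset.sum_congr rfl fun a _ => ?_
        simp [hz]
      simp only [dder, e3]
      have e4 : HasDerivAt (fun s : ℝ => ∑ a, (Φ (Sum.inr a) x + s * Y (Sum.inr a) x) * T.φ a z x)
          (∑ a, (1 * Y (Sum.inr a) x) * T.φ a z x) 0 :=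
        HasDerivAt.fun_sum fun a _ => (((hasDerivAt_id (0 : ℝ)).mul_const _).const_add _).mul_const _
      rw [e4.deriv]
      exact Finset.sum_congr rfl fun a _ => by ring
    rw [← e1, ← e2, fder_eq_hd, fder_eq_hd, fder_eq_hd,
      ← (hp.smoothFun_integral (μ := T.vol)).hd_add (timedPlots_pt 0 hΦ) (timedPlots_pt 0 hYz)
        (timedPlots_pt 0 hYl)]
    congr 1
    exact Prod.ext (by simp) hYe
  rw [hsplit, hz1, hz2, ← add_assoc, ← integral_add, ← integral_add]
  · congr 1
    funext x
    rw [Fintype.sum_sum_type, ← Finset.sum_add_distrib]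
    congr 1
    refine Finset.sum_congr rfl fun i _ => ?_
    simp only [Sum.elim_inl, dH, Pi.add_apply, add_mul]
    rfl
  · exact (integrable_finsetSum _ fun i _ => (((T.dh_local i).isSmooth 0 hzs).mul
      (hyzs i)).integrable).add (integrable_finsetSum _ fun i _ =>
      (((T.dφ_local i).isSmooth 0 hΦ).mul (hyzs i)).integrable)
  · exact integrable_finsetSum _ fun a _ => (((T.φ_local a).isSmooth 0 hzs).mul
      (hY _)).integrable
  · exact integrable_finsetSum _ fun i _ => (((T.dh_local i).isSmooth 0 hzs).mul
      (hyzs i)).integrable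
  · exact integrable_finsetSum _ fun i _ => (((T.dφ_local i).isSmooth 0 hΦ).mul
      (hyzs i)).integrable

end Hamiltonian

end GaugeTheory

/-! ### Couples -/

namespace GaugeTheory

variable {n : ℕ} [NeZero n] {M : Type*} [TopologicalSpace M]
  [ChartedSpace (EuclideanHalfSpace n) M] [IsManifold (𝓡∂ n) ∞ M] [MeasurableSpace M]
  {A Λ α : Type*} [Fintype A] [DecidableEq A] [Fintype Λ]
  (T : GaugeTheory n M A Λ α)

lemma σ_swap (i j : A) : T.σ j i = -T.σ i j := by
  have := congrFun (congrFun T.σ_antisymm i) j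
  simpa [Matrix.transpose_apply] using this

lemma sum_σ_antisymm (a b : A → ℝ) :
    ∑ i, a i * ∑ j, T.σ i j * b j = -∑ i, b i * ∑ j, T.σ i j * a j := by
  simp only [Finset.mul_sum]
  rw [Finset.sum_comm, ← Finset.sum_neg_distrib]
  refine Finset.sum_congr rfl fun i _ => ?_
  rw [← Finset.sum_neg_distrib]
  refine Finset.sum_congr rfl fun j _ => ?_
  rw [T.σ_swap i j]
  ring

section Ham

variable {E : A → ℝ → Conf M A Λ → M → ℝ} (hE : ∀ i, IsLocal n (E i))

include hE

lemma isLocal_ham (i : A) : IsLocal n (fun t Φ => T.ham E t Φ i) :=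
  IsLocal.sum fun j _ => (isLocal_const (T.σ i j)).mul (hE j)

lemma hd_ham (i : A) (x : M) {u v : ℝ × Conf M A Λ}
    (hu : (timedPlots n M (A ⊕ (ℕ × Λ))).Pt u) (hv : (timedPlots n M (A ⊕ (ℕ × Λ))).Pt v) :
    hd (fun u : ℝ × Conf M A Λ => T.ham E u.1 u.2 i x) u v =
      ∑ j, T.σ i j * hd (fun u : ℝ × Conf M A Λ => E j u.1 u.2 x) u v := by
  have h : ∀ j, HasDerivAt (fun s : ℝ => E j (u + s • v).1 (u + s • v).2 x)
      (hd (fun u : ℝ × Conf M A Λ => E j u.1 u.2 x) u v) 0 := fun j =>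
    ((hE j).smoothFun_timed x).hasDerivAt_line hu hv
  exact (HasDerivAt.fun_sum fun j _ => (h j).const_mul (T.σ i j)).deriv

lemma dder_ham (i : A) (t : ℝ) {Φ Y : Conf M A Λ} (hΦ : ∀ i, IsSmooth n (Φ i))
    (hY : ∀ i, IsSmooth n (Y i)) (x : M) :
    dder (fun Φ => T.ham E t Φ i) Φ Y x = ∑ j, T.σ i j * dder (E j t) Φ Y x := by
  have := T.hd_ham hE i x (timedPlots_pt t hΦ) (timedPlots_pt 0 hY)
  rw [hd_timed_apply (fun t Φ => T.ham E t Φ i)] at this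
  simpa only [hd_timed_apply] using this

end Ham

namespace Couple

variable {T} (c : T.Couple)

/-- The variational derivatives of `G`, those which are left out of the sums being replaced by
zero. -/
def Ebar (i : A ⊕ (ℕ × Λ)) (t : ℝ) (Φ : Conf M A Λ) : M → ℝ :=
  Sum.elim (fun i => c.E (Sum.inl i) t Φ)
    (fun p => if p.1 ≤ c.order then c.E (Sum.inr p) t Φ else 0) i

lemma isLocal_Ebar (i : A ⊕ (ℕ × Λ)) : IsLocal n (c.Ebar i) := by
  cases i with
  | inl i => exact c.E_local _
  | inr p =>
    by_cases h : p.1 ≤ c.order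
    · have e : c.Ebar (Sum.inr p) = c.E (Sum.inr p) := by
        funext t Φ; simp [Ebar, h]
      rw [e]; exact c.E_local _
    · have e : c.Ebar (Sum.inr p) = fun _ _ => 0 := by
        funext t Φ; simp [Ebar, h]
      rw [e]; exact isLocal_zero

lemma sum_Ebar {N : ℕ} (hN : c.order ≤ N) (t : ℝ) (Φ Y : Conf M A Λ) (x : M) :
    ∑ i ∈ upTo A Λ c.order, c.E i t Φ x * Y i x = ∑ i ∈ upTo A Λ N, c.Ebar i t Φ x * Y i x := by
  rw [← Finset.sum_subset (upTo_mono hN)]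
  · refine Finset.sum_congr rfl fun i hi => ?_
    cases i with
    | inl i => rfl
    | inr p =>
      have : p.1 ≤ c.order := by simpa using hi
      simp [Ebar, this]
  · intro i _ hi
    cases i with
    | inl i => exact absurd (inl_mem_upTo _ _) hi
    | inr p =>
      have : ¬ p.1 ≤ c.order := by simpa using hi
      simp [Ebar, this]

lemma isLocal_ham (i : A) : IsLocal n (fun t Φ => T.ham c.Ez t Φ i) :=
  T.isLocal_ham (fun _ => c.E_local _) i

lemma isLocal_tilde (i : A ⊕ (ℕ × Λ)) : IsLocal n (fun t Φ => c.tilde t Φ i) := by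
  cases i with
  | inl i => exact c.isLocal_ham i
  | inr p => exact T.isLocal_iterate_δt (c.δlam_local p.2) p.1

lemma smooth_tilde (t : ℝ) {Φ : Conf M A Λ} (hΦ : ∀ i, IsSmooth n (Φ i)) (i : A ⊕ (ℕ × Λ)) :
    IsSmooth n (c.tilde t Φ i) := (c.isLocal_tilde i).isSmooth t hΦ

lemma smoothMap_variation :
    (histPlots n M A Λ).SmoothMap (histPlots n M A Λ) c.variation := by
  intro P _ _ _ u hu i
  cases i with
  | inl i => exact (c.isLocal_ham i).jointSmooth contDiff_snd (jointSmooth_inst hu)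
  | inr a => exact (c.δlam_local a).jointSmooth contDiff_snd (jointSmooth_inst hu)

lemma smoothHist_variation {u : Hist M A Λ} (hu : SmoothHist n u) : SmoothHist n (c.variation u) :=
  histPlots_pt.1 (c.smoothMap_variation.pt (histPlots_pt.2 hu))

/-- The difference between the variation at fixed time and the variation of histories: in the
latter, time derivatives are not replaced using the equations of motion. -/
def defect (u : Hist M A Λ) (t : ℝ) : Conf M A Λ :=
  c.tilde t (inst u t) - inst (c.variation u) t

lemma smooth_defect {u : Hist M A Λ} (hu : SmoothHist n u) (t : ℝ) (i : A ⊕ (ℕ × Λ)) :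
    IsSmooth n (c.defect u t i) :=
  (c.smooth_tilde t (isSmooth_inst hu t) i).sub (isSmooth_inst (c.smoothHist_variation hu) t i)

lemma tilde_eq (u : Hist M A Λ) (t : ℝ) :
    c.tilde t (inst u t) = inst (c.variation u) t + c.defect u t := by
  simp [defect]

lemma low_tilde (u : Hist M A Λ) (t : ℝ) :
    low (c.tilde t (inst u t)) = low (inst (c.variation u) t) := by
  funext i
  cases i with
  | inl i => rfl
  | inr a =>
    funext x
    show c.δlam a t (inst u t) x = iteratedDeriv 0 (fun τ => c.δlam a τ (inst u τ) x) t
    rw [iteratedDeriv_zero]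

lemma jointSmooth_defect {u : Hist M A Λ} (hu : SmoothHist n u) (i : A ⊕ (ℕ × Λ)) :
    JointSmooth n ℝ (fun t => c.defect u t i) :=
  (jointSmooth_along (c.isLocal_tilde i) hu).sub
    (jointSmooth_inst_time (c.smoothHist_variation hu) i)

/-- On the histories satisfying the external boundary conditions the two variations agree at the
boundary, since the equations of motion hold there to infinite order. By induction on the order of
the time derivative: each further derivative adds the derivative of `δ_t^l Λ^a` along the equations
of motion to the time derivative of the previous defect. -/
lemma flat_defect {u : Hist M A Λ} (hu : T.External u) (t : ℝ) (i : A ⊕ (ℕ × Λ)) :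
    FlatOnBoundary n (c.defect u t i) := by
  cases i with
  | inl i =>
    have : c.defect u t (Sum.inl i) = 0 := sub_self (T.ham c.Ez t (inst u t) i)
    rw [this]
    exact flatOnBoundary_zero
  | inr p =>
    obtain ⟨l, a⟩ := p
    induction l generalizing t with
    | zero =>
      have : c.defect u t (Sum.inr (0, a)) = 0 := by
        have h := congrFun (c.low_tilde u t) (Sum.inr a)
        exact sub_eq_zero.2 h
      rw [this]
      exact flatOnBoundary_zero
    | succ l ih =>
      intro x hx
      have hf := T.isLocal_iterate_δt (c.δlam_local a) l
      have h1 := (c.jointSmooth_defect hu.1 (Sum.inr (l, a))).flatAt_deriv (x := x)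
        (fun s => ih s x hx) t
      have h2 := hf.flatAt_dder t (isSmooth_inst hu.1 t) (T.smooth_eomConf hu.1 t)
        fun i => T.flat_eomConf hu t i x hx
      have h3 : c.defect u t (Sum.inr (l + 1, a)) =
          (fun x => deriv (fun s => c.defect u s (Sum.inr (l, a)) x) t) -
            dder ((T.δt)^[l] (c.δlam a) t) (inst u t) (T.eomConf u t) := by
        funext x
        have e1 : deriv (fun s => c.defect u s (Sum.inr (l, a)) x) t =
            deriv (fun s => (T.δt)^[l] (c.δlam a) s (inst u s) x) t -
            deriv (fun s => inst (c.variation u) s (Sum.inr (l, a)) x) t :=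
          deriv_fun_sub
            ((((jointSmooth_along hf hu.1).contDiff x).differentiable (by simp)).differentiableAt)
            ((((jointSmooth_inst_time (c.smoothHist_variation hu.1)
              (Sum.inr (l, a))).contDiff x).differentiable (by simp)).differentiableAt)
        have e2 : deriv (fun s => inst (c.variation u) s (Sum.inr (l, a)) x) t =
            inst (c.variation u) t (Sum.inr (l + 1, a)) x := by
          show deriv (fun s => iteratedDeriv l (fun τ => c.variation u (Sum.inr a) τ x) s) t =
            iteratedDeriv (l + 1) (fun τ => c.variation u (Sum.inr a) τ x) t
          rw [iteratedDeriv_succ]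
        have e3 : c.defect u t (Sum.inr (l + 1, a)) x =
            T.δt ((T.δt)^[l] (c.δlam a)) t (inst u t) x -
              inst (c.variation u) t (Sum.inr (l + 1, a)) x := by
          rw [← Function.iterate_succ_apply' (T.δt) l (c.δlam a)]
          rfl
        rw [e3, Pi.sub_apply, e1, e2, T.deriv_along_apply hf hu.1 t x]
        ring
      rw [h3]
      exact FlatAt.sub ((c.jointSmooth_defect hu.1 (Sum.inr (l, a))).deriv_line.isSmooth t)
        (hf.isSmooth_dder t (isSmooth_inst hu.1 t) (T.smooth_eomConf hu.1 t)) h1 h2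

end Couple

section EulerLagrange

variable [CompactSpace M] [T2Space M] [BorelSpace M]

lemma Couple.hasEL {T : GaugeTheory n M A Λ α} (c : T.Couple) {N : ℕ} (hN : c.order ≤ N) :
    HasEL n T.vol (upTo A Λ N) c.G c.Ebar := by
  have h : HasEL n T.vol (upTo A Λ c.order) c.G c.E :=
    LocalFunctional.hasEL T.vol_smooth T.bvol_smooth (bvol := T.bvol) c.G_local c.E_local c.E_spec
  refine ⟨h.smooth, c.isLocal_Ebar, fun t Φ Y hΦ hY hf => ?_⟩
  rw [h.spec t Φ Y hΦ hY hf]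
  simp only [c.sum_Ebar hN]

/-- The variational derivatives of `H[z, λ]`, as a functional of `z` and of all the time
derivatives of `λ`. -/
def EH (i : A ⊕ (ℕ × Λ)) (_ : ℝ) (Φ : Conf M A Λ) : M → ℝ :=
  Sum.elim (fun i => T.dH i (low Φ))
    (fun p => if p.1 = 0 then T.φ p.2 (fun j => Φ (Sum.inl j)) else 0) i

lemma isLocal_EH (i : A ⊕ (ℕ × Λ)) : IsLocal n (T.EH i) := by
  cases i with
  | inl i => exact (T.isLocal_dH i).low
  | inr p =>
    by_cases h : p.1 = 0
    · have e : T.EH (Sum.inr p) = fun _ Φ => T.φ p.2 (fun j => Φ (Sum.inl j)) := by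
        funext t Φ; simp [EH, h]
      rw [e]; exact T.isLocal_φ _
    · have e : T.EH (Sum.inr p) = fun _ _ => 0 := by
        funext t Φ; simp [EH, h]
      rw [e]; exact isLocal_zero

lemma sum_EH (N : ℕ) (t : ℝ) (Φ : Conf M A Λ) (Y : A ⊕ (ℕ × Λ) → ℝ) (x : M) :
    ∑ i ∈ upTo A Λ N, T.EH i t Φ x * Y i =
      ∑ i, T.dH i (low Φ) x * Y (Sum.inl i) +
        ∑ a, T.φ a (fun j => Φ (Sum.inl j)) x * Y (Sum.inr (0, a)) := by
  rw [sum_upTo, Finset.sum_eq_single_of_mem (s := Finset.range (N + 1)) 0 (by simp)]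
  · rfl
  · intro l _ hl
    simp [EH, hl]

lemma localFunctional_H_low :
    LocalFunctional n T.vol T.bvol (fun _ (Φ : Conf M A Λ) => T.H (low Φ)) :=
  ⟨_, _, T.isLocal_hamiltonian_density.low, T.b_local.low, fun _ _ _ => rfl⟩

lemma hasEL_H (N : ℕ) :
    HasEL n T.vol (upTo A Λ N) (fun _ Φ => T.H (low Φ)) T.EH := by
  have := T.isFiniteMeasure_vol
  have := T.isFiniteMeasure_bvol
  have h : HasEL n T.vol Finset.univ (fun _ => T.H)
      (fun i _ => (Sum.elim T.dH (fun a Φ => T.φ a (fun j => Φ (Sum.inl j))) :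
        A ⊕ Λ → (A ⊕ Λ → M → ℝ) → M → ℝ) i) := by
    refine LocalFunctional.hasEL T.vol_smooth T.bvol_smooth T.localFunctional_H (fun i => ?_)
      fun _ => T.isVarDeriv_H
    cases i with
    | inl i => exact T.isLocal_dH i
    | inr a => exact (T.φ_local a).reindex Sum.inl
  refine ⟨T.localFunctional_H_low.smoothFun, T.isLocal_EH, fun t Φ Y hΦ hY hf => ?_⟩
  rw [fder_low, h.spec t (low Φ) (low Y) (smooth_low hΦ) (smooth_low hY) (flat_low hf)]
  congr 1
  funext x
  rw [T.sum_EH N t Φ (fun i => Y i x), Fintype.sum_sum_type]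
  rfl

end EulerLagrange

end GaugeTheory

/-! ### The conservation law and its Euler–Lagrange equations -/

section FderAdd

variable {n : ℕ} [NeZero n] {M : Type*} [TopologicalSpace M]
  [ChartedSpace (EuclideanHalfSpace n) M] [IsManifold (𝓡∂ n) ∞ M] {ι : Type*}
  {F : ℝ → (ι → M → ℝ) → ℝ} (hF : (timedPlots n M ι).SmoothFun (fun u => F u.1 u.2)) (t : ℝ)
  {Φ Y Z : ι → M → ℝ} (hΦ : ∀ i, IsSmooth n (Φ i)) (hY : ∀ i, IsSmooth n (Y i))
  (hZ : ∀ i, IsSmooth n (Z i))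

include hF hΦ hY hZ

lemma fder_add : fder (F t) Φ (Y + Z) = fder (F t) Φ Y + fder (F t) Φ Z := by
  rw [← hd_timed, ← hd_timed, ← hd_timed,
    ← hF.hd_add (timedPlots_pt t hΦ) (timedPlots_pt 0 hY) (timedPlots_pt 0 hZ)]
  simp

end FderAdd

lemma integrable_sum_mul {n : ℕ} [NeZero n] {M : Type*} [TopologicalSpace M] [CompactSpace M]
    [ChartedSpace (EuclideanHalfSpace n) M] [IsManifold (𝓡∂ n) ∞ M] [MeasurableSpace M]
    [BorelSpace M] {μ : Measure M} [IsFiniteMeasure μ] {β : Type*} (s : Finset β) {f g : β → M → ℝ}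
    (hf : ∀ b, IsSmooth n (f b)) (hg : ∀ b, IsSmooth n (g b)) :
    Integrable (fun x => ∑ b ∈ s, f b x * g b x) μ :=
  integrable_finsetSum _ fun b _ => ((hf b).mul (hg b)).integrable

lemma integral_add_sub_add {X : Type*} [MeasurableSpace X] {μ : Measure X}
    {f₁ f₂ f₃ f₄ f₅ : X → ℝ} (h₁ : Integrable f₁ μ) (h₂ : Integrable f₂ μ) (h₃ : Integrable f₃ μ)
    (h₄ : Integrable f₄ μ) (h₅ : Integrable f₅ μ) :
    (∫ x, f₁ x ∂μ) + (∫ x, f₂ x ∂μ) - ((∫ x, f₃ x ∂μ) + ∫ x, f₄ x ∂μ) + ∫ x, f₅ x ∂μ =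
      ∫ x, (f₁ x + f₂ x - (f₃ x + f₄ x) + f₅ x) ∂μ := by
  rw [integral_add (f := fun x => f₁ x + f₂ x - (f₃ x + f₄ x)) ((h₁.add h₂).sub (h₃.add h₄)) h₅,
    integral_sub (f := fun x => f₁ x + f₂ x) (g := fun x => f₃ x + f₄ x) (h₁.add h₂) (h₃.add h₄),
    integral_add h₁ h₂, integral_add h₃ h₄]

namespace GaugeTheory

variable {n : ℕ} [NeZero n] {M : Type*} [TopologicalSpace M] [CompactSpace M] [T2Space M]
  [ChartedSpace (EuclideanHalfSpace n) M] [IsManifold (𝓡∂ n) ∞ M] [MeasurableSpace M]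
  [BorelSpace M] {A Λ α : Type*} [Fintype A] [DecidableEq A] [Fintype Λ]
  {T : GaugeTheory n M A Λ α}

namespace Couple

variable (c : T.Couple)

/-- The left-hand side of the conservation law, written with derivatives along `∂/∂t + flow` and
`tilde`. -/
def noether (t : ℝ) (Φ : Conf M A Λ) : ℝ :=
  lieFun 1 T.flow c.G t Φ - lieFun 0 c.tilde (fun _ Φ => T.H (low Φ)) t Φ
    + ∫ x, ∑ i, T.dH i (low Φ) x * T.ham c.Ez t Φ i x ∂T.vol

lemma smoothFun_G : (timedPlots n M (A ⊕ (ℕ × Λ))).SmoothFun (fun u => c.G u.1 u.2) :=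
  (c.hasEL le_rfl).smooth

/-- The boundary terms in `{G, H}_ζ` complete the bulk bracket to the derivatives of `G` and `H`
along each other's hamiltonian vector fields; the bulk bracket is thus counted twice and the
integral in `noether` removes it once. -/
lemma noether_eq (t : ℝ) {Φ : Conf M A Λ} (hΦ : ∀ i, IsSmooth n (Φ i)) :
    DDt c.G t Φ + T.bracketζ c.G c.Ez (fun _ Φ => T.H (low Φ)) (fun i _ Φ => T.dH i (low Φ)) t Φ
      - fder (fun Φ => T.H (low Φ)) Φ (c.tildeLam t Φ) = c.noether t Φ := by
  have := T.isFiniteMeasure_vol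
  have := T.isFiniteMeasure_bvol
  have hG := c.smoothFun_G
  have hH := (T.localFunctional_H_low).smoothFun
  have e1 : T.flow t Φ =
      shift Φ + Sum.elim (T.ham (fun i _ Φ => T.dH i (low Φ)) t Φ) (0 : ℕ × Λ → M → ℝ) := by
    funext i x
    cases i with
    | inl i => simp only [flow, shift, Sum.elim_inl, Pi.add_apply, Pi.zero_apply, zero_add]; rfl
    | inr p => simp [flow, shift]
  have e2 : c.tilde t Φ = Sum.elim (T.ham c.Ez t Φ) (0 : ℕ × Λ → M → ℝ) + c.tildeLam t Φ := by
    funext i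
    cases i <;> simp [tilde, tildeLam]
  have s1 : ∀ i, IsSmooth n (shift Φ i) := by
    intro i
    cases i with
    | inl i => exact isSmooth_const 0
    | inr p => exact hΦ _
  have s2 : ∀ i, IsSmooth n ((Sum.elim (T.ham (fun i _ Φ => T.dH i (low Φ)) t Φ)
      (0 : ℕ × Λ → M → ℝ) : Conf M A Λ) i) := by
    intro i
    cases i with
    | inl i => exact (T.isLocal_ham (fun i => (T.isLocal_dH i).low) i).isSmooth t hΦ
    | inr p => exact isSmooth_const 0
  have s3 : ∀ i, IsSmooth n ((Sum.elim (T.ham c.Ez t Φ) (0 : ℕ × Λ → M → ℝ) : Conf M A Λ) i) := by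
    intro i
    cases i with
    | inl i => exact (c.isLocal_ham i).isSmooth t hΦ
    | inr p => exact isSmooth_const 0
  have s4 : ∀ i, IsSmooth n (c.tildeLam t Φ i) := by
    intro i
    cases i with
    | inl i => exact isSmooth_const 0
    | inr p => exact c.smooth_tilde t hΦ (Sum.inr p)
  rw [noether, lieFun_zero_left, e2, lieFun, hd_timed_split hG t 1 hΦ (T.smooth_flow t hΦ), e1,
    fder_add hG t hΦ s1 s2, fder_add (F := fun _ Φ => T.H (low Φ)) hH t hΦ s3 s4,
    DDt, bracketζ, poisson, boundaryTerm, boundaryTerm]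
  ring

lemma localFunctional_noether : LocalFunctional n T.vol T.bvol c.noether := by
  have := T.isFiniteMeasure_vol
  have := T.isFiniteMeasure_bvol
  have hG : LocalFunctional n T.vol T.bvol c.G := c.G_local
  exact ((hG.lieFun 1 T.isLocal_flow).sub (T.localFunctional_H_low.lieFun 0 c.isLocal_tilde)).add
    (localFunctional_integral (IsLocal.sum fun i _ =>
      (T.isLocal_dH i).low.mul (c.isLocal_ham i)))

/-- Index shift in the sum of the terms `δG/δλ^(l) · λ^(l+1)`. The sum may stop at `N` because the
derivatives beyond the order of `G` vanish. -/
lemma sum_Ebar_flow {N : ℕ} (hN : c.order < N) (t : ℝ) (Φ : Conf M A Λ) (Y : A ⊕ (ℕ × Λ) → ℝ)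
    (x : M) : ∑ l ∈ Finset.range (N + 1), ∑ a, c.Ebar (Sum.inr (l, a)) t Φ x * Y (Sum.inr (l + 1, a))
      = ∑ l ∈ Finset.range (N + 1), ∑ a : Λ,
        (if l = 0 then 0 else c.Ebar (Sum.inr (l - 1, a)) t Φ) x * Y (Sum.inr (l, a)) := by
  rw [Finset.sum_range_succ, Finset.sum_range_succ']
  simp [Ebar, not_le.2 hN]

end Couple

variable (T) in
/-- The formal adjoint of the linearisations `dder (g b)`, applied to the local functions `f b`.
The flatness hypotheses remove the boundary terms of the integration by parts. -/
lemma exists_adjoint {β : Type*} (s : Finset β) {f g : β → ℝ → Conf M A Λ → M → ℝ}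
    (hf : ∀ b, IsLocal n (f b)) (hg : ∀ b, IsLocal n (g b)) :
    ∃ R : A ⊕ (ℕ × Λ) → ℝ → Conf M A Λ → M → ℝ, (∀ i, IsLocal n (R i)) ∧
      ((∀ b, T.FlatExternal (f b)) → ∀ i, T.FlatExternal (R i)) ∧
      ∃ N, ∀ N' ≥ N, ∀ (t : ℝ) (Φ Y : Conf M A Λ), (∀ i, IsSmooth n (Φ i)) →
        (∀ i, IsSmooth n (Y i)) →
        ((∀ b, FlatOnBoundary n (f b t Φ)) ∨ ∀ i, FlatOnBoundary n (Y i)) →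
        ∫ x, ∑ b ∈ s, f b t Φ x * dder (g b t) Φ Y x ∂T.vol =
          ∫ x, ∑ i ∈ upTo A Λ N', R i t Φ x * Y i x ∂T.vol := by
  classical
  have := T.isFiniteMeasure_vol
  choose S EL hEL hEL0 hspec using fun b => exists_eulerLagrange T.vol_smooth (hg b)
  have hsub : ∀ b i, IsLocal n (fun t (Φ : Conf M A Λ) =>
      EL b i t (Sum.elim Φ fun _ => f b t Φ)) := by
    intro b i
    refine (hEL b i).subst (Ψ := fun t Φ => Sum.elim Φ fun _ => f b t Φ) fun j => ?_
    cases j with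
    | inl j => exact isLocal_field j
    | inr j => exact hf b
  obtain ⟨N₀, hN₀⟩ := exists_subset_upTo (s.biUnion S)
  refine ⟨fun i t Φ x => ∑ b ∈ s, EL b i t (Sum.elim Φ fun _ => f b t Φ) x,
    fun i => IsLocal.sum fun b _ => hsub b i, fun hflat i u hu t x hx => ?_,
    N₀, fun N hN t Φ Y hΦ hY hflat => ?_⟩
  · have hΦ := isSmooth_inst hu.1 t
    have e : (fun x => ∑ b ∈ s, EL b i t (Sum.elim (inst u t) fun _ => f b t (inst u t)) x) =
        ∑ b ∈ s, EL b i t (Sum.elim (inst u t) fun _ => f b t (inst u t)) := by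
      funext x; simp
    show FlatAt n _ x
    beta_reduce
    rw [e]
    refine flatAt_sum (fun b _ => (hsub b i).isSmooth t hΦ) fun b _ => ?_
    refine (hEL b i).flatAt t (Φ' := Sum.elim (inst u t) fun _ => 0) (fun j => ?_) (fun j => ?_)
      (fun j => ?_) (exists_eulerLagrange_zero T.vol_smooth (hEL b) (hEL0 b) (hspec b) t hΦ i)
    · cases j with
      | inl j => exact hΦ j
      | inr j => exact (hf b).isSmooth t hΦ
    · cases j with
      | inl j => exact hΦ j
      | inr j => exact isSmooth_const 0
    · cases j with
      | inl j => simpa using flatAt_zero x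
      | inr j =>
        simp only [Sum.elim_inr, sub_zero]
        exact hflat b u hu t x hx
  · have hfs : ∀ b, IsSmooth n (f b t Φ) := fun b => (hf b).isSmooth t hΦ
    rw [integral_finsetSum (f := fun b x => f b t Φ x * dder (g b t) Φ Y x) _ fun b _ =>
      ((hfs b).mul ((hg b).isSmooth_dder t hΦ hY)).integrable]
    have e1 : ∀ b ∈ s, ∫ x, f b t Φ x * dder (g b t) Φ Y x ∂T.vol =
        ∫ x, ∑ i ∈ upTo A Λ N, EL b i t (Sum.elim Φ fun _ => f b t Φ) x * Y i x ∂T.vol := by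
      intro b hb
      rw [hspec b t Φ Y _ hΦ hY (hfs b) (hflat.imp_left fun h => h b)]
      congr 1
      funext x
      refine Finset.sum_subset (((Finset.subset_biUnion_of_mem S hb).trans
        hN₀).trans (upTo_mono hN)) fun j _ hj => by simp [hEL0 b j hj]
    rw [Finset.sum_congr rfl e1, ← integral_finsetSum
      (f := fun b x => ∑ i ∈ upTo A Λ N, EL b i t (Sum.elim Φ fun _ => f b t Φ) x * Y i x) _
      fun b _ => integrable_finsetSum _ fun i _ =>
        (((hsub b i).isSmooth t hΦ).mul (hY i)).integrable]
    congr 1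
    funext x
    rw [Finset.sum_comm]
    simp only [Finset.sum_mul]

namespace Couple

variable (c : T.Couple)

/-- The Euler–Lagrange derivatives of the left-hand side of the conservation law. Deriving `G` along
the flow and `H` along `tilde` gives terms `∑ E_i δ(flow)_i` and `∑ (δH)_i δ(tilde)_i`, whose `z`
parts cancel against the variation of the bulk bracket by antisymmetry of `σ`. The remaining terms
`φ_a δΛ^a` are integrated by parts and collected in `Q`, which vanishes at the boundary together
with the constraints. -/
lemma exists_eulerLagrange_noether : ∃ Q : A ⊕ (ℕ × Λ) → ℝ → Conf M A Λ → M → ℝ,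
    (∀ i, IsLocal n (Q i)) ∧ (∀ i, T.FlatExternal (Q i)) ∧
    ∃ N, c.order < N ∧ ∀ N' ≥ N, ∀ (t : ℝ) (Φ Y : Conf M A Λ), (∀ i, IsSmooth n (Φ i)) →
      (∀ i, IsSmooth n (Y i)) → (∀ i, FlatOnBoundary n (Y i)) →
      fder (c.noether t) Φ Y = ∫ x, ∑ i ∈ upTo A Λ N', (lie 1 T.flow (c.Ebar i) t Φ x +
        (Sum.elim (fun _ => 0) (fun p => if p.1 = 0 then 0 else c.Ebar (Sum.inr (p.1 - 1, p.2)) t Φ)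
          i : M → ℝ) x - lie 0 c.tilde (T.EH i) t Φ x - Q i t Φ x) * Y i x ∂T.vol := by
  have := T.isFiniteMeasure_vol
  have := T.isFiniteMeasure_bvol
  obtain ⟨Q, hQ, hQf, N₀, hN₀⟩ := T.exists_adjoint Finset.univ (T.isLocal_φ) c.δlam_local
  refine ⟨Q, hQ, hQf fun a u hu t => hu.2.1 a t, max N₀ (c.order + 1), by simp,
    fun N hN t Φ Y hΦ hY hflat => ?_⟩
  · have hNo : c.order < N := lt_of_lt_of_le (Nat.lt_succ_self _) ((le_max_right _ _).trans hN)
    have hG : LocalFunctional n T.vol T.bvol c.G := c.G_local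
    have hdH : ∀ i, IsLocal n (fun _ (Φ : Conf M A Λ) => T.dH i (low Φ)) :=
      fun i => (T.isLocal_dH i).low
    have hL3 : IsLocal n (fun t (Φ : Conf M A Λ) x =>
        ∑ i, T.dH i (low Φ) x * T.ham c.Ez t Φ i x) :=
      IsLocal.sum fun i _ => (hdH i).mul (c.isLocal_ham i)
    have L1 := (c.hasEL hNo.le).fder_lieFun 1 T.isLocal_flow t hΦ hY hflat
    have L2 := (T.hasEL_H N).fder_lieFun 0 c.isLocal_tilde t hΦ hY hflat
    have L3 : fder (fun Φ : Conf M A Λ => ∫ x, ∑ i, T.dH i (low Φ) x * T.ham c.Ez t Φ i x ∂T.vol)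
        Φ Y = ∫ x, ∑ i, (dder (fun Φ => T.dH i (low Φ)) Φ Y x * T.ham c.Ez t Φ i x +
          T.dH i (low Φ) x * dder (fun Φ => T.ham c.Ez t Φ i) Φ Y x) ∂T.vol := by
      rw [hL3.fder_integral t hΦ hY]
      congr 1
      funext x
      have h1 : ∀ i, HasDerivAt (fun s : ℝ => T.dH i (low (Φ + s • Y)) x)
          (dder (fun Φ => T.dH i (low Φ)) Φ Y x) 0 := fun i =>
        ((hdH i).smoothFun 0 x).hasDerivAt_line (fieldPlots_pt hΦ) (fieldPlots_pt hY)
      have h2 : ∀ i, HasDerivAt (fun s : ℝ => T.ham c.Ez t (Φ + s • Y) i x)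
          (dder (fun Φ => T.ham c.Ez t Φ i) Φ Y x) 0 := fun i =>
        ((c.isLocal_ham i).smoothFun t x).hasDerivAt_line (fieldPlots_pt hΦ) (fieldPlots_pt hY)
      have h3 := (HasDerivAt.fun_sum (u := Finset.univ) fun i _ => (h1 i).mul (h2 i)).deriv
      refine h3.trans (Finset.sum_congr rfl fun i _ => ?_)
      simp
    have L4 : ∫ x, ∑ a, T.φ a (fun j => Φ (Sum.inl j)) x * dder (c.δlam a t) Φ Y x ∂T.vol =
        ∫ x, ∑ i ∈ upTo A Λ N, Q i t Φ x * Y i x ∂T.vol :=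
      hN₀ N ((le_max_left _ _).trans hN) t Φ Y hΦ hY (Or.inr hflat)
    have hs1 := (hG.lieFun 1 T.isLocal_flow).smoothFun
    have hs2 := (T.localFunctional_H_low.lieFun 0 c.isLocal_tilde).smoothFun
    have hs3 := hL3.smoothFun_integral (μ := T.vol)
    have hu := timedPlots_pt t hΦ
    have hv := timedPlots_pt (0 : ℝ) hY
    have hsplit : fder (c.noether t) Φ Y = fder (lieFun 1 T.flow c.G t) Φ Y
        - fder (lieFun 0 c.tilde (fun _ Φ => T.H (low Φ)) t) Φ Y
        + fder (fun Φ : Conf M A Λ => ∫ x, ∑ i, T.dH i (low Φ) x * T.ham c.Ez t Φ i x ∂T.vol)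
          Φ Y := by
      have a1 := (hs1.sub hs2).hd_fun_add hs3 hu hv
      rw [hs1.hd_fun_sub hs2 hu hv, hd_timed (lieFun 1 T.flow c.G),
        hd_timed (lieFun 0 c.tilde (fun _ Φ => T.H (low Φ))),
        hd_timed (fun t (Φ : Conf M A Λ) =>
          ∫ x, ∑ i, T.dH i (low Φ) x * T.ham c.Ez t Φ i x ∂T.vol)] at a1
      rw [← a1]
      exact (hd_timed c.noether t Φ Y).symm
    have i1 : Integrable (fun x => ∑ i ∈ upTo A Λ N, lie 1 T.flow (c.Ebar i) t Φ x * Y i x) T.vol :=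
      integrable_finsetSum _ fun i _ =>
        ((((c.isLocal_Ebar i).lie 1 T.isLocal_flow).isSmooth t hΦ).mul (hY i)).integrable
    have i2 : Integrable (fun x => ∑ i ∈ upTo A Λ N,
        c.Ebar i t Φ x * dder (fun Φ => T.flow t Φ i) Φ Y x) T.vol :=
      integrable_finsetSum _ fun i _ => (((c.isLocal_Ebar i).isSmooth t hΦ).mul
        ((T.isLocal_flow i).isSmooth_dder t hΦ hY)).integrable
    have i3 : Integrable (fun x => ∑ i ∈ upTo A Λ N, lie 0 c.tilde (T.EH i) t Φ x * Y i x) T.vol :=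
      integrable_finsetSum _ fun i _ =>
        ((((T.isLocal_EH i).lie 0 c.isLocal_tilde).isSmooth t hΦ).mul (hY i)).integrable
    have i4 : Integrable (fun x => ∑ i ∈ upTo A Λ N,
        T.EH i t Φ x * dder (fun Φ => c.tilde t Φ i) Φ Y x) T.vol :=
      integrable_finsetSum _ fun i _ => (((T.isLocal_EH i).isSmooth t hΦ).mul
        ((c.isLocal_tilde i).isSmooth_dder t hΦ hY)).integrable
    have i5 : Integrable (fun x => ∑ i, (dder (fun Φ => T.dH i (low Φ)) Φ Y x *
          T.ham c.Ez t Φ i x + T.dH i (low Φ) x * dder (fun Φ => T.ham c.Ez t Φ i) Φ Y x)) T.vol :=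
      integrable_finsetSum _ fun i _ =>
        ((((hdH i).isSmooth_dder t hΦ hY).mul ((c.isLocal_ham i).isSmooth t hΦ)).add
          (((hdH i).isSmooth t hΦ).mul ((c.isLocal_ham i).isSmooth_dder t hΦ hY))).integrable
    have i6 : Integrable (fun x => ∑ a, T.φ a (fun j => Φ (Sum.inl j)) x *
        dder (c.δlam a t) Φ Y x) T.vol :=
      integrable_finsetSum _ fun a _ => (((T.isLocal_φ a).isSmooth t hΦ).mul
        ((c.δlam_local a).isSmooth_dder t hΦ hY)).integrable
    have i7 : Integrable (fun x => ∑ i ∈ upTo A Λ N, Q i t Φ x * Y i x) T.vol :=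
      integrable_finsetSum _ fun i _ => (((hQ i).isSmooth t hΦ).mul (hY i)).integrable
    rw [hsplit, L1, L2, L3, integral_add_sub_add i1 i2 i3 i4 i5]
    -- pointwise, `φ_a δΛ^a` is the only term which still has to be integrated by parts
    have key : ∀ x, (∑ i ∈ upTo A Λ N, lie 1 T.flow (c.Ebar i) t Φ x * Y i x +
        ∑ i ∈ upTo A Λ N, c.Ebar i t Φ x * dder (fun Φ => T.flow t Φ i) Φ Y x -
        (∑ i ∈ upTo A Λ N, lie 0 c.tilde (T.EH i) t Φ x * Y i x +
        ∑ i ∈ upTo A Λ N, T.EH i t Φ x * dder (fun Φ => c.tilde t Φ i) Φ Y x) +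
        ∑ i, (dder (fun Φ => T.dH i (low Φ)) Φ Y x * T.ham c.Ez t Φ i x +
          T.dH i (low Φ) x * dder (fun Φ => T.ham c.Ez t Φ i) Φ Y x)) =
        (∑ i ∈ upTo A Λ N, (lie 1 T.flow (c.Ebar i) t Φ x +
        (Sum.elim (fun _ => 0) (fun p => if p.1 = 0 then 0 else c.Ebar (Sum.inr (p.1 - 1, p.2)) t Φ)
          i : M → ℝ) x - lie 0 c.tilde (T.EH i) t Φ x - Q i t Φ x) * Y i x) +
        (∑ i ∈ upTo A Λ N, Q i t Φ x * Y i x -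
          ∑ a, T.φ a (fun j => Φ (Sum.inl j)) x * dder (c.δlam a t) Φ Y x) := by
      intro x
      have k1 : ∑ i ∈ upTo A Λ N, c.Ebar i t Φ x * dder (fun Φ => T.flow t Φ i) Φ Y x =
          ∑ i, c.Ez i t Φ x * ∑ j, T.σ i j * dder (fun Φ => T.dH j (low Φ)) Φ Y x +
          ∑ i ∈ upTo A Λ N, (Sum.elim (fun _ => 0)
            (fun p => if p.1 = 0 then 0 else c.Ebar (Sum.inr (p.1 - 1, p.2)) t Φ)
            i : M → ℝ) x * Y i x := by
        rw [sum_upTo, sum_upTo]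
        have e1 : ∀ i : A, dder (fun Φ => T.flow t Φ (Sum.inl i)) Φ Y x =
            ∑ j, T.σ i j * dder (fun Φ => T.dH j (low Φ)) Φ Y x := fun i =>
          T.dder_ham (E := fun j _ Φ => T.dH j (low Φ)) hdH i t hΦ hY x
        have e2 : ∀ p : ℕ × Λ, dder (fun Φ => T.flow t Φ (Sum.inr p)) Φ Y x =
            Y (Sum.inr (p.1 + 1, p.2)) x := by
          intro p
          have h : HasDerivAt (fun s : ℝ => Φ (Sum.inr (p.1 + 1, p.2)) x
            + s * Y (Sum.inr (p.1 + 1, p.2)) x) (1 * Y (Sum.inr (p.1 + 1, p.2)) x) 0 :=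
            ((hasDerivAt_id (0 : ℝ)).mul_const _).const_add _
          rw [one_mul] at h
          exact h.deriv
        simp only [e1, e2]
        rw [c.sum_Ebar_flow hNo t Φ (fun i => Y i x) x]
        simp only [Sum.elim_inl, Sum.elim_inr, Pi.zero_apply, zero_mul, Finset.sum_const_zero,
          zero_add]
        rfl
      have k2 : ∑ i ∈ upTo A Λ N, T.EH i t Φ x * dder (fun Φ => c.tilde t Φ i) Φ Y x =
          ∑ i, T.dH i (low Φ) x * dder (fun Φ => T.ham c.Ez t Φ i) Φ Y x +
          ∑ a, T.φ a (fun j => Φ (Sum.inl j)) x * dder (c.δlam a t) Φ Y x :=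
        T.sum_EH N t Φ (fun i => dder (fun Φ => c.tilde t Φ i) Φ Y x) x
      have k3 : ∑ i, dder (fun Φ => T.dH i (low Φ)) Φ Y x * T.ham c.Ez t Φ i x =
          -∑ i, c.Ez i t Φ x * ∑ j, T.σ i j * dder (fun Φ => T.dH j (low Φ)) Φ Y x :=
        T.sum_σ_antisymm (fun i => dder (fun Φ => T.dH i (low Φ)) Φ Y x) (fun i => c.Ez i t Φ x)
      rw [k1, k2, Finset.sum_add_distrib, k3]
      simp only [sub_mul, add_mul, Finset.sum_add_distrib, Finset.sum_sub_distrib]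
      ring
    refine (integral_congr_ae (Eventually.of_forall key)).trans ?_
    have h0 := integral_sub i7 i6
    rw [L4, sub_self] at h0
    refine (integral_add ?_ (i7.sub i6)).trans ((congrArg (_ + ·) h0).trans (add_zero _))
    refine integrable_finsetSum _ fun i _ => IsSmooth.integrable (n := n) ?_
    refine IsSmooth.mul (((IsSmooth.add (((c.isLocal_Ebar i).lie 1 T.isLocal_flow).isSmooth t hΦ)
      ?_).sub (((T.isLocal_EH i).lie 0 c.isLocal_tilde).isSmooth t hΦ)).sub
      ((hQ i).isSmooth t hΦ)) (hY i)
    cases i with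
    | inl i => exact isSmooth_const 0
    | inr p =>
      simp only [Sum.elim_inr]
      split_ifs
      exacts [isSmooth_const 0, (c.isLocal_Ebar _).isSmooth t hΦ]

end Couple

end GaugeTheory

/-! ### The multiplier derivatives vanish at the boundary -/

namespace GaugeTheory

variable {n : ℕ} [NeZero n] {M : Type*} [TopologicalSpace M] [CompactSpace M] [T2Space M]
  [ChartedSpace (EuclideanHalfSpace n) M] [IsManifold (𝓡∂ n) ∞ M] [MeasurableSpace M]
  [BorelSpace M] {A Λ α : Type*} [Fintype A] [DecidableEq A] [Fintype Λ]
  {T : GaugeTheory n M A Λ α}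

namespace Couple

variable (c : T.Couple)

/-- The conservation law, in terms of `noether`. -/
def Conserved (v : ℝ → Conf M A Λ → M → ℝ) : Prop :=
  ∀ u, T.External u → ∀ t, c.noether t (inst u t) = T.boundaryFunctional v t (inst u t)

variable {c} in
/-- The conservation law holds at external histories only, but its variation, for flat directions,
vanishes at all configurations. -/
lemma Conserved.fder_eq {v : ℝ → Conf M A Λ → M → ℝ} (hv : IsLocal n v) (h : c.Conserved v)
    {u₀ : Hist M A Λ} (hu₀ : T.External u₀) (t : ℝ) {Φ Y : Conf M A Λ}
    (hΦ : ∀ i, IsSmooth n (Φ i)) (hY : ∀ i, IsSmooth n (Y i))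
    (hflat : ∀ i, FlatOnBoundary n (Y i)) :
    fder (fun Φ => c.noether t Φ - T.boundaryFunctional v t Φ) Φ Y = 0 := by
  have := T.isFiniteMeasure_vol
  have := T.isFiniteMeasure_bvol
  exact T.fder_eq_zero_of_external (K := fun t Φ => c.noether t Φ - T.boundaryFunctional v t Φ)
    (c.localFunctional_noether.sub (localFunctional_boundary hv)) hu₀
    (fun u hu t => by rw [h u hu t, sub_self]) t hΦ hY hflat

/-- The Euler–Lagrange equations of the conservation law, with respect to `z` and to `λ^(l+1)`. The
boundary term `v` does not contribute to variations supported in the interior. -/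
lemma exists_noether_relations {v : ℝ → Conf M A Λ → M → ℝ} (hv : IsLocal n v)
    (h : c.Conserved v) : ∃ Q : A ⊕ (ℕ × Λ) → ℝ → Conf M A Λ → M → ℝ,
    (∀ i, IsLocal n (Q i)) ∧ (∀ i, T.FlatExternal (Q i)) ∧
    ∀ u₀, T.External u₀ → ∀ (t : ℝ) (Φ : Conf M A Λ), (∀ i, IsSmooth n (Φ i)) →
      (∀ i : A, lie 1 T.flow (c.E (Sum.inl i)) t Φ =
        dder (fun Φ => T.dH i (low Φ)) Φ (c.tilde t Φ) + Q (Sum.inl i) t Φ) ∧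
      ∀ l a, c.Ebar (Sum.inr (l, a)) t Φ =
        Q (Sum.inr (l + 1, a)) t Φ - T.δt (c.Ebar (Sum.inr (l + 1, a))) t Φ := by
  have := T.isFiniteMeasure_vol
  have := T.isFiniteMeasure_bvol
  obtain ⟨Q, hQ, hQf, N₀, -, hN₀⟩ := c.exists_eulerLagrange_noether
  refine ⟨Q, hQ, hQf, fun u₀ hu₀ t Φ hΦ => ?_⟩
  have key : ∀ i : A ⊕ (ℕ × Λ), (fun x => lie 1 T.flow (c.Ebar i) t Φ x +
        (Sum.elim (fun _ => 0) (fun p => if p.1 = 0 then 0 else c.Ebar (Sum.inr (p.1 - 1, p.2)) t Φ)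
          i : M → ℝ) x - lie 0 c.tilde (T.EH i) t Φ x - Q i t Φ x) = 0 := by
    intro i
    obtain ⟨N₁, hN₁⟩ := exists_subset_upTo {i}
    refine eq_zero_of_integral_sum T.vol_smooth (S := upTo A Λ (max N₀ N₁))
      (f := fun i x => lie 1 T.flow (c.Ebar i) t Φ x +
        (Sum.elim (fun _ => 0) (fun p => if p.1 = 0 then 0 else c.Ebar (Sum.inr (p.1 - 1, p.2)) t Φ)
          i : M → ℝ) x - lie 0 c.tilde (T.EH i) t Φ x - Q i t Φ x)
      (fun i _ => ?_) (fun Y hY hYs => ?_) i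
      (upTo_mono (le_max_right _ _) (hN₁ (Finset.mem_singleton_self i)))
    · refine ((IsSmooth.add (((c.isLocal_Ebar i).lie 1 T.isLocal_flow).isSmooth t hΦ) ?_).sub
        (((T.isLocal_EH i).lie 0 c.isLocal_tilde).isSmooth t hΦ)).sub ((hQ i).isSmooth t hΦ)
      cases i with
      | inl i => exact isSmooth_const 0
      | inr p =>
        simp only [Sum.elim_inr]
        split_ifs
        exacts [isSmooth_const 0, (c.isLocal_Ebar _).isSmooth t hΦ]
    · have hflat : ∀ i, FlatOnBoundary n (Y i) := fun i => flatOnBoundary_of_tsupport (hYs i)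
      rw [← hN₀ _ (le_max_left _ _) t Φ Y hΦ hY hflat]
      have h1 := h.fder_eq hv hu₀ t hΦ hY hflat
      have h2 := (c.localFunctional_noether.smoothFun).hd_fun_sub
        (localFunctional_boundary (vol := T.vol) (bvol := T.bvol) hv).smoothFun
        (timedPlots_pt t hΦ) (timedPlots_pt 0 hY)
      rw [hd_timed c.noether, hd_timed (fun t (Φ : Conf M A Λ) => ∫ x, v t Φ x ∂T.bvol),
        hd_timed (fun t (Φ : Conf M A Λ) => c.noether t Φ - ∫ x, v t Φ x ∂T.bvol),
        hv.fder_boundary T.bvol_smooth t hΦ hY hflat, sub_zero] at h2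
      exact h2.symm.trans h1
  refine ⟨fun i => ?_, fun l a => ?_⟩
  · have := key (Sum.inl i)
    funext x
    have hx := congrFun this x
    have e : lie 0 c.tilde (T.EH (Sum.inl i)) t Φ =
      dder (fun Φ => T.dH i (low Φ)) Φ (c.tilde t Φ) := lie_zero_left _ _ _ _
    have e' : c.Ebar (Sum.inl i) = c.E (Sum.inl i) := rfl
    simp only [e, e', Sum.elim_inl, Pi.zero_apply] at hx
    rw [Pi.add_apply]
    linarith
  · have := key (Sum.inr (l + 1, a))
    funext x
    have hx := congrFun this x
    have e : lie 0 c.tilde (T.EH (Sum.inr (l + 1, a))) t Φ x = 0 := by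
      rw [lie_zero_left]
      simp [dder, EH]
    simp only [Sum.elim_inr, Nat.add_eq_zero_iff, one_ne_zero, and_false, if_false,
      Nat.add_sub_cancel, Pi.zero_apply] at hx
    rw [e] at hx
    rw [Pi.sub_apply, T.δt_eq_lie (c.isLocal_Ebar _) t hΦ]
    linarith

/-- The derivatives of `G` with respect to the multipliers vanish at the boundary. By downward
induction on `l`, starting above the order of `G`: the conservation law expresses `δG/δλ^(l)` by
constraint terms and by the time derivative of `δG/δλ^(l+1)`. -/
lemma flatExternal_Ebar {v : ℝ → Conf M A Λ → M → ℝ} (hv : IsLocal n v) (h : c.Conserved v)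
    (l : ℕ) (a : Λ) : T.FlatExternal (c.Ebar (Sum.inr (l, a))) := by
  obtain ⟨Q, hQ, hQf, hrel⟩ := c.exists_noether_relations hv h
  suffices hk : ∀ k l, c.order < l + k → T.FlatExternal (c.Ebar (Sum.inr (l, a))) from
    hk (c.order + 1) l (by omega)
  intro k
  induction k with
  | zero =>
    intro l hl u hu t
    have : c.Ebar (Sum.inr (l, a)) t (inst u t) = 0 := by
      simp only [Ebar, Sum.elim_inr]
      rw [if_neg (by simpa using hl)]
    rw [this]
    exact flatOnBoundary_zero
  | succ k ih =>
    intro l hl u hu t x hx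
    have hΦ := isSmooth_inst hu.1 t
    rw [(hrel u hu t _ hΦ).2 l a]
    exact FlatAt.sub ((hQ _).isSmooth t hΦ) ((T.isLocal_δt (c.isLocal_Ebar _)).isSmooth t hΦ)
      (hQf _ u hu t x hx)
      ((FlatExternal.δt T (c.isLocal_Ebar _) (ih (l + 1) (by omega))) u hu t x hx)

end Couple

end GaugeTheory

/-! ### Differentiability of the variation of a functional -/

section OneForm

variable {n : ℕ} [NeZero n] {M : Type*} [TopologicalSpace M] [CompactSpace M]
  [ChartedSpace (EuclideanHalfSpace n) M] [IsManifold (𝓡∂ n) ∞ M] [MeasurableSpace M]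
  [BorelSpace M] {A Λ : Type*} {μ : Measure M} [IsFiniteMeasure μ]
  {S : Finset (A ⊕ (ℕ × Λ))} {E : A ⊕ (ℕ × Λ) → ℝ → Conf M A Λ → M → ℝ}
  (hE : ∀ i, IsLocal n (E i))

include hE

lemma jointSmooth_oneForm (t : ℝ) {P : Type} [NormedAddCommGroup P] [NormedSpace ℝ P]
    [FiniteDimensional ℝ P] {c c' : P → Hist M A Λ} (hc : (histPlots n M A Λ).IsPlot P c)
    (hc' : (histPlots n M A Λ).IsPlot P c') :
    JointSmooth n P (fun p x => ∑ i ∈ S, E i t (inst (c p) t) x * inst (c' p) t i x) :=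
  JointSmooth.sum (f := fun i p x => E i t (inst (c p) t) x * inst (c' p) t i x) fun i _ =>
    ((hE i).histSmooth t P c hc).mul (jointSmooth_inst_param hc' t i)

lemma smoothFun_oneForm (t : ℝ) {δ : Hist M A Λ → Hist M A Λ}
    (hδ : (histPlots n M A Λ).SmoothMap (histPlots n M A Λ) δ) :
    (histPlots n M A Λ).SmoothFun
      (fun u => ∫ x, ∑ i ∈ S, E i t (inst u t) x * inst (δ u) t i x ∂μ) := fun P _ _ _ c hc =>
  (jointSmooth_oneForm hE t hc (hδ P c hc)).contDiff_integral

/-- The derivative of `∫ ∑ E_i δΦ_i` along the variation `δ'`. -/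
lemma hd_oneForm (t : ℝ) {δ δ' : Hist M A Λ → Hist M A Λ}
    (hδ : (histPlots n M A Λ).SmoothMap (histPlots n M A Λ) δ)
    (hδ' : (histPlots n M A Λ).SmoothMap (histPlots n M A Λ) δ') {u : Hist M A Λ}
    (hu : SmoothHist n u) :
    hd (fun u => ∫ x, ∑ i ∈ S, E i t (inst u t) x * inst (δ u) t i x ∂μ) u (δ' u) =
      (∫ x, ∑ i ∈ S, dder (E i t) (inst u t) (inst (δ' u) t) x * inst (δ u) t i x ∂μ) +
      ∫ x, ∑ i ∈ S, E i t (inst u t) x *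
        inst (fun i t x => deriv (fun s : ℝ => δ (u + s • δ' u) i t x) 0) t i x ∂μ := by
  have hu' := histPlots_pt.2 hu
  have hZ := hδ'.pt hu'
  have hl := hu'.line hZ
  have hδl := hδ ℝ _ hl
  have hW := (histPlots_pt (n := n)).1 ((isPlot_deriv_variation hδ' hδ
    (c := fun _ : ℝ => u) hu').pt 0)
  have h1 := ((jointSmooth_oneForm (S := S) hE t hl hδl).hasDerivAt_integral (μ := μ) 0).deriv
  refine h1.trans ?_
  rw [← integral_add]
  · congr 1
    funext x
    rw [← Finset.sum_add_distrib]
    have h2 : ∀ i, HasDerivAt (fun s : ℝ => E i t (inst (u + s • δ' u) t) x)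
        (dder (E i t) (inst u t) (inst (δ' u) t) x) 0 := by
      intro i
      rw [← hd_inst_apply (E i) t hu ((histPlots_pt (n := n)).1 hZ) x]
      exact (((hE i).histSmooth t).smoothFun x).hasDerivAt_line hu' hZ
    have h3 : ∀ i, HasDerivAt (fun s : ℝ => inst (δ (u + s • δ' u)) t i x)
        (inst (fun i t x => deriv (fun s : ℝ => δ (u + s • δ' u) i t x) 0) t i x) 0 := by
      intro i
      rw [← deriv_inst (hasVel_variation hδ' hδ hu) (histPlots_pt.1 (hδl.pt 0)) t i x]
      exact (((jointSmooth_inst_param hδl t i).contDiff x).differentiable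
        (by simp)).differentiableAt.hasDerivAt
    have h4 := (HasDerivAt.fun_sum (u := S) fun i _ => (h2 i).mul (h3 i)).deriv
    refine h4.trans (Finset.sum_congr rfl fun i _ => ?_)
    simp
  · exact integrable_finsetSum _ fun i _ => (((hE i).isSmooth_dder t (isSmooth_inst hu t)
      (isSmooth_inst (histPlots_pt.1 hZ) t)).mul
      (isSmooth_inst (histPlots_pt.1 (hδ.pt hu')) t i)).integrable
  · exact integrable_finsetSum _ fun i _ => (((hE i).isSmooth t (isSmooth_inst hu t)).mul
      (isSmooth_inst hW t i)).integrable

end OneForm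

namespace GaugeTheory

variable {n : ℕ} [NeZero n] {M : Type*} [TopologicalSpace M] [CompactSpace M] [T2Space M]
  [ChartedSpace (EuclideanHalfSpace n) M] [IsManifold (𝓡∂ n) ∞ M] [MeasurableSpace M]
  [BorelSpace M] {A Λ α : Type*} [Fintype A] [DecidableEq A] [Fintype Λ]
  {T : GaugeTheory n M A Λ α}

namespace Couple

variable (c c' : T.Couple)

/-- The functional obtained by deriving `G'` along `tilde` has, in the direction `Y`, the variation
which formal differentiation of `∫ ∑ E'_i δΦ_i` predicts, without boundary terms. -/
def Mixed (t : ℝ) (Φ Y : Conf M A Λ) : Prop :=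
  ∀ N, c'.order ≤ N → fder (lieFun 0 c.tilde c'.G t) Φ Y =
    (∫ x, ∑ i ∈ upTo A Λ N, lie 0 c.tilde (c'.Ebar i) t Φ x * Y i x ∂T.vol) +
      ∫ x, ∑ i ∈ upTo A Λ N, c'.Ebar i t Φ x * dder (fun Φ => c.tilde t Φ i) Φ Y x ∂T.vol

lemma mixed_of_flat (t : ℝ) {Φ Y : Conf M A Λ} (hΦ : ∀ i, IsSmooth n (Φ i))
    (hY : ∀ i, IsSmooth n (Y i)) (hflat : ∀ i, FlatOnBoundary n (Y i)) : Mixed c c' t Φ Y := by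
  have := T.isFiniteMeasure_vol
  exact fun N hN => (c'.hasEL hN).fder_lieFun 0 c.isLocal_tilde t hΦ hY hflat

variable {c c'}

/-- The differentiability condition, with any sufficiently high order of summation. -/
lemma varyFun_eq (h : c'.IsDifferentiable) {δ : Hist M A Λ → Hist M A Λ}
    (hδ : T.PreservesInternal δ) {u : Hist M A Λ} (hu : T.External u) (t : ℝ) {N : ℕ}
    (hN : c'.order ≤ N) : hd (fun u => c'.G t (inst u t)) u (δ u) =
      ∫ x, ∑ i ∈ upTo A Λ N, c'.Ebar i t (inst u t) x * inst (δ u) t i x ∂T.vol := by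
  refine ((h δ hδ u hu t).2).trans ?_
  simp only [c'.sum_Ebar hN t (inst u t) (inst (δ u) t)]

/-- The first differentiability condition on `(G, δ_G)` says that `[δ_G, δ]` preserves the internal
boundary conditions if `δ` does. -/
lemma preservesInternal_comm (hreg : T.RegularExternal) (hd : c.IsDifferentiable)
    (hE : T.PreservesExternal c.variation) {δ : Hist M A Λ → Hist M A Λ}
    (hδ : T.PreservesInternal δ) : T.PreservesInternal (comm c.variation δ) := by
  have hs := c.smoothMap_variation
  refine ⟨smoothVariation_iff.2 (smoothMap_comm hs hδ.smoothMap),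
    preservesExternal_comm hreg hs hδ.smoothMap hE hδ.2.1, fun u hu i t x hx => ?_⟩
  exact (hd_comm_eq hs hδ.smoothMap ((T.histSmooth_χAlong i t).smoothFun x) hu.1).trans
    ((hd δ hδ u hu t).1 i x hx)

/-- The variation of `δ̃_c G'` has no boundary terms. Both `δ` and `[δ_c, δ]` preserve the internal
boundary conditions, so the differentiability of `G'` computes `δ_c δ G'` and `[δ_c, δ] G'`, hence
`δ δ_c G'`. Passing from `δ_c` to `δ̃_c` adds the derivative along the defect, which is flat. -/
lemma mixed_of_external (hreg : T.RegularExternal) (hd₁ : c.IsDifferentiable)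
    (hE₁ : T.PreservesExternal c.variation) (hd₂ : c'.IsDifferentiable)
    {δ : Hist M A Λ → Hist M A Λ} (hδ : T.PreservesInternal δ) {u : Hist M A Λ}
    (hu : T.External u) (t : ℝ) : Mixed c c' t (inst u t) (inst (δ u) t) := by
  have := T.isFiniteMeasure_vol
  have := T.isFiniteMeasure_bvol
  intro N hN
  have hs := c.smoothMap_variation
  have hs' := hδ.smoothMap
  have hEL := c'.hasEL hN
  have hΦ := isSmooth_inst hu.1 t
  have hδu : SmoothHist n (δ u) := histPlots_pt.1 (hs'.pt (histPlots_pt.2 hu.1))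
  have hvu := c.smoothHist_variation hu.1
  have hY := isSmooth_inst hδu t
  have hsG := smoothFun_inst c'.smoothFun_G t
  have hlie := ((show LocalFunctional n T.vol T.bvol c'.G from c'.G_local).lieFun 0
    c.isLocal_tilde).smoothFun
  have hloc : IsLocal n (fun t Φ x => ∑ i ∈ upTo A Λ N, c'.Ebar i t Φ x * c.tilde t Φ i x) :=
    IsLocal.sum fun i _ => (c'.isLocal_Ebar i).mul (c.isLocal_tilde i)
  -- the one-forms `k δ' = ∫ ∑ E_i δ'Φ_i`
  set k : (Hist M A Λ → Hist M A Λ) → Hist M A Λ → ℝ := fun δ' u =>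
    ∫ x, ∑ i ∈ upTo A Λ N, c'.Ebar i t (inst u t) x * inst (δ' u) t i x ∂T.vol with hk
  have hks : ∀ {δ'}, (histPlots n M A Λ).SmoothMap (histPlots n M A Λ) δ' →
      (histPlots n M A Λ).SmoothFun (k δ') := fun h => smoothFun_oneForm c'.isLocal_Ebar t h
  set W : (Hist M A Λ → Hist M A Λ) → (Hist M A Λ → Hist M A Λ) → Hist M A Λ := fun δ δ' =>
    fun i t x => deriv (fun s : ℝ => δ (u + s • δ' u) i t x) 0 with hW
  have hWs : ∀ {δ δ'}, (histPlots n M A Λ).SmoothMap (histPlots n M A Λ) δ →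
      (histPlots n M A Λ).SmoothMap (histPlots n M A Λ) δ' → SmoothHist n (W δ δ') :=
    fun h h' => (histPlots_pt (n := n)).1 ((isPlot_deriv_variation h' h
      (c := fun _ : ℝ => u) (histPlots_pt.2 hu.1)).pt 0)
  -- on external histories `δ_c G'` and `∫ ∑ E_i δ_cΦ_i` differ by a local functional
  have e1 : ∀ w, T.External w → hd (fun u => c'.G t (inst u t)) w (c.variation w)
        - k c.variation w = lieFun 0 c.tilde c'.G t (inst w t)
        - ∫ x, ∑ i ∈ upTo A Λ N, c'.Ebar i t (inst w t) x * c.tilde t (inst w t) i x ∂T.vol := by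
    intro w hw
    have hw1 := c.smoothHist_variation hw.1
    have hwi := isSmooth_inst hw.1 t
    have hwd := c.smooth_defect hw.1 t
    rw [hd_inst c'.G t hw.1 hw1, lieFun_zero_left, c.tilde_eq w t,
      fder_add c'.smoothFun_G t hwi (isSmooth_inst hw1 t) hwd,
      hEL.spec t _ _ hwi hwd (c.flat_defect hw t)]
    simp only [Pi.add_apply, mul_add, Finset.sum_add_distrib]
    rw [integral_add]
    · simp only [hk]; ring
    · exact integrable_finsetSum _ fun i _ => (((c'.isLocal_Ebar i).isSmooth t hwi).mul
        (isSmooth_inst hw1 t i)).integrable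
    · exact integrable_finsetSum _ fun i _ => (((c'.isLocal_Ebar i).isSmooth t hwi).mul
        (hwd i)).integrable
  have hsl := smoothFun_inst (F := fun t Φ =>
    ∫ x, ∑ i ∈ upTo A Λ N, c'.Ebar i t Φ x * c.tilde t Φ i x ∂T.vol) hloc.smoothFun_integral t
  have e2 := hd_eq_hd_of_external hreg ((hsG.hd hs).sub (hks hs))
    ((smoothFun_inst hlie t).sub hsl) e1 hu hδu (hδ.2.1 u hu)
  rw [(hsG.hd hs).hd_fun_sub (hks hs) (histPlots_pt.2 hu.1) (histPlots_pt.2 hδu),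
    (smoothFun_inst hlie t).hd_fun_sub hsl
      (histPlots_pt.2 hu.1) (histPlots_pt.2 hδu),
    hd_inst (lieFun 0 c.tilde c'.G) t hu.1 hδu,
    hd_inst (fun t Φ => ∫ x, ∑ i ∈ upTo A Λ N, c'.Ebar i t Φ x * c.tilde t Φ i x ∂T.vol) t hu.1
      hδu] at e2
  -- `δ δ_c G'`, from the differentiability conditions
  have e3 : hd (fun v => hd (fun u => c'.G t (inst u t)) v (δ v)) u (c.variation u) =
      hd (k δ) u (c.variation u) :=
    hd_eq_hd_of_external hreg (hsG.hd hs') (hks hs') (fun w hw => varyFun_eq hd₂ hδ hw t hN)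
      hu hvu (hE₁ u hu)
  have e4 := hd_comm_eq hs hs' hsG hu.1
  rw [varyFun_eq hd₂ (preservesInternal_comm hreg hd₁ hE₁ hδ) hu t hN, e3] at e4
  -- the derivatives of `δ` along `δ_c` drop out of the product rule for the one-forms
  have e5 : comm c.variation δ u = W δ c.variation - W c.variation δ := rfl
  rw [e5, inst_sub (hWs hs' hs) (hWs hs hs')] at e4
  have e6 := hd_oneForm (μ := T.vol) (S := upTo A Λ N) c'.isLocal_Ebar t hs' hs hu.1
  have e7 := hd_oneForm (μ := T.vol) (S := upTo A Λ N) c'.isLocal_Ebar t hs hs' hu.1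
  rw [show hd (k δ) u (c.variation u) = _ from e6] at e4
  rw [show hd (k c.variation) u (δ u) = _ from e7] at e2
  have e8 : fder (fun Φ => ∫ x, ∑ i ∈ upTo A Λ N, c'.Ebar i t Φ x * c.tilde t Φ i x ∂T.vol)
      (inst u t) (inst (δ u) t) =
      (∫ x, ∑ i ∈ upTo A Λ N, dder (c'.Ebar i t) (inst u t) (inst (δ u) t) x *
        c.tilde t (inst u t) i x ∂T.vol) + ∫ x, ∑ i ∈ upTo A Λ N, c'.Ebar i t (inst u t) x *
        dder (fun Φ => c.tilde t Φ i) (inst u t) (inst (δ u) t) x ∂T.vol := by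
    rw [hloc.fder_integral t hΦ hY, ← integral_add]
    · congr 1
      funext x
      rw [← Finset.sum_add_distrib]
      have h1 : ∀ i, HasDerivAt (fun s : ℝ => c'.Ebar i t (inst u t + s • inst (δ u) t) x)
          (dder (c'.Ebar i t) (inst u t) (inst (δ u) t) x) 0 := fun i =>
        ((c'.isLocal_Ebar i).smoothFun t x).hasDerivAt_line (fieldPlots_pt hΦ) (fieldPlots_pt hY)
      have h2 : ∀ i, HasDerivAt (fun s : ℝ => c.tilde t (inst u t + s • inst (δ u) t) i x)
          (dder (fun Φ => c.tilde t Φ i) (inst u t) (inst (δ u) t) x) 0 := fun i =>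
        ((c.isLocal_tilde i).smoothFun t x).hasDerivAt_line (fieldPlots_pt hΦ) (fieldPlots_pt hY)
      have h3 := (HasDerivAt.fun_sum (u := upTo A Λ N) fun i _ => (h1 i).mul (h2 i)).deriv
      refine h3.trans (Finset.sum_congr rfl fun i _ => ?_)
      simp
    · exact integrable_finsetSum _ fun i _ => (((c'.isLocal_Ebar i).isSmooth_dder t hΦ hY).mul
        (c.smooth_tilde t hΦ i)).integrable
    · exact integrable_finsetSum _ fun i _ => (((c'.isLocal_Ebar i).isSmooth t hΦ).mul
        ((c.isLocal_tilde i).isSmooth_dder t hΦ hY)).integrable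
  -- the defect is flat, so that the second variation along it is symmetric
  have e9 := hEL.integral_dder_symm T.vol_smooth t hΦ hY (c.smooth_defect hu.1 t)
    (c.flat_defect hu t)
  have e10 : ∫ x, ∑ i ∈ upTo A Λ N, dder (c'.Ebar i t) (inst u t) (inst (δ u) t) x *
        c.tilde t (inst u t) i x ∂T.vol =
      (∫ x, ∑ i ∈ upTo A Λ N, dder (c'.Ebar i t) (inst u t) (inst (δ u) t) x *
        inst (c.variation u) t i x ∂T.vol) +
      ∫ x, ∑ i ∈ upTo A Λ N, dder (c'.Ebar i t) (inst u t) (inst (δ u) t) x *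
        c.defect u t i x ∂T.vol := by
    rw [← integral_add]
    · simp only [c.tilde_eq u t, Pi.add_apply, mul_add, Finset.sum_add_distrib]
    · exact integrable_finsetSum _ fun i _ => (((c'.isLocal_Ebar i).isSmooth_dder t hΦ hY).mul
        (isSmooth_inst hvu t i)).integrable
    · exact integrable_finsetSum _ fun i _ => (((c'.isLocal_Ebar i).isSmooth_dder t hΦ hY).mul
        (c.smooth_defect hu.1 t i)).integrable
  have e11 : ∫ x, ∑ i ∈ upTo A Λ N, lie 0 c.tilde (c'.Ebar i) t (inst u t) x *
        inst (δ u) t i x ∂T.vol =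
      (∫ x, ∑ i ∈ upTo A Λ N, dder (c'.Ebar i t) (inst u t) (inst (c.variation u) t) x *
        inst (δ u) t i x ∂T.vol) +
      ∫ x, ∑ i ∈ upTo A Λ N, dder (c'.Ebar i t) (inst u t) (c.defect u t) x *
        inst (δ u) t i x ∂T.vol := by
    rw [← integral_add]
    · congr 1
      funext x
      rw [← Finset.sum_add_distrib]
      refine Finset.sum_congr rfl fun i _ => ?_
      rw [lie_zero_left, c.tilde_eq u t, (c'.isLocal_Ebar i).dder_add t hΦ (isSmooth_inst hvu t)
        (c.smooth_defect hu.1 t), Pi.add_apply, add_mul]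
    · exact integrable_finsetSum _ fun i _ => (((c'.isLocal_Ebar i).isSmooth_dder t hΦ
        (isSmooth_inst hvu t)).mul (hY i)).integrable
    · exact integrable_finsetSum _ fun i _ => (((c'.isLocal_Ebar i).isSmooth_dder t hΦ
        (c.smooth_defect hu.1 t)).mul (hY i)).integrable
  have e12 : ∫ x, ∑ i ∈ upTo A Λ N, c'.Ebar i t (inst u t) x *
        (inst (W δ c.variation) t - inst (W c.variation δ) t) i x ∂T.vol =
      (∫ x, ∑ i ∈ upTo A Λ N, c'.Ebar i t (inst u t) x * inst (W δ c.variation) t i x ∂T.vol) -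
      ∫ x, ∑ i ∈ upTo A Λ N, c'.Ebar i t (inst u t) x * inst (W c.variation δ) t i x ∂T.vol := by
    rw [← integral_sub]
    · simp only [Pi.sub_apply, mul_sub, Finset.sum_sub_distrib]
    · exact integrable_finsetSum _ fun i _ => (((c'.isLocal_Ebar i).isSmooth t hΦ).mul
        (isSmooth_inst (hWs hs' hs) t i)).integrable
    · exact integrable_finsetSum _ fun i _ => (((c'.isLocal_Ebar i).isSmooth t hΦ).mul
        (isSmooth_inst (hWs hs hs') t i)).integrable
  rw [e12] at e4
  rw [e8, e10, e9] at e2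
  rw [e11]
  linarith

end Couple

end GaugeTheory

/-! ### The bracket of two couples -/

namespace GaugeTheory

variable {n : ℕ} [NeZero n] {M : Type*} [TopologicalSpace M] [CompactSpace M] [T2Space M]
  [ChartedSpace (EuclideanHalfSpace n) M] [IsManifold (𝓡∂ n) ∞ M] [MeasurableSpace M]
  [BorelSpace M] {A Λ α : Type*} [Fintype A] [DecidableEq A] [Fintype Λ]
  (T : GaugeTheory n M A Λ α)

lemma isSmooth_hd_timed {f : ℝ → Conf M A Λ → M → ℝ} (hf : IsLocal n f) (t a : ℝ)
    {Φ Y : Conf M A Λ} (hΦ : ∀ i, IsSmooth n (Φ i)) (hY : ∀ i, IsSmooth n (Y i)) :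
    IsSmooth n (fun x => hd (fun u : ℝ × Conf M A Λ => f u.1 u.2 x) (t, Φ) (a, Y)) :=
  (hf.lie a (Z := fun _ _ => Y) fun i => isLocal_fixed (hY i)).isSmooth t hΦ

lemma isLocal_poisson {E E' : A → ℝ → Conf M A Λ → M → ℝ} (hE : ∀ i, IsLocal n (E i))
    (hE' : ∀ i, IsLocal n (E' i)) :
    IsLocal n (fun t Φ x => ∑ i, E i t Φ x * T.ham E' t Φ i x) :=
  IsLocal.sum fun i _ => (hE i).mul (T.isLocal_ham hE' i)

/-- The Poisson bracket is antisymmetric, so that its derivative only involves the derivatives of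
the hamiltonian vector fields. -/
lemma hd_poisson {E E' : A → ℝ → Conf M A Λ → M → ℝ} (hE : ∀ i, IsLocal n (E i))
    (hE' : ∀ i, IsLocal n (E' i)) (t a : ℝ) {Φ Y : Conf M A Λ} (hΦ : ∀ i, IsSmooth n (Φ i))
    (hY : ∀ i, IsSmooth n (Y i)) :
    hd (fun u : ℝ × Conf M A Λ => T.poisson E E' u.1 u.2) (t, Φ) (a, Y) =
      (∫ x, ∑ i, E i t Φ x *
        hd (fun u : ℝ × Conf M A Λ => T.ham E' u.1 u.2 i x) (t, Φ) (a, Y) ∂T.vol) -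
      ∫ x, ∑ i, E' i t Φ x *
        hd (fun u : ℝ × Conf M A Λ => T.ham E u.1 u.2 i x) (t, Φ) (a, Y) ∂T.vol := by
  have := T.isFiniteMeasure_vol
  have hs := fun i => (hE i).isSmooth t hΦ
  have hs' := fun i => (hE' i).isSmooth t hΦ
  have hds := fun i => (isSmooth_hd_timed (T.isLocal_ham hE i)) t a hΦ hY
  have hds' := fun i => (isSmooth_hd_timed (T.isLocal_ham hE' i)) t a hΦ hY
  have hu := timedPlots_pt t hΦ
  have hv : (timedPlots n M (A ⊕ (ℕ × Λ))).Pt (a, Y) := timedPlots_pt a hY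
  refine ((T.isLocal_poisson hE hE').hd_integral t a hΦ hY).trans ?_
  rw [← integral_sub (integrable_sum_mul _ hs hds') (integrable_sum_mul _ hs' hds)]
  congr 1
  funext x
  rw [PlotSpace.SmoothFun.hd_fun_sum _ (fun i _ => ((hE i).smoothFun_timed x).mul
    ((T.isLocal_ham hE' i).smoothFun_timed x)) hu hv]
  have h4 := T.sum_σ_antisymm
    (fun i => GaugeField.hd (fun u : ℝ × Conf M A Λ => E i u.1 u.2 x) (t, Φ) (a, Y))
    (fun i => E' i t Φ x)
  simp only [T.hd_ham hE _ x hu hv]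
  rw [sub_eq_add_neg, ← h4, add_comm, ← Finset.sum_add_distrib]
  refine Finset.sum_congr rfl fun i _ => ?_
  rw [((hE i).smoothFun_timed x).hd_fun_mul ((T.isLocal_ham hE' i).smoothFun_timed x) hu hv,
    T.hd_ham hE' _ x hu hv]
  rfl

lemma fder_poisson {E E' : A → ℝ → Conf M A Λ → M → ℝ} (hE : ∀ i, IsLocal n (E i))
    (hE' : ∀ i, IsLocal n (E' i)) (t : ℝ) {Φ Y : Conf M A Λ} (hΦ : ∀ i, IsSmooth n (Φ i))
    (hY : ∀ i, IsSmooth n (Y i)) : fder (T.poisson E E' t) Φ Y =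
      (∫ x, ∑ i, E i t Φ x * dder (fun Φ => T.ham E' t Φ i) Φ Y x ∂T.vol) -
      ∫ x, ∑ i, E' i t Φ x * dder (fun Φ => T.ham E t Φ i) Φ Y x ∂T.vol := by
  rw [← hd_timed (T.poisson E E'), T.hd_poisson hE hE' t 0 hΦ hY]
  have e : ∀ (F : A → ℝ → Conf M A Λ → M → ℝ) i x,
      hd (fun u : ℝ × Conf M A Λ => T.ham F u.1 u.2 i x) (t, Φ) (0, Y) =
        dder (fun Φ => T.ham F t Φ i) Φ Y x :=
    fun F i x => hd_timed_apply (fun t Φ => T.ham F t Φ i) t Φ Y x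
  simp only [e]

variable {T}

namespace Couple

lemma smooth_hamZ {E : A → ℝ → Conf M A Λ → M → ℝ} (hE : ∀ i, IsLocal n (E i)) (t : ℝ)
    {Φ : Conf M A Λ} (hΦ : ∀ i, IsSmooth n (Φ i)) (i : A ⊕ (ℕ × Λ)) :
    IsSmooth n (T.hamZ E t Φ i) := by
  cases i with
  | inl i => exact (T.isLocal_ham hE i).isSmooth t hΦ
  | inr p => exact isSmooth_const 0

lemma flat_hamZ {E : A → ℝ → Conf M A Λ → M → ℝ} (hE : ∀ i, IsLocal n (E i))
    (hf : ∀ i, T.FlatExternal (E i)) {u : Hist M A Λ} (hu : T.External u) (t : ℝ)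
    (i : A ⊕ (ℕ × Λ)) : FlatOnBoundary n (T.hamZ E t (inst u t) i) := by
  have hΦ := isSmooth_inst hu.1 t
  cases i with
  | inl i =>
    intro x hx
    have e : T.hamZ E t (inst u t) (Sum.inl i) = ∑ k, T.σ i k • E k t (inst u t) := by
      funext x
      simp only [Finset.sum_apply, Pi.smul_apply, smul_eq_mul]
      rfl
    rw [e]
    exact flatAt_sum (fun k _ => ((hE k).isSmooth t hΦ).smul _) fun k _ =>
      FlatAt.smul ((hE k).isSmooth t hΦ) _ (hf k u hu t x hx)
  | inr a => exact flatOnBoundary_zero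

/-- Integration by parts of the derivatives of the transformation of the multipliers. This is where
flatness of `δG'/δλ^(l)` is needed. -/
lemma exists_adjoint_tilde (c c' : T.Couple) : ∃ R : A ⊕ (ℕ × Λ) → ℝ → Conf M A Λ → M → ℝ,
    (∀ i, IsLocal n (R i)) ∧
    ((∀ l a, T.FlatExternal (c'.Ebar (Sum.inr (l, a)))) → ∀ i, T.FlatExternal (R i)) ∧
    ∃ N, c'.order ≤ N ∧ ∀ N' ≥ N, ∀ (t : ℝ) (Φ Y : Conf M A Λ), (∀ i, IsSmooth n (Φ i)) →
      (∀ i, IsSmooth n (Y i)) →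
      ((∀ l a, FlatOnBoundary n (c'.Ebar (Sum.inr (l, a)) t Φ)) ∨ ∀ i, FlatOnBoundary n (Y i)) →
      ∫ x, ∑ i ∈ upTo A Λ N', c'.Ebar i t Φ x * dder (fun Φ => c.tilde t Φ i) Φ Y x ∂T.vol =
        (∫ x, ∑ i, c'.Ez i t Φ x * dder (fun Φ => T.ham c.Ez t Φ i) Φ Y x ∂T.vol) +
          ∫ x, ∑ i ∈ upTo A Λ N', R i t Φ x * Y i x ∂T.vol := by
  have := T.isFiniteMeasure_vol
  obtain ⟨R, hR, hRf, N, hN⟩ := T.exists_adjoint (Finset.range (c'.order + 1) ×ˢ Finset.univ)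
    (f := fun p => c'.Ebar (Sum.inr p)) (g := fun p => T.δt^[p.1] (c.δlam p.2))
    (fun p => c'.isLocal_Ebar _) (fun p => T.isLocal_iterate_δt (c.δlam_local p.2) p.1)
  refine ⟨R, hR, fun h => hRf fun p => h p.1 p.2, max N c'.order, le_max_right _ _,
    fun N' hN' t Φ Y hΦ hY hflat => ?_⟩
  rw [← hN N' ((le_max_left _ _).trans hN') t Φ Y hΦ hY (hflat.imp_left fun h p => h p.1 p.2),
    ← integral_add
      (integrable_sum_mul _ (f := fun i => c'.Ez i t Φ)
        (fun i => (c'.E_local (Sum.inl i)).isSmooth t hΦ)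
        fun i => (c.isLocal_ham i).isSmooth_dder t hΦ hY)
      (integrable_sum_mul _ (fun p => (c'.isLocal_Ebar (Sum.inr p)).isSmooth t hΦ)
        fun p => (T.isLocal_iterate_δt (c.δlam_local p.2) p.1).isSmooth_dder t hΦ hY)]
  congr 1
  funext x
  rw [sum_upTo, ← Finset.sum_product']
  refine congrArg₂ (· + ·) rfl (Finset.sum_subset ?_ fun p hp hp' => ?_).symm
  · refine Finset.product_subset_product_left (Finset.range_mono ?_)
    have := (le_max_right N c'.order).trans hN'
    omega
  · have : ¬ p.1 ≤ c'.order := fun h => hp' (by simp; omega)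
    simp [Ebar, this]

lemma bracketG_eq (c₁ c₂ : T.Couple) : T.bracketG c₁ c₂ = fun t Φ =>
    lieFun 0 c₁.tilde c₂.G t Φ - lieFun 0 c₂.tilde c₁.G t Φ - T.poisson c₂.Ez c₁.Ez t Φ := by
  funext t Φ
  rw [lieFun_zero_left, lieFun_zero_left]
  rfl

/-- The bracket of two couples is a couple. Its variational derivatives are known up to terms `R`
which vanish at the boundary: in the variation of `δ̃₁G₂ - δ̃₂G₁`, the variations of the hamiltonian
vector fields cancel against the variation of `{G₂, G₁}`, and the variations of the transformations
of the multipliers are integrated by parts. The last formula extends the variational derivatives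
from variations supported in the interior to those for which `Mixed` holds. -/
lemma exists_bracket (c₁ c₂ : T.Couple) : ∃ R : A ⊕ (ℕ × Λ) → ℝ → Conf M A Λ → M → ℝ,
    (∀ i, IsLocal n (R i)) ∧
    ((∀ l a, T.FlatExternal (c₁.Ebar (Sum.inr (l, a)))) →
      (∀ l a, T.FlatExternal (c₂.Ebar (Sum.inr (l, a)))) → ∀ i, T.FlatExternal (R i)) ∧
    ∃ c : T.Couple, c.G = T.bracketG c₁ c₂ ∧ c.δlam = T.bracketLam c₁ c₂ ∧
      (∀ i t Φ x, c.E i t Φ x =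
        lie 0 c₁.tilde (c₂.Ebar i) t Φ x - lie 0 c₂.tilde (c₁.Ebar i) t Φ x + R i t Φ x) ∧
      ∀ (t : ℝ) (Φ Y : Conf M A Λ), (∀ i, IsSmooth n (Φ i)) → (∀ i, IsSmooth n (Y i)) →
        Mixed c₁ c₂ t Φ Y → Mixed c₂ c₁ t Φ Y →
        ((∀ l a, FlatOnBoundary n (c₁.Ebar (Sum.inr (l, a)) t Φ) ∧
          FlatOnBoundary n (c₂.Ebar (Sum.inr (l, a)) t Φ)) ∨ ∀ i, FlatOnBoundary n (Y i)) →
        fder (c.G t) Φ Y = ∫ x, ∑ i ∈ upTo A Λ c.order, c.E i t Φ x * Y i x ∂T.vol := by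
  have := T.isFiniteMeasure_vol
  have := T.isFiniteMeasure_bvol
  obtain ⟨R, hR, hRf, N, hoN, hN⟩ := exists_adjoint_tilde c₁ c₂
  obtain ⟨R', hR', hRf', N', hoN', hN'⟩ := exists_adjoint_tilde c₂ c₁
  have hG₁ := (show LocalFunctional n T.vol T.bvol c₁.G from c₁.G_local).lieFun 0 c₂.isLocal_tilde
  have hG₂ := (show LocalFunctional n T.vol T.bvol c₂.G from c₂.G_local).lieFun 0 c₁.isLocal_tilde
  have hp := T.isLocal_poisson (E := c₂.Ez) (E' := c₁.Ez) (fun i => c₂.E_local _)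
    (fun i => c₁.E_local _)
  have hpl := localFunctional_integral (vol := T.vol) (bvol := T.bvol) hp
  have hbr := bracketG_eq c₁ c₂
  have hbG : LocalFunctional n T.vol T.bvol (T.bracketG c₁ c₂) := hbr ▸ (hG₂.sub hG₁).sub hpl
  set E : A ⊕ (ℕ × Λ) → ℝ → Conf M A Λ → M → ℝ := fun i t Φ x =>
    lie 0 c₁.tilde (c₂.Ebar i) t Φ x - lie 0 c₂.tilde (c₁.Ebar i) t Φ x
      + (R i t Φ x - R' i t Φ x) with hEdef
  have hl₂ := fun i => (c₂.isLocal_Ebar i).lie 0 c₁.isLocal_tilde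
  have hl₁ := fun i => (c₁.isLocal_Ebar i).lie 0 c₂.isLocal_tilde
  have hE : ∀ i, IsLocal n (E i) := fun i => ((hl₂ i).sub (hl₁ i)).add ((hR i).sub (hR' i))
  have key : ∀ (t : ℝ) (Φ Y : Conf M A Λ), (∀ i, IsSmooth n (Φ i)) → (∀ i, IsSmooth n (Y i)) →
      Mixed c₁ c₂ t Φ Y → Mixed c₂ c₁ t Φ Y →
      ((∀ l a, FlatOnBoundary n (c₁.Ebar (Sum.inr (l, a)) t Φ) ∧
        FlatOnBoundary n (c₂.Ebar (Sum.inr (l, a)) t Φ)) ∨ ∀ i, FlatOnBoundary n (Y i)) →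
      fder (T.bracketG c₁ c₂ t) Φ Y =
        ∫ x, ∑ i ∈ upTo A Λ (max N N'), E i t Φ x * Y i x ∂T.vol := by
    intro t Φ Y hΦ hY hm hm' hfl
    have e1 := ((hG₂.smoothFun.sub hG₁.smoothFun).hd_fun_sub hpl.smoothFun (timedPlots_pt t hΦ)
      (timedPlots_pt 0 hY))
    rw [hG₂.smoothFun.hd_fun_sub hG₁.smoothFun (timedPlots_pt t hΦ) (timedPlots_pt 0 hY),
      hd_timed (lieFun 0 c₁.tilde c₂.G), hd_timed (lieFun 0 c₂.tilde c₁.G),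
      hd_timed (fun t Φ => ∫ x, ∑ i, c₂.Ez i t Φ x * T.ham c₁.Ez t Φ i x ∂T.vol)] at e1
    have e2 : fder (fun Φ => ∫ x, ∑ i, c₂.Ez i t Φ x * T.ham c₁.Ez t Φ i x ∂T.vol) Φ Y = _ :=
      T.fder_poisson (E := c₂.Ez) (E' := c₁.Ez) (fun i => c₂.E_local _)
        (fun i => c₁.E_local _) t hΦ hY
    have e0 : fder (T.bracketG c₁ c₂ t) Φ Y = _ := (hd_timed (T.bracketG c₁ c₂) t Φ Y).symm
    rw [e0, hbr]
    refine e1.trans ?_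
    rw [e2, hm _ (hoN.trans (le_max_left N N')), hm' _ (hoN'.trans (le_max_right N N')),
      hN _ (le_max_left N N') t Φ Y hΦ hY (hfl.imp_left fun h l a => (h l a).2),
      hN' _ (le_max_right N N') t Φ Y hΦ hY (hfl.imp_left fun h l a => (h l a).1)]
    have i1 : ∀ {F : A ⊕ (ℕ × Λ) → ℝ → Conf M A Λ → M → ℝ}, (∀ i, IsLocal n (F i)) →
        Integrable (fun x => ∑ i ∈ upTo A Λ (max N N'), F i t Φ x * Y i x) T.vol := fun h =>
      integrable_sum_mul _ (fun i => (h i).isSmooth t hΦ) hY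
    have e3 : ∫ x, ∑ i ∈ upTo A Λ (max N N'), E i t Φ x * Y i x ∂T.vol =
        (∫ x, ∑ i ∈ upTo A Λ (max N N'), lie 0 c₁.tilde (c₂.Ebar i) t Φ x * Y i x ∂T.vol) -
        (∫ x, ∑ i ∈ upTo A Λ (max N N'), lie 0 c₂.tilde (c₁.Ebar i) t Φ x * Y i x ∂T.vol) +
        ((∫ x, ∑ i ∈ upTo A Λ (max N N'), R i t Φ x * Y i x ∂T.vol) -
          ∫ x, ∑ i ∈ upTo A Λ (max N N'), R' i t Φ x * Y i x ∂T.vol) := by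
      rw [← integral_sub (i1 hl₂) (i1 hl₁), ← integral_sub (i1 hR) (i1 hR'),
        ← integral_add (by exact (i1 hl₂).sub (i1 hl₁)) (by exact (i1 hR).sub (i1 hR'))]
      simp only [hEdef, add_mul, sub_mul, Finset.sum_add_distrib, Finset.sum_sub_distrib]
    rw [e3]
    ring
  refine ⟨fun i t Φ x => R i t Φ x - R' i t Φ x, fun i => (hR i).sub (hR' i),
    fun h₁ h₂ i u hu t x hx => FlatAt.sub ((hR i).isSmooth t (isSmooth_inst hu.1 t))
      ((hR' i).isSmooth t (isSmooth_inst hu.1 t)) (hRf h₂ i u hu t x hx) (hRf' h₁ i u hu t x hx),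
    { G := T.bracketG c₁ c₂
      δlam := T.bracketLam c₁ c₂
      order := max N N'
      E := E
      G_local := hbG
      δlam_local := fun a => ((c₂.δlam_local a).dder_subst isLocal_field c₁.isLocal_tilde).sub
        ((c₁.δlam_local a).dder_subst isLocal_field c₂.isLocal_tilde)
      E_local := hE
      E_spec := fun t Φ Y hΦ hY hYs => ?_ }, rfl, rfl, fun i t Φ x => rfl, key⟩
  have hflat : ∀ i, FlatOnBoundary n (Y i) := fun i => flatOnBoundary_of_tsupport (hYs i)
  exact key t Φ Y hΦ hY (mixed_of_flat c₁ c₂ t hΦ hY hflat) (mixed_of_flat c₂ c₁ t hΦ hY hflat)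
    (Or.inr hflat)

end Couple

end GaugeTheory

/-! ### The transformation generated by the bracket -/

namespace GaugeTheory

variable {n : ℕ} [NeZero n] {M : Type*} [TopologicalSpace M] [CompactSpace M] [T2Space M]
  [ChartedSpace (EuclideanHalfSpace n) M] [IsManifold (𝓡∂ n) ∞ M] [MeasurableSpace M]
  [BorelSpace M] {A Λ α : Type*} [Fintype A] [DecidableEq A] [Fintype Λ]
  {T : GaugeTheory n M A Λ α}

/-- All variations preserving the internal boundary conditions annihilate `f`, at external
histories. -/
def InternallyInvariant (T : GaugeTheory n M A Λ α) (f : Hist M A Λ → ℝ) : Prop :=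
  ∀ δ, T.PreservesInternal δ → ∀ u, T.External u → hd f u (δ u) = 0

/-- Since `[δ_G, δ]` preserves the internal boundary conditions if `δ` does, invariant expressions
are mapped to invariant expressions by `δ_G`. -/
lemma InternallyInvariant.variation {c : T.Couple} (hreg : T.RegularExternal)
    (hd₁ : c.IsDifferentiable) (hE : T.PreservesExternal c.variation) {f : Hist M A Λ → ℝ}
    (hf : (histPlots n M A Λ).SmoothFun f) (h : T.InternallyInvariant f) :
    T.InternallyInvariant (fun u => hd f u (c.variation u)) := by
  intro δ hδ u hu
  have hs := c.smoothMap_variation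
  have h1 := hd_comm_eq hs hδ.smoothMap hf hu.1
  rw [h _ (Couple.preservesInternal_comm hreg hd₁ hE hδ) u hu,
    hd_eq_zero_of_external hreg (hf.hd hδ.smoothMap) (h δ hδ) hu (c.smoothHist_variation hu.1)
      (hE u hu)] at h1
  linarith

namespace Couple

/-- `c` is the bracket of `c₁` and `c₂`, and its variational derivatives are those expected from
formal differentiation, up to terms `R` which vanish at the boundary. -/
structure IsBracket (c c₁ c₂ : T.Couple) (R : A ⊕ (ℕ × Λ) → ℝ → Conf M A Λ → M → ℝ) : Prop where
  G_eq : c.G = T.bracketG c₁ c₂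
  δlam_eq : c.δlam = T.bracketLam c₁ c₂
  E_eq : ∀ i t Φ x, c.E i t Φ x =
    lie 0 c₁.tilde (c₂.Ebar i) t Φ x - lie 0 c₂.tilde (c₁.Ebar i) t Φ x + R i t Φ x
  R_local : ∀ i, IsLocal n (R i)
  R_flat : ∀ i, T.FlatExternal (R i)

variable {c c₁ c₂ : T.Couple} {R : A ⊕ (ℕ × Λ) → ℝ → Conf M A Λ → M → ℝ}
  (hb : IsBracket c c₁ c₂ R)

include hb

/-- On `(z, λ)` the transformation generated by the bracket is the commutator of the
transformations at fixed time, up to terms which vanish at the boundary. -/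
lemma IsBracket.low_tilde (t : ℝ) {Φ : Conf M A Λ} (hΦ : ∀ i, IsSmooth n (Φ i)) (j : A ⊕ Λ) :
    low (c.tilde t Φ) j = dder (fun Φ => low (c₂.tilde t Φ) j) Φ (c₁.tilde t Φ)
      - dder (fun Φ => low (c₁.tilde t Φ) j) Φ (c₂.tilde t Φ)
      + low (T.hamZ (fun i => R (Sum.inl i)) t Φ) j := by
  cases j with
  | inl i =>
    funext x
    have e1 := T.dder_ham (E := c₂.Ez) (fun i => c₂.E_local _) i t hΦ (c₁.smooth_tilde t hΦ) x
    have e2 := T.dder_ham (E := c₁.Ez) (fun i => c₁.E_local _) i t hΦ (c₂.smooth_tilde t hΦ) x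
    show ∑ j, T.σ i j * c.E (Sum.inl j) t Φ x = dder (fun Φ => T.ham c₂.Ez t Φ i) Φ _ x -
      dder (fun Φ => T.ham c₁.Ez t Φ i) Φ _ x + ∑ j, T.σ i j * R (Sum.inl j) t Φ x
    rw [e1, e2, ← Finset.sum_sub_distrib, ← Finset.sum_add_distrib]
    refine Finset.sum_congr rfl fun j _ => ?_
    rw [hb.E_eq, lie_zero_left, lie_zero_left, mul_add, mul_sub]
    rfl
  | inr a =>
    show c.δlam a t Φ = _
    rw [hb.δlam_eq]
    exact (add_zero _).symm

/-- On histories, the transformation generated by the bracket is the commutator of the two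
transformations, up to the terms `R` and the derivatives along the defects, all of which are flat.
-/
lemma IsBracket.flat_sub_comm {u : Hist M A Λ} (hu : T.External u) (j : A ⊕ Λ) (t : ℝ) :
    FlatOnBoundary n ((c.variation u - comm c₁.variation c₂.variation u) j t) := by
  have hΦ := isSmooth_inst hu.1 t
  have hloc : ∀ c : T.Couple, IsLocal n (fun t Φ => low (c.tilde t Φ) j) := fun c => by
    cases j with
    | inl i => exact c.isLocal_tilde (Sum.inl i)
    | inr a => exact c.isLocal_tilde (Sum.inr (0, a))
  have hvar : ∀ (c : T.Couple) (v : Hist M A Λ), c.variation v j t = low (c.tilde t (inst v t)) j :=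
    fun c v => by cases j <;> rfl
  have hR : ∀ i, IsLocal n (R (Sum.inl i)) := fun i => hb.R_local _
  have hsR := smooth_low (smooth_hamZ (T := T) hR t hΦ) j
  have hfR := flat_low (flat_hamZ hR (fun i => hb.R_flat _) hu t) j
  have e : (c.variation u - comm c₁.variation c₂.variation u) j t =
      dder (fun Φ => low (c₂.tilde t Φ) j) (inst u t) (c₁.defect u t) -
        dder (fun Φ => low (c₁.tilde t Φ) j) (inst u t) (c₂.defect u t) +
        low (T.hamZ (fun i => R (Sum.inl i)) t (inst u t)) j := by
    have hc : comm c₁.variation c₂.variation u j t =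
        dder (fun Φ => low (c₂.tilde t Φ) j) (inst u t) (inst (c₁.variation u) t) -
        dder (fun Φ => low (c₁.tilde t Φ) j) (inst u t) (inst (c₂.variation u) t) := by
      funext x
      rw [Pi.sub_apply, ← hd_inst_apply (fun t Φ => low (c₂.tilde t Φ) j) t hu.1
        (c₁.smoothHist_variation hu.1) x, ← hd_inst_apply (fun t Φ => low (c₁.tilde t Φ) j) t hu.1
        (c₂.smoothHist_variation hu.1) x]
      simp only [comm, hd, hvar]
    rw [Pi.sub_apply, Pi.sub_apply, hc, hvar, hb.low_tilde t hΦ, defect, defect,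
      (hloc c₂).dder_sub t hΦ (c₁.smooth_tilde t hΦ) (isSmooth_inst (c₁.smoothHist_variation hu.1) t),
      (hloc c₁).dder_sub t hΦ (c₂.smooth_tilde t hΦ) (isSmooth_inst (c₂.smoothHist_variation hu.1) t)]
    abel
  have hs₂ := (hloc c₂).isSmooth_dder t hΦ (c₁.smooth_defect hu.1 t)
  have hs₁ := (hloc c₁).isSmooth_dder t hΦ (c₂.smooth_defect hu.1 t)
  intro x hx
  rw [e]
  exact FlatAt.add (hs₂.sub hs₁) hsR (FlatAt.sub hs₂ hs₁
    ((hloc c₂).flatAt_dder t hΦ (c₁.smooth_defect hu.1 t) fun i => c₁.flat_defect hu t i x hx)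
    ((hloc c₁).flatAt_dder t hΦ (c₂.smooth_defect hu.1 t) fun i => c₂.flat_defect hu t i x hx))
    (hfR x hx)

variable (hreg : T.RegularExternal) (hd₁ : c₁.IsDifferentiable) (hd₂ : c₂.IsDifferentiable)
  (hE₁ : T.PreservesExternal c₁.variation) (hE₂ : T.PreservesExternal c₂.variation)

lemma smooth_sub_comm {u : Hist M A Λ} (hu : SmoothHist n u) :
    SmoothHist n (c.variation u - comm c₁.variation c₂.variation u) :=
  (c.smoothHist_variation hu).sub (histPlots_pt.1
    ((smoothMap_comm c₁.smoothMap_variation c₂.smoothMap_variation).pt (histPlots_pt.2 hu)))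

include hreg hE₁ hE₂

/-- Commutators preserve the external boundary conditions, and flat variations do so as well. -/
lemma IsBracket.preservesExternal : T.PreservesExternal c.variation := by
  intro u hu
  have h := LinExternal.add hu.1 (histPlots_pt.1
    ((smoothMap_comm c₁.smoothMap_variation c₂.smoothMap_variation).pt (histPlots_pt.2 hu.1)))
    (smooth_sub_comm hb hu.1)
    (preservesExternal_comm hreg c₁.smoothMap_variation c₂.smoothMap_variation hE₁ hE₂ u hu)
    (linExternal_of_flat hu (smooth_sub_comm hb hu.1) fun j t => hb.flat_sub_comm hu j t)
  rwa [add_sub_cancel] at h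

include hd₁ hd₂

/-- The first differentiability condition for the bracket. At external histories `δ_c χ` is
`δ₁ δ₂ χ - δ₂ δ₁ χ`, which is annihilated by `δ` because `δ₁` and `δ₂` map invariant expressions to
invariant expressions. -/
lemma IsBracket.commutator_eq_zero {δ : Hist M A Λ → Hist M A Λ} (hδ : T.PreservesInternal δ)
    {u : Hist M A Λ} (hu : T.External u) (t : ℝ) (i : α) {x : M} (hx : x ∈ (𝓡∂ n).boundary M) :
    commutator c.variation δ (T.χAlong i) u t x = 0 := by
  set f : Hist M A Λ → ℝ := fun u => T.χAlong i u t x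
  have hf : (histPlots n M A Λ).SmoothFun f := (T.histSmooth_χAlong i t).smoothFun x
  have h0 : T.InternallyInvariant f := fun δ hδ u hu => hδ.2.2 u hu i t x hx
  have hs := c.smoothMap_variation
  have hs₁ := c₁.smoothMap_variation
  have hs₂ := c₂.smoothMap_variation
  have hδu := histPlots_pt.1 (hδ.smoothMap.pt (histPlots_pt.2 hu.1))
  have e1 : hd (fun v => hd f v (δ v)) u (c.variation u) = 0 :=
    hd_eq_zero_of_external hreg (hf.hd hδ.smoothMap) (h0 δ hδ) hu (c.smoothHist_variation hu.1)
      (hb.preservesExternal hreg hE₁ hE₂ u hu)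
  -- at external histories `δ_c χ = [δ₁, δ₂] χ`
  have e2 : ∀ v, T.External v → hd f v (c.variation v) =
      hd (fun w => hd f w (c₂.variation w)) v (c₁.variation v) -
        hd (fun w => hd f w (c₁.variation w)) v (c₂.variation v) := by
    intro v hv
    have hW := smooth_sub_comm hb hv.1
    have e3 : hd f v (c.variation v - comm c₁.variation c₂.variation v) = 0 := by
      have hl : IsLocal n (fun _ (Φ : Conf M A Λ) => T.χ i (low Φ)) := (T.χ_local i).low
      refine (hd_inst_apply (fun _ Φ => T.χ i (low Φ)) t hv.1 hW x).trans (FlatAt.eq_zero (n := n) ?_)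
      exact hl.flatAt_dder t (isSmooth_inst hv.1 t) (isSmooth_inst hW t)
        fun j => flat_inst hW (fun i t => hb.flat_sub_comm hv i t) t j x hx
    rw [← hd_comm_eq hs₁ hs₂ hf hv.1]
    rw [hf.hd_sub (histPlots_pt.2 hv.1) (hs.pt (histPlots_pt.2 hv.1))
      ((smoothMap_comm hs₁ hs₂).pt (histPlots_pt.2 hv.1))] at e3
    linarith
  have e4 : hd (fun v => hd f v (c.variation v)) u (δ u) = 0 := by
    refine (hd_eq_hd_of_external hreg (hf.hd hs) (((hf.hd hs₂).hd hs₁).sub ((hf.hd hs₁).hd hs₂))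
      e2 hu hδu (hδ.2.1 u hu)).trans ?_
    rw [((hf.hd hs₂).hd hs₁).hd_fun_sub ((hf.hd hs₁).hd hs₂) (histPlots_pt.2 hu.1)
      (histPlots_pt.2 hδu),
      ((h0.variation hreg hd₂ hE₂ hf).variation hreg hd₁ hE₁ (hf.hd hs₂)) δ hδ u hu,
      ((h0.variation hreg hd₁ hE₁ hf).variation hreg hd₂ hE₂ (hf.hd hs₁)) δ hδ u hu, sub_zero]
  exact (congrArg₂ (· - ·) e1 e4).trans (sub_zero 0)

end Couple

end GaugeTheory

/-! ### The conservation law of the bracket -/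

namespace GaugeTheory

variable {n : ℕ} [NeZero n] {M : Type*} [TopologicalSpace M] [CompactSpace M] [T2Space M]
  [ChartedSpace (EuclideanHalfSpace n) M] [IsManifold (𝓡∂ n) ∞ M] [MeasurableSpace M]
  [BorelSpace M] {A Λ α : Type*} [Fintype A] [DecidableEq A] [Fintype Λ]
  {T : GaugeTheory n M A Λ α}

namespace Couple

variable (c c' : T.Couple)

lemma sum_upTo_hamZ (N : ℕ) (F : A ⊕ (ℕ × Λ) → ℝ) (E : A → ℝ → Conf M A Λ → M → ℝ) (t : ℝ)
    (Φ : Conf M A Λ) (x : M) : ∑ i ∈ upTo A Λ N, F i * T.hamZ E t Φ i x =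
      ∑ i, F (Sum.inl i) * T.ham E t Φ i x := by
  simp [sum_upTo, hamZ]

section Boundary

variable {v : ℝ → Conf M A Λ → M → ℝ} (hv : IsLocal n v)

include hv

/-- On boundary functionals, `tilde` and the variation of histories act in the same way: they differ
by the defect, which is flat at the boundary. -/
lemma fder_boundary_tilde {u : Hist M A Λ} (hu : T.External u) (t : ℝ) :
    fder (T.boundaryFunctional v t) (inst u t) (c.tilde t (inst u t)) =
      hd (fun u => T.boundaryFunctional v t (inst u t)) u (c.variation u) := by
  have := T.isFiniteMeasure_bvol
  have hΦ := isSmooth_inst hu.1 t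
  have hs : (timedPlots n M (A ⊕ (ℕ × Λ))).SmoothFun
    (fun u => T.boundaryFunctional v u.1 u.2) := hv.smoothFun_integral
  rw [hd_inst (T.boundaryFunctional v) t hu.1 (c.smoothHist_variation hu.1), c.tilde_eq,
    fder_add hs t hΦ (isSmooth_inst (c.smoothHist_variation hu.1) t) (c.smooth_defect hu.1 t),
    show fder (T.boundaryFunctional v t) (inst u t) (c.defect u t) = 0 from
      hv.fder_boundary T.bvol_smooth t hΦ (c.smooth_defect hu.1 t) (c.flat_defect hu t), add_zero]

variable {c'} in
/-- At external histories, the conservation law of `c'` may be derived along `tilde`, although this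
is not the instantaneous value of a variation: the difference vanishes at the boundary. -/
lemma Conserved.fder_tilde (h : c'.Conserved v) (hreg : T.RegularExternal)
    (hE : T.PreservesExternal c.variation) {u : Hist M A Λ} (hu : T.External u) (t : ℝ) :
    lieFun 0 c.tilde c'.noether t (inst u t) =
      fder (T.boundaryFunctional v t) (inst u t) (c.tilde t (inst u t)) := by
  have := T.isFiniteMeasure_vol
  have := T.isFiniteMeasure_bvol
  have hΦ := isSmooth_inst hu.1 t
  have hvu := c.smoothHist_variation hu.1
  have hs : (timedPlots n M (A ⊕ (ℕ × Λ))).SmoothFun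
    (fun u => T.boundaryFunctional v u.1 u.2) := hv.smoothFun_integral
  have hn := c'.localFunctional_noether.smoothFun
  have hK := hn.sub hs
  have e1 := h.fder_eq hv hu t hΦ (c.smooth_defect hu.1 t) (c.flat_defect hu t)
  have hKi := smoothFun_inst (F := fun t Φ => c'.noether t Φ - T.boundaryFunctional v t Φ) hK t
  have e2 := hd_eq_zero_of_external hreg hKi (fun w hw => sub_eq_zero.2 (h w hw t)) hu hvu (hE u hu)
  rw [hd_inst (fun t Φ => c'.noether t Φ - T.boundaryFunctional v t Φ) t hu.1 hvu] at e2
  have e3 := fder_add (F := fun t Φ => c'.noether t Φ - T.boundaryFunctional v t Φ) hK t hΦ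
    (isSmooth_inst hvu t) (c.smooth_defect hu.1 t)
  rw [← c.tilde_eq] at e3
  have e4 := hn.hd_fun_sub hs (timedPlots_pt t hΦ) (timedPlots_pt 0 (c.smooth_tilde t hΦ))
  rw [hd_timed c'.noether, hd_timed (T.boundaryFunctional v),
    hd_timed (fun t Φ => c'.noether t Φ - T.boundaryFunctional v t Φ)] at e4
  rw [lieFun_zero_left]
  have e5 : fder (fun Φ => c'.noether t Φ - T.boundaryFunctional v t Φ) (inst u t)
      (c.tilde t (inst u t)) = 0 := e3.trans (by rw [e1, e2, add_zero])
  rw [e5] at e4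
  linarith

end Boundary

/-- The derivative along the flow of the hamiltonian vector field of `G`, by the Euler–Lagrange
equations `hrel` of the conservation law. -/
lemma hd_ham_flow {Q : A ⊕ (ℕ × Λ) → ℝ → Conf M A Λ → M → ℝ} (t : ℝ) {Φ : Conf M A Λ}
    (hΦ : ∀ i, IsSmooth n (Φ i)) (hrel : ∀ i : A, lie 1 T.flow (c.E (Sum.inl i)) t Φ =
      dder (fun Φ => T.dH i (low Φ)) Φ (c.tilde t Φ) + Q (Sum.inl i) t Φ) (i : A) (x : M) :
    hd (fun u : ℝ × Conf M A Λ => T.ham c.Ez u.1 u.2 i x) (t, Φ) (1, T.flow t Φ) =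
      dder (fun Φ => T.XH i (low Φ)) Φ (c.tilde t Φ) x +
        T.ham (fun i => Q (Sum.inl i)) t Φ i x := by
  have a2 : dder (fun Φ => T.XH i (low Φ)) Φ (c.tilde t Φ) x = _ :=
    T.dder_ham (E := fun j _ Φ => T.dH j (low Φ)) (fun j => (T.isLocal_dH j).low) i t hΦ
      (c.smooth_tilde t hΦ) x
  rw [T.hd_ham (E := c.Ez) (fun i => c.E_local _) i x (timedPlots_pt t hΦ)
    (timedPlots_pt 1 (T.smooth_flow t hΦ)), a2]
  refine Eq.trans ?_ Finset.sum_add_distrib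
  refine Finset.sum_congr rfl fun j _ => ?_
  rw [← mul_add]
  exact congrArg _ (congrFun (hrel j) x)

/-- The commutator of `D = ∂_t + flow` with `tilde` only acts on `z`, by the hamiltonian vector
field of the term `Q` in the variational derivatives of the conservation law. -/
lemma lieFun_flow_tilde {Q : A ⊕ (ℕ × Λ) → ℝ → Conf M A Λ → M → ℝ} (hQ : ∀ i, IsLocal n (Q i))
    (hQf : ∀ i, T.FlatExternal (Q i)) {u : Hist M A Λ} (hu : T.External u) (t : ℝ)
    (hrel : ∀ i : A, lie 1 T.flow (c.E (Sum.inl i)) t (inst u t) =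
        dder (fun Φ => T.dH i (low Φ)) (inst u t) (c.tilde t (inst u t))
          + Q (Sum.inl i) t (inst u t)) :
    lieFun 1 T.flow (lieFun 0 c.tilde c'.G) t (inst u t) =
      lieFun 0 c.tilde (lieFun 1 T.flow c'.G) t (inst u t) +
        ∫ x, ∑ i, c'.Ez i t (inst u t) x *
          T.ham (fun i => Q (Sum.inl i)) t (inst u t) i x ∂T.vol := by
  have hΦ := isSmooth_inst hu.1 t
  have hQz : ∀ i, IsLocal n (Q (Sum.inl i)) := fun i => hQ _
  have e1 := c'.smoothFun_G.hd_commutator (smoothMap_timed 1 T.isLocal_flow)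
    (smoothMap_timed 0 c.isLocal_tilde) (timedPlots_pt t hΦ)
    (hasVel_field 0 c.isLocal_tilde t 1 hΦ (T.smooth_flow t hΦ))
    (hasVel_field 1 T.isLocal_flow t 0 hΦ (c.smooth_tilde t hΦ))
  have e2 : ((0, fun i x => hd (fun u : ℝ × Conf M A Λ => c.tilde u.1 u.2 i x) (t, inst u t)
        (1, T.flow t (inst u t))) : ℝ × Conf M A Λ) -
      (0, fun i x => hd (fun u : ℝ × Conf M A Λ => T.flow u.1 u.2 i x) (t, inst u t)
        (0, c.tilde t (inst u t))) = (0, T.hamZ (fun i => Q (Sum.inl i)) t (inst u t)) := by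
    refine Prod.ext (sub_self 0) (funext fun i => funext fun x => sub_eq_of_eq_add ?_)
    cases i with
    | inl i =>
      exact (c.hd_ham_flow t hΦ hrel i x).trans (add_comm _ _)
    | inr p =>
      have a1 : T.δt (T.δt^[p.1] (c.δlam p.2)) t (inst u t) x = _ := congrFun (T.δt_eq_lie
        (T.isLocal_iterate_δt (c.δlam_local p.2) p.1) t hΦ) x
      have a2 : hd (fun u : ℝ × Conf M A Λ => T.flow u.1 u.2 (Sum.inr p) x) (t, inst u t)
          (0, c.tilde t (inst u t)) = c.tilde t (inst u t) (Sum.inr (p.1 + 1, p.2)) x := by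
        have h : HasDerivAt (fun s : ℝ => inst u t (Sum.inr (p.1 + 1, p.2)) x
            + s * c.tilde t (inst u t) (Sum.inr (p.1 + 1, p.2)) x)
            (1 * c.tilde t (inst u t) (Sum.inr (p.1 + 1, p.2)) x) 0 :=
          ((hasDerivAt_id (0 : ℝ)).mul_const _).const_add _
        rw [one_mul] at h
        exact h.deriv
      refine a1.symm.trans (Eq.trans ?_ (congrArg (_ + ·) a2.symm))
      rw [← Function.iterate_succ_apply' T.δt p.1]
      exact (zero_add _).symm
  rw [e2, hd_timed c'.G, (c'.hasEL le_rfl).spec t _ _ hΦ (smooth_hamZ hQz t hΦ)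
    (flat_hamZ hQz (fun i => hQf _) hu t)] at e1
  simp only [sum_upTo_hamZ] at e1
  exact sub_eq_iff_eq_add'.1 e1

/-- The derivative of `D G'` along `tilde`, using the conservation law of `c'`. -/
lemma lieFun_tilde_flow {v : ℝ → Conf M A Λ → M → ℝ} (hv : IsLocal n v) (h : c'.Conserved v)
    (hreg : T.RegularExternal) (hE : T.PreservesExternal c.variation) {u : Hist M A Λ}
    (hu : T.External u) (t : ℝ) :
    lieFun 0 c.tilde (lieFun 1 T.flow c'.G) t (inst u t) =
      fder (T.boundaryFunctional v t) (inst u t) (c.tilde t (inst u t)) +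
      lieFun 0 c.tilde (lieFun 0 c'.tilde (fun _ Φ => T.H (low Φ))) t (inst u t) -
      ((∫ x, ∑ i, T.dH i (low (inst u t)) x *
        dder (fun Φ => T.ham c'.Ez t Φ i) (inst u t) (c.tilde t (inst u t)) x ∂T.vol) -
      ∫ x, ∑ i, c'.Ez i t (inst u t) x *
        dder (fun Φ => T.XH i (low Φ)) (inst u t) (c.tilde t (inst u t)) x ∂T.vol) := by
  have := T.isFiniteMeasure_vol
  have := T.isFiniteMeasure_bvol
  have hΦ := isSmooth_inst hu.1 t
  have hX := c.smooth_tilde t hΦ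
  have hdH : ∀ i, IsLocal n (fun _ (Φ : Conf M A Λ) => T.dH i (low Φ)) :=
    fun i => (T.isLocal_dH i).low
  have hE' : ∀ i, IsLocal n (c'.Ez i) := fun i => c'.E_local _
  rw [← h.fder_tilde c hv hreg hE hu t]
  have e1 : fder (T.poisson (fun i _ Φ => T.dH i (low Φ)) c'.Ez t) (inst u t)
    (c.tilde t (inst u t)) = _ := T.fder_poisson hdH hE' t hΦ hX
  have hs1 := c'.localFunctional_noether.smoothFun
  have hs2 := (T.localFunctional_H_low.lieFun 0 c'.isLocal_tilde).smoothFun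
  have hs3 : (timedPlots n M (A ⊕ (ℕ × Λ))).SmoothFun
      (fun u => T.poisson (fun i _ Φ => T.dH i (low Φ)) c'.Ez u.1 u.2) :=
    (T.isLocal_poisson hdH hE').smoothFun_integral
  have e2 := (hs1.add hs2).hd_fun_sub hs3 (timedPlots_pt t hΦ) (timedPlots_pt 0 hX)
  rw [hs1.hd_fun_add hs2 (timedPlots_pt t hΦ) (timedPlots_pt 0 hX),
    hd_timed (T.poisson (fun i _ Φ => T.dH i (low Φ)) c'.Ez), e1] at e2
  refine Eq.trans ?_ e2
  refine congrArg (fun f => hd f (t, inst u t) (0, c.tilde t (inst u t))) (funext fun w => ?_)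
  simp only [noether]
  show _ = _ - _ + T.poisson (fun i _ Φ => T.dH i (low Φ)) c'.Ez w.1 w.2 + _ - _
  ring

end Couple

end GaugeTheory

namespace GaugeTheory

variable {n : ℕ} [NeZero n] {M : Type*} [TopologicalSpace M] [CompactSpace M] [T2Space M]
  [ChartedSpace (EuclideanHalfSpace n) M] [IsManifold (𝓡∂ n) ∞ M] [MeasurableSpace M]
  [BorelSpace M] {A Λ α : Type*} [Fintype A] [DecidableEq A] [Fintype Λ]
  {T : GaugeTheory n M A Λ α}

namespace Couple

/-! ### The boundary term of the bracket -/

section BoundaryTerm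

variable (c₁ c₂ : T.Couple) {v₁ v₂ : ℝ → Conf M A Λ → M → ℝ} (hv₁ : IsLocal n v₁)
  (hv₂ : IsLocal n v₂)

/-- The boundary term in the conservation law of the bracket. -/
def bracketV (v₁ v₂ : ℝ → Conf M A Λ → M → ℝ) (t : ℝ) (Φ : Conf M A Λ) (x : M) : ℝ :=
  lie 0 c₁.tilde v₂ t Φ x - lie 0 c₂.tilde v₁ t Φ x

include hv₁ hv₂

lemma isLocal_bracketV : IsLocal n (bracketV c₁ c₂ v₁ v₂) :=
  (hv₂.lie 0 c₁.isLocal_tilde).sub (hv₁.lie 0 c₂.isLocal_tilde)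

lemma boundaryFunctional_bracketV (t : ℝ) {Φ : Conf M A Λ} (hΦ : ∀ i, IsSmooth n (Φ i)) :
    T.boundaryFunctional (bracketV c₁ c₂ v₁ v₂) t Φ =
      fder (T.boundaryFunctional v₂ t) Φ (c₁.tilde t Φ) -
        fder (T.boundaryFunctional v₁ t) Φ (c₂.tilde t Φ) := by
  have := T.isFiniteMeasure_bvol
  have e1 : fder (T.boundaryFunctional v₁ t) Φ (c₂.tilde t Φ) = _ :=
    hv₁.fder_integral t hΦ (c₂.smooth_tilde t hΦ)
  have e2 : fder (T.boundaryFunctional v₂ t) Φ (c₁.tilde t Φ) = _ :=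
    hv₂.fder_integral t hΦ (c₁.smooth_tilde t hΦ)
  rw [e1, e2, ← integral_sub (hv₂.isSmooth_dder t hΦ (c₁.smooth_tilde t hΦ)).integrable
    (hv₁.isSmooth_dder t hΦ (c₂.smooth_tilde t hΦ)).integrable, ← lie_zero_left, ← lie_zero_left]
  rfl

variable {c₁ c₂}

/-- The boundary term of the bracket is invariant because, at external histories, it is the
variation of invariant boundary terms along `δ₁` and `δ₂`. -/
lemma internallyInvariant_bracketV (hreg : T.RegularExternal) (hd₁ : c₁.IsDifferentiable)
    (hd₂ : c₂.IsDifferentiable) (hE₁ : T.PreservesExternal c₁.variation)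
    (hE₂ : T.PreservesExternal c₂.variation) (t : ℝ)
    (h₁ : T.InternallyInvariant fun u => T.boundaryFunctional v₁ t (inst u t))
    (h₂ : T.InternallyInvariant fun u => T.boundaryFunctional v₂ t (inst u t)) :
    T.InternallyInvariant
      fun u => T.boundaryFunctional (bracketV c₁ c₂ v₁ v₂) t (inst u t) := by
  have := T.isFiniteMeasure_bvol
  have hs : ∀ {v : ℝ → Conf M A Λ → M → ℝ}, IsLocal n v →
      (histPlots n M A Λ).SmoothFun (fun u => T.boundaryFunctional v t (inst u t)) := fun hv =>
    smoothFun_inst (F := T.boundaryFunctional _) hv.smoothFun_integral t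
  have hs₁ := (hs hv₁).hd c₂.smoothMap_variation
  have hs₂ := (hs hv₂).hd c₁.smoothMap_variation
  intro δ hδ u hu
  have hδu := hδ.smoothMap.pt (histPlots_pt.2 hu.1)
  rw [hd_eq_hd_of_external hreg (hs (isLocal_bracketV c₁ c₂ hv₁ hv₂)) (hs₂.sub hs₁)
    (fun w hw => ?_) hu (histPlots_pt.1 hδu) (hδ.2.1 u hu),
    hs₂.hd_fun_sub hs₁ (histPlots_pt.2 hu.1) hδu,
    h₁.variation hreg hd₂ hE₂ (hs hv₁) δ hδ u hu, h₂.variation hreg hd₁ hE₁ (hs hv₂) δ hδ u hu,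
    sub_zero]
  rw [boundaryFunctional_bracketV c₁ c₂ hv₁ hv₂ t (isSmooth_inst hw.1 t),
    c₁.fder_boundary_tilde hv₂ hw, c₂.fder_boundary_tilde hv₁ hw]

end BoundaryTerm

variable {c c₁ c₂ : T.Couple} {R : A ⊕ (ℕ × Λ) → ℝ → Conf M A Λ → M → ℝ}

/-- The hamiltonian only involves `(z, λ)`, on which the bracket acts as the commutator. -/
lemma IsBracket.lieFun_H (hb : IsBracket c c₁ c₂ R) {u : Hist M A Λ} (hu : T.External u) (t : ℝ) :
    lieFun 0 c.tilde (fun _ Φ => T.H (low Φ)) t (inst u t) =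
      lieFun 0 c₁.tilde (lieFun 0 c₂.tilde (fun _ Φ => T.H (low Φ))) t (inst u t) -
      lieFun 0 c₂.tilde (lieFun 0 c₁.tilde (fun _ Φ => T.H (low Φ))) t (inst u t) +
      ∫ x, ∑ i, T.dH i (low (inst u t)) x *
        T.ham (fun i => R (Sum.inl i)) t (inst u t) i x ∂T.vol := by
  have hΦ := isSmooth_inst hu.1 t
  have hR : ∀ i, IsLocal n (R (Sum.inl i)) := fun i => hb.R_local _
  have hH := T.hasEL_H (A := A) (Λ := Λ) 0
  have hB : ∀ i, IsSmooth n (dder (fun Φ => c₂.tilde t Φ i) (inst u t) (c₁.tilde t (inst u t)) -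
      dder (fun Φ => c₁.tilde t Φ i) (inst u t) (c₂.tilde t (inst u t))) := fun i =>
    ((c₂.isLocal_tilde i).isSmooth_dder t hΦ (c₁.smooth_tilde t hΦ)).sub
      ((c₁.isLocal_tilde i).isSmooth_dder t hΦ (c₂.smooth_tilde t hΦ))
  have e1 := hH.smooth.hd_commutator
    (smoothMap_timed 0 c₁.isLocal_tilde) (smoothMap_timed 0 c₂.isLocal_tilde) (timedPlots_pt t hΦ)
    (hasVel_field 0 c₂.isLocal_tilde t 0 hΦ (c₁.smooth_tilde t hΦ))
    (hasVel_field 0 c₁.isLocal_tilde t 0 hΦ (c₂.smooth_tilde t hΦ))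
  have e2 : hd (fun u : ℝ × Conf M A Λ => T.H (low u.2)) (t, inst u t)
      (((0, fun i x => hd (fun u : ℝ × Conf M A Λ => c₂.tilde u.1 u.2 i x) (t, inst u t)
        (0, c₁.tilde t (inst u t))) : ℝ × Conf M A Λ) -
      (0, fun i x => hd (fun u : ℝ × Conf M A Λ => c₁.tilde u.1 u.2 i x) (t, inst u t)
        (0, c₂.tilde t (inst u t)))) = fder (fun Φ => T.H (low Φ)) (inst u t)
          (fun i => dder (fun Φ => c₂.tilde t Φ i) (inst u t) (c₁.tilde t (inst u t)) -
      dder (fun Φ => c₁.tilde t Φ i) (inst u t) (c₂.tilde t (inst u t))) := by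
    rw [← hd_timed (fun _ Φ => T.H (low Φ)) t]
    refine congrArg _ (Prod.ext (sub_self 0) (funext fun i => funext fun x => ?_))
    exact congrArg₂ (· - ·) (hd_timed_apply (fun t Φ => c₂.tilde t Φ i) t _ _ x)
      (hd_timed_apply (fun t Φ => c₁.tilde t Φ i) t _ _ x)
  have e3 := hH.spec t _ _ hΦ (smooth_hamZ hR t hΦ) (flat_hamZ hR (fun i => hb.R_flat _) hu t)
  simp only [sum_upTo_hamZ] at e3
  have e4 := fder_add (F := fun _ Φ => T.H (low Φ)) hH.smooth t hΦ hB
    (smooth_hamZ (T := T) hR t hΦ)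
  rw [lieFun_zero_left, fder_low]
  rw [fder_low] at e4
  have e5 : low (c.tilde t (inst u t)) = low ((fun i => dder (fun Φ => c₂.tilde t Φ i) (inst u t)
      (c₁.tilde t (inst u t)) - dder (fun Φ => c₁.tilde t Φ i) (inst u t)
      (c₂.tilde t (inst u t))) + T.hamZ (fun i => R (Sum.inl i)) t (inst u t)) := by
    funext j
    rw [hb.low_tilde t hΦ]
    cases j <;> rfl
  rw [e5, e4, e3, ← e2]
  exact congrArg (· + _) e1.symm

/-- The conservation laws of two couples imply the one of their bracket. The time derivative of
`δ̃₁G₂ - δ̃₂G₁` is reduced to `δ̃₁ v₂ - δ̃₂ v₁` and `[δ̃₁, δ̃₂] H` by commuting `D` with `δ̃` and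
using the conservation laws. All other terms (the hamiltonian vector fields of `Q₁`, `Q₂` and `R`,
and the derivatives of the bulk brackets) cancel. -/
lemma IsBracket.conserved (hb : IsBracket c c₁ c₂ R) (hreg : T.RegularExternal)
    (hE₁ : T.PreservesExternal c₁.variation) (hE₂ : T.PreservesExternal c₂.variation)
    {v₁ v₂ : ℝ → Conf M A Λ → M → ℝ} (hv₁ : IsLocal n v₁) (hv₂ : IsLocal n v₂)
    (h₁ : c₁.Conserved v₁) (h₂ : c₂.Conserved v₂) : c.Conserved (bracketV c₁ c₂ v₁ v₂) := by
  have := T.isFiniteMeasure_vol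
  have := T.isFiniteMeasure_bvol
  intro u hu t
  obtain ⟨Q₁, hQ₁, hQf₁, hrel₁⟩ := c₁.exists_noether_relations hv₁ h₁
  obtain ⟨Q₂, hQ₂, hQf₂, hrel₂⟩ := c₂.exists_noether_relations hv₂ h₂
  have hΦ := isSmooth_inst hu.1 t
  have hr₁ := (hrel₁ u hu t _ hΦ).1
  have hr₂ := (hrel₂ u hu t _ hΦ).1
  have hflow := T.smooth_flow t hΦ
  have hu' := timedPlots_pt t hΦ
  have hfl := timedPlots_pt 1 hflow
  have hEz : ∀ (c : T.Couple) i, IsLocal n (c.Ez i) := fun c i => c.E_local _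
  have hdH : ∀ i, IsLocal n (fun _ (Φ : Conf M A Λ) => T.dH i (low Φ)) :=
    fun i => (T.isLocal_dH i).low
  have hXH : ∀ i, IsLocal n (fun _ (Φ : Conf M A Λ) => T.XH i (low Φ)) :=
    fun i => (T.isLocal_XH i).low
  have hG : ∀ c c' : T.Couple, (timedPlots n M (A ⊕ (ℕ × Λ))).SmoothFun
      (fun w => lieFun 0 c.tilde c'.G w.1 w.2) := fun c c' =>
    ((show LocalFunctional n T.vol T.bvol c'.G from c'.G_local).lieFun 0 c.isLocal_tilde).smoothFun
  have hp : (timedPlots n M (A ⊕ (ℕ × Λ))).SmoothFun (fun w => T.poisson c₂.Ez c₁.Ez w.1 w.2) :=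
    (T.isLocal_poisson (hEz c₂) (hEz c₁)).smoothFun_integral
  -- the time derivative of the bracket
  have e1 : lieFun 1 T.flow c.G t (inst u t) = lieFun 1 T.flow (lieFun 0 c₁.tilde c₂.G) t (inst u t)
      - lieFun 1 T.flow (lieFun 0 c₂.tilde c₁.G) t (inst u t)
      - hd (fun w : ℝ × Conf M A Λ => T.poisson c₂.Ez c₁.Ez w.1 w.2) (t, inst u t)
        (1, T.flow t (inst u t)) := by
    rw [hb.G_eq, bracketG_eq]
    exact (((hG c₁ c₂).sub (hG c₂ c₁)).hd_fun_sub hp hu' hfl).trans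
      (congrArg (· - _) ((hG c₁ c₂).hd_fun_sub (hG c₂ c₁) hu' hfl))
  -- the time derivative of `{G₂, G₁}`, by the Euler–Lagrange equations of the conservation laws
  have e2 : ∀ (c c' : T.Couple) (Q : A ⊕ (ℕ × Λ) → ℝ → Conf M A Λ → M → ℝ),
      (∀ i, IsLocal n (Q i)) → (∀ i : A, lie 1 T.flow (c.E (Sum.inl i)) t (inst u t) =
        dder (fun Φ => T.dH i (low Φ)) (inst u t) (c.tilde t (inst u t))
          + Q (Sum.inl i) t (inst u t)) →
      ∫ x, ∑ i, c'.Ez i t (inst u t) x * hd (fun w : ℝ × Conf M A Λ => T.ham c.Ez w.1 w.2 i x)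
        (t, inst u t) (1, T.flow t (inst u t)) ∂T.vol =
      (∫ x, ∑ i, c'.Ez i t (inst u t) x *
        dder (fun Φ => T.XH i (low Φ)) (inst u t) (c.tilde t (inst u t)) x ∂T.vol) +
      ∫ x, ∑ i, c'.Ez i t (inst u t) x *
        T.ham (fun i => Q (Sum.inl i)) t (inst u t) i x ∂T.vol := by
    intro c c' Q hQ hr
    rw [← integral_add (integrable_sum_mul _ (fun i => (hEz c' i).isSmooth t hΦ)
      fun i => (hXH i).isSmooth_dder t hΦ (c.smooth_tilde t hΦ))
      (integrable_sum_mul _ (fun i => (hEz c' i).isSmooth t hΦ)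
      fun i => (T.isLocal_ham (fun i => hQ (Sum.inl i)) i).isSmooth t hΦ)]
    simp only [c.hd_ham_flow t hΦ hr, mul_add, Finset.sum_add_distrib]
  -- the hamiltonian vector field of the bracket is a commutator, up to `R`
  have e3 : ∫ x, ∑ i, T.dH i (low (inst u t)) x * T.ham c.Ez t (inst u t) i x ∂T.vol =
      (∫ x, ∑ i, T.dH i (low (inst u t)) x *
        dder (fun Φ => T.ham c₂.Ez t Φ i) (inst u t) (c₁.tilde t (inst u t)) x ∂T.vol) -
      (∫ x, ∑ i, T.dH i (low (inst u t)) x *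
        dder (fun Φ => T.ham c₁.Ez t Φ i) (inst u t) (c₂.tilde t (inst u t)) x ∂T.vol) +
      ∫ x, ∑ i, T.dH i (low (inst u t)) x *
        T.ham (fun i => R (Sum.inl i)) t (inst u t) i x ∂T.vol := by
    have hi : ∀ {F : A → M → ℝ}, (∀ i, IsSmooth n (F i)) →
        Integrable (fun x => ∑ i, T.dH i (low (inst u t)) x * F i x) T.vol := fun hF =>
      integrable_sum_mul _ (fun i => (hdH i).isSmooth t hΦ) hF
    have i₂ := hi fun i => (c₂.isLocal_ham i).isSmooth_dder t hΦ (c₁.smooth_tilde t hΦ)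
    have i₁ := hi fun i => (c₁.isLocal_ham i).isSmooth_dder t hΦ (c₂.smooth_tilde t hΦ)
    rw [← integral_sub i₂ i₁, ← integral_add (by exact i₂.sub i₁)
      (hi fun i => (T.isLocal_ham (fun i => hb.R_local (Sum.inl i)) i).isSmooth t hΦ)]
    congr 1
    funext x
    rw [← Finset.sum_sub_distrib, ← Finset.sum_add_distrib]
    refine Finset.sum_congr rfl fun i _ => ?_
    rw [← mul_sub, ← mul_add]
    exact congrArg _ (congrFun (hb.low_tilde t hΦ (Sum.inl i)) x)
  rw [noether, e1, e3, hb.lieFun_H hu t, T.hd_poisson (hEz c₂) (hEz c₁) t 1 hΦ hflow,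
    e2 c₁ c₂ Q₁ hQ₁ hr₁, e2 c₂ c₁ Q₂ hQ₂ hr₂, c₁.lieFun_flow_tilde c₂ hQ₁ hQf₁ hu t hr₁,
    c₂.lieFun_flow_tilde c₁ hQ₂ hQf₂ hu t hr₂, c₁.lieFun_tilde_flow c₂ hv₂ h₂ hreg hE₁ hu t,
    c₂.lieFun_tilde_flow c₁ hv₁ h₁ hreg hE₂ hu t, boundaryFunctional_bracketV c₁ c₂ hv₁ hv₂ t hΦ]
  ring

end Couple

end GaugeTheory

/-! ### The variation of the Lagrangian -/

namespace GaugeTheory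

variable {n : ℕ} [NeZero n] {M : Type*} [TopologicalSpace M] [CompactSpace M] [T2Space M]
  [ChartedSpace (EuclideanHalfSpace n) M] [IsManifold (𝓡∂ n) ∞ M] [MeasurableSpace M]
  [BorelSpace M] {A Λ α : Type*} [Fintype A] [DecidableEq A] [Fintype Λ]
  {T : GaugeTheory n M A Λ α}

section Matrix

open Matrix

lemma sum_σ_inv_mulVec (z e : A → ℝ) :
    ∑ i, ∑ j, z i * T.σ⁻¹ i j * ∑ k, T.σ j k * e k = ∑ i, z i * e i := by
  have h : T.σ⁻¹ *ᵥ (T.σ *ᵥ e) = e := by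
    rw [mulVec_mulVec, nonsing_inv_mul _ T.σ_invertible, one_mulVec]
  refine Finset.sum_congr rfl fun i _ => ?_
  conv_rhs => rw [← congrFun h i]
  simp only [mulVec, dotProduct, Finset.mul_sum, mul_assoc]

lemma sum_σ_inv_vecMul (e w : A → ℝ) :
    ∑ i, ∑ j, (∑ k, T.σ i k * e k) * T.σ⁻¹ i j * w j = -∑ i, e i * w i := by
  have h : (e ᵥ* T.σ) ᵥ* T.σ⁻¹ = e := by
    rw [vecMul_vecMul, mul_nonsing_inv _ T.σ_invertible, vecMul_one]
  have h' : ∀ i, ∑ k, T.σ i k * e k = -(e ᵥ* T.σ) i := fun i => by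
    simp only [vecMul, dotProduct, ← Finset.sum_neg_distrib]
    exact Finset.sum_congr rfl fun k _ => by rw [T.σ_swap]; ring
  rw [Finset.sum_comm, ← Finset.sum_neg_distrib]
  refine Finset.sum_congr rfl fun j _ => ?_
  rw [← Finset.sum_mul]
  conv_rhs => rw [← congrFun h j]
  simp only [h', vecMul, dotProduct, neg_mul, Finset.sum_neg_distrib]

end Matrix

/-- The variation of the Lagrangian. -/
lemma deriv_lagrangian {u Y : Hist M A Λ} (hu : SmoothHist n u) (hY : SmoothHist n Y) (t : ℝ) :
    deriv (fun s : ℝ => T.lagrangian (u + s • Y) t) 0 =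
      (∫ x, (1 / 2 : ℝ) * ∑ i, ∑ j, (Y (Sum.inl i) t x * T.σ⁻¹ i j *
          deriv (fun τ => u (Sum.inl j) τ x) t + u (Sum.inl i) t x * T.σ⁻¹ i j *
          deriv (fun τ => Y (Sum.inl j) τ x) t) ∂T.vol) -
        fder T.H (low (inst u t)) (low (inst Y t)) := by
  have := T.isFiniteMeasure_vol
  have := T.isFiniteMeasure_bvol
  have hl := (histPlots_pt.2 hu).line (histPlots_pt.2 hY)
  have h1 : JointSmooth n ℝ (fun s x => (1 / 2 : ℝ) * ∑ i, ∑ j, (u + s • Y) (Sum.inl i) t x *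
      T.σ⁻¹ i j * deriv (fun τ => (u + s • Y) (Sum.inl j) τ x) t) := by
    refine JointSmooth.mul (jointSmooth_const (isSmooth_const _)) (JointSmooth.sum fun i _ =>
      JointSmooth.sum fun j _ => JointSmooth.mul (JointSmooth.mul
        (jointSmooth_inst_param hl t (Sum.inl i)) (jointSmooth_const (isSmooth_const _)))
        (histSmooth_deriv (Sum.inl j) t ℝ _ hl))
  have h2 : HasDerivAt (fun s : ℝ => T.H (low (inst (u + s • Y) t)))
      (hd (fun u => T.H (low (inst u t))) u Y) 0 :=
    (smoothFun_inst (F := fun _ Φ => T.H (low Φ)) (T.localFunctional_H_low).smoothFun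
      t).hasDerivAt_line (histPlots_pt.2 hu) (histPlots_pt.2 hY)
  refine ((h1.hasDerivAt_integral (μ := T.vol) 0).sub h2).deriv.trans ?_
  rw [hd_inst (fun _ Φ => T.H (low Φ)) t hu hY, fder_low]
  congr 2
  funext x
  have h3 : ∀ i, HasDerivAt (fun s : ℝ => (u + s • Y) i t x) (Y i t x) 0 := fun i => by
    have h : HasDerivAt (fun s : ℝ => u i t x + s * Y i t x) (1 * Y i t x) 0 :=
      ((hasDerivAt_id (0 : ℝ)).mul_const _).const_add _
    rwa [one_mul] at h
  have h4 : ∀ i, HasDerivAt (fun s : ℝ => deriv (fun τ => (u + s • Y) i τ x) t)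
      (deriv (fun τ => Y i τ x) t) 0 := fun i => by
    have hd : ∀ s : ℝ, deriv (fun τ => (u + s • Y) i τ x) t =
        deriv (fun τ => u i τ x) t + s * deriv (fun τ => Y i τ x) t := fun s =>
      ((((hu.contDiff i x).differentiable (by simp) t).hasDerivAt).add
        ((((hY.contDiff i x).differentiable (by simp) t).hasDerivAt).const_mul s)).deriv
    simp only [hd]
    have h : HasDerivAt (fun s : ℝ => deriv (fun τ => u i τ x) t + s * deriv (fun τ => Y i τ x) t)
        (1 * deriv (fun τ => Y i τ x) t) 0 :=
      ((hasDerivAt_id (0 : ℝ)).mul_const _).const_add _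
    rwa [one_mul] at h
  have h5 := (HasDerivAt.const_mul (1 / 2 : ℝ) (HasDerivAt.fun_sum (u := Finset.univ) fun i _ =>
    HasDerivAt.fun_sum (u := Finset.univ) fun j _ =>
      ((h3 (Sum.inl i)).mul_const (T.σ⁻¹ i j)).mul (h4 (Sum.inl j)))).deriv
  refine h5.trans ?_
  simp

namespace Couple

/-- By the conservation law, the Lagrangian is invariant up to the boundary term and the total
derivative of `½ ∫ z^A δG/δz^A - G`. -/
lemma Conserved.exists_lagrangian {c : T.Couple} {v : ℝ → Conf M A Λ → M → ℝ}
    (h : c.Conserved v) : ∃ U : ℝ → Conf M A Λ → ℝ, T.IsLocalFunctional U ∧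
      ∀ u, T.External u → ∀ t, deriv (fun s : ℝ => T.lagrangian (u + s • c.variation u) t) 0 =
        deriv (fun τ => U τ (inst u τ)) t + T.boundaryFunctional v t (inst u t) := by
  have := T.isFiniteMeasure_vol
  have := T.isFiniteMeasure_bvol
  have hk : IsLocal n (fun t (Φ : Conf M A Λ) x =>
      (1 / 2 : ℝ) * ∑ i, Φ (Sum.inl i) x * c.Ez i t Φ x) :=
    (isLocal_const _).mul (IsLocal.sum fun i _ => (isLocal_field (Sum.inl i)).mul (c.E_local _))
  have hkl := localFunctional_integral (vol := T.vol) (bvol := T.bvol) hk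
  have hU := hkl.sub (show LocalFunctional n T.vol T.bvol c.G from c.G_local)
  refine ⟨_, hU, fun u hu t => ?_⟩
  have hΦ := isSmooth_inst hu.1 t
  have hY := c.smoothHist_variation hu.1
  have hplot : (timedPlots n M (A ⊕ (ℕ × Λ))).IsPlot ℝ (fun τ : ℝ => (τ, inst u τ)) :=
    ⟨contDiff_id, fun i => jointSmooth_inst_time hu.1 i⟩
  have hEz : ∀ i, IsLocal n (c.Ez i) := fun i => c.E_local _
  have hEj : ∀ i, JointSmooth n ℝ (fun τ => c.Ez i τ (inst u τ)) := fun i =>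
    jointSmooth_along (hEz i) hu.1
  have hEs : ∀ i, IsSmooth n (c.Ez i t (inst u t)) := fun i => (hEz i).isSmooth t hΦ
  have hz : ∀ i x, HasDerivAt (fun τ => u (Sum.inl i) τ x)
      (deriv (fun τ => u (Sum.inl i) τ x) t) t := fun i x =>
    ((hu.1.contDiff (Sum.inl i) x).differentiable (by simp) t).hasDerivAt
  have he : ∀ i x, HasDerivAt (fun τ => c.Ez i τ (inst u τ) x)
      (deriv (fun τ => c.Ez i τ (inst u τ) x) t) t := fun i x =>
    (((hEj i).contDiff x).differentiable (by simp) t).hasDerivAt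
  have hzs : ∀ i, IsSmooth n (fun x => deriv (fun τ => u (Sum.inl i) τ x) t) := fun i =>
    (histSmooth_deriv (Sum.inl i) t).isSmooth hu.1
  -- the time derivative of `U`
  have hj : JointSmooth n ℝ (fun τ x =>
      (1 / 2 : ℝ) * ∑ i, inst u τ (Sum.inl i) x * c.Ez i τ (inst u τ) x) := jointSmooth_along hk hu.1
  have e1 := ((hj.hasDerivAt_integral (μ := T.vol) t).sub
    (((c.smoothFun_G ℝ _ hplot).differentiable (by simp) t).hasDerivAt)).deriv
  have e2 : ∀ x, deriv (fun τ => (1 / 2 : ℝ) * ∑ i, inst u τ (Sum.inl i) x *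
      c.Ez i τ (inst u τ) x) t = (1 / 2 : ℝ) * ∑ i, (deriv (fun τ => u (Sum.inl i) τ x) t *
        c.Ez i t (inst u t) x + u (Sum.inl i) t x * deriv (fun τ => c.Ez i τ (inst u τ) x) t) :=
    fun x => (HasDerivAt.const_mul (1 / 2 : ℝ) (HasDerivAt.fun_sum (u := Finset.univ) fun i _ =>
      (hz i x).mul (he i x))).deriv
  -- the variation of the kinetic term
  have hYd : ∀ i x, deriv (fun τ => c.variation u (Sum.inl i) τ x) t =
      ∑ k, T.σ i k * deriv (fun τ => c.Ez k τ (inst u τ) x) t := fun i x =>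
    (HasDerivAt.fun_sum (u := Finset.univ) fun k _ => (he k x).const_mul (T.σ i k)).deriv
  have e3 : ∫ x, (1 / 2 : ℝ) * ∑ i, ∑ j, (c.variation u (Sum.inl i) t x * T.σ⁻¹ i j *
          deriv (fun τ => u (Sum.inl j) τ x) t + u (Sum.inl i) t x * T.σ⁻¹ i j *
          deriv (fun τ => c.variation u (Sum.inl j) τ x) t) ∂T.vol =
      (∫ x, deriv (fun τ => (1 / 2 : ℝ) * ∑ i, inst u τ (Sum.inl i) x *
        c.Ez i τ (inst u τ) x) t ∂T.vol) -
      ∫ x, ∑ i, c.Ez i t (inst u t) x * deriv (fun τ => u (Sum.inl i) τ x) t ∂T.vol := by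
    rw [← integral_sub (hj.deriv_line.isSmooth t).integrable (integrable_sum_mul _ hEs hzs)]
    congr 1
    funext x
    have a1 := T.sum_σ_inv_vecMul (fun i => c.Ez i t (inst u t) x)
      (fun i => deriv (fun τ => u (Sum.inl i) τ x) t)
    have a2 := T.sum_σ_inv_mulVec (fun i => u (Sum.inl i) t x)
      (fun i => deriv (fun τ => c.Ez i τ (inst u τ) x) t)
    simp only [e2, hYd, Finset.sum_add_distrib]
    rw [a2, show ∑ i, ∑ j, c.variation u (Sum.inl i) t x * T.σ⁻¹ i j *
      deriv (fun τ => u (Sum.inl j) τ x) t = _ from a1]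
    simp only [mul_comm (c.Ez _ t (inst u t) x)]
    ring
  -- the derivative of `G` involves the equations of motion, which are flat at the boundary
  have e4 := deriv_along (T := T) c.smoothFun_G hu.1 t
  rw [(c.hasEL le_rfl).spec t _ _ hΦ (T.smooth_eomConf hu.1 t) (T.flat_eomConf hu t)] at e4
  have hXs : ∀ i, IsSmooth n (T.XH i (low (inst u t))) := fun i =>
    ((T.isLocal_XH i).low (A := A) (Λ := Λ)).isSmooth t hΦ
  have e5 : ∫ x, ∑ i ∈ upTo A Λ c.order, c.Ebar i t (inst u t) x * T.eomConf u t i x ∂T.vol =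
      (∫ x, ∑ i, c.Ez i t (inst u t) x * deriv (fun τ => u (Sum.inl i) τ x) t ∂T.vol) +
      ∫ x, ∑ i, T.dH i (low (inst u t)) x * T.ham c.Ez t (inst u t) i x ∂T.vol := by
    rw [← integral_add (integrable_sum_mul _ hEs hzs) (integrable_sum_mul _
      (fun i => ((T.isLocal_dH i).low (A := A) (Λ := Λ)).isSmooth t hΦ)
      fun i => (c.isLocal_ham i).isSmooth t hΦ)]
    congr 1
    funext x
    rw [show ∑ i, T.dH i (low (inst u t)) x * T.ham c.Ez t (inst u t) i x = _ from
      T.sum_σ_antisymm (fun i => T.dH i (low (inst u t)) x) (fun i => c.Ez i t (inst u t) x),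
      ← sub_eq_add_neg, ← Finset.sum_sub_distrib, sum_upTo]
    simp only [eomConf, Sum.elim_inr, Pi.zero_apply, mul_zero, Finset.sum_const_zero, add_zero]
    exact Finset.sum_congr rfl fun i _ => mul_sub _ _ _
  have e6 := h u hu t
  rw [noether, lieFun_zero_left, fder_low, c.low_tilde] at e6
  rw [deriv_lagrangian hu.1 hY t, e3]
  refine Eq.trans ?_ (congrArg (· + _) e1.symm)
  rw [e5] at e4
  have e7 : deriv (fun τ => c.G τ (inst u τ)) t = _ := e4
  show _ = _ - deriv (fun τ => c.G τ (inst u τ)) t + _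
  rw [e7]
  linarith

end Couple

end GaugeTheory

end GaugeField

end

theorem mainTheorem8 {n : ℕ} [NeZero n] {M : Type*} [TopologicalSpace M] [CompactSpace M]
    [T2Space M] [ChartedSpace (EuclideanHalfSpace n) M] [IsManifold (𝓡∂ n) ∞ M]
    [MeasurableSpace M] [BorelSpace M]
    {A Λ α : Type*} [Fintype A] [DecidableEq A] [Fintype Λ]
    (T : GaugeField.GaugeTheory n M A Λ α)
    (hreg : T.RegularExternal) (hH : T.RegularHamiltonian)
    (c₁ c₂ : T.Couple)
    (hd₁ : c₁.IsDifferentiable) (hs₁ : c₁.GeneratesExternalSymmetry)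
    (hd₂ : c₂.IsDifferentiable) (hs₂ : c₂.GeneratesExternalSymmetry) :
    ∃ c : T.Couple, c.G = T.bracketG c₁ c₂ ∧ c.δlam = T.bracketLam c₁ c₂ ∧
      c.IsDifferentiable ∧ c.GeneratesExternalSymmetry := by
  open GaugeField GaugeTheory Couple in
  obtain ⟨hE₁, v₁, hv₁, hi₁, -, h₁⟩ := hs₁
  obtain ⟨hE₂, v₂, hv₂, hi₂, -, h₂⟩ := hs₂
  have hc₁ : c₁.Conserved v₁ := fun u hu t =>
    (c₁.noether_eq t (isSmooth_inst hu.1 t)).symm.trans (h₁ u hu t)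
  have hc₂ : c₂.Conserved v₂ := fun u hu t =>
    (c₂.noether_eq t (isSmooth_inst hu.1 t)).symm.trans (h₂ u hu t)
  have hf₁ := c₁.flatExternal_Ebar hv₁ hc₁
  have hf₂ := c₂.flatExternal_Ebar hv₂ hc₂
  obtain ⟨R, hR, hRf, c, hG, hl, hEq, hspec⟩ := exists_bracket c₁ c₂
  have hb : IsBracket c c₁ c₂ R := ⟨hG, hl, hEq, hR, hRf hf₁ hf₂⟩
  have hc := hb.conserved hreg hE₁ hE₂ hv₁ hv₂ hc₁ hc₂
  refine ⟨c, hG, hl, fun δ hδ u hu t => ⟨fun i x hx =>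
    hb.commutator_eq_zero hreg hd₁ hd₂ hE₁ hE₂ hδ hu t i hx, ?_⟩,
    hb.preservesExternal hreg hE₁ hE₂, bracketV c₁ c₂ v₁ v₂, isLocal_bracketV c₁ c₂ hv₁ hv₂,
    fun δ hδ u hu t => internallyInvariant_bracketV hv₁ hv₂ hreg hd₁ hd₂ hE₁ hE₂ t
      (fun δ hδ u hu => hi₁ δ hδ u hu t) (fun δ hδ u hu => hi₂ δ hδ u hu t) δ hδ u hu,
    hc.exists_lagrangian, fun u hu t =>
      (c.noether_eq t (isSmooth_inst hu.1 t)).trans (hc u hu t)⟩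
  have hδu := histPlots_pt.1 (hδ.smoothMap.pt (histPlots_pt.2 hu.1))
  exact (hd_inst c.G t hu.1 hδu).trans (hspec t _ _ (isSmooth_inst hu.1 t) (isSmooth_inst hδu t)
    (mixed_of_external hreg hd₁ hE₁ hd₂ hδ hu t) (mixed_of_external hreg hd₂ hE₂ hd₁ hδ hu t)
    (Or.inl fun l a => ⟨hf₁ l a u hu t, hf₂ l a u hu t⟩))
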